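/- **Setting.** All systems are based on two-sorted intuitionistic predicate logic with number variables $x,y,z,\dots$ and variables $\alpha,\beta,\dots$ for one-place number-theoretic functions; the logical symbols are $\to,\&,\vee,\neg,\forall,\exists$ (quantifiers of both sorts), and expressions are identified up to renaming of bound variables. Terms and functors are generated simultaneously: number variables are terms; function variables and the constants with one number argument and no function argument are functors; if $f$ is a constant with $k$ number and $l$ function arguments, then $f(t_1,\dots,t_k,u_1,\dots,u_l)$ is a term (for a functor constant this is the application $(f)(t)$); if $u$ is a functor and $t$ a term, $(u)(t)$ is a term; and if $t$ is a term, $\lambda x.t$ is a functor. Prime formulas are equations between terms. The following schemata are used, for formulas and terms of the language considered: - IND: $A(0)\,\&\,\forall x(A(x)\to A(x'))\to A(x)$; - $\lambda$-conversion: $(\lambda x.t(x))(s)=t(s)$; - $\mathrm{QF\text{-}AC_{00}}$: $\forall x\exists y\,A(x,y)\to\exists\alpha\forall x\,A(x,\alpha(x))$, for $A(x,y)$ quantifier-free and not containing $\alpha$. $\mathbf{EL}$ has the constant $0$, a constant for each primitive recursive description (among them the successor $S$) and a constant $\mathrm{rec}(t,u,s)$ with two number arguments $t,s$ and one function argument $u$.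 Its axioms are $x=x$, the schema $A(x)\,\&\,x=y\to A(y)$, IND, $\neg S(0)=0$, the defining equations of the primitive recursive descriptions, $\mathrm{rec}(x,\alpha,0)=x$ and $\mathrm{rec}(x,\alpha,S(y))=\alpha(\langle \mathrm{rec}(x,\alpha,y),y\rangle)$ with $\langle a,b\rangle=2^a\cdot3^b$, $\mathrm{QF\text{-}AC_{00}}$, and $\lambda$-conversion. $\mathbf{IA_1}+\mathrm{QF\text{-}AC_{00}}$ has the following 27 constants $f_0,\dots,f_{26}$: $0$, ${}'$, $+$, $\cdot$, $a^b$, $a!$, $\mathrm{pd}$, $a\dot- b$, $\min$, $\max$, $\overline{\mathrm{sg}}$, $\mathrm{sg}$, $|a-b|$, $\mathrm{rm}$ (remainder), $[a/b]$, $\Sigma_{y<z}\alpha(y)$, $\Pi_{y<z}\alpha(y)$, $\min_{y\le z}\alpha(y)$, $\max_{y\le z}\alpha(y)$, $p_i$, $(a)_i$, $\mathrm{lh}$, $a*b$, $\overline\alpha(x)$, $\widetilde\alpha(x)$, $a\circ b$, $\mathrm{ccp}$. Its axioms are $a=b\to(a=c\to b=c)$, $a=b\to a'=b'$, $\neg\,a'=0$,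 $a'=b'\to a=b$, $a=b\to\alpha(a)=\alpha(b)$, IND, the usual explicit or primitive recursive defining equations of $f_2,\dots,f_{18}$, the equations $$p_0=2,\quad p_{i'}=\mu b_{b<p_i!+2}[p_i<b\,\&\,b\text{ is prime}],\quad (a)_i=\mu x_{x<a}[p_i^{x}\mid a\,\&\,\neg\,p_i^{x'}\mid a],\quad \mathrm{lh}(a)=\Sigma_{i<a}\mathrm{sg}((a)_i),$$ $$a*b=a\cdot\Pi_{i<\mathrm{lh}(b)}p_{\mathrm{lh}(a)+i}^{(b)_i},\quad \overline\alpha(x)=\Pi_{i<x}p_i^{\alpha(i)+1},\quad \widetilde\alpha(x)=\Pi_{i<x}p_i^{\alpha(i)},\quad a\circ b=\Pi_{i<\max(a,b)}p_i^{\max((a)_i,(b)_i)},$$ $$\mathrm{ccp}(0)=1,\qquad \mathrm{ccp}(y')=\mathrm{ccp}(y)\cdot p_y^{\,r(y,\mathrm{ccp}(y))},$$ $\mathrm{QF\text{-}AC_{00}}$, and $\lambda$-conversion. Here $\Sigma_{y<t}\,s(y)$ stands for $f_{15}(t,\lambda y.s(y))$, similarly for $\Pi$; $\mu y_{y<z}R(y)$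 stands for $\Sigma_{x<z}\Pi_{y<x'}\,\chi(y)$ with $\chi$ a term for the characteristic function of $R$ (value $0$ when $R$ holds, else $1$); and $r(y,z)$ is a fixed term containing only constants among $f_0,\dots,f_{25}$ and no free variables other than $y,z$. The result holds for every choice of $r$. $\mathbf{EL}-\lambda$ and $\mathbf{IA_1}+\mathrm{QF\text{-}AC_{00}}-\lambda$ are obtained by omitting the symbol $\lambda$, its formation rule and $\lambda$-conversion, the schemata being restricted to the remaining language. In the second case each defining equation $s=t$ in which $\lambda$ occurs is expressed without $\lambda$, as $\forall w\,(G_t(w)\to s=w)$, where the $\lambda$-free formula $G_t(w)$ says that $w$ is the value of $t$: it names the values of the subterms and functors of $t$ by existentially quantified number and function variables, a function $\alpha$ being a value of $\lambda x.q$ when, for every $x$, $\alpha(x)$ is the value of $q$. A system $S_2$ that extends $S_1$ (in language and theorems) is a *definitional extension* of $S_1$ if there is an effective (computable on Gödel numbers) mapping $E\mapsto E'$ from formulas of $S_2$ to formulas of $S_1$ such that: (I) $E'\equiv E$ for every formula $E$ of $S_1$; (II) $\vdash_{S_2}E'\leftrightarrow E$; (III) if $\Gamma\vdash_{S_2}E$,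 then $\Gamma'\vdash_{S_1}E'$, for every finite list $\Gamma$ of formulas, where in deductions the free variables of the assumptions are held constant; (IV) the mapping commutes with $\to,\&,\vee,\neg$ and with the quantifiers of both sorts. **Theorem.** (a) $\mathbf{EL}$ is a definitional extension of $\mathbf{EL}-\lambda$. (b) $\mathbf{IA_1}+\mathrm{QF\text{-}AC_{00}}$ is a definitional extension of $\mathbf{IA_1}+\mathrm{QF\text{-}AC_{00}}-\lambda$. -/

import Mathlib

namespace TwoSorted

/-! ### Two-sorted languages, with and without the abstraction operator -/

/-- The function(al) constants of a two-sorted language: each constant takes `nArg` number arguments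
and `fArg` function arguments; `code` numbers the constants. -/
structure Sig where
  Con : Type
  nArg : Con → ℕ
  fArg : Con → ℕ
  code : Con → ℕ
  code_injective : Function.Injective code

/-- Constants with one number argument and no function argument; these are functors. -/
def Sig.Unary (L : Sig) (f : L.Con) : Prop := L.nArg f = 1 ∧ L.fArg f = 0

instance (L : Sig) (f : L.Con) : Decidable (L.Unary f) :=
  inferInstanceAs (Decidable (_ ∧ _))

/-
Expressions are written with de Bruijn indices, separately for number variables and for function
variables, so they are identified up to renaming of bound variables. The parameter `b` says whether
the language has the abstraction operator: `Tm L true`, `Fn L true` are the terms and functors of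
the language with it, `Tm L false`, `Fn L false` those of the language without it.
For a unary constant f the term f(t) is the application (f)(t) of the functor f.
-/
mutual
/-- Terms (expressions for natural numbers). -/
inductive Tm (L : Sig) (b : Bool) : Type
  | var : ℕ → Tm L b
  | cst (f : L.Con) (h : ¬ L.Unary f) (ts : Fin (L.nArg f) → Tm L b)
      (us : Fin (L.fArg f) → Fn L b) : Tm L b
  | app : Fn L b → Tm L b → Tm L b
/-- Functors (expressions for one-place number-theoretic functions). The constructor `lam` binds
the number variable with index 0. -/
inductive Fn (L : Sig) (b : Bool) : Type
  | var : ℕ → Fn L b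
  | cst (f : L.Con) (h : L.Unary f) : Fn L b
  | lam (h : b = true) (t : Tm L b) : Fn L b
end

/-- Formulas; `all0`, `ex0` bind the number variable 0 and `all1`, `ex1` the function variable 0. -/
inductive Fm (L : Sig) (b : Bool) : Type
  | eq : Tm L b → Tm L b → Fm L b
  | imp : Fm L b → Fm L b → Fm L b
  | and : Fm L b → Fm L b → Fm L b
  | or : Fm L b → Fm L b → Fm L b
  | neg : Fm L b → Fm L b
  | all0 : Fm L b → Fm L b
  | ex0 : Fm L b → Fm L b
  | all1 : Fm L b → Fm L b
  | ex1 : Fm L b → Fm L b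

variable {L : Sig} {b : Bool}

/-- The term f(t₁, …, tₖ, u₁, …, uₗ). -/
def call (f : L.Con) (ts : Fin (L.nArg f) → Tm L b) (us : Fin (L.fArg f) → Fn L b) : Tm L b :=
  if h : L.Unary f then .app (.cst f h) (ts ⟨0, by rw [h.1]; exact Nat.one_pos⟩)
  else .cst f h ts us

/-- The functor λx.t, with x the number variable 0. -/
def lam (t : Tm L true) : Fn L true := .lam rfl t

def Fm.iff (A B : Fm L b) : Fm L b := .and (.imp A B) (.imp B A)

/-- Quantifier-free formulas. -/
def Fm.QF : Fm L b → Prop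
  | .eq _ _ => True
  | .imp A B => A.QF ∧ B.QF
  | .and A B => A.QF ∧ B.QF
  | .or A B => A.QF ∧ B.QF
  | .neg A => A.QF
  | .all0 _ => False
  | .ex0 _ => False
  | .all1 _ => False
  | .ex1 _ => False

/-! ### Renaming and substitution -/

/-- Extension of a renaming under a binder. -/
def up (ρ : ℕ → ℕ) : ℕ → ℕ
  | 0 => 0
  | n + 1 => ρ n + 1

mutual
def Tm.ren (ρ θ : ℕ → ℕ) : Tm L b → Tm L b
  | .var n => .var (ρ n)
  | .cst f h ts us => .cst f h (fun i => (ts i).ren ρ θ) (fun i => (us i).ren ρ θ)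
  | .app u t => .app (u.ren ρ θ) (t.ren ρ θ)
/-- Renaming of the number variables by `ρ` and of the function variables by `θ`. -/
def Fn.ren (ρ θ : ℕ → ℕ) : Fn L b → Fn L b
  | .var n => .var (θ n)
  | .cst f h => .cst f h
  | .lam h t => .lam h (t.ren (up ρ) θ)
end

def Fm.ren (ρ θ : ℕ → ℕ) : Fm L b → Fm L b
  | .eq s t => .eq (s.ren ρ θ) (t.ren ρ θ)
  | .imp A B => .imp (A.ren ρ θ) (B.ren ρ θ)
  | .and A B => .and (A.ren ρ θ) (B.ren ρ θ)
  | .or A B => .or (A.ren ρ θ) (B.ren ρ θ)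
  | .neg A => .neg (A.ren ρ θ)
  | .all0 A => .all0 (A.ren (up ρ) θ)
  | .ex0 A => .ex0 (A.ren (up ρ) θ)
  | .all1 A => .all1 (A.ren ρ (up θ))
  | .ex1 A => .ex1 (A.ren ρ (up θ))

/-- Extension of a substitution `σ` (of terms for number variables) under a number binder. -/
def upN (σ : ℕ → Tm L b) : ℕ → Tm L b
  | 0 => .var 0
  | n + 1 => (σ n).ren Nat.succ id

/-- Extension of a substitution `τ` (of functors for function variables) under a function binder. -/
def upF (τ : ℕ → Fn L b) : ℕ → Fn L b
  | 0 => .var 0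
  | n + 1 => (τ n).ren id Nat.succ

mutual
def Tm.sub (σ : ℕ → Tm L b) (τ : ℕ → Fn L b) : Tm L b → Tm L b
  | .var n => σ n
  | .cst f h ts us => .cst f h (fun i => (ts i).sub σ τ) (fun i => (us i).sub σ τ)
  | .app u t => .app (u.sub σ τ) (t.sub σ τ)
/-- Simultaneous (capture-avoiding) substitution. -/
def Fn.sub (σ : ℕ → Tm L b) (τ : ℕ → Fn L b) : Fn L b → Fn L b
  | .var n => τ n
  | .cst f h => .cst f h
  | .lam h t => .lam h (t.sub (upN σ) (fun n => (τ n).ren Nat.succ id))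
end

def Fm.sub (σ : ℕ → Tm L b) (τ : ℕ → Fn L b) : Fm L b → Fm L b
  | .eq s t => .eq (s.sub σ τ) (t.sub σ τ)
  | .imp A B => .imp (A.sub σ τ) (B.sub σ τ)
  | .and A B => .and (A.sub σ τ) (B.sub σ τ)
  | .or A B => .or (A.sub σ τ) (B.sub σ τ)
  | .neg A => .neg (A.sub σ τ)
  | .all0 A => .all0 (A.sub (upN σ) (fun n => (τ n).ren Nat.succ id))
  | .ex0 A => .ex0 (A.sub (upN σ) (fun n => (τ n).ren Nat.succ id))
  | .all1 A => .all1 (A.sub (fun n => (σ n).ren id Nat.succ) (upF τ))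
  | .ex1 A => .ex1 (A.sub (fun n => (σ n).ren id Nat.succ) (upF τ))

/-- The substitution that replaces the number variable 0 by `t` and lowers the other ones. -/
def single0 (t : Tm L b) : ℕ → Tm L b
  | 0 => t
  | n + 1 => .var n

/-- The substitution that replaces the function variable 0 by `u` and lowers the other ones. -/
def single1 (u : Fn L b) : ℕ → Fn L b
  | 0 => u
  | n + 1 => .var n

def Tm.inst0 (s t : Tm L b) : Tm L b := s.sub (single0 t) .var
def Fm.inst0 (A : Fm L b) (t : Tm L b) : Fm L b := A.sub (single0 t) .var
def Fm.inst1 (A : Fm L b) (u : Fn L b) : Fm L b := A.sub .var (single1 u)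

/-! ### Two-sorted intuitionistic predicate logic -/

/-- `Deriv Ax Γ A`: the formula `A` is deducible from the assumptions `Γ` (whose free variables are
held constant) in two-sorted intuitionistic predicate logic with the axioms `Ax`. -/
inductive Deriv (Ax : Fm L b → Prop) : List (Fm L b) → Fm L b → Prop
  | ax {Γ A} : Ax A → Deriv Ax Γ A
  | hyp {Γ A} : A ∈ Γ → Deriv Ax Γ A
  | impI {Γ A B} : Deriv Ax (A :: Γ) B → Deriv Ax Γ (.imp A B)
  | impE {Γ A B} : Deriv Ax Γ (.imp A B) → Deriv Ax Γ A → Deriv Ax Γ B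
  | andI {Γ A B} : Deriv Ax Γ A → Deriv Ax Γ B → Deriv Ax Γ (.and A B)
  | andE1 {Γ A B} : Deriv Ax Γ (.and A B) → Deriv Ax Γ A
  | andE2 {Γ A B} : Deriv Ax Γ (.and A B) → Deriv Ax Γ B
  | orI1 {Γ A B} : Deriv Ax Γ A → Deriv Ax Γ (.or A B)
  | orI2 {Γ A B} : Deriv Ax Γ B → Deriv Ax Γ (.or A B)
  | orE {Γ A B C} : Deriv Ax Γ (.or A B) → Deriv Ax (A :: Γ) C → Deriv Ax (B :: Γ) C →
      Deriv Ax Γ C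
  | negI {Γ A B} : Deriv Ax (A :: Γ) B → Deriv Ax (A :: Γ) (.neg B) → Deriv Ax Γ (.neg A)
  | negE {Γ A B} : Deriv Ax Γ (.neg A) → Deriv Ax Γ A → Deriv Ax Γ B
  | all0I {Γ A} : Deriv Ax (Γ.map (Fm.ren Nat.succ id)) A → Deriv Ax Γ (.all0 A)
  | all0E {Γ A} (t : Tm L b) : Deriv Ax Γ (.all0 A) → Deriv Ax Γ (A.inst0 t)
  | ex0I {Γ A} (t : Tm L b) : Deriv Ax Γ (A.inst0 t) → Deriv Ax Γ (.ex0 A)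
  | ex0E {Γ A C} : Deriv Ax Γ (.ex0 A) →
      Deriv Ax (A :: Γ.map (Fm.ren Nat.succ id)) (C.ren Nat.succ id) → Deriv Ax Γ C
  | all1I {Γ A} : Deriv Ax (Γ.map (Fm.ren id Nat.succ)) A → Deriv Ax Γ (.all1 A)
  | all1E {Γ A} (u : Fn L b) : Deriv Ax Γ (.all1 A) → Deriv Ax Γ (A.inst1 u)
  | ex1I {Γ A} (u : Fn L b) : Deriv Ax Γ (A.inst1 u) → Deriv Ax Γ (.ex1 A)
  | ex1E {Γ A C} : Deriv Ax Γ (.ex1 A) →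
      Deriv Ax (A :: Γ.map (Fm.ren id Nat.succ)) (C.ren id Nat.succ) → Deriv Ax Γ C

/-! ### The inclusion of the language without abstraction in the language with it -/

mutual
def Tm.emb : Tm L false → Tm L true
  | .var n => .var n
  | .cst f h ts us => .cst f h (fun i => (ts i).emb) (fun i => (us i).emb)
  | .app u t => .app u.emb t.emb
def Fn.emb : Fn L false → Fn L true
  | .var n => .var n
  | .cst f h => .cst f h
  | .lam _ t => .lam rfl t.emb
end

def Fm.emb : Fm L false → Fm L true
  | .eq s t => .eq s.emb t.emb
  | .imp A B => .imp A.emb B.emb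
  | .and A B => .and A.emb B.emb
  | .or A B => .or A.emb B.emb
  | .neg A => .neg A.emb
  | .all0 A => .all0 A.emb
  | .ex0 A => .ex0 A.emb
  | .all1 A => .all1 A.emb
  | .ex1 A => .ex1 A.emb

/-! ### Gödel numbers -/

mutual
def Tm.code : Tm L b → ℕ
  | .var n => Nat.pair 0 n
  | .cst f _ ts us => Nat.pair 1 (Nat.pair (L.code f)
      (Nat.pair (Encodable.encode (List.ofFn fun i => (ts i).code))
        (Encodable.encode (List.ofFn fun i => (us i).code))))
  | .app u t => Nat.pair 2 (Nat.pair u.code t.code)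
def Fn.code : Fn L b → ℕ
  | .var n => Nat.pair 0 n
  | .cst f _ => Nat.pair 1 (L.code f)
  | .lam _ t => Nat.pair 2 t.code
end

def Fm.code : Fm L b → ℕ
  | .eq s t => Nat.pair 0 (Nat.pair s.code t.code)
  | .imp A B => Nat.pair 1 (Nat.pair A.code B.code)
  | .and A B => Nat.pair 2 (Nat.pair A.code B.code)
  | .or A B => Nat.pair 3 (Nat.pair A.code B.code)
  | .neg A => Nat.pair 4 A.code
  | .all0 A => Nat.pair 5 A.code
  | .ex0 A => Nat.pair 6 A.code
  | .all1 A => Nat.pair 7 A.code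
  | .ex1 A => Nat.pair 8 A.code

/-! ### Definitional extensions -/

/-- An effective translation satisfying the elimination relations, from the formulas of the
system with axioms `Ax₂` (with abstraction) to those of the system with axioms `Ax₁` (without). -/
structure IsElimination (Ax₂ : Fm L true → Prop) (Ax₁ : Fm L false → Prop)
    (tr : Fm L true → Fm L false) : Prop where
  effective : ∃ g : ℕ → ℕ, Computable g ∧ ∀ E, (tr E).code = g E.code
  tr_emb : ∀ E : Fm L false, tr E.emb = E
  equiv : ∀ E : Fm L true, Deriv Ax₂ [] ((tr E).emb.iff E)
  sound : ∀ (Γ : List (Fm L true)) (E : Fm L true), Deriv Ax₂ Γ E → Deriv Ax₁ (Γ.map tr) (tr E)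
  tr_imp : ∀ A B, tr (.imp A B) = .imp (tr A) (tr B)
  tr_and : ∀ A B, tr (.and A B) = .and (tr A) (tr B)
  tr_or : ∀ A B, tr (.or A B) = .or (tr A) (tr B)
  tr_neg : ∀ A, tr (.neg A) = .neg (tr A)
  tr_all0 : ∀ A, tr (.all0 A) = .all0 (tr A)
  tr_ex0 : ∀ A, tr (.ex0 A) = .ex0 (tr A)
  tr_all1 : ∀ A, tr (.all1 A) = .all1 (tr A)
  tr_ex1 : ∀ A, tr (.ex1 A) = .ex1 (tr A)

/-- The system with axioms `Ax₂` (with abstraction) extends the system with axioms `Ax₁`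
(without abstraction), and it is a definitional extension of it. -/
def IsDefinitionalExtension (Ax₂ : Fm L true → Prop) (Ax₁ : Fm L false → Prop) : Prop :=
  (∀ (Γ : List (Fm L false)) (E : Fm L false),
    Deriv Ax₁ Γ E → Deriv Ax₂ (Γ.map Fm.emb) E.emb) ∧
  ∃ tr : Fm L true → Fm L false, IsElimination Ax₂ Ax₁ tr

/-! ### Axiom schemata common to the systems -/

/-- Induction: A(0) & ∀x (A(x) → A(x')) → ∀x A(x), for a constant 0 and a successor constant. -/
inductive Ind (zero : Tm L b) (succ : Tm L b → Tm L b) : Fm L b → Prop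
  | mk (A : Fm L b) : Ind zero succ
      (.imp (.and (A.inst0 zero)
        (.all0 (.imp A (A.sub (fun | 0 => succ (.var 0) | n + 1 => .var (n + 1)) .var))))
        (.all0 A))

/-- QF-AC₀₀: ∀x ∃y A(x, y) → ∃α ∀x A(x, α(x)), for A quantifier-free and not containing α. In
`A` the variables y, x are the number variables 0, 1. -/
inductive QFAC : Fm L b → Prop
  | mk (A : Fm L b) (hA : A.QF) : QFAC
      (.imp (.all0 (.ex0 A))
        (.ex1 (.all0 (A.sub (fun | 0 => .app (.var 0) (.var 0) | n + 1 => .var n)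
          (fun n => .var (n + 1))))))

/-- The schema of λ-conversion: (λx.t(x))(s) = t(s). -/
inductive LamConv : Fm L true → Prop
  | mk (t s : Tm L true) : LamConv (.eq (.app (lam t) s) (t.inst0 s))

/-! ### Primitive recursive descriptions and the system EL -/

/-- Descriptions of primitive recursive functions of `n` arguments. -/
inductive PR : ℕ → Type
  | zero (n : ℕ) : PR n
  | succ : PR 1
  | proj (n : ℕ) (i : Fin n) : PR n
  | comp {m n : ℕ} (g : PR m) (h : Fin m → PR n) : PR n
  | prec {n : ℕ} (g : PR n) (h : PR (n + 2)) : PR (n + 1)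

def PR.code : {n : ℕ} → PR n → ℕ
  | _, .zero _ => Nat.pair 0 0
  | _, .succ => Nat.pair 1 0
  | _, .proj _ i => Nat.pair 2 i
  | _, .comp (m := m) g h => Nat.pair 3 (Nat.pair m (Nat.pair g.code
      (Encodable.encode (List.ofFn fun i => (h i).code))))
  | _, .prec g h => Nat.pair 4 (Nat.pair g.code h.code)

theorem PR.code_injective {n : ℕ} (p q : PR n) (e : p.code = q.code) : p = q := by
  induction p with
  | zero n => cases q <;> simp_all [PR.code]
  | succ => cases q <;> simp_all [PR.code]
  | proj n i => cases q <;> simp_all [PR.code, Fin.ext_iff]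
  | comp g h ihg ihh =>
    cases q with
    | comp g' h' =>
      simp only [PR.code, Nat.pair_eq_pair, true_and] at e
      obtain ⟨rfl, e1, e2⟩ := e
      have e3 := List.ofFn_injective (Encodable.encode_injective e2)
      rw [ihg g' e1, funext fun i => ihh i (h' i) (congrFun e3 i)]
    | _ => simp_all [PR.code]
  | prec g h ihg ihh =>
    cases q with
    | prec g' h' =>
      simp only [PR.code, Nat.pair_eq_pair, true_and] at e
      rw [ihg g' e.1, ihh h' e.2]
    | _ => simp_all [PR.code]

/-- The constants of EL: 0, a constant for each primitive recursive description, the recursor. -/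
inductive ELCon : Type
  | zero : ELCon
  | prim (n : ℕ) (p : PR n) : ELCon
  | recursor : ELCon

def ELCon.code : ELCon → ℕ
  | .zero => Nat.pair 0 0
  | .prim n p => Nat.pair 1 (Nat.pair n p.code)
  | .recursor => Nat.pair 2 0

theorem ELCon.code_injective : Function.Injective ELCon.code := by
  intro p q e
  cases p <;> cases q <;> simp only [ELCon.code, Nat.pair_eq_pair] at e <;> try omega
  · rfl
  · obtain ⟨-, rfl, e⟩ := e
    rw [PR.code_injective _ _ e]
  · rfl

abbrev ELSig : Sig where
  Con := ELCon
  nArg := fun | .zero => 0 | .prim n _ => n | .recursor => 2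
  fArg := fun | .zero => 0 | .prim _ _ => 0 | .recursor => 1
  code := ELCon.code
  code_injective := ELCon.code_injective

namespace EL

def zero : Tm ELSig b := call (L := ELSig) ELCon.zero ![] ![]
def prim {n : ℕ} (p : PR n) (ts : Fin n → Tm ELSig b) : Tm ELSig b :=
  call (L := ELSig) (ELCon.prim n p) ts ![]
def succ (t : Tm ELSig b) : Tm ELSig b := prim PR.succ ![t]
/-- rec(t, u, s) -/
def recr (t : Tm ELSig b) (u : Fn ELSig b) (s : Tm ELSig b) : Tm ELSig b :=
  call (L := ELSig) ELCon.recursor ![t, s] ![u]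

/-- The description of y + x by recursion on y. -/
def addD : PR 2 := .prec (.proj 1 0) (.comp .succ ![.proj 3 1])
/-- The description of y · x by recursion on y. -/
def mulD : PR 2 := .prec (.zero 1) (.comp addD ![.proj 3 1, .proj 3 2])
/-- The description of x ^ y, as a function of (y, x), by recursion on y. -/
def powD : PR 2 := .prec (.comp .succ ![.zero 1]) (.comp mulD ![.proj 3 1, .proj 3 2])

/-- ⟨t, s⟩ = 2 ^ t · 3 ^ s -/
def pair (t s : Tm ELSig b) : Tm ELSig b :=
  prim mulD ![prim powD ![t, succ (succ zero)], prim powD ![s, succ (succ (succ zero))]]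

/-- The axioms of HA₁ other than λ-conversion, with the schemata for the language given by `b`. -/
inductive Arith : Fm ELSig b → Prop
  | refl : Arith (.eq (.var 0) (.var 0))
  | repl (A : Fm ELSig b) (i j : ℕ) :
      Arith (.imp (.and (A.inst0 (.var i)) (.eq (.var i) (.var j))) (A.inst0 (.var j)))
  | ind (A : Fm ELSig b) : Ind zero succ A → Arith A
  | succ_ne_zero : Arith (.neg (.eq (succ zero) zero))
  | prim_zero (n : ℕ) : Arith (.eq (prim (.zero n) fun i => .var i) zero)
  | prim_proj (n : ℕ) (i : Fin n) : Arith (.eq (prim (.proj n i) fun j => .var j) (.var i))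
  | prim_comp {m n : ℕ} (g : PR m) (h : Fin m → PR n) :
      Arith (.eq (prim (.comp g h) fun i => .var i) (prim g fun j => prim (h j) fun i => .var i))
  | prim_prec_zero {n : ℕ} (g : PR n) (h : PR (n + 2)) :
      Arith (.eq (prim (.prec g h) (Fin.cons zero fun i => .var i)) (prim g fun i => .var i))
  | prim_prec_succ {n : ℕ} (g : PR n) (h : PR (n + 2)) :
      Arith (.eq (prim (.prec g h) (Fin.cons (succ (.var 0)) fun i => .var (i + 1)))
        (prim h (Fin.cons (.var 0) (Fin.cons
          (prim (.prec g h) (Fin.cons (.var 0) fun i => .var (i + 1)))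
          fun i => .var (i + 1)))))
  | rec_zero : Arith (.eq (recr (.var 0) (.var 0) zero) (.var 0))
  | rec_succ : Arith (.eq (recr (.var 0) (.var 0) (succ (.var 1)))
      (.app (.var 0) (pair (recr (.var 0) (.var 0) (.var 1)) (.var 1))))

/-- The axioms of EL = HA₁ + QF-AC₀₀. -/
def WithLam (A : Fm ELSig true) : Prop := Arith A ∨ QFAC A ∨ LamConv A

/-- The axioms of EL − λ. -/
def WithoutLam (A : Fm ELSig false) : Prop := Arith A ∨ QFAC A

end EL

/-! ### The systems based on IA₁ -/

/-- The 27 function(al) constants f₀, …, f₂₆ of IA₁, in this order. -/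
inductive IACon : Type
  | zero | succ | add | mul | pow | fac | pd | sub | min | max | sgb | sg | dist | rm | quo
  | sum | prod | minle | maxle | prime | expo | lh | conc | bar | tilde | circ | ccp

def IACon.idx : IACon → ℕ
  | .zero => 0 | .succ => 1 | .add => 2 | .mul => 3 | .pow => 4 | .fac => 5 | .pd => 6 | .sub => 7
  | .min => 8 | .max => 9 | .sgb => 10 | .sg => 11 | .dist => 12 | .rm => 13 | .quo => 14
  | .sum => 15 | .prod => 16 | .minle => 17 | .maxle => 18 | .prime => 19 | .expo => 20 | .lh => 21
  | .conc => 22 | .bar => 23 | .tilde => 24 | .circ => 25 | .ccp => 26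

theorem IACon.idx_injective : Function.Injective IACon.idx := by
  intro p q e
  cases p <;> cases q <;> first | rfl | (simp [IACon.idx] at e)

abbrev IASig : Sig where
  Con := IACon
  nArg := fun
    | .zero => 0
    | .succ | .fac | .pd | .sgb | .sg | .sum | .prod | .minle | .maxle | .prime | .lh | .bar
    | .tilde | .ccp => 1
    | .add | .mul | .pow | .sub | .min | .max | .dist | .rm | .quo | .expo | .conc | .circ => 2
  fArg := fun
    | .sum | .prod | .minle | .maxle | .bar | .tilde => 1
    | _ => 0
  code := IACon.idx
  code_injective := IACon.idx_injective

namespace IA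

def zero : Tm IASig b := call (L := IASig) IACon.zero ![] ![]
/-- t' -/
def succ (t : Tm IASig b) : Tm IASig b := call (L := IASig) IACon.succ ![t] ![]
def add (s t : Tm IASig b) : Tm IASig b := call (L := IASig) IACon.add ![s, t] ![]
def mul (s t : Tm IASig b) : Tm IASig b := call (L := IASig) IACon.mul ![s, t] ![]
/-- s ^ t -/
def pow (s t : Tm IASig b) : Tm IASig b := call (L := IASig) IACon.pow ![s, t] ![]
/-- t! -/
def fac (t : Tm IASig b) : Tm IASig b := call (L := IASig) IACon.fac ![t] ![]
/-- predecessor -/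
def pd (t : Tm IASig b) : Tm IASig b := call (L := IASig) IACon.pd ![t] ![]
/-- truncated subtraction s ∸ t -/
def sub (s t : Tm IASig b) : Tm IASig b := call (L := IASig) IACon.sub ![s, t] ![]
def min (s t : Tm IASig b) : Tm IASig b := call (L := IASig) IACon.min ![s, t] ![]
def max (s t : Tm IASig b) : Tm IASig b := call (L := IASig) IACon.max ![s, t] ![]
/-- the complement of the sign -/
def sgb (t : Tm IASig b) : Tm IASig b := call (L := IASig) IACon.sgb ![t] ![]
/-- sign -/
def sg (t : Tm IASig b) : Tm IASig b := call (L := IASig) IACon.sg ![t] ![]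
/-- |s - t| -/
def dist (s t : Tm IASig b) : Tm IASig b := call (L := IASig) IACon.dist ![s, t] ![]
/-- remainder of s by t -/
def rm (s t : Tm IASig b) : Tm IASig b := call (L := IASig) IACon.rm ![s, t] ![]
/-- integer quotient of s by t -/
def quo (s t : Tm IASig b) : Tm IASig b := call (L := IASig) IACon.quo ![s, t] ![]
/-- Σ_{y<t} u(y) -/
def sum (t : Tm IASig b) (u : Fn IASig b) : Tm IASig b := call (L := IASig) IACon.sum ![t] ![u]
/-- Π_{y<t} u(y) -/
def prod (t : Tm IASig b) (u : Fn IASig b) : Tm IASig b := call (L := IASig) IACon.prod ![t] ![u]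
/-- min_{y≤t} u(y) -/
def minle (t : Tm IASig b) (u : Fn IASig b) : Tm IASig b := call (L := IASig) IACon.minle ![t] ![u]
/-- max_{y≤t} u(y) -/
def maxle (t : Tm IASig b) (u : Fn IASig b) : Tm IASig b := call (L := IASig) IACon.maxle ![t] ![u]
/-- the t-th prime -/
def prime (t : Tm IASig b) : Tm IASig b := call (L := IASig) IACon.prime ![t] ![]
/-- (s)_t, the exponent of the t-th prime in s -/
def expo (s t : Tm IASig b) : Tm IASig b := call (L := IASig) IACon.expo ![s, t] ![]
/-- lh(t) -/
def lh (t : Tm IASig b) : Tm IASig b := call (L := IASig) IACon.lh ![t] ![]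
/-- s * t, concatenation -/
def conc (s t : Tm IASig b) : Tm IASig b := call (L := IASig) IACon.conc ![s, t] ![]
/-- the code of the sequence u(0) + 1, …, u(t-1) + 1 -/
def bar (t : Tm IASig b) (u : Fn IASig b) : Tm IASig b := call (L := IASig) IACon.bar ![t] ![u]
/-- the code of the sequence u(0), …, u(t-1) -/
def tilde (t : Tm IASig b) (u : Fn IASig b) : Tm IASig b := call (L := IASig) IACon.tilde ![t] ![u]
/-- s ∘ t -/
def circ (s t : Tm IASig b) : Tm IASig b := call (L := IASig) IACon.circ ![s, t] ![]
def ccp (t : Tm IASig b) : Tm IASig b := call (L := IASig) IACon.ccp ![t] ![]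

def one : Tm IASig b := succ zero
def two : Tm IASig b := succ one

/-- The axioms of IA₁ for equality and for the constants f₀, …, f₁₈, the first axiom for f₁₉ and
for f₂₆ (none of which contains λ), and induction, for the language given by `b`. The number
variables 0, 1, 2 are written a, b, c below. -/
inductive Arith : Fm IASig b → Prop
  | ind (A : Fm IASig b) : Ind zero succ A → Arith A
  /-- a = b → (a = c → b = c) -/
  | eq_trans : Arith (.imp (.eq (.var 0) (.var 1))
      (.imp (.eq (.var 0) (.var 2)) (.eq (.var 1) (.var 2))))
  /-- a = b → α(a) = α(b) -/
  | eq_app : Arith (.imp (.eq (.var 0) (.var 1))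
      (.eq (.app (.var 0) (.var 0)) (.app (.var 0) (.var 1))))
  | succ_ne_zero : Arith (.neg (.eq (succ (.var 0)) zero))
  | succ_congr : Arith (.imp (.eq (.var 0) (.var 1)) (.eq (succ (.var 0)) (succ (.var 1))))
  | succ_inj : Arith (.imp (.eq (succ (.var 0)) (succ (.var 1))) (.eq (.var 0) (.var 1)))
  | add_zero : Arith (.eq (add (.var 0) zero) (.var 0))
  | add_succ : Arith (.eq (add (.var 0) (succ (.var 1))) (succ (add (.var 0) (.var 1))))
  | mul_zero : Arith (.eq (mul (.var 0) zero) zero)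
  | mul_succ : Arith (.eq (mul (.var 0) (succ (.var 1))) (add (mul (.var 0) (.var 1)) (.var 0)))
  | pow_zero : Arith (.eq (pow (.var 0) zero) one)
  | pow_succ : Arith (.eq (pow (.var 0) (succ (.var 1))) (mul (pow (.var 0) (.var 1)) (.var 0)))
  | fac_zero : Arith (.eq (fac zero) one)
  | fac_succ : Arith (.eq (fac (succ (.var 0))) (mul (fac (.var 0)) (succ (.var 0))))
  | pd_zero : Arith (.eq (pd zero) zero)
  | pd_succ : Arith (.eq (pd (succ (.var 0))) (.var 0))
  | sub_zero : Arith (.eq (sub (.var 0) zero) (.var 0))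
  | sub_succ : Arith (.eq (sub (.var 0) (succ (.var 1))) (pd (sub (.var 0) (.var 1))))
  | min_def : Arith (.eq (min (.var 0) (.var 1)) (sub (.var 1) (sub (.var 1) (.var 0))))
  | max_def : Arith (.eq (max (.var 0) (.var 1)) (add (sub (.var 0) (.var 1)) (.var 1)))
  | sgb_zero : Arith (.eq (sgb zero) one)
  | sgb_succ : Arith (.eq (sgb (succ (.var 0))) zero)
  | sg_zero : Arith (.eq (sg zero) zero)
  | sg_succ : Arith (.eq (sg (succ (.var 0))) one)
  | dist_def : Arith (.eq (dist (.var 0) (.var 1))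
      (add (sub (.var 0) (.var 1)) (sub (.var 1) (.var 0))))
  | rm_zero : Arith (.eq (rm zero (.var 1)) zero)
  | rm_succ : Arith (.eq (rm (succ (.var 0)) (.var 1))
      (mul (succ (rm (.var 0) (.var 1))) (sg (dist (.var 1) (succ (rm (.var 0) (.var 1)))))))
  | quo_zero : Arith (.eq (quo zero (.var 1)) zero)
  | quo_succ : Arith (.eq (quo (succ (.var 0)) (.var 1))
      (add (quo (.var 0) (.var 1)) (sgb (dist (.var 1) (succ (rm (.var 0) (.var 1)))))))
  | sum_zero : Arith (.eq (sum zero (.var 0)) zero)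
  | sum_succ : Arith (.eq (sum (succ (.var 0)) (.var 0))
      (add (sum (.var 0) (.var 0)) (.app (.var 0) (.var 0))))
  | prod_zero : Arith (.eq (prod zero (.var 0)) one)
  | prod_succ : Arith (.eq (prod (succ (.var 0)) (.var 0))
      (mul (prod (.var 0) (.var 0)) (.app (.var 0) (.var 0))))
  | minle_zero : Arith (.eq (minle zero (.var 0)) (.app (.var 0) zero))
  | minle_succ : Arith (.eq (minle (succ (.var 0)) (.var 0))
      (min (minle (.var 0) (.var 0)) (.app (.var 0) (succ (.var 0)))))
  | maxle_zero : Arith (.eq (maxle zero (.var 0)) (.app (.var 0) zero))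
  | maxle_succ : Arith (.eq (maxle (succ (.var 0)) (.var 0))
      (max (maxle (.var 0) (.var 0)) (.app (.var 0) (succ (.var 0)))))
  | prime_zero : Arith (.eq (prime zero) two)
  | ccp_zero : Arith (.eq (ccp zero) one)

/-- μy_{y<z} R(y), as the term Σ_{x<z} Π_{y<x'} r(y), where the term `r` has values at most 1 and
r(y) = 0 expresses R(y); in `r` the variable y is the number variable 0. -/
def mu (z r : Tm IASig true) : Tm IASig true :=
  sum z (lam (prod (succ (.var 0)) (lam (r.ren (up Nat.succ) id))))

/-- Terms with values at most 1 that are 0 if and only if s < t, s ∣ t, not s ∣ t, t is a prime (it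
has exactly two divisors among 1, …, t), and both relations hold. -/
def ltChar (s t : Tm IASig b) : Tm IASig b := sg (sub (succ s) t)
def dvdChar (s t : Tm IASig b) : Tm IASig b := sg (rm t s)
def notDvdChar (s t : Tm IASig b) : Tm IASig b := sgb (rm t s)
def primeChar (t : Tm IASig true) : Tm IASig true :=
  sg (dist (sum t (lam (sgb (rm (t.ren Nat.succ id) (succ (.var 0)))))) two)
def andChar (s t : Tm IASig b) : Tm IASig b := sg (add s t)

/-- The defining equations `s = t` of IA₁ that are written with λ. The term `r` is r(y, z), with y,
z the number variables 0, 1. -/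
inductive LamDef (r : Tm IASig true) : Tm IASig false → Tm IASig true → Prop
  /-- p_{i'} = μb_{b < p_i! + 2} [p_i < b & Pr(b)] -/
  | prime_succ : LamDef r (prime (succ (.var 0)))
      (mu (add (fac (prime (.var 0))) two)
        (andChar (ltChar (prime (.var 1)) (.var 0)) (primeChar (.var 0))))
  /-- (a)_i = μx_{x < a} [p_i ^ x ∣ a & ¬ p_i ^ x' ∣ a], a, i being the variables 0, 1 -/
  | expo_def : LamDef r (expo (.var 0) (.var 1))
      (mu (.var 0) (andChar (dvdChar (pow (prime (.var 2)) (.var 0)) (.var 1))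
        (notDvdChar (pow (prime (.var 2)) (succ (.var 0))) (.var 1))))
  /-- lh(a) = Σ_{i < a} sg((a)_i) -/
  | lh_def : LamDef r (lh (.var 0)) (sum (.var 0) (lam (sg (expo (.var 1) (.var 0)))))
  /-- a * b = a · Π_{i < lh(b)} p_{lh(a) + i} ^ (b)_i, a, b being the variables 0, 1 -/
  | conc_def : LamDef r (conc (.var 0) (.var 1))
      (mul (.var 0) (prod (lh (.var 1))
        (lam (pow (prime (add (lh (.var 1)) (.var 0))) (expo (.var 2) (.var 0))))))
  /-- Π_{i < x} p_i ^ (α(i) + 1) -/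
  | bar_def : LamDef r (bar (.var 0) (.var 0))
      (prod (.var 0) (lam (pow (prime (.var 0)) (add (.app (.var 0) (.var 0)) one))))
  /-- Π_{i < x} p_i ^ α(i) -/
  | tilde_def : LamDef r (tilde (.var 0) (.var 0))
      (prod (.var 0) (lam (pow (prime (.var 0)) (.app (.var 0) (.var 0)))))
  /-- a ∘ b = Π_{i < max(a, b)} p_i ^ max((a)_i, (b)_i), a, b being the variables 0, 1 -/
  | circ_def : LamDef r (circ (.var 0) (.var 1))
      (prod (max (.var 0) (.var 1))
        (lam (pow (prime (.var 0)) (max (expo (.var 1) (.var 0)) (expo (.var 2) (.var 0))))))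
  /-- ccp(y') = ccp(y) · p_y ^ r(y, ccp(y)) -/
  | ccp_succ : LamDef r (ccp (succ (.var 0)))
      (mul (ccp (.var 0)) (pow (prime (.var 0))
        (r.sub (fun | 0 => .var 0 | 1 => ccp (.var 0) | n + 2 => .var n) .var)))

end IA

mutual
/-- All free number (function) variables have index below `m` (below `n`), and all constants
satisfy `P`. -/
def Tm.Below (P : L.Con → Prop) (m n : ℕ) : Tm L b → Prop
  | .var i => i < m
  | .cst f _ ts us => P f ∧ (∀ i, (ts i).Below P m n) ∧ ∀ i, (us i).Below P m n
  | .app u t => u.Below P m n ∧ t.Below P m n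
def Fn.Below (P : L.Con → Prop) (m n : ℕ) : Fn L b → Prop
  | .var i => i < n
  | .cst f _ => P f
  | .lam _ t => t.Below P (m + 1) n
end

/-! ### The graph of a term, expressed without λ -/

/-- ∃ over `k` number variables. -/
def exs0 : ℕ → Fm L b → Fm L b
  | 0, A => A
  | k + 1, A => .ex0 (exs0 k A)

/-- ∃ over `k` function variables. -/
def exs1 : ℕ → Fm L b → Fm L b
  | 0, A => A
  | k + 1, A => .ex1 (exs1 k A)

/-- Index of a variable of the graph of an argument, below the new quantifiers: the value of the
argument becomes the variable `i`, the other variables are raised. -/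
def slot (i k : ℕ) : ℕ → ℕ
  | 0 => i
  | n + 1 => n + k

mutual
/-- A λ-free formula saying that the value of the term is w, where w is the number variable 0 (the
number variables of the term are raised by 1): the values of all subterms and functors are named by
quantified variables, and a function variable α is a value of λx.s when, for all x, α(x) is the
value of s. For f(t₁, …, u₁, …) it is
∃y₁ … ∃β₁ … [y₁ is the value of t₁ & … & β₁ is the value of u₁ & … & f(y₁, …, β₁, …) = w]. -/
def Tm.graph : Tm L true → Fm L false
  | .var n => .eq (.var (n + 1)) (.var 0)
  | .cst f h ts us =>
      exs0 (L.nArg f) (exs1 (L.fArg f)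
        ((List.ofFn fun i => (ts i).graph.ren (slot i (L.nArg f + 1)) (· + L.fArg f)).foldr .and
          ((List.ofFn fun j => (us j).graph.ren (· + (L.nArg f + 1)) (slot j (L.fArg f))).foldr .and
            (.eq (.cst f h (fun i => .var i) (fun j => .var j)) (.var (L.nArg f))))))
  | .app u t =>
      .ex0 (.ex1 (.and (u.graph.ren (· + 2) id)
        (.and (t.graph.ren (slot 0 2) Nat.succ) (.eq (.app (.var 0) (.var 0)) (.var 1)))))
/-- A λ-free formula saying that the value of the functor is α, where α is the function variable 0
(the function variables of the functor are raised by 1). -/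
def Fn.graph : Fn L true → Fm L false
  | .var n => .all0 (.eq (.app (.var (n + 1)) (.var 0)) (.app (.var 0) (.var 0)))
  | .cst f h => .all0 (.eq (.app (.cst f h) (.var 0)) (.app (.var 0) (.var 0)))
  | .lam _ s => .all0 (.ex0 (.and (s.graph.ren id Nat.succ)
      (.eq (.var 0) (.app (.var 0) (.var 1)))))
end

namespace IA

/-- The defining equations written with λ, in the system with λ. -/
inductive Def (r : Tm IASig true) : Fm IASig true → Prop
  | mk (s : Tm IASig false) (t : Tm IASig true) : LamDef r s t → Def r (.eq s.emb t)

/-- The same equations s = t, expressed in the language without λ: for all w, if w is the value of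
t, then s = w. -/
inductive DefWithout (r : Tm IASig true) : Fm IASig false → Prop
  | mk (s : Tm IASig false) (t : Tm IASig true) : LamDef r s t →
      DefWithout r (.all0 (.imp t.graph (.eq (s.ren Nat.succ id) (.var 0))))

/-- The axioms of IA₁ + QF-AC₀₀. -/
def WithLam (r : Tm IASig true) (A : Fm IASig true) : Prop :=
  Arith A ∨ Def r A ∨ QFAC A ∨ LamConv A

/-- The axioms of IA₁ + QF-AC₀₀ − λ. -/
def WithoutLam (r : Tm IASig true) (A : Fm IASig false) : Prop :=
  Arith A ∨ DefWithout r A ∨ QFAC A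

/-- The requirement on the term r(y, z) in the definition of ccp = f₂₆: it contains only the
constants f₀, …, f₂₅, and no free variables other than the number variables y, z. -/
def Admissible (r : Tm IASig true) : Prop :=
  r.Below (L := IASig) (fun f => IACon.idx f < 26) 2 0

end IA

end TwoSorted

/-!
# Elimination of λ from two-sorted intuitionistic arithmetic

The translation `Fm.tr` leaves the logical symbols alone and acts on equations. An equation without λ
stays as it is; an equation s = t in which λ occurs becomes ∃w (w is the value of s & w is the value
of t), where the λ-free formula "w is the value of t" is the graph `Tm.graph`. It has to be shown that
the translation is sound for the system without λ, that E′ ↔ E holds in the presence of λ-conversion,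
and that the translation is computable.

*Soundness.* Values are unique (`Ev.uniq`) and compatible with substitution (`ev_sub`), by induction on
terms. The quantifier rules for arbitrary terms and λ-conversion also require that every term has a value
(`ev_total`). This is proved in a stronger form, `total`: the value of t is a function of the number
variables, since the value of λx.t has to be a function, and the only means to obtain functions is
QF-AC₀₀. The induction passes through a constant f with a function argument provided that
f(γ(x), λy.B(x, y)) is a function of x for all functions γ and B (`Pairing.Uniform`); several variables are
combined into one by a pairing. As the terms of the language do not suffice for the projections of a
pairing in an obvious way, these are defined from a function variable for the integer square root, whose
existence follows by QF-AC₀₀ (`Arithmetic.pairing`). Then deductions translate (`tr_sound`), and so do the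
schemata: induction and λ-conversion directly (`tr_ind`, `tr_lamConv`), the defining equations with λ
because their λ-free versions are axioms (`tr_def`), and QF-AC₀₀ because the translation of a
quantifier-free formula is equivalent to a λ-free quantifier-free formula in which function variables name
the functions defined by the terms (`representable`, `tr_qfac`).

*Equivalence.* With λ-conversion the graph of t is equivalent to t = w (`graph_emb_iff`), which gives
E′ ↔ E (`tr_equiv`) and the λ-free versions of the defining equations (`def_emb`).

*Computability.* The translation is primitive recursive on codes, by a recursion along subexpressions
(`exists_primrec`) that carries the renaming under which a graph occurs (`graphRel_step`,
`tr_computable`).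

*Uniform evaluation in EL* (`uniform_recursor`). The recursion with λz.B(x, z) is a component of a recursion
with one fixed function, whose values carry x and the argument along. This function has to decode
2 ^ a · 3 ^ b, which is possible by QF-AC₀₀ (`exists_decode`).

*Uniform evaluation in IA₁* (`uniform`). All sections λy.B(x, y) are laid out in one function δ, the block
at k² + y with y ≤ 2k being a section for each k. A sum over a section is a difference of two partial sums of
δ (`uniformOp_sum`). A product is a quotient of two partial products, once the factors 0 are replaced by 1
and counted by a sum (`uniformOp_prod`). Maxima and minima are determined by the comparisons of the values
with a threshold, which are products (`Threshold.uniformOp`), and the operations on finite sequences are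
products of a composition (`UniformOp.comp`).
-/

namespace TwoSorted
variable {L : Sig} {b : Bool}

/-! ### The calculus of renamings and substitutions -/

theorem up_comp (ρ ρ' : ℕ → ℕ) (n : ℕ) : up ρ' (up ρ n) = up (fun n => ρ' (ρ n)) n := by
  cases n <;> rfl

theorem up_comp' (ρ ρ' : ℕ → ℕ) : (fun n => up ρ' (up ρ n)) = up (fun n => ρ' (ρ n)) :=
  funext (up_comp ρ ρ')

mutual
theorem Tm.ren_ren (ρ θ ρ' θ' : ℕ → ℕ) : ∀ t : Tm L b,
    (t.ren ρ θ).ren ρ' θ' = t.ren (fun n => ρ' (ρ n)) (fun n => θ' (θ n))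
  | .var n => rfl
  | .cst f h ts us => by
    simp only [Tm.ren, Tm.cst.injEq, heq_eq_eq, true_and]
    exact ⟨funext fun i => (ts i).ren_ren .., funext fun i => (us i).ren_ren ..⟩
  | .app u t => by simp only [Tm.ren, u.ren_ren, t.ren_ren]
theorem Fn.ren_ren (ρ θ ρ' θ' : ℕ → ℕ) : ∀ t : Fn L b,
    (t.ren ρ θ).ren ρ' θ' = t.ren (fun n => ρ' (ρ n)) (fun n => θ' (θ n))
  | .var n => rfl
  | .cst f h => rfl
  | .lam h t => by simp only [Fn.ren, t.ren_ren, up_comp']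
end

theorem Fm.ren_ren (A : Fm L b) : ∀ (ρ θ ρ' θ' : ℕ → ℕ),
    (A.ren ρ θ).ren ρ' θ' = A.ren (fun n => ρ' (ρ n)) (fun n => θ' (θ n)) := by
  induction A <;> intros <;> simp_all [Fm.ren, Tm.ren_ren, up_comp']

theorem upN_up (σ : ℕ → Tm L b) (ρ : ℕ → ℕ) :
    (fun n => upN σ (up ρ n)) = upN (fun n => σ (ρ n)) := by
  funext n; cases n <;> rfl

theorem upF_up (τ : ℕ → Fn L b) (ρ : ℕ → ℕ) :
    (fun n => upF τ (up ρ n)) = upF (fun n => τ (ρ n)) := by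
  funext n; cases n <;> rfl

mutual
theorem Tm.ren_sub (ρ θ : ℕ → ℕ) : ∀ (t : Tm L b) (σ : ℕ → Tm L b) (τ : ℕ → Fn L b),
    (t.ren ρ θ).sub σ τ = t.sub (fun n => σ (ρ n)) (fun n => τ (θ n))
  | .var n, σ, τ => rfl
  | .cst f h ts us, σ, τ => by
    simp only [Tm.ren, Tm.sub, Tm.cst.injEq, heq_eq_eq, true_and]
    exact ⟨funext fun i => (ts i).ren_sub .., funext fun i => (us i).ren_sub ..⟩
  | .app u t, σ, τ => by simp only [Tm.ren, Tm.sub, u.ren_sub, t.ren_sub]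
theorem Fn.ren_sub (ρ θ : ℕ → ℕ) : ∀ (t : Fn L b) (σ : ℕ → Tm L b) (τ : ℕ → Fn L b),
    (t.ren ρ θ).sub σ τ = t.sub (fun n => σ (ρ n)) (fun n => τ (θ n))
  | .var n, σ, τ => rfl
  | .cst f h, σ, τ => rfl
  | .lam h t, σ, τ => by simp only [Fn.ren, Fn.sub, t.ren_sub, upN_up]
end

theorem Fm.ren_sub (A : Fm L b) : ∀ (ρ θ : ℕ → ℕ) (σ : ℕ → Tm L b) (τ : ℕ → Fn L b),
    (A.ren ρ θ).sub σ τ = A.sub (fun n => σ (ρ n)) (fun n => τ (θ n)) := by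
  induction A <;> intros <;> simp_all [Fm.ren, Fm.sub, Tm.ren_sub, upN_up, upF_up]

theorem upN_ren (σ : ℕ → Tm L b) (ρ θ : ℕ → ℕ) :
    (fun n => (upN σ n).ren (up ρ) θ) = upN (fun n => (σ n).ren ρ θ) := by
  funext n; cases n
  · rfl
  · simp [upN, Tm.ren_ren, up]

theorem upF_ren (τ : ℕ → Fn L b) (ρ θ : ℕ → ℕ) :
    (fun n => (upF τ n).ren ρ (up θ)) = upF (fun n => (τ n).ren ρ θ) := by
  funext n; cases n
  · rfl
  · simp [upF, Fn.ren_ren, up]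

mutual
theorem Tm.sub_ren : ∀ (t : Tm L b) (σ : ℕ → Tm L b) (τ : ℕ → Fn L b) (ρ θ : ℕ → ℕ),
    (t.sub σ τ).ren ρ θ = t.sub (fun n => (σ n).ren ρ θ) (fun n => (τ n).ren ρ θ)
  | .var n, σ, τ, _, _ => rfl
  | .cst f h ts us, σ, τ, _, _ => by
    simp only [Tm.ren, Tm.sub, Tm.cst.injEq, heq_eq_eq, true_and]
    exact ⟨funext fun i => (ts i).sub_ren .., funext fun i => (us i).sub_ren ..⟩
  | .app u t, σ, τ, _, _ => by simp only [Tm.ren, Tm.sub, u.sub_ren, t.sub_ren]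
theorem Fn.sub_ren : ∀ (t : Fn L b) (σ : ℕ → Tm L b) (τ : ℕ → Fn L b) (ρ θ : ℕ → ℕ),
    (t.sub σ τ).ren ρ θ = t.sub (fun n => (σ n).ren ρ θ) (fun n => (τ n).ren ρ θ)
  | .var n, σ, τ, _, _ => rfl
  | .cst f h, σ, τ, _, _ => rfl
  | .lam h t, σ, τ, _, _ => by
    simp only [Fn.ren, Fn.sub, t.sub_ren, upN_ren, Fn.ren_ren, up, id]
end

theorem Fm.sub_ren (A : Fm L b) : ∀ (σ : ℕ → Tm L b) (τ : ℕ → Fn L b) (ρ θ : ℕ → ℕ),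
    (A.sub σ τ).ren ρ θ = A.sub (fun n => (σ n).ren ρ θ) (fun n => (τ n).ren ρ θ) := by
  induction A <;> intros <;>
    simp_all [Fm.ren, Fm.sub, Tm.sub_ren, upN_ren, upF_ren, Tm.ren_ren, Fn.ren_ren, up]

theorem upN_sub (σ σ' : ℕ → Tm L b) (τ' : ℕ → Fn L b) :
    (fun n => (upN σ n).sub (upN σ') (fun n => (τ' n).ren Nat.succ id)) =
      upN (fun n => (σ n).sub σ' τ') := by
  funext n; cases n
  · rfl
  · simp [upN, Tm.ren_sub, Tm.sub_ren]

theorem upF_sub (τ : ℕ → Fn L b) (σ' : ℕ → Tm L b) (τ' : ℕ → Fn L b) :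
    (fun n => (upF τ n).sub (fun n => (σ' n).ren id Nat.succ) (upF τ')) =
      upF (fun n => (τ n).sub σ' τ') := by
  funext n; cases n
  · rfl
  · simp [upF, Fn.ren_sub, Fn.sub_ren]

mutual
theorem Tm.sub_sub : ∀ (t : Tm L b) (σ : ℕ → Tm L b) (τ : ℕ → Fn L b) (σ' : ℕ → Tm L b)
    (τ' : ℕ → Fn L b),
    (t.sub σ τ).sub σ' τ' = t.sub (fun n => (σ n).sub σ' τ') (fun n => (τ n).sub σ' τ')
  | .var n, σ, τ, _, _ => rfl
  | .cst f h ts us, σ, τ, _, _ => by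
    simp only [Tm.sub, Tm.cst.injEq, heq_eq_eq, true_and]
    exact ⟨funext fun i => (ts i).sub_sub .., funext fun i => (us i).sub_sub ..⟩
  | .app u t, σ, τ, _, _ => by simp only [Tm.sub, u.sub_sub, t.sub_sub]
theorem Fn.sub_sub : ∀ (t : Fn L b) (σ : ℕ → Tm L b) (τ : ℕ → Fn L b) (σ' : ℕ → Tm L b)
    (τ' : ℕ → Fn L b),
    (t.sub σ τ).sub σ' τ' = t.sub (fun n => (σ n).sub σ' τ') (fun n => (τ n).sub σ' τ')
  | .var n, σ, τ, _, _ => rfl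
  | .cst f h, σ, τ, _, _ => rfl
  | .lam h t, σ, τ, _, _ => by
    simp only [Fn.sub, t.sub_sub, upN_sub, Fn.ren_sub, Fn.sub_ren]
    rfl
end

theorem upN_succ (σ : ℕ → Tm L b) (n : ℕ) : upN σ (n + 1) = (σ n).ren Nat.succ id := rfl

theorem upF_succ (τ : ℕ → Fn L b) (n : ℕ) : upF τ (n + 1) = (τ n).ren id Nat.succ := rfl

theorem Fm.sub_sub (A : Fm L b) : ∀ (σ : ℕ → Tm L b) (τ : ℕ → Fn L b) (σ' : ℕ → Tm L b)
    (τ' : ℕ → Fn L b),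
    (A.sub σ τ).sub σ' τ' = A.sub (fun n => (σ n).sub σ' τ') (fun n => (τ n).sub σ' τ') := by
  induction A <;> intros <;>
    simp_all [Fm.sub, Tm.sub_sub, upN_sub, upF_sub, Tm.ren_sub, Fn.ren_sub, Tm.sub_ren,
      Fn.sub_ren, upN_succ, upF_succ]

theorem upN_var : upN (Tm.var : ℕ → Tm L b) = .var := by
  funext n; cases n <;> rfl

theorem upF_var : upF (Fn.var : ℕ → Fn L b) = .var := by
  funext n; cases n <;> rfl

mutual
theorem Tm.sub_var : ∀ t : Tm L b, t.sub .var .var = t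
  | .var n => rfl
  | .cst f h ts us => by
    simp only [Tm.sub, Tm.cst.injEq, heq_eq_eq, true_and]
    exact ⟨funext fun i => (ts i).sub_var, funext fun i => (us i).sub_var⟩
  | .app u t => by simp only [Tm.sub, u.sub_var, t.sub_var]
theorem Fn.sub_var : ∀ t : Fn L b, t.sub .var .var = t
  | .var n => rfl
  | .cst f h => rfl
  | .lam h t => by
    simp only [Fn.sub, upN_var, Fn.ren, id]
    rw [t.sub_var]
end

theorem Fm.sub_var (A : Fm L b) : A.sub .var .var = A := by
  induction A <;> simp_all [Fm.sub, Tm.sub_var, upN_var, upF_var, Tm.ren, Fn.ren]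

theorem Tm.ren_eq_sub (t : Tm L b) (ρ θ : ℕ → ℕ) :
    t.ren ρ θ = t.sub (fun n => .var (ρ n)) (fun n => .var (θ n)) := by
  rw [← Tm.ren_sub, Tm.sub_var]

theorem Fn.ren_eq_sub (t : Fn L b) (ρ θ : ℕ → ℕ) :
    t.ren ρ θ = t.sub (fun n => .var (ρ n)) (fun n => .var (θ n)) := by
  rw [← Fn.ren_sub, Fn.sub_var]

theorem Fm.ren_eq_sub (A : Fm L b) (ρ θ : ℕ → ℕ) :
    A.ren ρ θ = A.sub (fun n => .var (ρ n)) (fun n => .var (θ n)) := by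
  rw [← Fm.ren_sub, Fm.sub_var]

theorem Tm.ren_id (t : Tm L b) : t.ren (fun n => n) (fun n => n) = t := by
  rw [Tm.ren_eq_sub, Tm.sub_var]

theorem Fn.ren_id (t : Fn L b) : t.ren (fun n => n) (fun n => n) = t := by
  rw [Fn.ren_eq_sub, Fn.sub_var]

theorem Fm.ren_id (A : Fm L b) : A.ren (fun n => n) (fun n => n) = A := by
  rw [Fm.ren_eq_sub, Fm.sub_var]


/-! ### Structural rules of deductions -/

theorem Deriv.weaken {Ax : Fm L b → Prop} {Γ : List (Fm L b)} {A : Fm L b} (h : Deriv Ax Γ A) :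
    ∀ {Δ : List (Fm L b)}, Γ ⊆ Δ → Deriv Ax Δ A := by
  induction h with
  | ax h => exact fun _ => .ax h
  | hyp h => exact fun s => .hyp (s h)
  | impI _ ih => exact fun s => .impI (ih (List.cons_subset_cons _ s))
  | impE _ _ ih1 ih2 => exact fun s => .impE (ih1 s) (ih2 s)
  | andI _ _ ih1 ih2 => exact fun s => .andI (ih1 s) (ih2 s)
  | andE1 _ ih => exact fun s => .andE1 (ih s)
  | andE2 _ ih => exact fun s => .andE2 (ih s)
  | orI1 _ ih => exact fun s => .orI1 (ih s)
  | orI2 _ ih => exact fun s => .orI2 (ih s)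
  | orE _ _ _ ih1 ih2 ih3 =>
    exact fun s => .orE (ih1 s) (ih2 (List.cons_subset_cons _ s)) (ih3 (List.cons_subset_cons _ s))
  | negI _ _ ih1 ih2 =>
    exact fun s => .negI (ih1 (List.cons_subset_cons _ s)) (ih2 (List.cons_subset_cons _ s))
  | negE _ _ ih1 ih2 => exact fun s => .negE (ih1 s) (ih2 s)
  | all0I _ ih => exact fun s => .all0I (ih (List.map_subset _ s))
  | all0E t _ ih => exact fun s => .all0E t (ih s)
  | ex0I t _ ih => exact fun s => .ex0I t (ih s)
  | ex0E _ _ ih1 ih2 =>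
    exact fun s => .ex0E (ih1 s) (ih2 (List.cons_subset_cons _ (List.map_subset _ s)))
  | all1I _ ih => exact fun s => .all1I (ih (List.map_subset _ s))
  | all1E t _ ih => exact fun s => .all1E t (ih s)
  | ex1I t _ ih => exact fun s => .ex1I t (ih s)
  | ex1E _ _ ih1 ih2 =>
    exact fun s => .ex1E (ih1 s) (ih2 (List.cons_subset_cons _ (List.map_subset _ s)))

theorem Deriv.weaken_cons {Ax : Fm L b → Prop} {Γ : List (Fm L b)} {A B : Fm L b}
    (h : Deriv Ax Γ A) : Deriv Ax (B :: Γ) A := h.weaken (List.subset_cons_self _ _)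

theorem Deriv.head {Ax : Fm L b → Prop} {Γ : List (Fm L b)} {A : Fm L b} :
    Deriv Ax (A :: Γ) A := .hyp List.mem_cons_self

/-- Finitely many expressions have a common bound for their variables. -/
theorem exists_bound_fin {k : ℕ} (P : Fin k → ℕ → ℕ → Prop)
    (mono : ∀ i m n m' n', m ≤ m' → n ≤ n' → P i m n → P i m' n') (h : ∀ i, ∃ m n, P i m n) :
    ∃ m n, ∀ i, P i m n := by
  choose m n hmn using h
  exact ⟨Finset.univ.sup m, Finset.univ.sup n, fun i => mono i _ _ _ _
    (Finset.le_sup (Finset.mem_univ i)) (Finset.le_sup (Finset.mem_univ i)) (hmn i)⟩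

/-- The substitutions agree on the number variables below `m` and on the function variables
below `n`. -/
def Agree (m n : ℕ) (σ : ℕ → Tm L b) (τ : ℕ → Fn L b) (σ' : ℕ → Tm L b) (τ' : ℕ → Fn L b) : Prop :=
  (∀ i < m, σ i = σ' i) ∧ ∀ i < n, τ i = τ' i

theorem Agree.mono {m n m' n' : ℕ} {σ σ' : ℕ → Tm L b} {τ τ' : ℕ → Fn L b}
    (h : Agree m n σ τ σ' τ') (hm : m' ≤ m) (hn : n' ≤ n) : Agree m' n' σ τ σ' τ' :=
  ⟨fun i hi => h.1 i (by omega), fun i hi => h.2 i (by omega)⟩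

theorem Agree.up0 {m n : ℕ} {σ σ' : ℕ → Tm L b} {τ τ' : ℕ → Fn L b} (h : Agree m n σ τ σ' τ') :
    Agree m n (upN σ) (fun n => (τ n).ren Nat.succ id) (upN σ')
      (fun n => (τ' n).ren Nat.succ id) := by
  refine ⟨fun i hi => ?_, fun i hi => by simp only [h.2 i hi]⟩
  cases i with
  | zero => rfl
  | succ i => simp only [upN_succ, h.1 i (by omega)]

theorem Agree.up1 {m n : ℕ} {σ σ' : ℕ → Tm L b} {τ τ' : ℕ → Fn L b} (h : Agree m n σ τ σ' τ') :
    Agree m n (fun n => (σ n).ren id Nat.succ) (upF τ) (fun n => (σ' n).ren id Nat.succ)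
      (upF τ') := by
  refine ⟨fun i hi => by simp only [h.1 i hi], fun i hi => ?_⟩
  cases i with
  | zero => rfl
  | succ i => simp only [upF_succ, h.2 i (by omega)]

mutual
theorem Tm.exists_bound : ∀ t : Tm L b, ∃ m n, ∀ (σ : ℕ → Tm L b) (τ : ℕ → Fn L b) σ' τ',
    Agree m n σ τ σ' τ' → t.sub σ τ = t.sub σ' τ'
  | .var k => ⟨k + 1, 0, fun _ _ _ _ h => h.1 k (Nat.lt_succ_self k)⟩
  | .cst f h ts us => by
    obtain ⟨m, n, h1⟩ := exists_bound_fin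
      (fun i m n => ∀ (σ : ℕ → Tm L b) (τ : ℕ → Fn L b) σ' τ',
        Agree m n σ τ σ' τ' → (ts i).sub σ τ = (ts i).sub σ' τ')
      (fun i m n m' n' hm hn H σ τ σ' τ' h => H _ _ _ _ (h.mono hm hn))
      (fun i => (ts i).exists_bound)
    obtain ⟨m', n', h2⟩ := exists_bound_fin
      (fun i m n => ∀ (σ : ℕ → Tm L b) (τ : ℕ → Fn L b) σ' τ',
        Agree m n σ τ σ' τ' → (us i).sub σ τ = (us i).sub σ' τ')
      (fun i m n m' n' hm hn H σ τ σ' τ' h => H _ _ _ _ (h.mono hm hn))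
      (fun i => (us i).exists_bound)
    refine ⟨max m m', max n n', fun σ τ σ' τ' H => ?_⟩
    simp only [Tm.sub, Tm.cst.injEq, heq_eq_eq, true_and]
    exact ⟨funext fun i => h1 i _ _ _ _ (H.mono (le_max_left ..) (le_max_left ..)),
      funext fun i => h2 i _ _ _ _ (H.mono (le_max_right ..) (le_max_right ..))⟩
  | .app u t => by
    obtain ⟨m, n, h1⟩ := u.exists_bound
    obtain ⟨m', n', h2⟩ := t.exists_bound
    refine ⟨max m m', max n n', fun σ τ σ' τ' H => ?_⟩
    simp only [Tm.sub]
    rw [h1 _ _ _ _ (H.mono (le_max_left ..) (le_max_left ..)),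
      h2 _ _ _ _ (H.mono (le_max_right ..) (le_max_right ..))]
theorem Fn.exists_bound : ∀ t : Fn L b, ∃ m n, ∀ (σ : ℕ → Tm L b) (τ : ℕ → Fn L b) σ' τ',
    Agree m n σ τ σ' τ' → t.sub σ τ = t.sub σ' τ'
  | .var k => ⟨0, k + 1, fun _ _ _ _ h => h.2 k (Nat.lt_succ_self k)⟩
  | .cst f h => ⟨0, 0, fun _ _ _ _ _ => rfl⟩
  | .lam h t => by
    obtain ⟨m, n, h1⟩ := t.exists_bound
    refine ⟨m, n, fun σ τ σ' τ' H => ?_⟩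
    simp only [Fn.sub]
    rw [h1 _ _ _ _ H.up0]
end

/-- Only finitely many variables are free in a formula. -/
theorem Fm.exists_bound (A : Fm L b) : ∃ m n, ∀ (σ : ℕ → Tm L b) (τ : ℕ → Fn L b) σ' τ',
    Agree m n σ τ σ' τ' → A.sub σ τ = A.sub σ' τ' := by
  have two : ∀ {m n m' n' : ℕ} {σ σ' : ℕ → Tm L b} {τ τ' : ℕ → Fn L b},
      Agree (max m m') (max n n') σ τ σ' τ' → Agree m n σ τ σ' τ' ∧ Agree m' n' σ τ σ' τ' :=
    fun H => ⟨H.mono (le_max_left ..) (le_max_left ..), H.mono (le_max_right ..) (le_max_right ..)⟩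
  induction A with
  | eq s t =>
    obtain ⟨m, n, h1⟩ := s.exists_bound
    obtain ⟨m', n', h2⟩ := t.exists_bound
    exact ⟨max m m', max n n', fun σ τ σ' τ' H => by
      simp only [Fm.sub]; rw [h1 _ _ _ _ (two H).1, h2 _ _ _ _ (two H).2]⟩
  | imp A B ihA ihB | and A B ihA ihB | or A B ihA ihB =>
    obtain ⟨m, n, h1⟩ := ihA
    obtain ⟨m', n', h2⟩ := ihB
    exact ⟨max m m', max n n', fun σ τ σ' τ' H => by
      simp only [Fm.sub]; rw [h1 _ _ _ _ (two H).1, h2 _ _ _ _ (two H).2]⟩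
  | neg A ih =>
    obtain ⟨m, n, h1⟩ := ih
    exact ⟨m, n, fun σ τ σ' τ' H => by simp only [Fm.sub]; rw [h1 _ _ _ _ H]⟩
  | all0 A ih | ex0 A ih =>
    obtain ⟨m, n, h1⟩ := ih
    exact ⟨m, n, fun σ τ σ' τ' H => by simp only [Fm.sub]; rw [h1 _ _ _ _ H.up0]⟩
  | all1 A ih | ex1 A ih =>
    obtain ⟨m, n, h1⟩ := ih
    exact ⟨m, n, fun σ τ σ' τ' H => by simp only [Fm.sub]; rw [h1 _ _ _ _ H.up1]⟩

/-- A theorem stays a theorem when the first `m` number variables and the first `n` function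
variables are replaced: generalize them and instantiate the quantifiers. -/
theorem Deriv.sub_prefix {Ax : Fm L b → Prop} (m n : ℕ) : ∀ {A : Fm L b} (s : ℕ → Tm L b)
    (u : ℕ → Fn L b), Deriv Ax [] A →
    Deriv Ax [] (A.sub (fun k => if k < m then s k else .var (k - m))
      (fun k => if k < n then u k else .var (k - n))) := by
  induction m with
  | succ m ih =>
    intro A s u h
    have h1 := (ih (fun k => s (k + 1)) u (.all0I (Γ := []) h)).all0E (s 0)
    rw [Fm.inst0, Fm.sub_sub] at h1
    convert h1 using 2
    · funext k
      cases k with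
      | zero => simp [upN, Tm.sub, single0]
      | succ k =>
        rw [upN_succ, Tm.ren_sub]
        simp only [id, single0, Tm.sub_var, Nat.add_lt_add_iff_right, Nat.add_sub_add_right]
    · funext k
      rw [Fn.ren_sub]
      simp only [id, single0, Fn.sub_var]
  | zero =>
    induction n with
    | zero => intro A s u h; simpa [Fm.sub_var] using h
    | succ n ih =>
      intro A s u h
      have h1 := (ih s (fun k => u (k + 1)) (.all1I (Γ := []) h)).all1E (u 0)
      rw [Fm.inst1, Fm.sub_sub] at h1
      convert h1 using 2
      · funext k
        simp [Tm.ren, Tm.sub]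
      · funext k
        cases k with
        | zero => simp [upF, Fn.sub, single1]
        | succ k =>
          rw [upF_succ, Fn.ren_sub]
          simp only [id, single1, Fn.sub_var, Nat.add_lt_add_iff_right, Nat.add_sub_add_right]

/-- Theorems are closed under substitution. -/
theorem Deriv.sub_nil {Ax : Fm L b → Prop} {A : Fm L b} (h : Deriv Ax [] A) (σ : ℕ → Tm L b)
    (τ : ℕ → Fn L b) : Deriv Ax [] (A.sub σ τ) := by
  obtain ⟨m, n, H⟩ := A.exists_bound
  rw [H σ τ _ _ ⟨fun i hi => (if_pos hi).symm, fun i hi => (if_pos hi).symm⟩]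
  exact h.sub_prefix m n σ τ

/-- Bₙ → … → B₁ → A, for the list of formulas B₁, …, Bₙ. -/
def imps : List (Fm L b) → Fm L b → Fm L b
  | [], A => A
  | B :: Γ, A => imps Γ (.imp B A)

/-- Assumptions can be discharged, so that a substitution can act on them. -/
theorem imps_intro {Ax : Fm L b → Prop} : ∀ {Γ : List (Fm L b)} {A : Fm L b}, Deriv Ax Γ A →
    Deriv Ax [] (imps Γ A)
  | [], _, h => h
  | _ :: Γ, _, h => imps_intro (Γ := Γ) h.impI

theorem imps_elim {Ax : Fm L b → Prop} {Δ : List (Fm L b)} : ∀ {Γ : List (Fm L b)} {A : Fm L b},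
    Deriv Ax Δ (imps Γ A) → (∀ B ∈ Γ, Deriv Ax Δ B) → Deriv Ax Δ A
  | [], _, h, _ => h
  | _ :: Γ, _, h, s => (imps_elim (Γ := Γ) h fun C hC => s C (List.mem_cons_of_mem _ hC)).impE
      (s _ List.mem_cons_self)

theorem imps_sub (σ : ℕ → Tm L b) (τ : ℕ → Fn L b) : ∀ (Γ : List (Fm L b)) (A : Fm L b),
    (imps Γ A).sub σ τ = imps (Γ.map (Fm.sub σ τ)) (A.sub σ τ)
  | [], _ => rfl
  | _ :: Γ, _ => by rw [imps, imps_sub σ τ Γ]; rfl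

/-- Deductions are closed under substitution. -/
theorem Deriv.sub {Ax : Fm L b → Prop} {Γ Δ : List (Fm L b)} {A : Fm L b} (h : Deriv Ax Γ A)
    (σ : ℕ → Tm L b) (τ : ℕ → Fn L b) (hΓ : ∀ B ∈ Γ, Deriv Ax Δ (B.sub σ τ)) :
    Deriv Ax Δ (A.sub σ τ) := by
  have h1 := (imps_intro h).sub_nil σ τ
  rw [imps_sub] at h1
  refine imps_elim (h1.weaken (List.nil_subset _)) ?_
  simpa using hΓ

/-- The context `Δ` extends the renamed context `Γ`. -/
def Ext (ρ θ : ℕ → ℕ) (Γ Δ : List (Fm L b)) : Prop := ∀ B ∈ Γ, B.ren ρ θ ∈ Δ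

theorem Deriv.ren {Ax : Fm L b → Prop} {Γ Δ : List (Fm L b)} {A : Fm L b} (h : Deriv Ax Γ A)
    {ρ θ : ℕ → ℕ} (hΓ : Ext ρ θ Γ Δ) : Deriv Ax Δ (A.ren ρ θ) := by
  rw [Fm.ren_eq_sub]
  refine h.sub _ _ fun B hB => .hyp ?_
  rw [← Fm.ren_eq_sub]
  exact hΓ B hB

theorem Ext.shift0 (Γ : List (Fm L b)) : Ext Nat.succ id Γ (Γ.map (Fm.ren Nat.succ id)) :=
  fun _ hB => List.mem_map_of_mem hB

theorem Ext.shift1 (Γ : List (Fm L b)) : Ext id Nat.succ Γ (Γ.map (Fm.ren id Nat.succ)) :=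
  fun _ hB => List.mem_map_of_mem hB

theorem Ext.cons {ρ θ : ℕ → ℕ} {Γ Δ : List (Fm L b)} (h : Ext ρ θ Γ Δ) (A : Fm L b) :
    Ext ρ θ Γ (A :: Δ) := fun B hB => List.mem_cons_of_mem _ (h B hB)

theorem Ext.trans {ρ θ ρ' θ' : ℕ → ℕ} {Γ Δ Θ : List (Fm L b)} (h : Ext ρ θ Γ Δ)
    (h' : Ext ρ' θ' Δ Θ) : Ext (fun n => ρ' (ρ n)) (fun n => θ' (θ n)) Γ Θ := fun B hB => by
  rw [← Fm.ren_ren]; exact h' _ (h B hB)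

theorem Ext.refl (Γ : List (Fm L b)) : Ext (fun n => n) (fun n => n) Γ Γ := fun B hB => by
  rwa [Fm.ren_id]

theorem Deriv.cut {Ax : Fm L b → Prop} {Γ : List (Fm L b)} {A B : Fm L b} (h : Deriv Ax Γ A)
    (h' : Deriv Ax (A :: Γ) B) : Deriv Ax Γ B := h'.impI.impE h

theorem Deriv.iff_mp {Ax : Fm L b → Prop} {Γ : List (Fm L b)} {A B : Fm L b}
    (h : Deriv Ax Γ (A.iff B)) (h' : Deriv Ax Γ A) : Deriv Ax Γ B := h.andE1.impE h'

theorem Deriv.iff_mpr {Ax : Fm L b → Prop} {Γ : List (Fm L b)} {A B : Fm L b}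
    (h : Deriv Ax Γ (A.iff B)) (h' : Deriv Ax Γ B) : Deriv Ax Γ A := h.andE2.impE h'

theorem Deriv.iffI {Ax : Fm L b → Prop} {Γ : List (Fm L b)} {A B : Fm L b}
    (h : Deriv Ax (A :: Γ) B) (h' : Deriv Ax (B :: Γ) A) : Deriv Ax Γ (A.iff B) :=
  .andI h.impI h'.impI


/-! ### Rules for formulas under an environment

An environment `σ`, `τ` gives terms and functors for the free variables of a formula `A`. In this form the
rules for the quantifiers read like the clauses of Kripke semantics, the contexts being the
worlds: a quantifier extends the environment. -/

/-- The environment that sends 0 to `a` and is `σ` from then on. -/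
def scons {α : Type} (a : α) (σ : ℕ → α) : ℕ → α
  | 0 => a
  | n + 1 => σ n

/-- The environment that is `a` below `k` and `σ` from then on. -/
def fapp {α : Type} (k : ℕ) (a σ : ℕ → α) (n : ℕ) : α := if n < k then a n else σ (n - k)

theorem fapp_zero {α : Type} (a σ : ℕ → α) : fapp 0 a σ = σ := by
  funext n; simp [fapp]

theorem fapp_succ {α : Type} (k : ℕ) (a σ : ℕ → α) :
    fapp k a (scons (a k) σ) = fapp (k + 1) a σ := by
  funext n
  rcases Nat.lt_trichotomy n k with h | rfl | h
  · simp [fapp, h, Nat.lt_succ_of_lt h]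
  · simp [fapp, scons]
  · obtain ⟨d, rfl⟩ := Nat.exists_eq_add_of_lt h
    simp [fapp, show ¬ k + d + 1 < k by omega, show k + d + 1 - k = d + 1 by omega,
      show k + d + 1 - (k + 1) = d by omega, scons]

theorem single0_eq (t : Tm L b) : single0 t = scons t .var := by
  funext n; cases n <;> rfl

theorem single1_eq (u : Fn L b) : single1 u = scons u .var := by
  funext n; cases n <;> rfl

theorem upN_eq (σ : ℕ → Tm L b) : upN σ = scons (.var 0) (fun n => (σ n).ren Nat.succ id) := by
  funext n; cases n <;> rfl

theorem upF_eq (τ : ℕ → Fn L b) : upF τ = scons (.var 0) (fun n => (τ n).ren id Nat.succ) := by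
  funext n; cases n <;> rfl

theorem scons_apply {α β : Type} (g : α → β) (a : α) (σ : ℕ → α) :
    (fun n => g (scons a σ n)) = scons (g a) (fun n => g (σ n)) := by
  funext n; cases n <;> rfl

theorem upN_single0 (σ : ℕ → Tm L b) (a : Tm L b) :
    (fun n => (upN σ n).sub (single0 a) .var) = scons a σ := by
  funext n; cases n
  · rfl
  · simp [upN, Tm.ren_sub, scons, single0, Tm.sub_var]

theorem upF_single1 (τ : ℕ → Fn L b) (a : Fn L b) :
    (fun n => (upF τ n).sub .var (single1 a)) = scons a τ := by
  funext n; cases n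
  · rfl
  · simp [upF, Fn.ren_sub, scons, single1, Fn.sub_var]

theorem Fm.sub_up0_inst (A : Fm L b) (σ : ℕ → Tm L b) (τ : ℕ → Fn L b) (a : Tm L b) :
    (A.sub (upN σ) (fun n => (τ n).ren Nat.succ id)).inst0 a = A.sub (scons a σ) τ := by
  rw [Fm.inst0, Fm.sub_sub, upN_single0]
  congr 1
  funext n
  simp [Fn.ren_sub, single0, Fn.sub_var]

theorem Fm.sub_up1_inst (A : Fm L b) (σ : ℕ → Tm L b) (τ : ℕ → Fn L b) (a : Fn L b) :
    (A.sub (fun n => (σ n).ren id Nat.succ) (upF τ)).inst1 a = A.sub σ (scons a τ) := by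
  rw [Fm.inst1, Fm.sub_sub, upF_single1]
  congr 1
  funext n
  simp [Tm.ren_sub, single1, Tm.sub_var]

section rules
variable {Ax : Fm L b → Prop} {Γ : List (Fm L b)} {A C : Fm L b} {σ : ℕ → Tm L b} {τ : ℕ → Fn L b}

theorem Deriv.envAll0E (h : Deriv Ax Γ ((Fm.all0 A).sub σ τ)) (a : Tm L b) :
    Deriv Ax Γ (A.sub (scons a σ) τ) := by
  rw [← Fm.sub_up0_inst]; exact h.all0E a

theorem Deriv.envAll1E (h : Deriv Ax Γ ((Fm.all1 A).sub σ τ)) (a : Fn L b) :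
    Deriv Ax Γ (A.sub σ (scons a τ)) := by
  rw [← Fm.sub_up1_inst]; exact h.all1E a

theorem Deriv.envEx0I (a : Tm L b) (h : Deriv Ax Γ (A.sub (scons a σ) τ)) :
    Deriv Ax Γ ((Fm.ex0 A).sub σ τ) := by
  rw [← Fm.sub_up0_inst] at h; exact h.ex0I a

theorem Deriv.envEx1I (a : Fn L b) (h : Deriv Ax Γ (A.sub σ (scons a τ))) :
    Deriv Ax Γ ((Fm.ex1 A).sub σ τ) := by
  rw [← Fm.sub_up1_inst] at h; exact h.ex1I a

theorem Deriv.envAll0I (H : ∀ Δ ρ θ (a : Tm L b), Ext ρ θ Γ Δ →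
    Deriv Ax Δ (A.sub (scons a fun n => (σ n).ren ρ θ) fun n => (τ n).ren ρ θ)) :
    Deriv Ax Γ ((Fm.all0 A).sub σ τ) := by
  refine .all0I ?_
  have := H _ _ _ (.var 0) (.shift0 Γ)
  rwa [← upN_eq] at this

theorem Deriv.envEx0E (h : Deriv Ax Γ ((Fm.ex0 A).sub σ τ)) (H : ∀ Δ ρ θ (a : Tm L b),
    Ext ρ θ Γ Δ → Deriv Ax Δ (A.sub (scons a fun n => (σ n).ren ρ θ) fun n => (τ n).ren ρ θ) →
      Deriv Ax Δ (C.ren ρ θ)) : Deriv Ax Γ C := by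
  refine h.ex0E (H _ _ _ (.var 0) (.cons (.shift0 Γ) _) ?_)
  rw [← upN_eq]
  exact .head

theorem Deriv.envEx1E (h : Deriv Ax Γ ((Fm.ex1 A).sub σ τ)) (H : ∀ Δ ρ θ (a : Fn L b),
    Ext ρ θ Γ Δ → Deriv Ax Δ (A.sub (fun n => (σ n).ren ρ θ) (scons a fun n => (τ n).ren ρ θ)) →
      Deriv Ax Δ (C.ren ρ θ)) : Deriv Ax Γ C := by
  refine h.ex1E (H _ _ _ (.var 0) (.cons (.shift1 Γ) _) ?_)
  rw [← upF_eq]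
  exact .head

theorem Deriv.envExs0I {k : ℕ} (a : ℕ → Tm L b) : ∀ {σ : ℕ → Tm L b},
    Deriv Ax Γ (A.sub (fapp k a σ) τ) → Deriv Ax Γ ((exs0 k A).sub σ τ) := by
  induction k with
  | zero => intro σ h; rwa [fapp_zero] at h
  | succ k ih => intro σ h; rw [← fapp_succ] at h; exact .envEx0I _ (ih h)

theorem Deriv.envExs1I {k : ℕ} (a : ℕ → Fn L b) : ∀ {τ : ℕ → Fn L b},
    Deriv Ax Γ (A.sub σ (fapp k a τ)) → Deriv Ax Γ ((exs1 k A).sub σ τ) := by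
  induction k with
  | zero => intro σ h; rwa [fapp_zero] at h
  | succ k ih => intro σ h; rw [← fapp_succ] at h; exact .envEx1I _ (ih h)

theorem Deriv.envExs0E {k : ℕ} : ∀ {Γ : List (Fm L b)} {C : Fm L b} {σ : ℕ → Tm L b}
    {τ : ℕ → Fn L b}, Deriv Ax Γ ((exs0 k A).sub σ τ) → (∀ Δ ρ θ (a : ℕ → Tm L b),
    Ext ρ θ Γ Δ → Deriv Ax Δ (A.sub (fapp k a fun n => (σ n).ren ρ θ) fun n => (τ n).ren ρ θ) →
      Deriv Ax Δ (C.ren ρ θ)) → Deriv Ax Γ C := by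
  induction k with
  | zero =>
    intro Γ C σ τ h H
    have := H Γ (fun n => n) (fun n => n) .var (.refl Γ)
    simp only [fapp_zero, Tm.ren_id, Fn.ren_id, Fm.ren_id] at this
    exact this h
  | succ k ih =>
    intro Γ C σ τ h H
    refine Deriv.envEx0E (A := exs0 k A) h fun Δ ρ θ a e h => ih h fun Δ' ρ' θ' a' e' h' => ?_
    rw [Fm.ren_ren]
    refine H Δ' _ _ (fun n => if n < k then a' n else a.ren ρ' θ') (e.trans e') ?_
    convert h' using 2
    · funext n
      simp only [fapp, ← Tm.ren_ren]
      rcases Nat.lt_trichotomy n k with h | rfl | h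
      · simp [h, Nat.lt_succ_of_lt h]
      · simp [scons]
      · obtain ⟨d, rfl⟩ := Nat.exists_eq_add_of_lt h
        simp [show ¬ k + d + 1 < k by omega, show k + d + 1 - k = d + 1 by omega,
          show k + d + 1 - (k + 1) = d by omega, scons]
    · simp only [Fn.ren_ren]

theorem Deriv.envExs1E {k : ℕ} : ∀ {Γ : List (Fm L b)} {C : Fm L b} {σ : ℕ → Tm L b}
    {τ : ℕ → Fn L b}, Deriv Ax Γ ((exs1 k A).sub σ τ) → (∀ Δ ρ θ (a : ℕ → Fn L b),
    Ext ρ θ Γ Δ → Deriv Ax Δ (A.sub (fun n => (σ n).ren ρ θ) (fapp k a fun n => (τ n).ren ρ θ)) →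
      Deriv Ax Δ (C.ren ρ θ)) → Deriv Ax Γ C := by
  induction k with
  | zero =>
    intro Γ C σ τ h H
    have := H Γ (fun n => n) (fun n => n) .var (.refl Γ)
    simp only [fapp_zero, Tm.ren_id, Fn.ren_id, Fm.ren_id] at this
    exact this h
  | succ k ih =>
    intro Γ C σ τ h H
    refine Deriv.envEx1E (A := exs1 k A) h fun Δ ρ θ a e h => ih h fun Δ' ρ' θ' a' e' h' => ?_
    rw [Fm.ren_ren]
    refine H Δ' _ _ (fun n => if n < k then a' n else a.ren ρ' θ') (e.trans e') ?_
    convert h' using 2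
    · simp only [Tm.ren_ren]
    · funext n
      simp only [fapp, ← Fn.ren_ren]
      rcases Nat.lt_trichotomy n k with h | rfl | h
      · simp [h, Nat.lt_succ_of_lt h]
      · simp [scons]
      · obtain ⟨d, rfl⟩ := Nat.exists_eq_add_of_lt h
        simp [show ¬ k + d + 1 < k by omega, show k + d + 1 - k = d + 1 by omega,
          show k + d + 1 - (k + 1) = d by omega, scons]

theorem deriv_foldr_and {B : Fm L b} : ∀ {l : List (Fm L b)},
    Deriv Ax Γ ((l.foldr .and B).sub σ τ) ↔
      (∀ A ∈ l, Deriv Ax Γ (A.sub σ τ)) ∧ Deriv Ax Γ (B.sub σ τ)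
  | [] => by simp
  | A :: l => by
    have ih := deriv_foldr_and (B := B) (l := l)
    rw [List.forall_mem_cons, and_assoc, ← ih]
    exact ⟨fun h => ⟨h.andE1, h.andE2⟩, fun h => .andI h.1 h.2⟩

end rules

/-! ### Congruence rules for equivalence -/

section iff
variable {Ax : Fm L b → Prop} {Γ : List (Fm L b)} {A B C A' B' : Fm L b}

theorem Deriv.iff_refl (A : Fm L b) : Deriv Ax Γ (A.iff A) := .iffI .head .head

theorem Deriv.iff_trans (h : Deriv Ax Γ (A.iff B)) (h' : Deriv Ax Γ (B.iff C)) :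
    Deriv Ax Γ (A.iff C) :=
  .iffI (h'.weaken_cons.iff_mp (h.weaken_cons.iff_mp .head))
    (h.weaken_cons.iff_mpr (h'.weaken_cons.iff_mpr .head))

theorem Deriv.iff_imp (h : Deriv Ax Γ (A.iff A')) (h' : Deriv Ax Γ (B.iff B')) :
    Deriv Ax Γ ((A.imp B).iff (A'.imp B')) := by
  refine .iffI (.impI ?_) (.impI ?_)
  · exact h'.weaken_cons.weaken_cons.iff_mp
      (Deriv.impE (.weaken_cons .head) (h.weaken_cons.weaken_cons.iff_mpr .head))
  · exact h'.weaken_cons.weaken_cons.iff_mpr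
      (Deriv.impE (.weaken_cons .head) (h.weaken_cons.weaken_cons.iff_mp .head))

theorem Deriv.iff_and (h : Deriv Ax Γ (A.iff A')) (h' : Deriv Ax Γ (B.iff B')) :
    Deriv Ax Γ ((A.and B).iff (A'.and B')) :=
  .iffI (.andI (h.weaken_cons.iff_mp (.andE1 .head)) (h'.weaken_cons.iff_mp (.andE2 .head)))
    (.andI (h.weaken_cons.iff_mpr (.andE1 .head)) (h'.weaken_cons.iff_mpr (.andE2 .head)))

theorem Deriv.iff_or (h : Deriv Ax Γ (A.iff A')) (h' : Deriv Ax Γ (B.iff B')) :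
    Deriv Ax Γ ((A.or B).iff (A'.or B')) :=
  .iffI (.orE .head (.orI1 (h.weaken_cons.weaken_cons.iff_mp .head))
      (.orI2 (h'.weaken_cons.weaken_cons.iff_mp .head)))
    (.orE .head (.orI1 (h.weaken_cons.weaken_cons.iff_mpr .head))
      (.orI2 (h'.weaken_cons.weaken_cons.iff_mpr .head)))

theorem Deriv.iff_neg (h : Deriv Ax Γ (A.iff A')) : Deriv Ax Γ (A.neg.iff A'.neg) :=
  .iffI (.negI (h.weaken_cons.weaken_cons.iff_mpr .head) (.weaken_cons .head))
    (.negI (h.weaken_cons.weaken_cons.iff_mp .head) (.weaken_cons .head))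

theorem Fm.ren_up0_inst (A : Fm L b) : (A.ren (up Nat.succ) id).inst0 (.var 0) = A := by
  rw [Fm.inst0, Fm.ren_sub]
  conv_rhs => rw [← A.sub_var]
  congr 1
  funext n; cases n <;> rfl

theorem Fm.ren_up1_inst (A : Fm L b) : (A.ren id (up Nat.succ)).inst1 (.var 0) = A := by
  rw [Fm.inst1, Fm.ren_sub]
  conv_rhs => rw [← A.sub_var]
  congr 1
  funext n; cases n <;> rfl

theorem Deriv.all0_mono (h : Deriv Ax (A :: Γ.map (Fm.ren Nat.succ id)) B) :
    Deriv Ax (.all0 A :: Γ) (.all0 B) := by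
  refine .all0I (Deriv.cut (A := A) ?_ (h.weaken ?_))
  · have := Deriv.all0E (Ax := Ax) (.var 0) (Deriv.head (A := (Fm.all0 A).ren Nat.succ id)
      (Γ := Γ.map (Fm.ren Nat.succ id)))
    rwa [Fm.ren_up0_inst] at this
  · intro B hB
    simp only [List.map_cons, List.mem_cons] at hB ⊢
    tauto

theorem Deriv.all1_mono (h : Deriv Ax (A :: Γ.map (Fm.ren id Nat.succ)) B) :
    Deriv Ax (.all1 A :: Γ) (.all1 B) := by
  refine .all1I (Deriv.cut (A := A) ?_ (h.weaken ?_))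
  · have := Deriv.all1E (Ax := Ax) (.var 0) (Deriv.head (A := (Fm.all1 A).ren id Nat.succ)
      (Γ := Γ.map (Fm.ren id Nat.succ)))
    rwa [Fm.ren_up1_inst] at this
  · intro B hB
    simp only [List.map_cons, List.mem_cons] at hB ⊢
    tauto

theorem Deriv.ex0_mono (h : Deriv Ax (A :: Γ.map (Fm.ren Nat.succ id)) B) :
    Deriv Ax (.ex0 A :: Γ) (.ex0 B) := by
  refine .ex0E .head (.ex0I (.var 0) ?_)
  rw [Fm.ren_up0_inst]
  refine h.weaken ?_
  intro B hB
  simp only [List.map_cons, List.mem_cons] at hB ⊢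
  tauto

theorem Deriv.ex1_mono (h : Deriv Ax (A :: Γ.map (Fm.ren id Nat.succ)) B) :
    Deriv Ax (.ex1 A :: Γ) (.ex1 B) := by
  refine .ex1E .head (.ex1I (.var 0) ?_)
  rw [Fm.ren_up1_inst]
  refine h.weaken ?_
  intro B hB
  simp only [List.map_cons, List.mem_cons] at hB ⊢
  tauto

theorem Deriv.iff_all0 (h : Deriv Ax (Γ.map (Fm.ren Nat.succ id)) (A.iff B)) :
    Deriv Ax Γ ((Fm.all0 A).iff (.all0 B)) :=
  .iffI (.all0_mono (h.weaken_cons.iff_mp .head)) (.all0_mono (h.weaken_cons.iff_mpr .head))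

theorem Deriv.iff_all1 (h : Deriv Ax (Γ.map (Fm.ren id Nat.succ)) (A.iff B)) :
    Deriv Ax Γ ((Fm.all1 A).iff (.all1 B)) :=
  .iffI (.all1_mono (h.weaken_cons.iff_mp .head)) (.all1_mono (h.weaken_cons.iff_mpr .head))

theorem Deriv.iff_ex0 (h : Deriv Ax (Γ.map (Fm.ren Nat.succ id)) (A.iff B)) :
    Deriv Ax Γ ((Fm.ex0 A).iff (.ex0 B)) :=
  .iffI (.ex0_mono (h.weaken_cons.iff_mp .head)) (.ex0_mono (h.weaken_cons.iff_mpr .head))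

theorem Deriv.iff_ex1 (h : Deriv Ax (Γ.map (Fm.ren id Nat.succ)) (A.iff B)) :
    Deriv Ax Γ ((Fm.ex1 A).iff (.ex1 B)) :=
  .iffI (.ex1_mono (h.weaken_cons.iff_mp .head)) (.ex1_mono (h.weaken_cons.iff_mpr .head))

end iff


/-! ### Equality -/

/-- Extensional equality of functors: ∀x u(x) = v(x). -/
def feq (u v : Fn L b) : Fm L b :=
  .all0 (.eq (.app (u.ren Nat.succ id) (.var 0)) (.app (v.ren Nat.succ id) (.var 0)))

/-- Basic properties of equality, and the schema QF-AC₀₀. -/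
structure EqBase (Ax : Fm L b → Prop) : Prop where
  refl : ∀ (Γ : List (Fm L b)) t, Deriv Ax Γ (.eq t t)
  euclid : ∀ {Γ : List (Fm L b)} {r s t}, Deriv Ax Γ (.eq r s) → Deriv Ax Γ (.eq r t) →
    Deriv Ax Γ (.eq s t)
  app : ∀ {Γ : List (Fm L b)} {u s t}, Deriv Ax Γ (.eq s t) → Deriv Ax Γ (.eq (.app u s) (.app u t))
  qfac : ∀ {A}, QFAC A → ∀ Γ, Deriv Ax Γ A

/-- The systems under consideration: moreover the constants respect (extensional) equality of their
arguments. -/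
structure Base (Ax : Fm L b → Prop) : Prop extends EqBase Ax where
  cst : ∀ {Γ : List (Fm L b)} {f h ts us ts' us'}, (∀ i, Deriv Ax Γ (.eq (ts i) (ts' i))) →
    (∀ j, Deriv Ax Γ (feq (us j) (us' j))) → Deriv Ax Γ (.eq (.cst f h ts us) (.cst f h ts' us'))

theorem feq_sub (u v : Fn L b) (σ : ℕ → Tm L b) (τ : ℕ → Fn L b) :
    (feq u v).sub σ τ = feq (u.sub σ τ) (v.sub σ τ) := by
  simp only [feq, Fm.sub, Tm.sub, Fn.ren_sub, Fn.sub_ren, id, upN]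

theorem feq_ren (u v : Fn L b) (ρ θ : ℕ → ℕ) :
    (feq u v).ren ρ θ = feq (u.ren ρ θ) (v.ren ρ θ) := by
  simp only [Fm.ren_eq_sub, Fn.ren_eq_sub, feq_sub]

namespace EqBase
variable {Ax : Fm L b → Prop} (S : EqBase Ax) {Γ : List (Fm L b)}
include S

theorem symm {s t : Tm L b} (h : Deriv Ax Γ (.eq s t)) : Deriv Ax Γ (.eq t s) :=
  S.euclid h (S.refl Γ s)

theorem trans {r s t : Tm L b} (h : Deriv Ax Γ (.eq r s)) (h' : Deriv Ax Γ (.eq s t)) :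
    Deriv Ax Γ (.eq r t) := S.euclid (S.symm h) h'

omit S in
theorem feq_app {u v : Fn L b} (h : Deriv Ax Γ (feq u v)) (t : Tm L b) :
    Deriv Ax Γ (.eq (.app u t) (.app v t)) := by
  have := h.all0E t
  simpa [Fm.inst0, Fm.sub, Tm.sub, Fn.ren_sub, single0, Fn.sub_var] using this

omit S in
theorem feqI {u v : Fn L b} (h : ∀ Δ ρ θ a, Ext ρ θ Γ Δ →
    Deriv Ax Δ (.eq (.app (u.ren ρ θ) a) (.app (v.ren ρ θ) a))) : Deriv Ax Γ (feq u v) :=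
  .all0I (h _ _ _ _ (.shift0 Γ))

theorem app_congr {u v : Fn L b} {s t : Tm L b} (h : Deriv Ax Γ (feq u v))
    (h' : Deriv Ax Γ (.eq s t)) : Deriv Ax Γ (.eq (.app u s) (.app v t)) :=
  S.trans (feq_app h s) (S.app h')

omit S in
theorem feq_mono {u v : Fn L b} (h : Deriv Ax Γ (feq u v)) {Δ : List (Fm L b)} {ρ θ : ℕ → ℕ}
    (e : Ext ρ θ Γ Δ) : Deriv Ax Δ (feq (u.ren ρ θ) (v.ren ρ θ)) := by
  rw [← feq_ren]; exact h.ren e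

theorem feq_refl (u : Fn L b) : Deriv Ax Γ (feq u u) := feqI fun _ _ _ _ _ => S.refl _ _

theorem feq_symm {u v : Fn L b} (h : Deriv Ax Γ (feq u v)) : Deriv Ax Γ (feq v u) :=
  feqI fun _ _ _ _ e => S.symm (feq_app (feq_mono h e) _)

theorem feq_trans {u v w : Fn L b} (h : Deriv Ax Γ (feq u v)) (h' : Deriv Ax Γ (feq v w)) :
    Deriv Ax Γ (feq u w) :=
  feqI fun _ _ _ _ e => S.trans (feq_app (feq_mono h e) _) (feq_app (feq_mono h' e) _)

/-- QF-AC₀₀ under an environment, in the form of an elimination rule. -/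
theorem choice {A C : Fm L b} (hA : A.QF) {σ : ℕ → Tm L b} {τ : ℕ → Fn L b}
    (h : Deriv Ax Γ ((Fm.all0 (.ex0 A)).sub σ τ))
    (H : ∀ Δ ρ θ (α : Fn L b), Ext ρ θ Γ Δ →
      (∀ Δ' ρ' θ' (x : Tm L b), Ext ρ' θ' Δ Δ' →
        Deriv Ax Δ' (A.sub (scons (.app (α.ren ρ' θ') x) (scons x fun n => ((σ n).ren ρ θ).ren ρ' θ'))
        fun n => ((τ n).ren ρ θ).ren ρ' θ')) → Deriv Ax Δ (C.ren ρ θ)) : Deriv Ax Γ C := by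
  have h1 := ((S.qfac (.mk A hA) []).sub_nil σ τ).weaken (List.nil_subset Γ)
  refine Deriv.envEx1E (h1.impE h) fun Δ ρ θ α e h => H Δ ρ θ α e fun Δ' ρ' θ' x e' => ?_
  have h2 := h.ren e'
  rw [Fm.sub_ren] at h2
  have h3 := h2.envAll0E x
  rw [Fm.sub_sub] at h3
  simp only [scons_apply] at h3
  convert h3 using 2
  · funext n
    rcases n with _ | _ | n <;> rfl
  · rfl

/-- A term t(x), with x the number variable 0, defines a function. -/
theorem exists_fun (t : Tm L b) {C : Fm L b}
    (H : ∀ Δ ρ θ (α : Fn L b), Ext ρ θ Γ Δ →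
      (∀ Δ' ρ' θ' (x : Tm L b), Ext ρ' θ' Δ Δ' →
        Deriv Ax Δ' (.eq (.app (α.ren ρ' θ') x) (t.sub (scons x fun n => .var (ρ' (ρ n)))
          fun n => .var (θ' (θ n))))) → Deriv Ax Δ (C.ren ρ θ)) : Deriv Ax Γ C := by
  refine S.choice (A := .eq (.var 0) (t.ren Nat.succ id)) (σ := .var) (τ := .var) trivial ?_
    fun Δ ρ θ α e h => H Δ ρ θ α e fun Δ' ρ' θ' x e' => ?_
  · refine .envAll0I fun Δ ρ θ a e => .envEx0I
      (t.sub (scons a fun n => .var (ρ n)) fun n => .var (θ n)) ?_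
    simp only [Fm.sub, Tm.ren_sub]
    exact S.refl _ _
  · have := h Δ' ρ' θ' x e'
    simp only [Fm.sub, Tm.ren_sub] at this
    exact this

end EqBase

/-! ### Evaluation

The graph of a term `t` under an environment says that `w` is the value of `t` there. -/

/-- It is deducible that the term `t` has the value `w` under the environment `σ`, `τ`. -/
def Ev (Ax : Fm L false → Prop) (Γ : List (Fm L false)) (σ : ℕ → Tm L false) (τ : ℕ → Fn L false)
    (t : Tm L true) (w : Tm L false) : Prop := Deriv Ax Γ (t.graph.sub (scons w σ) τ)

/-- It is deducible that the functor `u` has the value `α` under the environment `σ`, `τ`. -/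
def EvF (Ax : Fm L false → Prop) (Γ : List (Fm L false)) (σ : ℕ → Tm L false) (τ : ℕ → Fn L false)
    (u : Fn L true) (α : Fn L false) : Prop := Deriv Ax Γ (u.graph.sub σ (scons α τ))

section ev
variable {Ax : Fm L false → Prop} {Γ Δ : List (Fm L false)} {σ : ℕ → Tm L false}
  {τ : ℕ → Fn L false} {t : Tm L true} {u : Fn L true} {w w' : Tm L false} {α α' : Fn L false}
  {C : Fm L false} {ρ θ : ℕ → ℕ}

theorem Fm.graph_sub_ren (A : Fm L false) : (A.sub (scons w σ) τ).ren ρ θ =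
    A.sub (scons (w.ren ρ θ) fun n => (σ n).ren ρ θ) fun n => (τ n).ren ρ θ := by
  rw [Fm.sub_ren, scons_apply (fun t : Tm L false => t.ren ρ θ)]

theorem Fm.graphF_sub_ren (A : Fm L false) : (A.sub σ (scons α τ)).ren ρ θ =
    A.sub (fun n => (σ n).ren ρ θ) (scons (α.ren ρ θ) fun n => (τ n).ren ρ θ) := by
  rw [Fm.sub_ren, scons_apply (fun t : Fn L false => t.ren ρ θ)]

theorem Ev.mono (h : Ev Ax Γ σ τ t w) (e : Ext ρ θ Γ Δ) :
    Ev Ax Δ (fun n => (σ n).ren ρ θ) (fun n => (τ n).ren ρ θ) t (w.ren ρ θ) := by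
  rw [Ev, ← Fm.graph_sub_ren]; exact Deriv.ren h e

theorem EvF.mono (h : EvF Ax Γ σ τ u α) (e : Ext ρ θ Γ Δ) :
    EvF Ax Δ (fun n => (σ n).ren ρ θ) (fun n => (τ n).ren ρ θ) u (α.ren ρ θ) := by
  rw [EvF, ← Fm.graphF_sub_ren]; exact Deriv.ren h e

theorem Deriv.eq_mono {Ax : Fm L b → Prop} {Γ Δ : List (Fm L b)} {s t : Tm L b}
    (h : Deriv Ax Γ (.eq s t)) (e : Ext ρ θ Γ Δ) :
    Deriv Ax Δ (.eq (s.ren ρ θ) (t.ren ρ θ)) := h.ren e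

theorem slot_scons {β : Type} (k i : ℕ) (hi : i < k) (a σ : ℕ → β) (w : β) :
    (fun n => fapp k a (scons w σ) (slot i (k + 1) n)) = scons (a i) σ := by
  funext n
  cases n with
  | zero => simp [slot, fapp, hi, scons]
  | succ n => simp [slot, fapp, scons, show n + (k + 1) - k = n + 1 by omega,
      show ¬ n + (k + 1) < k by omega]

theorem slot_scons' {β : Type} (k i : ℕ) (hi : i < k) (a σ : ℕ → β) :
    (fun n => fapp k a σ (slot i k n)) = scons (a i) σ := by
  funext n
  cases n with
  | zero => simp [slot, fapp, hi, scons]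
  | succ n => simp [slot, fapp, scons]

theorem add_fapp {β : Type} (k : ℕ) (a σ : ℕ → β) : (fun n => fapp k a σ (n + k)) = σ := by
  funext n
  simp [fapp]

theorem add_fapp_scons {β : Type} (k : ℕ) (a σ : ℕ → β) (w : β) :
    (fun n => fapp k a (scons w σ) (n + (k + 1))) = σ := by
  funext n
  simp [fapp, show n + (k + 1) - k = n + 1 by omega, scons,
    show ¬ n + (k + 1) < k by omega]

/-- The matrix of the graph of f(t₁, …, u₁, …), at values of its bound variables. -/
theorem cst_body_iff {f : L.Con} {h : ¬ L.Unary f} {ts : Fin (L.nArg f) → Tm L true}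
    {us : Fin (L.fArg f) → Fn L true} (a : ℕ → Tm L false) (β : ℕ → Fn L false) :
    Deriv Ax Γ (((List.ofFn fun i => (ts i).graph.ren (slot i (L.nArg f + 1)) (· + L.fArg f)).foldr Fm.and
          ((List.ofFn fun j => (us j).graph.ren (· + (L.nArg f + 1)) (slot j (L.fArg f))).foldr Fm.and
            (Fm.eq (.cst f h (fun i => .var i) (fun j => .var j)) (.var (L.nArg f))))).sub
              (fapp (L.nArg f) a (scons w σ)) (fapp (L.fArg f) β τ)) ↔
      (∀ i, Ev Ax Γ σ τ (ts i) (a i)) ∧ (∀ j, EvF Ax Γ σ τ (us j) (β j)) ∧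
      Deriv Ax Γ (.eq (.cst f h (fun i => a i) (fun j => β j)) w) := by
  rw [deriv_foldr_and, deriv_foldr_and, List.forall_mem_ofFn_iff, List.forall_mem_ofFn_iff]
  refine and_congr (forall_congr' fun i => ?_) (and_congr (forall_congr' fun j => ?_) ?_)
  · rw [Fm.ren_sub, slot_scons _ _ i.2, add_fapp, Ev]
  · rw [Fm.ren_sub, slot_scons' _ _ j.2, add_fapp_scons, EvF]
  · simp [Fm.sub, Tm.sub, Fn.sub, fapp, scons]

theorem Ev.cst {f : L.Con} {h : ¬ L.Unary f} {ts : Fin (L.nArg f) → Tm L true}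
    {us : Fin (L.fArg f) → Fn L true} {a : Fin (L.nArg f) → Tm L false}
    {β : Fin (L.fArg f) → Fn L false} (ha : ∀ i, Ev Ax Γ σ τ (ts i) (a i))
    (hβ : ∀ j, EvF Ax Γ σ τ (us j) (β j)) (hw : Deriv Ax Γ (.eq (.cst f h a β) w)) :
    Ev Ax Γ σ τ (.cst f h ts us) w := by
  unfold Ev
  rw [Tm.graph]
  refine .envExs0I (fun n => if hn : n < L.nArg f then a ⟨n, hn⟩ else .var 0)
    (.envExs1I (fun n => if hn : n < L.fArg f then β ⟨n, hn⟩ else .var 0) ?_)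
  rw [cst_body_iff]
  exact ⟨fun i => by simpa using ha i, fun j => by simpa using hβ j, by simpa using hw⟩

theorem Ev.cst_elim {f : L.Con} {h : ¬ L.Unary f} {ts : Fin (L.nArg f) → Tm L true}
    {us : Fin (L.fArg f) → Fn L true} (hv : Ev Ax Γ σ τ (.cst f h ts us) w)
    (H : ∀ Δ ρ θ (a : Fin (L.nArg f) → Tm L false) (β : Fin (L.fArg f) → Fn L false),
      Ext ρ θ Γ Δ →
      (∀ i, Ev Ax Δ (fun n => (σ n).ren ρ θ) (fun n => (τ n).ren ρ θ) (ts i) (a i)) →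
      (∀ j, EvF Ax Δ (fun n => (σ n).ren ρ θ) (fun n => (τ n).ren ρ θ) (us j) (β j)) →
      Deriv Ax Δ (.eq (.cst f h a β) (w.ren ρ θ)) → Deriv Ax Δ (C.ren ρ θ)) : Deriv Ax Γ C := by
  unfold Ev at hv
  rw [Tm.graph] at hv
  refine hv.envExs0E fun Δ ρ θ a e hv => hv.envExs1E fun Δ' ρ' θ' β e' hv => ?_
  have h1 : (fun n => (fapp (L.nArg f) a (fun n => (scons w σ n).ren ρ θ) n).ren ρ' θ') =
      fapp (L.nArg f) (fun n => (a n).ren ρ' θ')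
        (scons (w.ren (fun n => ρ' (ρ n)) (fun n => θ' (θ n)))
          fun n => (σ n).ren (fun n => ρ' (ρ n)) (fun n => θ' (θ n))) := by
    funext n
    simp only [fapp]
    split
    · rfl
    · simp only [Tm.ren_ren]
      cases n - L.nArg f <;> rfl
  rw [h1, cst_body_iff] at hv
  rw [Fm.ren_ren]
  simp only [Fn.ren_ren] at hv
  exact H Δ' _ _ _ _ (e.trans e') hv.1 hv.2.1 hv.2.2

theorem Ev.app {a : Tm L false} (hu : EvF Ax Γ σ τ u α) (ht : Ev Ax Γ σ τ t a)
    (hw : Deriv Ax Γ (.eq (.app α a) w)) : Ev Ax Γ σ τ (.app u t) w := by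
  unfold Ev
  rw [Tm.graph]
  refine .envEx0I a (.envEx1I α (.andI ?_ (.andI ?_ hw)))
  · rw [Fm.ren_sub]; exact hu
  · rw [Fm.ren_sub]
    unfold Ev at ht
    convert ht using 2
    · funext n; cases n <;> rfl
    · rfl

theorem Ev.app_elim (hv : Ev Ax Γ σ τ (.app u t) w)
    (H : ∀ Δ ρ θ (a : Tm L false) (α : Fn L false), Ext ρ θ Γ Δ →
      EvF Ax Δ (fun n => (σ n).ren ρ θ) (fun n => (τ n).ren ρ θ) u α →
      Ev Ax Δ (fun n => (σ n).ren ρ θ) (fun n => (τ n).ren ρ θ) t a →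
      Deriv Ax Δ (.eq (.app α a) (w.ren ρ θ)) → Deriv Ax Δ (C.ren ρ θ)) : Deriv Ax Γ C := by
  unfold Ev at hv
  rw [Tm.graph] at hv
  refine hv.envEx0E fun Δ ρ θ a e hv => hv.envEx1E fun Δ' ρ' θ' α e' hv => ?_
  rw [Fm.ren_ren]
  refine H Δ' _ _ (a.ren ρ' θ') α (e.trans e') ?_ ?_ ?_
  · have := hv.andE1
    rw [Fm.ren_sub] at this
    unfold EvF
    convert this using 2
    · funext n; simp [scons, Tm.ren_ren]
    · funext n; cases n <;> simp [scons, Fn.ren_ren]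
  · have := hv.andE2.andE1
    rw [Fm.ren_sub] at this
    unfold Ev
    convert this using 2
    · funext n; cases n <;> simp [scons, slot, Tm.ren_ren]
    · simp [scons, Fn.ren_ren]
  · have := hv.andE2.andE2
    simpa [Fm.sub, Tm.sub, Fn.sub, scons, Tm.ren_ren] using this

theorem ev_var {n : ℕ} : Ev Ax Γ σ τ (.var n) w ↔ Deriv Ax Γ (.eq (σ n) w) := Iff.rfl

theorem evF_var {n : ℕ} : EvF Ax Γ σ τ (.var n) α ↔ Deriv Ax Γ (feq (τ n) α) := Iff.rfl

theorem evF_cst {f : L.Con} {h : L.Unary f} :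
    EvF Ax Γ σ τ (.cst f h) α ↔ Deriv Ax Γ (feq (.cst f h) α) := Iff.rfl

theorem evF_lam_raw {h : true = true} (H : ∀ Δ ρ θ a, Ext ρ θ Γ Δ → ∃ y,
    Ev Ax Δ (scons a fun n => (σ n).ren ρ θ) (fun n => (τ n).ren ρ θ) t y ∧
      Deriv Ax Δ (.eq y (.app (α.ren ρ θ) a))) : EvF Ax Γ σ τ (.lam h t) α := by
  unfold EvF
  rw [Fn.graph]
  refine .envAll0I fun Δ ρ θ a e => ?_
  obtain ⟨y, h1, h2⟩ := H Δ ρ θ a e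
  refine .envEx0I y (.andI ?_ h2)
  rw [Fm.ren_sub]
  exact h1

theorem EvF.lam {h : true = true} (S : Base Ax) (H : ∀ Δ ρ θ a, Ext ρ θ Γ Δ →
    Ev Ax Δ (scons a fun n => (σ n).ren ρ θ) (fun n => (τ n).ren ρ θ) t (.app (α.ren ρ θ) a)) :
    EvF Ax Γ σ τ (.lam h t) α :=
  evF_lam_raw fun Δ ρ θ a e => ⟨_, H Δ ρ θ a e, S.refl _ _⟩

theorem EvF.lam_elim {h : true = true} (hv : EvF Ax Γ σ τ (.lam h t) α) (a : Tm L false)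
    (H : ∀ Δ ρ θ y, Ext ρ θ Γ Δ →
      Ev Ax Δ (scons (a.ren ρ θ) fun n => (σ n).ren ρ θ) (fun n => (τ n).ren ρ θ) t y →
      Deriv Ax Δ (.eq y (.app (α.ren ρ θ) (a.ren ρ θ))) → Deriv Ax Δ (C.ren ρ θ)) :
    Deriv Ax Γ C := by
  unfold EvF at hv
  rw [Fn.graph] at hv
  refine (hv.envAll0E a).envEx0E fun Δ ρ θ y e hv => H Δ ρ θ y e ?_ hv.andE2
  have := hv.andE1
  rw [Fm.ren_sub] at this
  unfold Ev
  convert this using 2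
  · funext n; rcases n with _ | _ | n <;> rfl
  · rfl

/-- The value of a term may be replaced by an equal term. -/
theorem Ev.resp (S : Base Ax) (h : Ev Ax Γ σ τ t w) (e : Deriv Ax Γ (.eq w w')) :
    Ev Ax Γ σ τ t w' := by
  cases t with
  | var n => exact S.trans h e
  | cst f hf ts us =>
    refine Ev.cst_elim h fun Δ ρ θ a β ext ha hβ hw => ?_
    rw [Fm.graph_sub_ren]
    exact Ev.cst ha hβ (S.trans hw (e.eq_mono ext))
  | app u t =>
    refine Ev.app_elim h fun Δ ρ θ a β ext ha hβ hw => ?_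
    rw [Fm.graph_sub_ren]
    exact Ev.app ha hβ (S.trans hw (e.eq_mono ext))

/-- The value of λx.s at a is the value of s for a. -/
theorem EvF.lam_apply (S : Base Ax) {h : true = true} (hv : EvF Ax Γ σ τ (.lam h t) α)
    (a : Tm L false) : Ev Ax Γ (scons a σ) τ t (.app α a) := by
  refine hv.lam_elim a fun Δ ρ θ y e h1 h2 => ?_
  rw [Fm.graph_sub_ren, scons_apply (fun t : Tm L false => t.ren ρ θ)]
  exact h1.resp S h2

theorem EvF.resp (S : Base Ax) (h : EvF Ax Γ σ τ u α) (e : Deriv Ax Γ (feq α α')) :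
    EvF Ax Γ σ τ u α' := by
  cases u with
  | var n => exact S.feq_trans (evF_var.1 h) e
  | cst f hf => exact S.feq_trans (evF_cst.1 h) e
  | lam hl t => exact EvF.lam S fun Δ ρ θ a ext =>
      ((h.mono ext).lam_apply S a).resp S (EqBase.feq_app (EqBase.feq_mono e ext) a)

end ev

section uniq
variable {Ax : Fm L false → Prop} (S : Base Ax)
include S

mutual
/-- Values are unique. -/
theorem Ev.uniq : ∀ (t : Tm L true) {Γ : List (Fm L false)} {σ : ℕ → Tm L false}
    {τ : ℕ → Fn L false} {w w' : Tm L false}, Ev Ax Γ σ τ t w → Ev Ax Γ σ τ t w' →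
    Deriv Ax Γ (.eq w w')
  | .var _, _, _, _, _, _, h, h' => S.euclid h h'
  | .cst f hf ts us, _, _, _, _, _, h, h' => by
    refine h.cst_elim fun Δ ρ θ a β e ha hβ hw => (h'.mono e).cst_elim
      fun Δ' ρ' θ' a' β' e' ha' hβ' hw' => ?_
    exact S.euclid (hw.eq_mono e') (S.trans (S.cst (fun i => Ev.uniq (ts i) ((ha i).mono e') (ha' i))
      (fun j => EvF.uniq (us j) ((hβ j).mono e') (hβ' j))) hw')
  | .app u t, _, _, _, _, _, h, h' => by
    refine h.app_elim fun Δ ρ θ a β e hβ ha hw => (h'.mono e).app_elim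
      fun Δ' ρ' θ' a' β' e' hβ' ha' hw' => ?_
    exact S.euclid (hw.eq_mono e') (S.trans (S.app_congr (EvF.uniq u (hβ.mono e') hβ')
      (Ev.uniq t (ha.mono e') ha')) hw')
theorem EvF.uniq : ∀ (u : Fn L true) {Γ : List (Fm L false)} {σ : ℕ → Tm L false}
    {τ : ℕ → Fn L false} {α α' : Fn L false}, EvF Ax Γ σ τ u α → EvF Ax Γ σ τ u α' →
    Deriv Ax Γ (feq α α')
  | .var _, _, _, _, _, _, h, h' => S.feq_trans (S.feq_symm (evF_var.1 h)) (evF_var.1 h')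
  | .cst _ _, _, _, _, _, _, h, h' => S.feq_trans (S.feq_symm (evF_cst.1 h)) (evF_cst.1 h')
  | .lam _ t, _, _, _, _, _, h, h' => EqBase.feqI fun _ _ _ a e =>
      Ev.uniq t ((h.mono e).lam_apply S a) ((h'.mono e).lam_apply S a)
end

end uniq

/-! ### Graphs and substitution -/

theorem exs0_ren (ρ θ : ℕ → ℕ) : ∀ (k : ℕ) (A : Fm L b),
    (exs0 k A).ren ρ θ = exs0 k (A.ren (up^[k] ρ) θ)
  | 0, _ => rfl
  | k + 1, A => by
    rw [exs0, Fm.ren, exs0_ren _ _ k]; rfl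

theorem exs1_ren (ρ θ : ℕ → ℕ) : ∀ (k : ℕ) (A : Fm L b),
    (exs1 k A).ren ρ θ = exs1 k (A.ren ρ (up^[k] θ))
  | 0, _ => rfl
  | k + 1, A => by
    rw [exs1, Fm.ren, exs1_ren _ _ k]; rfl

theorem up_iter_lt (ρ : ℕ → ℕ) : ∀ (k n : ℕ), n < k → (up^[k] ρ) n = n
  | k + 1, n, h => by
    rw [Function.iterate_succ_apply']
    cases n with
    | zero => rfl
    | succ n => rw [up, up_iter_lt ρ k n (by omega)]

theorem up_iter_add (ρ : ℕ → ℕ) : ∀ (k n : ℕ), (up^[k] ρ) (n + k) = ρ n + k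
  | 0, n => rfl
  | k + 1, n => by
    rw [Function.iterate_succ_apply', ← Nat.add_assoc, up, up_iter_add ρ k n, Nat.add_assoc]

theorem up_iter_add_succ (ρ : ℕ → ℕ) (k n : ℕ) :
    (up^[k] (up ρ)) (n + (k + 1)) = ρ n + (k + 1) := by
  rw [show n + (k + 1) = n + 1 + k by omega, up_iter_add, up]
  omega

theorem foldr_and_ren (ρ θ : ℕ → ℕ) (B : Fm L b) : ∀ l : List (Fm L b),
    (l.foldr .and B).ren ρ θ = (l.map (Fm.ren ρ θ)).foldr .and (B.ren ρ θ)
  | [] => rfl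
  | A :: l => by simp only [List.foldr, List.map, Fm.ren, foldr_and_ren ρ θ B l]

mutual
theorem Tm.graph_ren : ∀ (t : Tm L true) (ρ θ : ℕ → ℕ),
    (t.ren ρ θ).graph = t.graph.ren (up ρ) θ
  | .var n, ρ, θ => rfl
  | .cst f h ts us, ρ, θ => by
    rw [Tm.ren, Tm.graph, Tm.graph, exs0_ren, exs1_ren, foldr_and_ren, foldr_and_ren, List.map_ofFn,
      List.map_ofFn]
    refine congrArg (exs0 _) (congrArg (exs1 _) (congrArg₂ (fun i l => List.foldr Fm.and i l)
      (congrArg₂ (fun i l => List.foldr Fm.and i l) ?_ (congrArg List.ofFn (funext fun i => ?_)))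
        (congrArg List.ofFn (funext fun i => ?_))))
    · simp only [Fm.ren, Tm.ren, Fn.ren, up_iter_lt _ _ _ (Fin.is_lt _)]
      have := up_iter_add (up ρ) (L.nArg f) 0
      rw [Nat.zero_add, up, Nat.zero_add] at this
      rw [this]
    · simp only [(us i).graph_ren, Function.comp_apply, Fm.ren_ren]
      congr 1
      · funext n
        exact (up_iter_add_succ ρ _ n).symm
      · funext n
        cases n with
        | zero => simp only [slot, up, up_iter_lt _ _ _ i.2]
        | succ n => rw [slot, up, slot, up_iter_add]
    · simp only [(ts i).graph_ren, Function.comp_apply, Fm.ren_ren]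
      congr 1
      · funext n
        cases n with
        | zero => simp only [slot, up, up_iter_lt _ _ _ (Nat.lt_of_lt_of_le i.2 (Nat.le_refl _))]
        | succ n =>
          exact (up_iter_add_succ ρ _ n).symm
      · funext n
        rw [up_iter_add]
  | .app u t, ρ, θ => by
    simp only [Tm.ren, Tm.graph, Fm.ren, u.graph_ren, t.graph_ren, Fm.ren_ren, Fn.ren]
    congr 3
    congr 2
    funext n; cases n <;> rfl
theorem Fn.graph_ren : ∀ (t : Fn L true) (ρ θ : ℕ → ℕ),
    (t.ren ρ θ).graph = t.graph.ren ρ (up θ)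
  | .var n, ρ, θ => rfl
  | .cst f h, ρ, θ => rfl
  | .lam h t, ρ, θ => by
    simp only [Fn.ren, Fn.graph, Fm.ren, t.graph_ren, Fm.ren_ren]
    rfl
end

section sub
variable {Ax : Fm L false → Prop}

theorem scons_up {α : Type} (a : α) (σ : ℕ → α) (ρ : ℕ → ℕ) :
    (fun n => scons a σ (up ρ n)) = scons a fun n => σ (ρ n) := by
  funext n; cases n <;> rfl

theorem ev_ren {Γ : List (Fm L false)} {σ : ℕ → Tm L false} {τ : ℕ → Fn L false} {t : Tm L true}
    {w : Tm L false} {ρ θ : ℕ → ℕ} : Ev Ax Γ σ τ (t.ren ρ θ) w ↔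
      Ev Ax Γ (fun n => σ (ρ n)) (fun n => τ (θ n)) t w := by
  rw [Ev, Ev, Tm.graph_ren, Fm.ren_sub, scons_up]

theorem evF_ren {Γ : List (Fm L false)} {σ : ℕ → Tm L false} {τ : ℕ → Fn L false} {u : Fn L true}
    {α : Fn L false} {ρ θ : ℕ → ℕ} : EvF Ax Γ σ τ (u.ren ρ θ) α ↔
      EvF Ax Γ (fun n => σ (ρ n)) (fun n => τ (θ n)) u α := by
  rw [EvF, EvF, Fn.graph_ren, Fm.ren_sub, scons_up]

variable (S : Base Ax)
include S

/-- The hypothesis of the substitution lemmas, one binder further in. -/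
theorem ev_upN {Γ Δ : List (Fm L false)} {ρ ρ' : ℕ → Tm L false} {θ : ℕ → Fn L false}
    {σ : ℕ → Tm L true} {r q : ℕ → ℕ} (hσ : ∀ n, Ev Ax Γ ρ θ (σ n) (ρ' n)) (e : Ext r q Γ Δ)
    (a : Tm L false) (n : ℕ) : Ev Ax Δ (scons a fun n => (ρ n).ren r q) (fun n => (θ n).ren r q)
      (upN σ n) (scons a (fun n => (ρ' n).ren r q) n) := by
  cases n with
  | zero => exact S.refl _ _
  | succ n => rw [upN_succ, ev_ren]; exact (hσ n).mono e

mutual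
/-- Substitution lemma: the value of t[σ, τ] is the value of t under the environment of the values
of σ, τ. -/
theorem ev_sub : ∀ (t : Tm L true) {Γ : List (Fm L false)} {ρ ρ' : ℕ → Tm L false}
    {θ θ' : ℕ → Fn L false} {σ : ℕ → Tm L true} {τ : ℕ → Fn L true} {w : Tm L false},
    (∀ n, Ev Ax Γ ρ θ (σ n) (ρ' n)) → (∀ n, EvF Ax Γ ρ θ (τ n) (θ' n)) →
    (Ev Ax Γ ρ θ (t.sub σ τ) w ↔ Ev Ax Γ ρ' θ' t w)
  | .var n, _, _, _, _, _, _, _, _, hσ, _ =>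
    ⟨fun h => Ev.uniq S _ (hσ n) h, fun h => (hσ n).resp S h⟩
  | .cst f hf ts us, _, _, _, _, _, _, _, _, hσ, hτ => by
    constructor
    · intro h
      refine Ev.cst_elim h fun Δ r q a β e ha hβ hw => ?_
      rw [Fm.graph_sub_ren]
      exact Ev.cst
        (fun i => (ev_sub (ts i) (fun n => (hσ n).mono e) fun n => (hτ n).mono e).1 (ha i))
        (fun j => (evF_sub (us j) (fun n => (hσ n).mono e) fun n => (hτ n).mono e).1 (hβ j)) hw
    · intro h
      refine Ev.cst_elim h fun Δ r q a β e ha hβ hw => ?_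
      rw [Fm.graph_sub_ren]
      exact Ev.cst
        (fun i => (ev_sub (ts i) (fun n => (hσ n).mono e) fun n => (hτ n).mono e).2 (ha i))
        (fun j => (evF_sub (us j) (fun n => (hσ n).mono e) fun n => (hτ n).mono e).2 (hβ j)) hw
  | .app u t, _, _, _, _, _, _, _, _, hσ, hτ => by
    constructor
    · intro h
      refine Ev.app_elim h fun Δ r q a β e hβ ha hw => ?_
      rw [Fm.graph_sub_ren]
      exact Ev.app ((evF_sub u (fun n => (hσ n).mono e) fun n => (hτ n).mono e).1 hβ)
        ((ev_sub t (fun n => (hσ n).mono e) fun n => (hτ n).mono e).1 ha) hw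
    · intro h
      refine Ev.app_elim h fun Δ r q a β e hβ ha hw => ?_
      rw [Fm.graph_sub_ren]
      exact Ev.app ((evF_sub u (fun n => (hσ n).mono e) fun n => (hτ n).mono e).2 hβ)
        ((ev_sub t (fun n => (hσ n).mono e) fun n => (hτ n).mono e).2 ha) hw
theorem evF_sub : ∀ (u : Fn L true) {Γ : List (Fm L false)} {ρ ρ' : ℕ → Tm L false}
    {θ θ' : ℕ → Fn L false} {σ : ℕ → Tm L true} {τ : ℕ → Fn L true} {α : Fn L false},
    (∀ n, Ev Ax Γ ρ θ (σ n) (ρ' n)) → (∀ n, EvF Ax Γ ρ θ (τ n) (θ' n)) →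
    (EvF Ax Γ ρ θ (u.sub σ τ) α ↔ EvF Ax Γ ρ' θ' u α)
  | .var n, _, _, _, _, _, _, _, _, _, hτ =>
    ⟨fun h => EvF.uniq S _ (hτ n) h, fun h => (hτ n).resp S h⟩
  | .cst f hf, _, _, _, _, _, _, _, _, _, _ => Iff.rfl
  | .lam hl t, _, _, _, _, _, _, _, _, hσ, hτ => by
    exact ⟨fun h => EvF.lam S fun Δ r q a e => (ev_sub t (ev_upN S hσ e a) (fun n => by
        rw [evF_ren]; exact (hτ n).mono e)).1 ((h.mono e).lam_apply S a),
      fun h => EvF.lam S fun Δ r q a e => (ev_sub t (ev_upN S hσ e a) (fun n => by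
        rw [evF_ren]; exact (hτ n).mono e)).2 ((h.mono e).lam_apply S a)⟩
end

mutual
/-- A term without λ is its own value. -/
theorem ev_emb : ∀ (t : Tm L false) {Γ : List (Fm L false)} {σ : ℕ → Tm L false}
    {τ : ℕ → Fn L false}, Ev Ax Γ σ τ t.emb (t.sub σ τ)
  | .var _, _, _, _ => S.refl _ _
  | .cst _ _ ts us, _, _, _ => Ev.cst (fun i => ev_emb (ts i)) (fun j => evF_emb (us j))
      (S.refl _ _)
  | .app u t, _, _, _ => Ev.app (evF_emb u) (ev_emb t) (S.refl _ _)
theorem evF_emb : ∀ (u : Fn L false) {Γ : List (Fm L false)} {σ : ℕ → Tm L false}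
    {τ : ℕ → Fn L false}, EvF Ax Γ σ τ u.emb (u.sub σ τ)
  | .var _, _, _, _ => evF_var.2 (S.feq_refl _)
  | .cst _ _, _, _, _ => evF_cst.2 (S.feq_refl _)
  | .lam h _, _, _, _ => nomatch h
end

theorem ev_emb_iff (t : Tm L false) {Γ : List (Fm L false)} {σ : ℕ → Tm L false}
    {τ : ℕ → Fn L false} {w : Tm L false} :
    Ev Ax Γ σ τ t.emb w ↔ Deriv Ax Γ (.eq (t.sub σ τ) w) :=
  ⟨fun h => Ev.uniq S _ (ev_emb S t) h, fun h => (ev_emb S t).resp S h⟩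

theorem ev_env_congr {t : Tm L true} {Γ : List (Fm L false)} {ρ ρ' : ℕ → Tm L false}
    {θ θ' : ℕ → Fn L false} {w : Tm L false} (hσ : ∀ n, Deriv Ax Γ (.eq (ρ n) (ρ' n)))
    (hτ : ∀ n, Deriv Ax Γ (feq (θ n) (θ' n))) : Ev Ax Γ ρ θ t w ↔ Ev Ax Γ ρ' θ' t w := by
  have := ev_sub S t (w := w) (σ := .var) (τ := .var) hσ hτ
  rwa [Tm.sub_var] at this

mutual
theorem Base.sub_congr : ∀ (t : Tm L false) {Γ : List (Fm L false)} {σ σ' : ℕ → Tm L false}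
    {τ τ' : ℕ → Fn L false}, (∀ n, Deriv Ax Γ (.eq (σ n) (σ' n))) →
    (∀ n, Deriv Ax Γ (feq (τ n) (τ' n))) → Deriv Ax Γ (.eq (t.sub σ τ) (t.sub σ' τ'))
  | .var n, _, _, _, _, _, hσ, _ => hσ n
  | .cst _ _ ts us, _, _, _, _, _, hσ, hτ => S.cst (fun i => Base.sub_congr (ts i) hσ hτ)
      (fun j => Base.subF_congr (us j) hσ hτ)
  | .app u t, _, _, _, _, _, hσ, hτ => S.app_congr (Base.subF_congr u hσ hτ)
      (Base.sub_congr t hσ hτ)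
theorem Base.subF_congr : ∀ (u : Fn L false) {Γ : List (Fm L false)} {σ σ' : ℕ → Tm L false}
    {τ τ' : ℕ → Fn L false}, (∀ n, Deriv Ax Γ (.eq (σ n) (σ' n))) →
    (∀ n, Deriv Ax Γ (feq (τ n) (τ' n))) → Deriv Ax Γ (feq (u.sub σ τ) (u.sub σ' τ'))
  | .var n, _, _, _, _, _, _, hτ => hτ n
  | .cst f h, _, _, _, _, _, _, _ => S.feq_refl (.cst f h)
  | .lam h _, _, _, _, _, _, _, _ => nomatch h
end

end sub


/-! ### Totality of evaluation -/

/-- A pairing of numbers, relative to a functor parameter `R` with the property `ax R`: terms for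
the pair and for the components, with the laws of projections. The existence of a suitable
parameter is deducible. -/
structure Pairing (Ax : Fm L false → Prop) where
  ax : Fn L false → Fm L false
  pr : Tm L false → Tm L false → Tm L false
  p1 : Fn L false → Tm L false → Tm L false
  p2 : Fn L false → Tm L false → Tm L false
  ax_sub : ∀ R σ τ, (ax R).sub σ τ = ax (R.sub σ τ)
  pr_sub : ∀ x y σ τ, (pr x y).sub σ τ = pr (x.sub σ τ) (y.sub σ τ)
  p1_sub : ∀ R x σ τ, (p1 R x).sub σ τ = p1 (R.sub σ τ) (x.sub σ τ)
  p2_sub : ∀ R x σ τ, (p2 R x).sub σ τ = p2 (R.sub σ τ) (x.sub σ τ)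
  exists_ax : ∀ Γ, Deriv Ax Γ (.ex1 (ax (.var 0)))
  p1_pr : ∀ {Γ R}, Deriv Ax Γ (ax R) → ∀ x y, Deriv Ax Γ (.eq (p1 R (pr x y)) x)
  p2_pr : ∀ {Γ R}, Deriv Ax Γ (ax R) → ∀ x y, Deriv Ax Γ (.eq (p2 R (pr x y)) y)
  pr_congr : ∀ {Γ x x' y y'}, Deriv Ax Γ (.eq x x') → Deriv Ax Γ (.eq y y') →
    Deriv Ax Γ (.eq (pr x y) (pr x' y'))

namespace Pairing
variable {Ax : Fm L false → Prop} (P : Pairing Ax) {Γ Δ : List (Fm L false)} {ρ θ : ℕ → ℕ}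
include P

theorem ax_mono {R : Fn L false} (h : Deriv Ax Γ (P.ax R)) (e : Ext ρ θ Γ Δ) :
    Deriv Ax Δ (P.ax (R.ren ρ θ)) := by
  have := h.ren e
  rwa [Fm.ren_eq_sub, P.ax_sub, ← Fn.ren_eq_sub] at this

/-- The functor `α` is the section λy.B(x, y) of the function `B` of pairs. -/
def sect (α B : Fn L false) (x : Tm L false) : Fm L false :=
  .all0 (.eq (.app (α.ren Nat.succ id) (.var 0))
    (.app (B.ren Nat.succ id) (P.pr (x.ren Nat.succ id) (.var 0))))

theorem sect_sub (α B : Fn L false) (x : Tm L false) (σ : ℕ → Tm L false) (τ : ℕ → Fn L false) :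
    (P.sect α B x).sub σ τ = P.sect (α.sub σ τ) (B.sub σ τ) (x.sub σ τ) := by
  simp only [sect, Fm.sub, Tm.sub, Fn.ren_sub, Fn.sub_ren, P.pr_sub, Tm.ren_sub, Tm.sub_ren, id, upN]

theorem sect_ren (α B : Fn L false) (x : Tm L false) (ρ θ : ℕ → ℕ) :
    (P.sect α B x).ren ρ θ = P.sect (α.ren ρ θ) (B.ren ρ θ) (x.ren ρ θ) := by
  simp only [Fm.ren_eq_sub, Fn.ren_eq_sub, Tm.ren_eq_sub, sect_sub]

theorem sect_mono {α B : Fn L false} {x : Tm L false} (h : Deriv Ax Γ (P.sect α B x))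
    (e : Ext ρ θ Γ Δ) : Deriv Ax Δ (P.sect (α.ren ρ θ) (B.ren ρ θ) (x.ren ρ θ)) := by
  rw [← sect_ren]; exact h.ren e

theorem sect_apply {α B : Fn L false} {x : Tm L false} (h : Deriv Ax Γ (P.sect α B x))
    (y : Tm L false) : Deriv Ax Γ (.eq (.app α y) (.app B (P.pr x y))) := by
  have := h.all0E y
  simpa [Fm.inst0, Fm.sub, Tm.sub, Fn.ren_sub, single0, Fn.sub_var, P.pr_sub, Tm.ren_sub,
    Tm.sub_var] using this

theorem sectI {α B : Fn L false} {x : Tm L false} (h : ∀ Δ ρ θ y, Ext ρ θ Γ Δ →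
    Deriv Ax Δ (.eq (.app (α.ren ρ θ) y) (.app (B.ren ρ θ) (P.pr (x.ren ρ θ) y)))) :
    Deriv Ax Γ (P.sect α B x) := .all0I (h _ _ _ _ (.shift0 Γ))

/-- Sections exist. -/
theorem exists_sect (S : EqBase Ax) (B : Fn L false) (x : Tm L false) {C : Fm L false}
    (H : ∀ Δ ρ θ α, Ext ρ θ Γ Δ → Deriv Ax Δ (P.sect α (B.ren ρ θ) (x.ren ρ θ)) →
      Deriv Ax Δ (C.ren ρ θ)) : Deriv Ax Γ C := by
  refine S.exists_fun (.app (B.ren Nat.succ id) (P.pr (x.ren Nat.succ id) (.var 0)))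
    fun Δ ρ θ α e h => H Δ ρ θ α e (P.sectI fun Δ' ρ' θ' y e' => ?_)
  have := h Δ' ρ' θ' y e'
  simp only [Tm.sub, Fn.ren_sub, P.pr_sub, Tm.ren_sub, scons, id] at this
  simpa only [Fn.ren_ren, Tm.ren_ren, ← Fn.ren_eq_sub B, ← Tm.ren_eq_sub x] using this

/-- δ(x) = f(γ(x), λy.B(x, y)) for all x, with the section named by a function variable. -/
def uni (f : L.Con) (h : ¬ L.Unary f) (γ : Fin (L.nArg f) → Fn L false) (B δ : Fn L false) :
    Fm L false :=
  .all0 (.all1 (.imp (P.sect (.var 0) (B.ren Nat.succ Nat.succ) (.var 0))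
    (.eq (.cst f h (fun i => .app ((γ i).ren Nat.succ Nat.succ) (.var 0)) fun _ => .var 0)
      (.app (δ.ren Nat.succ Nat.succ) (.var 0)))))

/-- The property of a constant that makes evaluation total: f(γ(x), λy.B(x, y)) is a function of
x, for all functions γ, B. -/
def Uniform (f : L.Con) : Prop :=
  ∀ (h : ¬ L.Unary f) {Γ : List (Fm L false)} {R : Fn L false} {C : Fm L false}
    (γ : Fin (L.nArg f) → Fn L false) (B : Fn L false), Deriv Ax Γ (P.ax R) →
    (∀ Δ ρ θ δ, Ext ρ θ Γ Δ →
      Deriv Ax Δ (P.uni f h (fun i => (γ i).ren ρ θ) (B.ren ρ θ) δ) → Deriv Ax Δ (C.ren ρ θ)) →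
    Deriv Ax Γ C

theorem uni_apply {f : L.Con} {h : ¬ L.Unary f} {γ : Fin (L.nArg f) → Fn L false}
    {B δ : Fn L false} (hu : Deriv Ax Γ (P.uni f h γ B δ)) {x : Tm L false} {α : Fn L false}
    (hα : Deriv Ax Γ (P.sect α B x)) :
    Deriv Ax Γ (.eq (.cst f h (fun i => .app (γ i) x) fun _ => α) (.app δ x)) := by
  have h1 := (hu.all0E x).all1E α
  simp only [Fm.inst1, Fm.sub, sect_sub, Tm.sub, Fn.sub, Fn.ren_sub, Fn.sub_sub,
    Tm.ren_sub, single0, single1, Fn.sub_var, Tm.sub_var, upF, Fn.ren, id] at h1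
  exact h1.impE hα

theorem uni_ren (f : L.Con) (h : ¬ L.Unary f) (γ : Fin (L.nArg f) → Fn L false)
    (B δ : Fn L false) (ρ θ : ℕ → ℕ) : (P.uni f h γ B δ).ren ρ θ =
      P.uni f h (fun i => (γ i).ren ρ θ) (B.ren ρ θ) (δ.ren ρ θ) := by
  simp only [uni, Fm.ren, sect_ren, Fn.ren_ren, Tm.ren, Fn.ren, up]

theorem uni_mono {f : L.Con} {h : ¬ L.Unary f} {γ : Fin (L.nArg f) → Fn L false}
    {B δ : Fn L false} (hu : Deriv Ax Γ (P.uni f h γ B δ)) (e : Ext ρ θ Γ Δ) :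
    Deriv Ax Δ (P.uni f h (fun i => (γ i).ren ρ θ) (B.ren ρ θ) (δ.ren ρ θ)) := by
  rw [← uni_ren]; exact hu.ren e

theorem uniI {f : L.Con} {h : ¬ L.Unary f} {γ : Fin (L.nArg f) → Fn L false} {B δ : Fn L false}
    (H : ∀ Δ ρ θ (x : Tm L false) (α : Fn L false), Ext ρ θ Γ Δ →
      Deriv Ax Δ (P.sect α (B.ren ρ θ) x) →
      Deriv Ax Δ (.eq (.cst f h (fun i => .app ((γ i).ren ρ θ) x) fun _ => α)
        (.app (δ.ren ρ θ) x))) : Deriv Ax Γ (P.uni f h γ B δ) :=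
  .all0I (.all1I (.impI (H _ _ _ (.var 0) (.var 0) (((Ext.shift0 Γ).trans (.shift1 _)).cons _) .head)))

/-- Every constant without function arguments is uniform, by QF-AC₀₀. -/
theorem uniform_of_fArg_eq_zero (S : Base Ax) {f : L.Con} (hf : L.fArg f = 0) : P.Uniform f := by
  intro h Γ R C γ B _ H
  refine S.exists_fun (.cst f h (fun i => .app ((γ i).ren Nat.succ id) (.var 0)) fun _ => .var 0)
    fun Δ ρ θ δ e hδ => H Δ ρ θ δ e (P.uniI fun Δ' ρ' θ' x α e' _ => ?_)
  have := hδ Δ' ρ' θ' x e'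
  simp only [Tm.sub, Fn.ren_sub, scons, id] at this
  refine S.symm (S.trans this (S.cst (fun i => ?_) fun j => (Fin.cast hf j).elim0))
  simp only [Fn.ren_ren, ← Fn.ren_eq_sub (γ i)]
  exact S.refl _ _

/-- δ(x) is the value of `t` for all x, where x is the number variable 0 in `σ`. -/
def IsTot (Γ : List (Fm L false)) (σ : ℕ → Tm L false) (τ : ℕ → Fn L false) (t : Tm L true)
    (δ : Fn L false) : Prop :=
  Deriv Ax Γ (.all0 (t.graph.sub (scons (.app (δ.ren Nat.succ id) (.var 0)) σ)
    fun n => (τ n).ren Nat.succ id))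

omit P in
theorem IsTot.intro {σ : ℕ → Tm L false} {τ : ℕ → Fn L false} {t : Tm L true} {δ : Fn L false}
    (H : Ev Ax (Γ.map (Fm.ren Nat.succ id)) σ (fun n => (τ n).ren Nat.succ id) t
      (.app (δ.ren Nat.succ id) (.var 0))) : IsTot (Ax := Ax) Γ σ τ t δ := .all0I H

omit P in
theorem IsTot.apply {σ : ℕ → Tm L false} {τ : ℕ → Fn L false} {t : Tm L true} {δ : Fn L false}
    (h : IsTot (Ax := Ax) Γ σ τ t δ) (x : Tm L false) :
    Ev Ax Γ (fun n => (σ n).inst0 x) τ t (.app δ x) := by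
  have := Deriv.all0E x h
  rw [Fm.inst0, Fm.sub_sub, scons_apply (fun s : Tm L false => s.sub (single0 x) .var)] at this
  simp only [Tm.sub, Fn.ren_sub, single0, Fn.sub_var, id] at this
  exact this

omit P in
theorem IsTot.mono {σ : ℕ → Tm L false} {τ : ℕ → Fn L false} {t : Tm L true} {δ : Fn L false}
    (h : IsTot (Ax := Ax) Γ σ τ t δ) (e : Ext ρ θ Γ Δ) : IsTot (Ax := Ax) Δ
      (fun n => (σ n).ren (up ρ) θ) (fun n => (τ n).ren ρ θ) t (δ.ren ρ θ) := by
  have := Deriv.ren h e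
  rw [Fm.ren, Fm.graph_sub_ren] at this
  simpa only [IsTot, Tm.ren, Fn.ren_ren, up, id] using this

/-- B(x, y) is the value of the functor `u` at y for all x, y, where x is the number variable 0
in `σ`. -/
def IsTotF (Γ : List (Fm L false)) (σ : ℕ → Tm L false) (τ : ℕ → Fn L false) (u : Fn L true)
    (B : Fn L false) : Prop :=
  Deriv Ax Γ (.all0 (.all1 (.imp (P.sect (.var 0) (B.ren Nat.succ Nat.succ) (.var 0))
    (u.graph.sub (fun n => (σ n).ren id Nat.succ)
      (scons (.var 0) fun n => (τ n).ren Nat.succ Nat.succ)))))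

theorem IsTotF.apply {σ : ℕ → Tm L false} {τ : ℕ → Fn L false} {u : Fn L true} {B α : Fn L false}
    (h : P.IsTotF Γ σ τ u B) {x : Tm L false} (hα : Deriv Ax Γ (P.sect α B x)) :
    EvF Ax Γ (fun n => (σ n).inst0 x) τ u α := by
  have h1 := (Deriv.all0E x h).all1E α
  simp only [Fm.inst1, Fm.sub_sub, Fm.sub, sect_sub, Tm.sub, Fn.sub, Fn.ren_sub,
    Fn.sub_sub, Tm.ren_sub, single0, single1, Fn.sub_var, Tm.sub_var, upF, Fn.ren,
    Tm.sub_sub, id] at h1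
  have h2 := h1.impE hα
  unfold EvF
  convert h2 using 2
  · funext n
    rw [Tm.inst0]
    congr 1
  · funext n; cases n <;> simp [scons, Fn.sub, single1, Fn.ren_sub, Fn.sub_var]

theorem IsTotF.mono {σ : ℕ → Tm L false} {τ : ℕ → Fn L false} {u : Fn L true} {B : Fn L false}
    (h : P.IsTotF Γ σ τ u B) (e : Ext ρ θ Γ Δ) : P.IsTotF Δ
      (fun n => (σ n).ren (up ρ) θ) (fun n => (τ n).ren ρ θ) u (B.ren ρ θ) := by
  have := Deriv.ren h e
  simp only [Fm.ren, Fm.graphF_sub_ren, sect_ren] at this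
  simpa only [IsTotF, Tm.ren, Tm.ren_ren, Fn.ren_ren, Fn.ren, up, id] using this

theorem IsTotF.intro {σ : ℕ → Tm L false} {τ : ℕ → Fn L false} {u : Fn L true} {B : Fn L false}
    (H : ∀ Δ α, Ext Nat.succ Nat.succ Γ Δ →
      Deriv Ax Δ (P.sect α (B.ren Nat.succ Nat.succ) (.var 0)) →
      EvF Ax Δ (fun n => (σ n).ren id Nat.succ) (fun n => (τ n).ren Nat.succ Nat.succ) u α) :
    P.IsTotF Γ σ τ u B :=
  .all0I (.all1I (.impI (H _ (.var 0) (((Ext.shift0 Γ).trans (.shift1 _)).cons _) .head)))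

omit P in
/-- If each of finitely many properties is satisfied by a functor in some extension of every context,
then there is an extension with functors for all of them. -/
theorem exists_family {k : ℕ} (Q : Fin k → List (Fm L false) → (ℕ → ℕ) → (ℕ → ℕ) → Fn L false → Prop)
    (mono : ∀ i Δ ρ θ γ Δ' ρ' θ', Ext ρ' θ' Δ Δ' → Q i Δ ρ θ γ →
      Q i Δ' (fun n => ρ' (ρ n)) (fun n => θ' (θ n)) (γ.ren ρ' θ'))
    (ex : ∀ i Δ ρ θ (C : Fm L false), Ext ρ θ Γ Δ → (∀ Δ' ρ' θ' γ, Ext ρ' θ' Δ Δ' →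
      Q i Δ' (fun n => ρ' (ρ n)) (fun n => θ' (θ n)) γ → Deriv Ax Δ' (C.ren ρ' θ')) → Deriv Ax Δ C) :
    ∀ {Δ : List (Fm L false)} {ρ θ : ℕ → ℕ} {C : Fm L false}, Ext ρ θ Γ Δ →
    (∀ Δ' ρ' θ' (γ : Fin k → Fn L false), Ext ρ' θ' Δ Δ' →
      (∀ i, Q i Δ' (fun n => ρ' (ρ n)) (fun n => θ' (θ n)) (γ i)) → Deriv Ax Δ' (C.ren ρ' θ')) →
    Deriv Ax Δ C := by
  induction k with
  | zero =>
    intro Δ ρ θ C _ H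
    have := H Δ _ _ Fin.elim0 (.refl Δ) fun i => i.elim0
    rwa [Fm.ren_id] at this
  | succ k ih =>
    intro Δ ρ θ C e H
    refine ih (fun i => Q i.castSucc) (fun i => mono _) (fun i => ex _) e
      fun Δ' ρ' θ' γ e' hγ => ex (Fin.last k) _ _ _ _ (e.trans e') fun Δ'' ρ'' θ'' γ' e'' hγ' => ?_
    rw [Fm.ren_ren]
    refine H Δ'' _ _ (Fin.snoc (fun i => (γ i).ren ρ'' θ'') γ') (e'.trans e'') fun i => ?_
    induction i using Fin.lastCases with
    | last => simpa using hγ'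
    | cast i => simpa using mono _ _ _ _ _ _ _ _ e'' (hγ i)

/-- A functor names the values of a term. -/
def Total (t : Tm L true) : Prop :=
  ∀ (Γ : List (Fm L false)) (R : Fn L false) (C : Fm L false) (σ : ℕ → Tm L false)
    (τ : ℕ → Fn L false), Deriv Ax Γ (P.ax R) →
    (∀ Δ ρ θ δ, Ext ρ θ Γ Δ → IsTot (Ax := Ax) Δ (fun n => (σ n).ren (up ρ) θ)
      (fun n => (τ n).ren ρ θ) t δ → Deriv Ax Δ (C.ren ρ θ)) → Deriv Ax Γ C

/-- A functor names the values of a functor, as a function of pairs. -/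
def TotalF (u : Fn L true) : Prop :=
  ∀ (Γ : List (Fm L false)) (R : Fn L false) (C : Fm L false) (σ : ℕ → Tm L false)
    (τ : ℕ → Fn L false), Deriv Ax Γ (P.ax R) →
    (∀ Δ ρ θ B, Ext ρ θ Γ Δ → P.IsTotF Δ (fun n => (σ n).ren (up ρ) θ)
      (fun n => (τ n).ren ρ θ) u B → Deriv Ax Δ (C.ren ρ θ)) → Deriv Ax Γ C

theorem total_family {k : ℕ} {ts : Fin k → Tm L true} (h : ∀ i, P.Total (ts i)) {R : Fn L false}
    {C : Fm L false} (σ : ℕ → Tm L false) (τ : ℕ → Fn L false) (hR : Deriv Ax Γ (P.ax R))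
    (H : ∀ Δ ρ θ (δ : Fin k → Fn L false), Ext ρ θ Γ Δ → (∀ i, IsTot (Ax := Ax) Δ
      (fun n => (σ n).ren (up ρ) θ) (fun n => (τ n).ren ρ θ) (ts i) (δ i)) →
        Deriv Ax Δ (C.ren ρ θ)) : Deriv Ax Γ C := by
  refine exists_family (Γ := Γ) (fun i Δ ρ θ δ => IsTot (Ax := Ax) Δ (fun n => (σ n).ren (up ρ) θ)
    (fun n => (τ n).ren ρ θ) (ts i) δ) ?_ ?_ (.refl Γ) H
  · intro i Δ ρ θ γ Δ' ρ' θ' e h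
    have := h.mono e
    simpa only [Tm.ren_ren, Fn.ren_ren, up_comp'] using this
  · intro i Δ ρ θ C e H
    refine h i _ _ _ (fun n => (σ n).ren (up ρ) θ) (fun n => (τ n).ren ρ θ) (P.ax_mono hR e)
      fun Δ' ρ' θ' δ e' hδ => H Δ' ρ' θ' δ e' ?_
    simpa only [Tm.ren_ren, Fn.ren_ren, up_comp'] using hδ

theorem totalF_family {k : ℕ} {us : Fin k → Fn L true} (h : ∀ i, P.TotalF (us i)) {R : Fn L false}
    {C : Fm L false} (σ : ℕ → Tm L false) (τ : ℕ → Fn L false) (hR : Deriv Ax Γ (P.ax R))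
    (H : ∀ Δ ρ θ (δ : Fin k → Fn L false), Ext ρ θ Γ Δ → (∀ i, P.IsTotF Δ
      (fun n => (σ n).ren (up ρ) θ) (fun n => (τ n).ren ρ θ) (us i) (δ i)) →
        Deriv Ax Δ (C.ren ρ θ)) : Deriv Ax Γ C := by
  refine exists_family (Γ := Γ) (fun i Δ ρ θ δ => P.IsTotF Δ (fun n => (σ n).ren (up ρ) θ)
    (fun n => (τ n).ren ρ θ) (us i) δ) ?_ ?_ (.refl Γ) H
  · intro i Δ ρ θ γ Δ' ρ' θ' e h
    have := IsTotF.mono P h e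
    simpa only [Tm.ren_ren, Fn.ren_ren, up_comp'] using this
  · intro i Δ ρ θ C e H
    refine h i _ _ _ (fun n => (σ n).ren (up ρ) θ) (fun n => (τ n).ren ρ θ) (P.ax_mono hR e)
      fun Δ' ρ' θ' δ e' hδ => H Δ' ρ' θ' δ e' ?_
    simpa only [Tm.ren_ren, Fn.ren_ren, up_comp'] using hδ

omit P in
theorem inst0_ren_up (t : Tm L b) (ρ θ : ℕ → ℕ) (x : Tm L b) :
    (t.ren (up ρ) θ).inst0 x = t.sub (scons x fun n => .var (ρ n)) fun n => .var (θ n) := by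
  rw [Tm.inst0, Tm.ren_sub, single0_eq, scons_up]

omit P in
theorem inst0_var0 (σ : Tm L b) : (σ.ren (up Nat.succ) id).inst0 (.var 0) = σ := by
  rw [inst0_ren_up]
  conv_rhs => rw [← σ.sub_var]
  congr 1
  funext n; cases n <;> rfl

omit P in
/-- The value at x, in the context where the variable x is introduced. -/
theorem IsTot.apply_var {σ : ℕ → Tm L false} {τ : ℕ → Fn L false} {t : Tm L true} {δ : Fn L false}
    (h : IsTot (Ax := Ax) Γ σ τ t δ) : Ev Ax (Γ.map (Fm.ren Nat.succ id)) σ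
      (fun n => (τ n).ren Nat.succ id) t (.app (δ.ren Nat.succ id) (.var 0)) := by
  have := (h.mono (.shift0 Γ)).apply (.var 0)
  simpa only [inst0_var0] using this

theorem IsTotF.apply_var {σ : ℕ → Tm L false} {τ : ℕ → Fn L false} {u : Fn L true}
    {B α : Fn L false} (h : P.IsTotF Γ σ τ u B) (e : Ext ρ θ (Γ.map (Fm.ren Nat.succ id)) Δ)
    (hα : Deriv Ax Δ (P.sect α ((B.ren Nat.succ id).ren ρ θ) (.var (ρ 0)))) :
    EvF Ax Δ (fun n => (σ n).ren ρ θ) (fun n => ((τ n).ren Nat.succ id).ren ρ θ) u α := by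
  rw [Fn.ren_ren] at hα
  have := (IsTotF.mono P h ((Ext.shift0 Γ).trans e)).apply P hα
  simp only [Fn.ren_ren]
  convert this using 2
  rw [inst0_ren_up, Tm.ren_eq_sub]
  congr 1
  funext n; cases n <;> rfl

end Pairing

section total
variable {Ax : Fm L false → Prop} (P : Pairing Ax) (S : Base Ax) (hU : ∀ f, P.Uniform f)
  (hf : ∀ f, L.fArg f ≤ 1)
include S hU hf

open Pairing in
mutual
/-- The values of a term depend functionally on the values of its variables. -/
theorem total : ∀ t : Tm L true, P.Total t
  | .var n => by
    intro Γ R C σ τ _ H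
    refine S.exists_fun (σ n) fun Δ ρ θ δ e hδ => H Δ ρ θ δ e (.intro (ev_var.2 (S.symm ?_)))
    have := hδ _ _ _ (.var 0) (.shift0 Δ)
    convert this using 2
    rw [Tm.ren_eq_sub]
    congr 1
    funext n; cases n <;> rfl
  | .cst f h ts us => by
    intro Γ R C σ τ hR H
    refine P.total_family (fun i => total (ts i)) σ τ hR fun Δ ρ θ γ e hγ =>
      P.totalF_family (fun j => totalF (us j)) (fun n => (σ n).ren (up ρ) θ)
        (fun n => (τ n).ren ρ θ) (P.ax_mono hR e) fun Δ₁ ρ₁ θ₁ B e₁ hB => ?_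
    -- there is at most one function argument
    obtain ⟨B₀, hB₀⟩ : ∃ B₀, ∀ j, B j = B₀ := by
      by_cases h0 : 0 < L.fArg f
      · exact ⟨B ⟨0, h0⟩, fun j => congrArg B (Fin.ext (by have := hf f; omega))⟩
      · exact ⟨.var 0, fun j => absurd j.pos h0⟩
    refine hU f h (fun i => (γ i).ren ρ₁ θ₁) B₀ (P.ax_mono (P.ax_mono hR e) e₁)
      fun Δ₂ ρ₂ θ₂ δ e₂ hδ => ?_
    rw [Fm.ren_ren, Fm.ren_ren]
    refine H Δ₂ _ _ δ ((e.trans e₁).trans e₂) (.intro ?_)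
    refine P.exists_sect S.toEqBase ((B₀.ren ρ₂ θ₂).ren Nat.succ id) (.var 0) fun Δ₃ ρ₃ θ₃ α e₃ hα => ?_
    have hγ' := fun i => ((hγ i).mono (e₁.trans e₂)).apply_var.mono e₃
    have hB' := fun j => (IsTotF.mono P (hB j) e₂).apply_var P (α := α) e₃ (by rw [hB₀]; exact hα)
    have hδ' := P.uni_apply (P.uni_mono (P.uni_mono hδ (.shift0 Δ₂)) e₃) hα
    rw [Fm.graph_sub_ren]
    simp only [Tm.ren_ren, Fn.ren_ren, up_comp', Tm.ren] at hγ' hB' hδ' ⊢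
    exact Ev.cst hγ' hB' hδ'
  | .app u t => by
    intro Γ R C σ τ hR H
    refine total t _ _ _ σ τ hR fun Δ ρ θ γ e hγ =>
      totalF u _ _ _ (fun n => (σ n).ren (up ρ) θ) (fun n => (τ n).ren ρ θ) (P.ax_mono hR e) fun Δ₁ ρ₁ θ₁ B e₁ hB => ?_
    refine S.exists_fun (.app (B.ren Nat.succ id)
      (P.pr (.var 0) (.app ((γ.ren ρ₁ θ₁).ren Nat.succ id) (.var 0)))) fun Δ₂ ρ₂ θ₂ δ e₂ hδ => ?_
    rw [Fm.ren_ren, Fm.ren_ren]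
    refine H Δ₂ _ _ δ ((e.trans e₁).trans e₂) (.intro ?_)
    refine P.exists_sect S.toEqBase ((B.ren ρ₂ θ₂).ren Nat.succ id) (.var 0) fun Δ₃ ρ₃ θ₃ α e₃ hα => ?_
    have hγ' := (hγ.mono (e₁.trans e₂)).apply_var.mono e₃
    have hB' := (IsTotF.mono P hB e₂).apply_var P e₃ hα
    have hδ' := hδ _ _ _ (.var (ρ₃ 0)) ((Ext.shift0 Δ₂).trans e₃)
    simp only [Tm.sub, P.pr_sub, Fn.ren_sub, scons, id] at hδ'
    rw [Fm.graph_sub_ren]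
    simp only [Tm.ren_ren, Fn.ren_ren, up_comp', Tm.ren, ← Fn.ren_eq_sub] at hγ' hB' hδ' hα ⊢
    refine Ev.app hB' hγ' (S.trans (P.sect_apply hα _) (S.symm hδ'))
theorem totalF : ∀ u : Fn L true, P.TotalF u
  | .var n => by
    intro Γ R C σ τ hR H
    refine S.exists_fun (.app ((τ n).ren Nat.succ id) (P.p2 (R.ren Nat.succ id) (.var 0)))
      fun Δ ρ θ B e hB => H Δ ρ θ B e (.intro P fun Δ₁ α e₁ hα => ?_)
    refine evF_var.2 (EqBase.feqI fun Δ₂ ρ₂ θ₂ y e₂ => S.symm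
      (S.trans (P.sect_apply (P.sect_mono hα e₂) y) ?_))
    have hB' := hB _ _ _ (P.pr (.var (ρ₂ 0)) y) (e₁.trans e₂)
    simp only [Tm.sub, P.p2_sub, Fn.ren_sub, scons, id, ← Fn.ren_eq_sub] at hB'
    simp only [Fn.ren_ren] at hB' ⊢
    refine S.trans hB' (S.app (P.p2_pr ?_ _ _))
    simpa only [Fn.ren_ren] using P.ax_mono (P.ax_mono (P.ax_mono hR e) e₁) e₂
  | .cst f h => by
    intro Γ R C σ τ hR H
    refine S.exists_fun (.app (.cst f h) (P.p2 (R.ren Nat.succ id) (.var 0)))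
      fun Δ ρ θ B e hB => H Δ ρ θ B e (.intro P fun Δ₁ α e₁ hα => ?_)
    refine evF_cst.2 (EqBase.feqI fun Δ₂ ρ₂ θ₂ y e₂ => S.symm
      (S.trans (P.sect_apply (P.sect_mono hα e₂) y) ?_))
    have hB' := hB _ _ _ (P.pr (.var (ρ₂ 0)) y) (e₁.trans e₂)
    simp only [Tm.sub, P.p2_sub, Fn.ren_sub, scons, id, Fn.sub, ← Fn.ren_eq_sub] at hB'
    simp only [Fn.ren_ren] at hB' ⊢
    refine S.trans hB' (S.app (P.p2_pr ?_ _ _))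
    simpa only [Fn.ren_ren] using P.ax_mono (P.ax_mono (P.ax_mono hR e) e₁) e₂
  | .lam h t => by
    intro Γ R C σ τ hR H
    -- the bound variable becomes the second component of the argument
    refine total t _ _ _ (scons (P.p2 (R.ren Nat.succ id) (.var 0)) fun n =>
      (σ n).sub (scons (P.p1 (R.ren Nat.succ id) (.var 0)) fun k => .var (k + 1)) .var) τ hR
      fun Δ ρ θ B e hB => H Δ ρ θ B e (.intro P fun Δ₁ α e₁ hα => ?_)
    refine EvF.lam S fun Δ₂ ρ₂ θ₂ y e₂ => ?_
    have h1 := (hB.mono (e₁.trans e₂)).apply (P.pr (.var (ρ₂ 0)) y)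
    have hR' := P.ax_mono hR ((e.trans e₁).trans e₂)
    have h2 := P.sect_apply (P.sect_mono hα e₂) y
    simp only [Fn.ren_ren, Tm.ren] at h2
    refine (ev_env_congr S (fun n => ?_) fun n => ?_).1 (h1.resp S (S.symm h2))
    · rw [inst0_ren_up, Tm.ren_sub]
      cases n with
      | zero =>
        simp only [scons, P.p2_sub, Fn.ren_sub, Tm.sub, ← Fn.ren_eq_sub, up, id]
        exact P.p2_pr hR' _ _
      | succ n =>
        simp only [Tm.ren_ren]
        rw [scons, scons, Tm.sub_sub, Tm.ren_eq_sub]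
        refine S.sub_congr (σ n) (fun k => ?_) fun k => S.feq_refl _
        cases k with
        | zero =>
          simp only [scons, P.p1_sub, Fn.ren_sub, Tm.sub, ← Fn.ren_eq_sub, up, id]
          exact P.p1_pr hR' _ _
        | succ k => exact S.refl _ _
    · simp only [Fn.ren_ren]
      exact S.feq_refl _
end

end total

/-! ### The translation -/

mutual
/-- The term does not contain λ. -/
def Tm.LamFree : Tm L true → Prop
  | .var _ => True
  | .cst _ _ ts us => (∀ i, (ts i).LamFree) ∧ ∀ j, (us j).LamFree
  | .app u t => u.LamFree ∧ t.LamFree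
/-- The functor does not contain λ. -/
def Fn.LamFree : Fn L true → Prop
  | .var _ => True
  | .cst _ _ => True
  | .lam _ _ => False
end

mutual
/-- The inverse of `Tm.emb`, with a junk value for λ. -/
def Tm.strip : Tm L true → Tm L false
  | .var n => .var n
  | .cst f h ts us => .cst f h (fun i => (ts i).strip) fun j => (us j).strip
  | .app u t => .app u.strip t.strip
/-- The inverse of `Fn.emb`, with a junk value for λ. -/
def Fn.strip : Fn L true → Fn L false
  | .var n => .var n
  | .cst f h => .cst f h
  | .lam _ _ => .var 0
end

mutual
theorem Tm.lamFree_emb : ∀ t : Tm L false, t.emb.LamFree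
  | .var _ => trivial
  | .cst _ _ ts us => ⟨fun i => (ts i).lamFree_emb, fun j => (us j).lamFree_emb⟩
  | .app u t => ⟨u.lamFree_emb, t.lamFree_emb⟩
theorem Fn.lamFree_emb : ∀ u : Fn L false, u.emb.LamFree
  | .var _ => trivial
  | .cst _ _ => trivial
  | .lam h _ => nomatch h
end

mutual
theorem Tm.strip_emb : ∀ t : Tm L false, t.emb.strip = t
  | .var _ => rfl
  | .cst f h ts us => by
    simp only [Tm.emb, Tm.strip, Tm.cst.injEq, heq_eq_eq, true_and]
    exact ⟨funext fun i => (ts i).strip_emb, funext fun j => (us j).strip_emb⟩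
  | .app u t => by simp only [Tm.emb, Tm.strip, u.strip_emb, t.strip_emb]
theorem Fn.strip_emb : ∀ u : Fn L false, u.emb.strip = u
  | .var _ => rfl
  | .cst _ _ => rfl
  | .lam h _ => nomatch h
end

mutual
theorem Tm.emb_strip : ∀ t : Tm L true, t.LamFree → t.strip.emb = t
  | .var _, _ => rfl
  | .cst f h ts us, H => by
    simp only [Tm.emb, Tm.strip, Tm.cst.injEq, heq_eq_eq, true_and]
    exact ⟨funext fun i => (ts i).emb_strip (H.1 i), funext fun j => (us j).emb_strip (H.2 j)⟩
  | .app u t, H => by simp only [Tm.emb, Tm.strip, u.emb_strip H.1, t.emb_strip H.2]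
theorem Fn.emb_strip : ∀ u : Fn L true, u.LamFree → u.strip.emb = u
  | .var _, _ => rfl
  | .cst _ _, _ => rfl
  | .lam _ _, H => H.elim
end

mutual
theorem Tm.lamFree_ren : ∀ (t : Tm L true) (ρ θ : ℕ → ℕ), (t.ren ρ θ).LamFree ↔ t.LamFree
  | .var _, _, _ => Iff.rfl
  | .cst _ _ ts us, _, _ => and_congr (forall_congr' fun i => (ts i).lamFree_ren _ _)
      (forall_congr' fun j => (us j).lamFree_ren _ _)
  | .app u t, _, _ => and_congr (u.lamFree_ren _ _) (t.lamFree_ren _ _)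
theorem Fn.lamFree_ren : ∀ (u : Fn L true) (ρ θ : ℕ → ℕ), (u.ren ρ θ).LamFree ↔ u.LamFree
  | .var _, _, _ => Iff.rfl
  | .cst _ _, _, _ => Iff.rfl
  | .lam _ _, _, _ => Iff.rfl
end

mutual
theorem Tm.strip_ren : ∀ (t : Tm L true) (ρ θ : ℕ → ℕ), t.LamFree →
    (t.ren ρ θ).strip = t.strip.ren ρ θ
  | .var _, _, _, _ => rfl
  | .cst _ _ ts us, ρ, θ, H => by
    simp only [Tm.ren, Tm.strip, Tm.cst.injEq, heq_eq_eq, true_and]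
    exact ⟨funext fun i => (ts i).strip_ren ρ θ (H.1 i),
      funext fun j => (us j).strip_ren ρ θ (H.2 j)⟩
  | .app u t, ρ, θ, H => by
    simp only [Tm.ren, Tm.strip, u.strip_ren ρ θ H.1, t.strip_ren ρ θ H.2]
theorem Fn.strip_ren : ∀ (u : Fn L true) (ρ θ : ℕ → ℕ), u.LamFree →
    (u.ren ρ θ).strip = u.strip.ren ρ θ
  | .var _, _, _, _ => rfl
  | .cst _ _, _, _, _ => rfl
  | .lam _ _, _, _, H => H.elim
end

open Classical in
/-- The translation of an equation: itself if it does not contain λ, otherwise the formula that the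
two sides have a common value. -/
noncomputable def trEq (s t : Tm L true) : Fm L false :=
  if s.LamFree ∧ t.LamFree then .eq s.strip t.strip else .ex0 (.and s.graph t.graph)

/-- The translation of formulas. -/
noncomputable def Fm.tr : Fm L true → Fm L false
  | .eq s t => trEq s t
  | .imp A B => .imp A.tr B.tr
  | .and A B => .and A.tr B.tr
  | .or A B => .or A.tr B.tr
  | .neg A => .neg A.tr
  | .all0 A => .all0 A.tr
  | .ex0 A => .ex0 A.tr
  | .all1 A => .all1 A.tr
  | .ex1 A => .ex1 A.tr

theorem Fm.tr_emb (A : Fm L false) : A.emb.tr = A := by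
  induction A <;> simp_all [Fm.emb, Fm.tr, trEq, Tm.lamFree_emb, Tm.strip_emb]

theorem Fm.tr_ren (A : Fm L true) : ∀ ρ θ : ℕ → ℕ, (A.ren ρ θ).tr = A.tr.ren ρ θ := by
  induction A with
  | eq s t =>
    intro ρ θ
    by_cases h : s.LamFree ∧ t.LamFree
    · rw [Fm.ren, Fm.tr, Fm.tr, trEq, trEq, if_pos h, if_pos (by rwa [s.lamFree_ren, t.lamFree_ren]),
        Tm.strip_ren _ _ _ h.1, Tm.strip_ren _ _ _ h.2, Fm.ren]
    · rw [Fm.ren, Fm.tr, Fm.tr, trEq, trEq, if_neg h, if_neg (by rwa [s.lamFree_ren, t.lamFree_ren]),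
        Tm.graph_ren, Tm.graph_ren]
      simp only [Fm.ren]
  | _ => intros; simp_all [Fm.ren, Fm.tr]

section tr
variable {Ax : Fm L false → Prop} (S : Base Ax)
include S

/-- The two cases of the translation of an equation agree up to equivalence, since the graph of a λ-free
term `t` is equivalent to t = w. -/
theorem trEq_iff {s t : Tm L true} {Γ : List (Fm L false)} {σ : ℕ → Tm L false}
    {τ : ℕ → Fn L false} :
    Deriv Ax Γ ((trEq s t).sub σ τ) ↔ Deriv Ax Γ ((Fm.ex0 (.and s.graph t.graph)).sub σ τ) := by
  unfold trEq
  split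
  · next h =>
    have hs := fun {Γ σ τ w} => ev_emb_iff S s.strip (Γ := Γ) (σ := σ) (τ := τ) (w := w)
    have ht := fun {Γ σ τ w} => ev_emb_iff S t.strip (Γ := Γ) (σ := σ) (τ := τ) (w := w)
    rw [Tm.emb_strip _ h.1] at hs
    rw [Tm.emb_strip _ h.2] at ht
    refine ⟨fun H => .envEx0I (t.strip.sub σ τ) (.andI (hs.2 H) (ht.2 (S.refl _ _))), fun H => ?_⟩
    refine Deriv.envEx0E H fun Δ ρ θ w e H => ?_
    have := S.trans (hs.1 H.andE1) (S.symm (ht.1 H.andE2))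
    rw [Fm.sub_ren]
    exact this
  · rfl

theorem trEq_intro {s t : Tm L true} {Γ : List (Fm L false)} {σ : ℕ → Tm L false}
    {τ : ℕ → Fn L false} {w : Tm L false} (h : Ev Ax Γ σ τ s w) (h' : Ev Ax Γ σ τ t w) :
    Deriv Ax Γ ((trEq s t).sub σ τ) := (trEq_iff S).2 (.envEx0I w (.andI h h'))

theorem trEq_elim {s t : Tm L true} {Γ : List (Fm L false)} {σ : ℕ → Tm L false}
    {τ : ℕ → Fn L false} {C : Fm L false} (h : Deriv Ax Γ ((trEq s t).sub σ τ))
    (H : ∀ Δ ρ θ w, Ext ρ θ Γ Δ → Ev Ax Δ (fun n => (σ n).ren ρ θ) (fun n => (τ n).ren ρ θ) s w →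
      Ev Ax Δ (fun n => (σ n).ren ρ θ) (fun n => (τ n).ren ρ θ) t w → Deriv Ax Δ (C.ren ρ θ)) :
    Deriv Ax Γ C :=
  Deriv.envEx0E ((trEq_iff S).1 h) fun Δ ρ θ w e h => H Δ ρ θ w e h.andE1 h.andE2

omit S in
theorem evF_upF (S : Base Ax) {Γ Δ : List (Fm L false)} {ρ : ℕ → Tm L false}
    {θ θ' : ℕ → Fn L false} {τ : ℕ → Fn L true} {r q : ℕ → ℕ}
    (hτ : ∀ n, EvF Ax Γ ρ θ (τ n) (θ' n)) (e : Ext r q Γ Δ) (α : Fn L false) (n : ℕ) :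
    EvF Ax Δ (fun n => (ρ n).ren r q) (scons α fun n => (θ n).ren r q)
      (upF τ n) (scons α (fun n => (θ' n).ren r q) n) := by
  cases n with
  | zero => exact evF_var.2 (S.feq_refl _)
  | succ n => rw [upF_succ, evF_ren]; exact (hτ n).mono e

/-- Substitution lemma for the translation. -/
theorem tr_sub (A : Fm L true) : ∀ {Γ : List (Fm L false)} {ρ ρ' : ℕ → Tm L false}
    {θ θ' : ℕ → Fn L false} {σ : ℕ → Tm L true} {τ : ℕ → Fn L true},
    (∀ n, Ev Ax Γ ρ θ (σ n) (ρ' n)) → (∀ n, EvF Ax Γ ρ θ (τ n) (θ' n)) →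
    Deriv Ax Γ (((A.sub σ τ).tr.sub ρ θ).iff (A.tr.sub ρ' θ')) := by
  induction A with
  | eq s t =>
    intro Γ ρ ρ' θ θ' σ τ hσ hτ
    refine .iffI ?_ ?_
    · refine trEq_elim S .head fun Δ r q w e h1 h2 => ?_
      have e' : Ext r q Γ Δ := fun B hB => e B (List.mem_cons_of_mem _ hB)
      rw [Fm.sub_ren]
      exact trEq_intro S
        ((ev_sub S s (fun n => (hσ n).mono e') fun n => (hτ n).mono e').1 h1)
        ((ev_sub S t (fun n => (hσ n).mono e') fun n => (hτ n).mono e').1 h2)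
    · refine trEq_elim S .head fun Δ r q w e h1 h2 => ?_
      have e' : Ext r q Γ Δ := fun B hB => e B (List.mem_cons_of_mem _ hB)
      rw [Fm.sub_ren]
      exact trEq_intro S
        ((ev_sub S s (fun n => (hσ n).mono e') fun n => (hτ n).mono e').2 h1)
        ((ev_sub S t (fun n => (hσ n).mono e') fun n => (hτ n).mono e').2 h2)
  | imp A B ihA ihB => intro Γ ρ ρ' θ θ' σ τ hσ hτ; exact .iff_imp (ihA hσ hτ) (ihB hσ hτ)
  | and A B ihA ihB => intro Γ ρ ρ' θ θ' σ τ hσ hτ; exact .iff_and (ihA hσ hτ) (ihB hσ hτ)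
  | or A B ihA ihB => intro Γ ρ ρ' θ θ' σ τ hσ hτ; exact .iff_or (ihA hσ hτ) (ihB hσ hτ)
  | neg A ih => intro Γ ρ ρ' θ θ' σ τ hσ hτ; exact .iff_neg (ih hσ hτ)
  | all0 A ih | ex0 A ih =>
    intro Γ ρ ρ' θ θ' σ τ hσ hτ
    first | refine .iff_all0 ?_ | refine .iff_ex0 ?_
    refine ih (fun n => ?_) fun n => ?_
    · rw [upN_eq, upN_eq]; exact ev_upN S hσ (.shift0 Γ) _ n
    · rw [evF_ren]; exact (hτ n).mono (.shift0 Γ)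
  | all1 A ih | ex1 A ih =>
    intro Γ ρ ρ' θ θ' σ τ hσ hτ
    first | refine .iff_all1 ?_ | refine .iff_ex1 ?_
    refine ih (fun n => ?_) fun n => ?_
    · rw [ev_ren]; exact (hσ n).mono (.shift1 Γ)
    · rw [upF_eq, upF_eq]; exact evF_upF S hτ (.shift1 Γ) _ n

theorem tr_env_congr (A : Fm L true) {Γ : List (Fm L false)} {ρ ρ' : ℕ → Tm L false}
    {θ θ' : ℕ → Fn L false} (hσ : ∀ n, Deriv Ax Γ (.eq (ρ n) (ρ' n)))
    (hτ : ∀ n, Deriv Ax Γ (feq (θ n) (θ' n))) :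
    Deriv Ax Γ ((A.tr.sub ρ θ).iff (A.tr.sub ρ' θ')) := by
  have := tr_sub S A (Γ := Γ) (ρ := ρ) (ρ' := ρ') (θ := θ) (θ' := θ') (σ := .var) (τ := .var) hσ hτ
  rwa [Fm.sub_var] at this

/-- The translation commutes with the substitution of terms without λ. -/
theorem tr_sub_emb (A : Fm L true) {Γ : List (Fm L false)} {σ : ℕ → Tm L true} {τ : ℕ → Fn L true}
    {σ' : ℕ → Tm L false} {τ' : ℕ → Fn L false} (hσ : ∀ n, σ n = (σ' n).emb)
    (hτ : ∀ n, τ n = (τ' n).emb) : Deriv Ax Γ ((A.sub σ τ).tr.iff (A.tr.sub σ' τ')) := by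
  have := tr_sub S A (Γ := Γ) (ρ := .var) (ρ' := σ') (θ := .var) (θ' := τ') (σ := σ) (τ := τ)
    (fun n => by
      have := ev_emb S (σ' n) (Γ := Γ) (σ := .var) (τ := .var)
      rw [Tm.sub_var] at this
      rwa [hσ n])
    (fun n => by
      have := evF_emb S (τ' n) (Γ := Γ) (σ := .var) (τ := .var)
      rw [Fn.sub_var] at this
      rwa [hτ n])
  rwa [Fm.sub_var] at this

end tr

/-! ### Soundness of the translation -/

section sound
variable {Ax : Fm L false → Prop} (P : Pairing Ax) (S : Base Ax) (hU : ∀ f, P.Uniform f)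
  (hf : ∀ f, L.fArg f ≤ 1)
include P

theorem Pairing.elim {Γ : List (Fm L false)} {C : Fm L false}
    (H : ∀ Δ ρ θ R, Ext ρ θ Γ Δ → Deriv Ax Δ (P.ax R) → Deriv Ax Δ (C.ren ρ θ)) :
    Deriv Ax Γ C := by
  have h := P.exists_ax Γ
  rw [← Fm.sub_var (.ex1 _)] at h
  refine h.envEx1E fun Δ ρ θ R e h => H Δ ρ θ R e ?_
  rwa [P.ax_sub] at h

include S hU hf

omit P S hU hf in
theorem Tm.shift_ren_up_inst0 (t : Tm L b) (ρ θ : ℕ → ℕ) (x : Tm L b) :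
    ((t.ren Nat.succ id).ren (up ρ) θ).inst0 x = t.ren ρ θ := by
  rw [Tm.inst0, Tm.ren_ren, Tm.ren_sub, Tm.ren_eq_sub]
  rfl

theorem ev_total (t : Tm L true) {Γ : List (Fm L false)} {C : Fm L false} (σ : ℕ → Tm L false)
    (τ : ℕ → Fn L false) (H : ∀ Δ ρ θ w, Ext ρ θ Γ Δ →
      Ev Ax Δ (fun n => (σ n).ren ρ θ) (fun n => (τ n).ren ρ θ) t w → Deriv Ax Δ (C.ren ρ θ)) :
    Deriv Ax Γ C := by
  refine P.elim fun Δ ρ θ R e hR => total P S hU hf t Δ R _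
    (fun n => ((σ n).ren ρ θ).ren Nat.succ id) (fun n => (τ n).ren ρ θ) hR fun Δ₁ ρ₁ θ₁ δ e₁ h => ?_
  have := h.apply (.var 0)
  simp only [Tm.shift_ren_up_inst0] at this
  rw [Fm.ren_ren]
  refine H Δ₁ _ _ (.app δ (.var 0)) (e.trans e₁) ?_
  simpa only [Tm.ren_ren, Fn.ren_ren] using this

theorem evF_total (u : Fn L true) {Γ : List (Fm L false)} {C : Fm L false} (σ : ℕ → Tm L false)
    (τ : ℕ → Fn L false) (H : ∀ Δ ρ θ α, Ext ρ θ Γ Δ →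
      EvF Ax Δ (fun n => (σ n).ren ρ θ) (fun n => (τ n).ren ρ θ) u α → Deriv Ax Δ (C.ren ρ θ)) :
    Deriv Ax Γ C := by
  refine P.elim fun Δ ρ θ R e hR => totalF P S hU hf u Δ R _
    (fun n => ((σ n).ren ρ θ).ren Nat.succ id) (fun n => (τ n).ren ρ θ) hR fun Δ₁ ρ₁ θ₁ B e₁ h => ?_
  refine P.exists_sect S.toEqBase B (.var 0) fun Δ₂ ρ₂ θ₂ α e₂ hα => ?_
  have := (Pairing.IsTotF.mono P h e₂).apply P hα
  simp only [Tm.ren_ren (fun n => up _ _), up_comp', Tm.shift_ren_up_inst0] at this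
  rw [Fm.ren_ren, Fm.ren_ren]
  refine H Δ₂ _ _ α ((e.trans e₁).trans e₂) ?_
  simpa only [Tm.ren_ren, Fn.ren_ren] using this

omit P S hU hf in
theorem inst0_eq_sub (A : Fm L b) (t : Tm L b) : A.inst0 t = A.sub (scons t .var) .var := by
  rw [Fm.inst0, single0_eq]

omit P S hU hf in
theorem inst1_eq_sub (A : Fm L b) (t : Fn L b) : A.inst1 t = A.sub .var (scons t .var) := by
  rw [Fm.inst1, single1_eq]

omit P hU hf in
/-- If `w` is the value of `t`, the translation of A(t) is equivalent to that of A at w. -/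
theorem tr_inst0 (A : Fm L true) {t : Tm L true} {Γ : List (Fm L false)} {ρ θ : ℕ → ℕ}
    {w : Tm L false} (h : Ev Ax Γ (fun n => .var (ρ n)) (fun n => .var (θ n)) t w) :
    Deriv Ax Γ (((A.inst0 t).tr.ren ρ θ).iff
      (A.tr.sub (scons w fun n => .var (ρ n)) fun n => .var (θ n))) := by
  rw [inst0_eq_sub, Fm.ren_eq_sub]
  refine tr_sub S A (fun n => ?_) fun n => evF_var.2 (S.feq_refl _)
  cases n with
  | zero => exact h
  | succ n => exact S.refl _ _

omit P hU hf in
/-- If `α` is the value of `u`, the translation of A(u) is equivalent to that of A at α. -/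
theorem tr_inst1 (A : Fm L true) {u : Fn L true} {Γ : List (Fm L false)} {ρ θ : ℕ → ℕ}
    {α : Fn L false} (h : EvF Ax Γ (fun n => .var (ρ n)) (fun n => .var (θ n)) u α) :
    Deriv Ax Γ (((A.inst1 u).tr.ren ρ θ).iff
      (A.tr.sub (fun n => .var (ρ n)) (scons α fun n => .var (θ n)))) := by
  rw [inst1_eq_sub, Fm.ren_eq_sub]
  refine tr_sub S A (fun n => S.refl _ _) fun n => ?_
  cases n with
  | zero => exact h
  | succ n => exact evF_var.2 (S.feq_refl _)

omit P S hU hf in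
theorem map_tr_shift (ρ θ : ℕ → ℕ) (Γ : List (Fm L true)) :
    (Γ.map (Fm.ren ρ θ)).map Fm.tr = (Γ.map Fm.tr).map (Fm.ren ρ θ) := by
  simp only [List.map_map]
  exact List.map_congr_left fun A _ => A.tr_ren ρ θ

/-- The translation preserves deducibility if it preserves the axioms. -/
theorem tr_sound {Ax' : Fm L true → Prop} (hAx : ∀ A, Ax' A → Deriv Ax [] A.tr)
    {Γ : List (Fm L true)} {A : Fm L true} (h : Deriv Ax' Γ A) : Deriv Ax (Γ.map Fm.tr) A.tr := by
  induction h with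
  | ax h => exact (hAx _ h).weaken (List.nil_subset _)
  | hyp h => exact .hyp (List.mem_map_of_mem h)
  | impI _ ih => exact .impI ih
  | impE _ _ ih1 ih2 => exact .impE ih1 ih2
  | andI _ _ ih1 ih2 => exact .andI ih1 ih2
  | andE1 _ ih => exact .andE1 ih
  | andE2 _ ih => exact .andE2 ih
  | orI1 _ ih => exact .orI1 ih
  | orI2 _ ih => exact .orI2 ih
  | orE _ _ _ ih1 ih2 ih3 => exact .orE ih1 ih2 ih3
  | negI _ _ ih1 ih2 => exact .negI ih1 ih2
  | negE _ _ ih1 ih2 => exact .negE ih1 ih2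
  | all0I _ ih => rw [map_tr_shift] at ih; exact .all0I ih
  | all1I _ ih => rw [map_tr_shift] at ih; exact .all1I ih
  | ex0E _ _ ih1 ih2 =>
    rw [List.map_cons, map_tr_shift, Fm.tr_ren] at ih2; exact .ex0E ih1 ih2
  | ex1E _ _ ih1 ih2 =>
    rw [List.map_cons, map_tr_shift, Fm.tr_ren] at ih2; exact .ex1E ih1 ih2
  | @all0E Γ A t _ ih =>
    refine ev_total P S hU hf t .var .var fun Δ ρ θ w e h => (tr_inst0 S A h).iff_mpr ?_
    have := ih.ren e
    rw [Fm.ren_eq_sub] at this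
    exact this.envAll0E w
  | @ex0I Γ A t _ ih =>
    refine ev_total P S hU hf t .var .var fun Δ ρ θ w e h => ?_
    rw [Fm.ren_eq_sub]
    exact .envEx0I w ((tr_inst0 S A h).iff_mp (ih.ren e))
  | @all1E Γ A t _ ih =>
    refine evF_total P S hU hf t .var .var fun Δ ρ θ w e h => (tr_inst1 S A h).iff_mpr ?_
    have := ih.ren e
    rw [Fm.ren_eq_sub] at this
    exact this.envAll1E w
  | @ex1I Γ A t _ ih =>
    refine evF_total P S hU hf t .var .var fun Δ ρ θ w e h => ?_
    rw [Fm.ren_eq_sub]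
    exact .envEx1I w ((tr_inst1 S A h).iff_mp (ih.ren e))

end sound


/-! ### Quantifier-free formulas and their translations -/

theorem Fm.QF.sub : ∀ {A : Fm L b}, A.QF → ∀ σ τ, (A.sub σ τ).QF
  | .eq _ _, _, _, _ => trivial
  | .imp _ _, h, σ, τ => ⟨h.1.sub σ τ, h.2.sub σ τ⟩
  | .and _ _, h, σ, τ => ⟨h.1.sub σ τ, h.2.sub σ τ⟩
  | .or _ _, h, σ, τ => ⟨h.1.sub σ τ, h.2.sub σ τ⟩
  | .neg A, h, σ, τ => Fm.QF.sub (A := A) h σ τ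

theorem Fm.QF.ren {A : Fm L b} (h : A.QF) (ρ θ : ℕ → ℕ) : (A.ren ρ θ).QF := by
  rw [Fm.ren_eq_sub]; exact h.sub _ _

theorem Fm.QF.emb : ∀ {A : Fm L false}, A.QF → A.emb.QF
  | .eq _ _, _ => trivial
  | .imp _ _, h => ⟨h.1.emb, h.2.emb⟩
  | .and _ _, h => ⟨h.1.emb, h.2.emb⟩
  | .or _ _, h => ⟨h.1.emb, h.2.emb⟩
  | .neg A, h => Fm.QF.emb (A := A) h

section rep
variable {Ax : Fm L false → Prop} {Γ Δ : List (Fm L false)} {σ : ℕ → Tm L false}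
  {τ : ℕ → Fn L false} {ρ θ : ℕ → ℕ}

/-- The formula `B` is equivalent to the translation of `A` under the environment `σ`, `τ`, for all
values of x, where x is the number variable 0 in `σ` and in `B`. -/
def IsRep (Ax : Fm L false → Prop) (Γ : List (Fm L false)) (σ : ℕ → Tm L false)
    (τ : ℕ → Fn L false) (A : Fm L true) (B : Fm L false) : Prop :=
  Deriv Ax Γ (.all0 ((A.tr.sub σ fun n => (τ n).ren Nat.succ id).iff B))

theorem IsRep.mono {A : Fm L true} {B : Fm L false} (h : IsRep Ax Γ σ τ A B) (e : Ext ρ θ Γ Δ) :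
    IsRep Ax Δ (fun n => (σ n).ren (up ρ) θ) (fun n => (τ n).ren ρ θ) A (B.ren (up ρ) θ) := by
  have := Deriv.ren h e
  rw [Fm.ren, Fm.iff, Fm.ren, Fm.ren, Fm.ren, Fm.sub_ren] at this
  simpa only [IsRep, Fn.ren_ren, up, id, Fm.iff, Nat.succ_eq_add_one] using this

theorem IsRep.apply {A : Fm L true} {B : Fm L false} (h : IsRep Ax Γ σ τ A B) (x : Tm L false) :
    Deriv Ax Γ ((A.tr.sub (fun n => (σ n).inst0 x) τ).iff (B.inst0 x)) := by
  have := Deriv.all0E x h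
  rw [Fm.inst0, Fm.iff, Fm.sub, Fm.sub, Fm.sub, Fm.sub_sub] at this
  simp only [Fn.ren_sub, single0, Fn.sub_var, id] at this
  exact this

theorem IsRep.unfold {A : Fm L true} {B : Fm L false} (h : IsRep Ax Γ σ τ A B) :
    Deriv Ax (Γ.map (Fm.ren Nat.succ id))
      ((A.tr.sub σ fun n => (τ n).ren Nat.succ id).iff B) := by
  have := (IsRep.mono h (.shift0 Γ)).apply (.var 0)
  simpa only [Pairing.inst0_var0, Fm.ren_up0_inst] using this

theorem IsRep.intro {A : Fm L true} {B : Fm L false} (h : Deriv Ax (Γ.map (Fm.ren Nat.succ id))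
    ((A.tr.sub σ fun n => (τ n).ren Nat.succ id).iff B)) : IsRep Ax Γ σ τ A B := .all0I h

/-- In every environment depending on x there are parameters for which a quantifier-free formula is
equivalent to the translation of `A`. -/
def Representable (P : Pairing Ax) (A : Fm L true) : Prop :=
  ∀ (Γ : List (Fm L false)) (R : Fn L false) (C : Fm L false) (σ : ℕ → Tm L false)
    (τ : ℕ → Fn L false), Deriv Ax Γ (P.ax R) →
    (∀ Δ ρ θ B, Ext ρ θ Γ Δ → B.QF →
      IsRep Ax Δ (fun n => (σ n).ren (up ρ) θ) (fun n => (τ n).ren ρ θ) A B →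
      Deriv Ax Δ (C.ren ρ θ)) → Deriv Ax Γ C

theorem Representable.map₂ {P : Pairing Ax} {A B : Fm L true} {c : Fm L true → Fm L true → Fm L true}
    {c' : Fm L false → Fm L false → Fm L false} (hA : Representable P A) (hB : Representable P B)
    (hQF : ∀ A B : Fm L false, A.QF → B.QF → (c' A B).QF)
    (hc : ∀ {Γ : List (Fm L false)} {σ τ A' B'}, IsRep Ax Γ σ τ A A' → IsRep Ax Γ σ τ B B' →
      IsRep Ax Γ σ τ (c A B) (c' A' B')) : Representable P (c A B) := by
  intro Γ R C σ τ hR H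
  refine hA _ _ _ σ τ hR fun Δ ρ θ A' e hA' h1 => hB _ _ _ (fun n => (σ n).ren (up ρ) θ) (fun n => (τ n).ren ρ θ) (P.ax_mono hR e)
    fun Δ' ρ' θ' B' e' hB' h2 => ?_
  rw [Fm.ren_ren]
  refine H Δ' _ _ (c' (A'.ren (up ρ') θ') B') (e.trans e') (hQF _ _ (hA'.ren _ _) hB') ?_
  simpa only [Tm.ren_ren, Fn.ren_ren, up_comp'] using hc (h1.mono e') h2

variable (P : Pairing Ax) (S : Base Ax) (hU : ∀ f, P.Uniform f) (hf : ∀ f, L.fArg f ≤ 1)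
include S hU hf

/-- Quantifier-free formulas are representable: the parameters name the functions that the terms
define. -/
theorem representable (A : Fm L true) : A.QF → Representable P A := by
  induction A with
  | eq s t =>
    intro _ Γ R C σ τ hR H
    refine total P S hU hf s Γ R C σ τ hR fun Δ ρ θ γ e h1 => total P S hU hf t Δ _ _
      (fun n => (σ n).ren (up ρ) θ) (fun n => (τ n).ren ρ θ)
      (P.ax_mono hR e) fun Δ' ρ' θ' δ e' h2 => ?_
    rw [Fm.ren_ren]
    refine H Δ' _ _ (.eq (.app ((γ.ren ρ' θ').ren Nat.succ id) (.var 0))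
      (.app (δ.ren Nat.succ id) (.var 0))) (e.trans e') trivial (.intro (.iffI ?_ ?_))
    · refine trEq_elim S .head fun Δ₁ ρ₁ θ₁ w e₁ h3 h4 => ?_
      have e₂ : Ext ρ₁ θ₁ (Δ'.map (Fm.ren Nat.succ id)) Δ₁ :=
        fun B hB => e₁ B (List.mem_cons_of_mem _ hB)
      have h1' := (h1.mono e').apply_var.mono e₂
      have h2' := h2.apply_var.mono e₂
      simp only [Tm.ren_ren, Fn.ren_ren, up_comp', Tm.ren, Fm.ren] at h1' h2' h3 h4 ⊢
      exact S.trans (Ev.uniq S _ h1' h3) (Ev.uniq S _ h4 h2')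
    · have e₂ : Ext (fun n => n) (fun n => n) (Δ'.map (Fm.ren Nat.succ id))
          (.eq (.app ((γ.ren ρ' θ').ren Nat.succ id) (.var 0))
            (.app (δ.ren Nat.succ id) (.var 0)) :: Δ'.map (Fm.ren Nat.succ id)) :=
        fun B hB => by rw [Fm.ren_id]; exact List.mem_cons_of_mem _ hB
      have h1' := (h1.mono e').apply_var.mono e₂
      have h2' := h2.apply_var.mono e₂
      simp only [Tm.ren_id, Fn.ren_id] at h1' h2'
      simp only [Tm.ren_ren, Fn.ren_ren, up_comp'] at h1' h2' ⊢
      exact trEq_intro S (h1'.resp S .head) h2'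
  | imp A B ihA ihB =>
    intro h
    exact (ihA h.1).map₂ (c' := .imp) (ihB h.2) (fun _ _ h h' => ⟨h, h'⟩)
      fun h h' => .intro (.iff_imp h.unfold h'.unfold)
  | and A B ihA ihB =>
    intro h
    exact (ihA h.1).map₂ (c' := .and) (ihB h.2) (fun _ _ h h' => ⟨h, h'⟩)
      fun h h' => .intro (.iff_and h.unfold h'.unfold)
  | or A B ihA ihB =>
    intro h
    exact (ihA h.1).map₂ (c' := .or) (ihB h.2) (fun _ _ h h' => ⟨h, h'⟩)
      fun h h' => .intro (.iff_or h.unfold h'.unfold)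
  | neg A ih =>
    intro h Γ R C σ τ hR H
    exact ih h _ _ _ σ τ hR fun Δ ρ θ B e hB hr => H Δ ρ θ (.neg B) e hB (.intro (.iff_neg hr.unfold))
  | all0 A ih => exact fun h => h.elim
  | all1 A ih => exact fun h => h.elim
  | ex0 A ih => exact fun h => h.elim
  | ex1 A ih => exact fun h => h.elim

end rep

/-! ### The translations of the axiom schemata -/

section schemata
variable {Ax : Fm L false → Prop} (P : Pairing Ax) (S : Base Ax) (hU : ∀ f, P.Uniform f)
  (hf : ∀ f, L.fArg f ≤ 1)

include S in
/-- The translation of an instance of induction is an instance of induction, up to equivalence, since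
`A(0)` and `A(x′)` are obtained by λ-free substitutions. -/
theorem tr_ind {zero : Tm L false} {succ : Tm L false → Tm L false} {succ' : Tm L true → Tm L true}
    (hs : succ' (.var 0) = (succ (.var 0)).emb) (hI : ∀ A, Ind zero succ A → Deriv Ax [] A)
    {A : Fm L true} (h : Ind zero.emb succ' A) : Deriv Ax [] A.tr := by
  obtain ⟨A⟩ := h
  refine Deriv.iff_mpr (.iff_imp (.iff_and ?_ (.iff_all0 (.iff_imp (.iff_refl _) ?_))) (.iff_refl _))
    (hI _ (.mk A.tr))
  · exact tr_sub_emb S A (fun n => by cases n <;> rfl) fun n => rfl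
  · refine tr_sub_emb S A (fun n => ?_) fun n => rfl
    rcases n with _ | n
    · exact hs
    · rfl

include P S hU hf

/-- By the totality of evaluation, s has a value w and λx.t a value α; then α(w) is a value of both
sides of λ-conversion. -/
theorem tr_lamConv {A : Fm L true} (h : LamConv A) : Deriv Ax [] A.tr := by
  obtain ⟨t, s⟩ := h
  refine ev_total P S hU hf s .var .var fun Δ ρ θ w e hw =>
    evF_total P S hU hf (lam t) (fun n => .var (ρ n)) (fun n => .var (θ n))
      fun Δ' ρ' θ' α e' hα => ?_
  rw [Fm.tr, Fm.ren_ren, Fm.ren_eq_sub]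
  refine trEq_intro S (w := .app α (w.ren ρ' θ')) (.app hα (hw.mono e') (S.refl _ _)) ?_
  rw [Tm.inst0, single0_eq]
  refine (ev_sub S t (ρ' := scons (w.ren ρ' θ') fun n => .var (ρ' (ρ n)))
    (θ' := fun n => .var (θ' (θ n))) (σ := scons s .var) (τ := .var)
    (fun n => ?_) fun n => evF_var.2 (S.feq_refl _)).2 (hα.lam_apply S _)
  cases n with
  | zero => exact hw.mono e'
  | succ n => exact S.refl _ _

/-- The translation of a quantifier-free formula A(x, y) is represented by a λ-free quantifier-free formula
in one variable, read at the pair of x and y; to it QF-AC₀₀ applies. -/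
theorem tr_qfac {A : Fm L true} (h : QFAC A) : Deriv Ax [] A.tr := by
  obtain ⟨A, hA⟩ := h
  refine P.elim fun Δ₀ ρ₀ θ₀ R e₀ hR => .impI ?_
  have hR : Deriv Ax ((Fm.all0 (Fm.ex0 A)).tr.ren ρ₀ θ₀ :: Δ₀) (P.ax R) := hR.weaken_cons
  refine representable P S hU hf A hA _ _ _ (scons (P.p2 (R.ren Nat.succ id) (.var 0))
    (scons (P.p1 (R.ren Nat.succ id) (.var 0)) fun n => .var (ρ₀ n + 1))) (fun n => .var (θ₀ n)) hR
    fun Δ ρ θ B e hB hr => ?_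
  have h0 : Deriv Ax Δ ((Fm.all0 (.ex0 A.tr)).sub (fun n => .var (ρ (ρ₀ n)))
      fun n => .var (θ (θ₀ n))) := by
    have := Deriv.ren (Deriv.head (Ax := Ax) (A := (Fm.all0 (Fm.ex0 A)).tr.ren ρ₀ θ₀) (Γ := Δ₀)) e
    rw [Fm.ren_ren, Fm.ren_eq_sub] at this
    exact this
  have hR' := P.ax_mono hR e
  -- the representing formula at the pair of x and y
  have key : ∀ Δ' ρ' θ' x y, Ext ρ' θ' Δ Δ' → Deriv Ax Δ'
      ((A.tr.sub (scons y (scons x fun n => .var (ρ' (ρ (ρ₀ n))))) fun n => .var (θ' (θ (θ₀ n)))).iff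
        ((B.sub (scons (P.pr (.var 1) (.var 0)) fun n => .var (n + 2)) .var).sub
          (scons y (scons x fun n => .var (ρ' n))) fun n => .var (θ' n))) := by
    intro Δ' ρ' θ' x y e'
    have h1 := (hr.mono e').apply (P.pr x y)
    have h2 : (B.ren (up ρ') θ').inst0 (P.pr x y) =
        (B.sub (scons (P.pr (.var 1) (.var 0)) fun n => .var (n + 2)) .var).sub
          (scons y (scons x fun n => .var (ρ' n))) fun n => .var (θ' n) := by
      rw [Fm.inst0, Fm.ren_sub, Fm.sub_sub]
      congr 1
      funext n; cases n
      · simp only [up, single0, scons, P.pr_sub, Tm.sub]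
      · rfl
    rw [h2] at h1
    refine .iff_trans (tr_env_congr S A (fun n => ?_) fun n => S.feq_refl _) h1
    have hR'' := P.ax_mono hR' e'
    rcases n with _ | _ | n
    · simp only [scons, Tm.inst0, P.p2_sub, Tm.ren_eq_sub (P.p2 _ _),
        Fn.ren_sub, Tm.sub, up, single0, id, Fn.sub_sub, Fn.sub]
      refine S.symm ?_
      have := P.p2_pr hR'' x y
      simpa only [Fn.ren_eq_sub, Fn.sub_sub, Fn.sub, Tm.sub] using this
    · simp only [scons, Tm.inst0, P.p1_sub, Tm.ren_eq_sub (P.p1 _ _),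
        Fn.ren_sub, Tm.sub, up, single0, id, Fn.sub_sub, Fn.sub]
      refine S.symm ?_
      have := P.p1_pr hR'' x y
      simpa only [Fn.ren_eq_sub, Fn.sub_sub, Fn.sub, Tm.sub] using this
    · exact S.refl _ _
  refine S.choice (A := B.sub (scons (P.pr (.var 1) (.var 0)) fun n => .var (n + 2)) .var)
    (hB.sub _ _) (σ := .var) (τ := .var) ?_ fun Δ₁ ρ₁ θ₁ α e₁ hα => ?_
  · refine .envAll0I fun Δ₁ ρ₁ θ₁ x e₁ => ?_
    have h1 := h0.ren e₁
    rw [Fm.sub_ren] at h1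
    refine (h1.envAll0E x).envEx0E fun Δ₂ ρ₂ θ₂ y e₂ h2 => ?_
    rw [Fm.sub_ren]
    refine .envEx0I y ?_
    have h3 := key Δ₂ _ _ (x.ren ρ₂ θ₂) y (e₁.trans e₂)
    simp only [scons_apply (fun t : Tm L false => t.ren ρ₂ θ₂)] at h2 ⊢
    exact h3.iff_mp h2
  · have hC : (((Fm.ex1 (.all0 (A.sub (fun | 0 => .app (.var 0) (.var 0) | n + 1 => .var n)
          fun n => .var (n + 1)))).tr.ren ρ₀ θ₀).ren ρ θ).ren ρ₁ θ₁ =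
        (Fm.ex1 (.all0 (A.sub (fun | 0 => .app (.var 0) (.var 0) | n + 1 => .var n)
          fun n => .var (n + 1)).tr)).sub (fun n => .var (ρ₁ (ρ (ρ₀ n))))
          fun n => .var (θ₁ (θ (θ₀ n))) := by
      rw [Fm.ren_ren, Fm.ren_ren, Fm.ren_eq_sub]; rfl
    refine hC ▸ Deriv.envEx1I α (.envAll0I fun Δ₂ ρ₂ θ₂ x e₂ => ?_)
    have h2 := (key Δ₂ _ _ x (.app (α.ren ρ₂ θ₂) x) (e₁.trans e₂)).iff_mpr (hα Δ₂ ρ₂ θ₂ x e₂)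
    refine (tr_sub S A (fun n => ?_) fun n => ?_).iff_mpr h2
    · rcases n with _ | _ | n
      · exact Ev.app (evF_var.2 (S.feq_refl _)) (ev_var.2 (S.refl _ _)) (S.refl _ _)
      · exact S.refl _ _
      · exact S.refl _ _
    · exact evF_var.2 (S.feq_refl _)

omit P S hU hf in
/-- The defining equation `s = t` without λ, under an environment. -/
theorem eq_of_ev {Γ : List (Fm L false)} {s : Tm L false} {t : Tm L true} {σ : ℕ → Tm L false}
    {τ : ℕ → Fn L false} {w : Tm L false}
    (h : Deriv Ax [] (.all0 (.imp t.graph (.eq (s.ren Nat.succ id) (.var 0)))))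
    (hw : Ev Ax Γ σ τ t w) : Deriv Ax Γ (.eq (s.sub σ τ) w) := by
  have h2 := (((h.sub_nil σ τ).weaken (List.nil_subset Γ)).envAll0E w).impE hw
  simpa only [Fm.sub, Tm.ren_sub, Tm.sub, scons, id] using h2

/-- The translation of an equation between a λ-free term and `t`, from its expression by means of
the graph of `t`. -/
theorem tr_def {s : Tm L false} {t : Tm L true}
    (h : Deriv Ax [] (.all0 (.imp t.graph (.eq (s.ren Nat.succ id) (.var 0))))) :
    Deriv Ax [] (Fm.eq s.emb t).tr := by
  refine ev_total P S hU hf t .var .var fun Δ ρ θ w e hw => ?_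
  rw [Fm.tr, Fm.ren_eq_sub]
  refine trEq_intro S ((ev_emb_iff S s).2 ?_) hw
  exact eq_of_ev h hw

end schemata


/-! ### The inclusion of the language without λ and deducibility -/

mutual
theorem Tm.emb_ren : ∀ (t : Tm L false) (ρ θ : ℕ → ℕ), (t.ren ρ θ).emb = t.emb.ren ρ θ
  | .var _, _, _ => rfl
  | .cst f h ts us, ρ, θ => by
    simp only [Tm.emb, Tm.ren, Tm.cst.injEq, heq_eq_eq, true_and]
    exact ⟨funext fun i => (ts i).emb_ren ρ θ, funext fun j => (us j).emb_ren ρ θ⟩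
  | .app u t, ρ, θ => by simp only [Tm.emb, Tm.ren, u.emb_ren, t.emb_ren]
theorem Fn.emb_ren : ∀ (u : Fn L false) (ρ θ : ℕ → ℕ), (u.ren ρ θ).emb = u.emb.ren ρ θ
  | .var _, _, _ => rfl
  | .cst _ _, _, _ => rfl
  | .lam h _, _, _ => nomatch h
end

mutual
theorem Tm.emb_sub : ∀ (t : Tm L false) (σ : ℕ → Tm L false) (τ : ℕ → Fn L false),
    (t.sub σ τ).emb = t.emb.sub (fun n => (σ n).emb) fun n => (τ n).emb
  | .var _, _, _ => rfl
  | .cst f h ts us, σ, τ => by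
    simp only [Tm.emb, Tm.sub, Tm.cst.injEq, heq_eq_eq, true_and]
    exact ⟨funext fun i => (ts i).emb_sub σ τ, funext fun j => (us j).emb_sub σ τ⟩
  | .app u t, σ, τ => by simp only [Tm.emb, Tm.sub, u.emb_sub, t.emb_sub]
theorem Fn.emb_sub : ∀ (u : Fn L false) (σ : ℕ → Tm L false) (τ : ℕ → Fn L false),
    (u.sub σ τ).emb = u.emb.sub (fun n => (σ n).emb) fun n => (τ n).emb
  | .var _, _, _ => rfl
  | .cst _ _, _, _ => rfl
  | .lam h _, _, _ => nomatch h
end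

theorem Fm.emb_ren (A : Fm L false) : ∀ ρ θ : ℕ → ℕ, (A.ren ρ θ).emb = A.emb.ren ρ θ := by
  induction A <;> intros <;> simp_all [Fm.emb, Fm.ren, Tm.emb_ren]

theorem upN_emb (σ : ℕ → Tm L false) : (fun n => (upN σ n).emb) = upN fun n => (σ n).emb := by
  funext n; cases n <;> simp [upN, Tm.emb, Tm.emb_ren]

theorem upF_emb (τ : ℕ → Fn L false) : (fun n => (upF τ n).emb) = upF fun n => (τ n).emb := by
  funext n; cases n <;> simp [upF, Fn.emb, Fn.emb_ren]

theorem Fm.emb_sub (A : Fm L false) : ∀ (σ : ℕ → Tm L false) (τ : ℕ → Fn L false),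
    (A.sub σ τ).emb = A.emb.sub (fun n => (σ n).emb) fun n => (τ n).emb := by
  induction A <;> intros <;>
    simp_all [Fm.emb, Fm.sub, Tm.emb_sub, upN_emb, upF_emb, Tm.emb_ren, Fn.emb_ren]

theorem Fm.emb_inst0 (A : Fm L false) (t : Tm L false) : (A.inst0 t).emb = A.emb.inst0 t.emb := by
  rw [Fm.inst0, Fm.emb_sub, Fm.inst0, single0_eq, scons_apply Tm.emb, single0_eq]; rfl

theorem Fm.emb_inst1 (A : Fm L false) (u : Fn L false) : (A.inst1 u).emb = A.emb.inst1 u.emb := by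
  rw [Fm.inst1, Fm.emb_sub, Fm.inst1, single1_eq, scons_apply Fn.emb, single1_eq]; rfl

theorem exs0_emb (A : Fm L false) : ∀ k, (exs0 k A).emb = exs0 k A.emb
  | 0 => rfl
  | k + 1 => by rw [exs0, Fm.emb, exs0_emb A k, exs0]

theorem exs1_emb (A : Fm L false) : ∀ k, (exs1 k A).emb = exs1 k A.emb
  | 0 => rfl
  | k + 1 => by rw [exs1, Fm.emb, exs1_emb A k, exs1]

theorem foldr_and_emb (B : Fm L false) : ∀ l : List (Fm L false),
    (l.foldr .and B).emb = (l.map Fm.emb).foldr .and B.emb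
  | [] => rfl
  | A :: l => by rw [List.foldr, Fm.emb, foldr_and_emb B l]; rfl

theorem map_emb_ren (ρ θ : ℕ → ℕ) (Γ : List (Fm L false)) :
    (Γ.map (Fm.ren ρ θ)).map Fm.emb = (Γ.map Fm.emb).map (Fm.ren ρ θ) := by
  simp only [List.map_map]
  exact List.map_congr_left fun A _ => A.emb_ren ρ θ

/-- The inclusion preserves deducibility if it preserves the axioms. -/
theorem Deriv.emb {Ax : Fm L false → Prop} {Ax' : Fm L true → Prop}
    (hAx : ∀ A, Ax A → Deriv Ax' [] A.emb) {Γ : List (Fm L false)} {A : Fm L false}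
    (h : Deriv Ax Γ A) : Deriv Ax' (Γ.map Fm.emb) A.emb := by
  induction h with
  | ax h => exact (hAx _ h).weaken (List.nil_subset _)
  | hyp h => exact .hyp (List.mem_map_of_mem h)
  | impI _ ih => exact .impI ih
  | impE _ _ ih1 ih2 => exact .impE ih1 ih2
  | andI _ _ ih1 ih2 => exact .andI ih1 ih2
  | andE1 _ ih => exact .andE1 ih
  | andE2 _ ih => exact .andE2 ih
  | orI1 _ ih => exact .orI1 ih
  | orI2 _ ih => exact .orI2 ih
  | orE _ _ _ ih1 ih2 ih3 => exact .orE ih1 ih2 ih3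
  | negI _ _ ih1 ih2 => exact .negI ih1 ih2
  | negE _ _ ih1 ih2 => exact .negE ih1 ih2
  | all0I _ ih => rw [map_emb_ren] at ih; exact .all0I ih
  | all1I _ ih => rw [map_emb_ren] at ih; exact .all1I ih
  | ex0E _ _ ih1 ih2 => rw [List.map_cons, map_emb_ren, Fm.emb_ren] at ih2; exact .ex0E ih1 ih2
  | ex1E _ _ ih1 ih2 => rw [List.map_cons, map_emb_ren, Fm.emb_ren] at ih2; exact .ex1E ih1 ih2
  | all0E t _ ih => rw [Fm.emb_inst0]; exact .all0E _ ih
  | all1E t _ ih => rw [Fm.emb_inst1]; exact .all1E _ ih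
  | ex0I t _ ih => rw [Fm.emb_inst0] at ih; exact .ex0I _ ih
  | ex1I t _ ih => rw [Fm.emb_inst1] at ih; exact .ex1I _ ih

theorem Ind.emb {zero : Tm L false} {succ : Tm L false → Tm L false}
    {succ' : Tm L true → Tm L true} (hs : succ' (.var 0) = (succ (.var 0)).emb) {A : Fm L false}
    (h : Ind zero succ A) : Ind zero.emb succ' A.emb := by
  obtain ⟨A⟩ := h
  simp only [Fm.emb, Fm.emb_inst0, Fm.emb_sub]
  convert Ind.mk (zero := zero.emb) (succ := succ') A.emb using 6
  · funext n; cases n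
    · exact hs.symm
    · rfl
  · rfl

theorem QFAC.emb {A : Fm L false} (h : QFAC A) : QFAC A.emb := by
  obtain ⟨A, hA⟩ := h
  simp only [Fm.emb, Fm.emb_sub]
  convert QFAC.mk A.emb hA.emb using 5
  · funext n; cases n <;> rfl
  · rfl

/-! ### Graphs in the presence of λ-conversion -/

section graph
variable {Ax : Fm L true → Prop} {Γ : List (Fm L true)}

theorem cst_body_emb_iff {f : L.Con} {h : ¬ L.Unary f} {ts : Fin (L.nArg f) → Tm L true}
    {us : Fin (L.fArg f) → Fn L true} {σ : ℕ → Tm L true} {τ : ℕ → Fn L true} {w : Tm L true}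
    (a : ℕ → Tm L true) (β : ℕ → Fn L true) :
    Deriv Ax Γ (((List.ofFn fun i => (ts i).graph.ren (slot i (L.nArg f + 1))
          (· + L.fArg f)).foldr Fm.and
          ((List.ofFn fun j => (us j).graph.ren (· + (L.nArg f + 1)) (slot j (L.fArg f))).foldr Fm.and
            (Fm.eq (.cst f h (fun i => .var i) (fun j => .var j)) (.var (L.nArg f))))).emb.sub
              (fapp (L.nArg f) a (scons w σ)) (fapp (L.fArg f) β τ)) ↔
      (∀ i, Deriv Ax Γ ((ts i).graph.emb.sub (scons (a i) σ) τ)) ∧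
      (∀ j, Deriv Ax Γ ((us j).graph.emb.sub σ (scons (β j) τ))) ∧
      Deriv Ax Γ (.eq (.cst f h (fun i => a i) (fun j => β j)) w) := by
  rw [foldr_and_emb, foldr_and_emb, List.map_ofFn, List.map_ofFn, deriv_foldr_and, deriv_foldr_and,
    List.forall_mem_ofFn_iff, List.forall_mem_ofFn_iff]
  refine and_congr (forall_congr' fun i => ?_) (and_congr (forall_congr' fun j => ?_) ?_)
  · rw [Function.comp_apply, Fm.emb_ren, Fm.ren_sub, slot_scons _ _ i.2, add_fapp]
  · rw [Function.comp_apply, Fm.emb_ren, Fm.ren_sub, slot_scons' _ _ j.2, add_fapp_scons]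
  · simp [Fm.emb, Tm.emb, Fn.emb, Fm.sub, Tm.sub, Fn.sub, fapp, scons]

variable (S : Base Ax) (hL : ∀ A, LamConv A → Deriv Ax [] A)
include S hL

omit S in
/-- λ-conversion with a simultaneous substitution for the other variables. -/
theorem beta {h : true = true} (t : Tm L true) (σ : ℕ → Tm L true) (τ : ℕ → Fn L true)
    (a : Tm L true) :
    Deriv Ax Γ (.eq (.app ((Fn.lam h t).sub σ τ) a) (t.sub (scons a σ) τ)) := by
  have h1 := (hL _ (.mk (t.sub (upN σ) fun n => (τ n).ren Nat.succ id) a)).weaken (List.nil_subset Γ)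
  rw [Tm.inst0, Tm.sub_sub, upN_single0] at h1
  simp only [Fn.ren_sub, single0, Fn.sub_var, id] at h1
  exact h1

mutual
/-- With λ-conversion, the graph of `t` says that the value is equal to `t`. -/
theorem graph_emb_iff : ∀ (t : Tm L true) {Γ : List (Fm L true)} {σ : ℕ → Tm L true}
    {τ : ℕ → Fn L true} {w : Tm L true},
    Deriv Ax Γ (t.graph.emb.sub (scons w σ) τ) ↔ Deriv Ax Γ (.eq (t.sub σ τ) w)
  | .var n, _, _, _, _ => Iff.rfl
  | .cst f hf ts us, Γ, σ, τ, w => by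
    constructor
    · intro hv
      rw [Tm.graph, exs0_emb, exs1_emb] at hv
      refine hv.envExs0E fun Δ ρ θ a e hv => hv.envExs1E fun Δ' ρ' θ' β e' hv => ?_
      have h1 : (fun n => (fapp (L.nArg f) a (fun n => (scons w σ n).ren ρ θ) n).ren ρ' θ') =
          fapp (L.nArg f) (fun n => (a n).ren ρ' θ')
            (scons (w.ren (fun n => ρ' (ρ n)) (fun n => θ' (θ n)))
              fun n => (σ n).ren (fun n => ρ' (ρ n)) (fun n => θ' (θ n))) := by
        funext n
        simp only [fapp]
        split
        · rfl
        · simp only [Tm.ren_ren]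
          cases n - L.nArg f <;> rfl
      rw [h1, cst_body_emb_iff] at hv
      obtain ⟨h2, h3, h4⟩ := hv
      rw [Fm.ren_ren, Fm.ren, Tm.sub_ren]
      simp only [Fn.ren_ren] at h2 h3
      exact S.trans (S.cst (fun i => (graph_emb_iff (ts i)).1 (h2 i))
        fun j => (graphF_emb_iff (us j)).1 (h3 j)) h4
    · intro hv
      rw [Tm.graph, exs0_emb, exs1_emb]
      refine .envExs0I (fun n => if hn : n < L.nArg f then (ts ⟨n, hn⟩).sub σ τ else .var 0)
        (.envExs1I (fun n => if hn : n < L.fArg f then (us ⟨n, hn⟩).sub σ τ else .var 0) ?_)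
      rw [cst_body_emb_iff]
      refine ⟨fun i => ?_, fun j => ?_, by simpa [Tm.sub] using hv⟩
      · simp only [Fin.is_lt, dif_pos]; exact (graph_emb_iff (ts i)).2 (S.refl _ _)
      · simp only [Fin.is_lt, dif_pos]; exact (graphF_emb_iff (us j)).2 (S.feq_refl _)
  | .app u t, Γ, σ, τ, w => by
    constructor
    · intro hv
      rw [Tm.graph] at hv
      refine Deriv.envEx0E hv fun Δ ρ θ a e hv => Deriv.envEx1E hv fun Δ' ρ' θ' α e' hv => ?_
      rw [Fm.ren_ren, Fm.ren, Tm.sub_ren]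
      have h1 := hv.andE1
      have h2 := hv.andE2.andE1
      have h3 := hv.andE2.andE2
      rw [Fm.emb_ren, Fm.ren_sub] at h1 h2
      refine S.trans (s := .app α (a.ren ρ' θ')) (S.app_congr ((graphF_emb_iff u).1 ?_)
        ((graph_emb_iff t).1 ?_)) ?_
      · convert h1 using 2
        · funext n; simp [scons, Tm.ren_ren]
        · funext n; cases n <;> simp [scons, Fn.ren_ren]
      · convert h2 using 2
        · funext n; cases n <;> simp [scons, slot, Tm.ren_ren]
        · simp [scons, Fn.ren_ren]
      · simpa [Fm.emb, Tm.emb, Fn.emb, Fm.sub, Tm.sub, Fn.sub, scons, Tm.ren_ren] using h3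
    · intro hv
      rw [Tm.graph]
      refine .envEx0I (t.sub σ τ) (.envEx1I (u.sub σ τ) (.andI ?_ (.andI ?_ hv)))
      · rw [Fm.emb_ren, Fm.ren_sub]; exact (graphF_emb_iff u).2 (S.feq_refl _)
      · rw [Fm.emb_ren, Fm.ren_sub]
        convert (graph_emb_iff t).2 (S.refl _ _) using 2
        funext n; cases n <;> rfl
/-- With λ-conversion, the graph of `u` says that the value is extensionally equal to `u`. -/
theorem graphF_emb_iff : ∀ (u : Fn L true) {Γ : List (Fm L true)} {σ : ℕ → Tm L true}
    {τ : ℕ → Fn L true} {α : Fn L true},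
    Deriv Ax Γ (u.graph.emb.sub σ (scons α τ)) ↔ Deriv Ax Γ (feq (u.sub σ τ) α)
  | .var n, _, _, _, _ => Iff.rfl
  | .cst f h, _, _, _, _ => Iff.rfl
  | .lam h t, Γ, σ, τ, α => by
    constructor
    · intro hv
      refine EqBase.feqI fun Δ ρ θ a e => ?_
      have hv := hv.ren e
      rw [Fm.sub_ren, Fn.graph] at hv
      refine (Deriv.envAll0E hv a).envEx0E fun Δ' ρ' θ' y e' hv => ?_
      have h1 := hv.andE1
      rw [Fm.emb_ren, Fm.ren_sub] at h1
      rw [Fm.ren, Tm.ren, Tm.ren, Fn.sub_ren, Fn.sub_ren]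
      refine S.trans (beta hL t _ _ _) (S.trans (s := y) ((graph_emb_iff t).1 ?_) ?_)
      · convert h1 using 2
        · funext n; rcases n with _ | _ | n <;> rfl
        · rfl
      · exact hv.andE2
    · intro hv
      rw [Fn.graph]
      refine .envAll0I fun Δ ρ θ a e => .envEx0I
        (t.sub (scons a fun n => (σ n).ren ρ θ) fun n => (τ n).ren ρ θ) (.andI ?_ ?_)
      · rw [Fm.emb_ren, Fm.ren_sub]
        exact (graph_emb_iff t).2 (S.refl _ _)
      · have h1 := EqBase.feq_app (EqBase.feq_mono hv e) a
        rw [Fn.sub_ren] at h1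
        exact S.trans (S.symm (beta hL t _ _ _)) h1
end

/-- With λ-conversion, the translation of a formula is equivalent to it. -/
theorem tr_equiv (A : Fm L true) : ∀ {Γ : List (Fm L true)}, Deriv Ax Γ (A.tr.emb.iff A) := by
  induction A with
  | eq s t =>
    intro Γ
    by_cases h : s.LamFree ∧ t.LamFree
    · rw [Fm.tr, trEq, if_pos h, Fm.emb, Tm.emb_strip _ h.1, Tm.emb_strip _ h.2]
      exact .iff_refl _
    · rw [Fm.tr, trEq, if_neg h]
      refine .iffI ?_ ?_
      · have h1 := Deriv.head (Ax := Ax) (A := (Fm.ex0 (.and s.graph t.graph)).emb) (Γ := Γ)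
        have h1 : Deriv Ax ((Fm.ex0 (.and s.graph t.graph)).emb :: Γ)
            ((Fm.ex0 (.and s.graph t.graph)).emb.sub .var .var) := by rwa [Fm.sub_var]
        refine Deriv.envEx0E h1 fun Δ ρ θ w e h => ?_
        have h2 := S.trans ((graph_emb_iff S hL s).1 h.andE1)
          (S.symm ((graph_emb_iff S hL t).1 h.andE2))
        rw [Fm.ren, Tm.ren_eq_sub, Tm.ren_eq_sub]
        exact h2
      · refine Fm.sub_var (Fm.emb (.ex0 (.and s.graph t.graph))) ▸ Deriv.envEx0I t (.andI ((graph_emb_iff S hL s).2 ?_)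
          ((graph_emb_iff S hL t).2 (S.refl _ _ |> fun h => by rwa [Tm.sub_var])))
        rw [Tm.sub_var]
        exact .head
  | imp A B ihA ihB => exact .iff_imp ihA ihB
  | and A B ihA ihB => exact .iff_and ihA ihB
  | or A B ihA ihB => exact .iff_or ihA ihB
  | neg A ih => exact .iff_neg ih
  | all0 A ih => exact .iff_all0 ih
  | ex0 A ih => exact .iff_ex0 ih
  | all1 A ih => exact .iff_all1 ih
  | ex1 A ih => exact .iff_ex1 ih

/-- With λ-conversion, the equation s = t implies its expression by means of the graph of `t`. -/
theorem def_emb {s : Tm L false} {t : Tm L true} (h : Deriv Ax [] (.eq s.emb t)) :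
    Deriv Ax [] (Fm.all0 (.imp t.graph (.eq (s.ren Nat.succ id) (.var 0)))).emb := by
  refine .all0I (.impI ?_)
  have h1 : Deriv Ax [t.graph.emb] (t.graph.emb.sub (scons (.var 0) fun n => .var (n + 1)) .var) := by
    have : (scons (.var 0) fun n => .var (n + 1) : ℕ → Tm L true) = .var := by
      funext n; cases n <;> rfl
    rw [this, Fm.sub_var]
    exact .head
  have h2 := (graph_emb_iff S hL t).1 h1
  have h3 := (h.sub_nil (fun n => .var (n + 1)) .var).weaken (List.nil_subset [t.graph.emb])
  have h4 : (s.ren Nat.succ id).emb = s.emb.sub (fun n => .var (n + 1)) .var := by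
    rw [Tm.emb_ren, Tm.ren_eq_sub]; rfl
  exact S.trans (h4 ▸ h3) h2

end graph

/-- The conditions under which `Fm.tr` makes a system with λ a definitional extension. -/
theorem isDefinitionalExtension {Ax₁ : Fm L false → Prop} {Ax₂ : Fm L true → Prop}
    (P : Pairing Ax₁) (S₁ : Base Ax₁) (hU : ∀ f, P.Uniform f) (hf : ∀ f, L.fArg f ≤ 1)
    (S₂ : Base Ax₂) (hL : ∀ A, LamConv A → Deriv Ax₂ [] A)
    (hemb : ∀ A, Ax₁ A → Deriv Ax₂ [] A.emb) (htr : ∀ A, Ax₂ A → Deriv Ax₁ [] A.tr)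
    (heff : ∃ g : ℕ → ℕ, Computable g ∧ ∀ E : Fm L true, E.tr.code = g E.code) :
    IsDefinitionalExtension Ax₂ Ax₁ :=
  ⟨fun _ _ h => h.emb hemb, Fm.tr, heff, Fm.tr_emb, fun E => tr_equiv S₂ hL E,
    fun _ _ h => tr_sound P S₁ hU hf htr h, fun _ _ => rfl, fun _ _ => rfl, fun _ _ => rfl,
    fun _ => rfl, fun _ => rfl, fun _ => rfl, fun _ => rfl, fun _ => rfl⟩


/-! ### The translation is computable -/

attribute [fun_prop] Primrec
attribute [fun_prop] Primrec.id Primrec.const Primrec.fst Primrec.snd Primrec.comp Primrec.pair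

section primrec
variable {α β σ : Type} [Primcodable α] [Primcodable β] [Primcodable σ]

@[fun_prop]
theorem primrec_natPair {f g : α → ℕ} (hf : Primrec f) (hg : Primrec g) :
    Primrec fun a => Nat.pair (f a) (g a) := Primrec₂.natPair.comp hf hg

@[fun_prop]
theorem primrec_unpair {f : α → ℕ} (hf : Primrec f) : Primrec fun a => (f a).unpair :=
  Primrec.unpair.comp hf

@[fun_prop]
theorem primrec_add {f g : α → ℕ} (hf : Primrec f) (hg : Primrec g) :
    Primrec fun a => f a + g a := Primrec.nat_add.comp hf hg

@[fun_prop]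
theorem primrec_mul {f g : α → ℕ} (hf : Primrec f) (hg : Primrec g) :
    Primrec fun a => f a * g a := Primrec.nat_mul.comp hf hg

@[fun_prop]
theorem primrec_cons {f : α → β} {g : α → List β} (hf : Primrec f) (hg : Primrec g) :
    Primrec fun a => f a :: g a := Primrec.list_cons.comp hf hg

@[fun_prop]
theorem primrec_append {f g : α → List β} (hf : Primrec f) (hg : Primrec g) :
    Primrec fun a => f a ++ g a := Primrec.list_append.comp hf hg

@[fun_prop]
theorem primrec_map {f : α → List β} {g : α → β → σ} (hf : Primrec f)
    (hg : Primrec fun p : α × β => g p.1 p.2) : Primrec fun a => (f a).map (g a) :=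
  Primrec.list_map hf hg

@[fun_prop]
theorem primrec_foldr {f : α → List β} {g : α → σ} {h : α → β → σ → σ} (hf : Primrec f)
    (hg : Primrec g) (hh : Primrec fun p : α × β × σ => h p.1 p.2.1 p.2.2) :
    Primrec fun a => (f a).foldr (h a) (g a) :=
  Primrec.list_foldr (h := fun a p => h a p.1 p.2) hf hg hh

@[fun_prop]
theorem primrec_range {f : α → ℕ} (hf : Primrec f) : Primrec fun a => List.range (f a) :=
  Primrec.list_range.comp hf

@[fun_prop]
theorem primrec_getD {f : α → List ℕ} {g h : α → ℕ} (hf : Primrec f) (hg : Primrec g)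
    (hh : Primrec h) : Primrec fun a => (f a).getD (g a) (h a) :=
  (Primrec.option_getD.comp (Primrec.list_getElem?.comp hf hg) hh).of_eq fun a => by
    simp [List.getD_eq_getElem?_getD]

@[fun_prop]
theorem primrec_iterate {f : α → ℕ} {g : α → σ} {h : σ → σ} (hh : Primrec h) (hf : Primrec f)
    (hg : Primrec g) : Primrec fun a => h^[f a] (g a) :=
  Primrec.nat_iterate hf hg (hh.comp Primrec.snd)

@[fun_prop]
theorem primrec_ite {c d : α → ℕ} {f g : α → σ} (hc : Primrec c) (hd : Primrec d) (hf : Primrec f)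
    (hg : Primrec g) : Primrec fun a => if c a = d a then f a else g a :=
  Primrec.ite (Primrec.eq.comp hc hd) hf hg

/-- Recursion along the subexpression relation on codes: a relation between codes and values that
determines the value from the values for the children is contained in a primitive recursive
function. -/
theorem exists_primrec {R : α → σ → Prop} {ch : α → List α} {h : α → List σ → σ} {rank : α → ℕ}
    (hch : Primrec ch) (hh : Primrec fun p : α × List σ => h p.1 p.2) (hrank : Primrec rank)
    (H : ∀ x v, R x v → ∃ vs, v = h x vs ∧ List.Forall₂ R (ch x) vs ∧
      ∀ y ∈ ch x, rank y < rank x) : ∃ g : α → σ, Primrec g ∧ ∀ x v, R x v → g x = v := by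
  -- only children of smaller rank are used, so that the recursion is well-founded on all inputs
  let l : α → List α := fun x => (ch x).flatMap fun y => if rank y < rank x then [y] else []
  have mem_l : ∀ x y, y ∈ l x → rank y < rank x := by
    intro x y hy
    simp only [l, List.mem_flatMap] at hy
    obtain ⟨z, -, hz⟩ := hy
    split at hz
    · rw [List.mem_singleton] at hz; rwa [hz]
    · simp at hz
  let F : ℕ → α → σ := fun n => n.rec (fun x => h x []) fun _ f x => h x ((l x).map f)
  have F_eq : ∀ n x, rank x < n → F n x = F (rank x + 1) x := by
    intro n
    induction n using Nat.strong_induction_on with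
    | _ n ih =>
      intro x hx
      obtain ⟨m, rfl⟩ : ∃ m, n = m + 1 := ⟨n - 1, by omega⟩
      change h x ((l x).map (F m)) = h x ((l x).map (F (rank x)))
      congr 1
      refine List.map_congr_left fun y hy => ?_
      have := mem_l x y hy
      rw [ih m (by omega) y (by omega)]
      rcases Nat.lt_or_ge (rank x) (m + 1) with h1 | h1
      · rcases Nat.lt_or_ge (rank x) m with h2 | h2
        · rw [ih (rank x) (by omega) y (by omega)]
        · rw [show rank x = m by omega, ih m (by omega) y (by omega)]
      · omega
  refine ⟨fun x => F (rank x + 1) x, ?_, ?_⟩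
  · have hl : Primrec l := Primrec.list_flatMap hch (Primrec.ite (Primrec.nat_lt.comp
      (hrank.comp Primrec.snd) (hrank.comp Primrec.fst)) (by fun_prop) (by fun_prop))
    refine Primrec.nat_omega_rec' (m := rank) (l := l) (g := fun x vs => some (h x vs)) _ hrank hl
      (Primrec.option_some.comp hh) mem_l fun x => ?_
    change some _ = some (h x ((l x).map (F (rank x))))
    congr 2
    exact List.map_congr_left fun y hy => (F_eq _ _ (mem_l x y hy)).symm
  · suffices ∀ n x v, rank x < n → R x v → F (rank x + 1) x = v from
      fun x v => this _ x v (Nat.lt_succ_self _)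
    intro n
    induction n with
    | zero => intro x v hx; omega
    | succ n ih =>
      intro x v hx hR
      obtain ⟨vs, rfl, h1, h2⟩ := H x v hR
      have hl : l x = ch x := by
        have : ∀ l' : List α, (∀ y ∈ l', rank y < rank x) →
            l'.flatMap (fun y => if rank y < rank x then [y] else []) = l' := by
          intro l' hl'
          induction l' with
          | nil => rfl
          | cons y l' ih' =>
            rw [List.flatMap_cons, ih' fun z hz => hl' z (List.mem_cons_of_mem _ hz),
              if_pos (hl' y List.mem_cons_self)]
            rfl
        exact this _ h2
      change h x ((l x).map (F (rank x))) = h x vs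
      rw [hl]
      congr 1
      have : ∀ (l' : List α) vs, List.Forall₂ R l' vs → (∀ y ∈ l', rank y < rank x) →
          l'.map (F (rank x)) = vs := by
        intro l' vs hl'
        induction hl' with
        | nil => intro _; rfl
        | @cons y v l' vs h3 _ ih' =>
          intro h4
          have h5 := h4 y List.mem_cons_self
          rw [List.map_cons, ih' fun z hz => h4 z (List.mem_cons_of_mem _ hz), F_eq _ _ h5,
            ih y v (by omega) h3]
      exact this _ _ h1 h2

end primrec

/-- The list with the given code. -/
def decodeList (n : ℕ) : List ℕ := ((Encodable.decode n : Option (List ℕ))).getD []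

@[fun_prop]
theorem primrec_decodeList {α : Type} [Primcodable α] {f : α → ℕ} (hf : Primrec f) :
    Primrec fun a => decodeList (f a) :=
  Primrec.option_getD.comp (Primrec.decode.comp hf) (Primrec.const [])

theorem decodeList_encode (l : List ℕ) : decodeList (Encodable.encode l) = l := by
  simp [decodeList]

@[fun_prop]
theorem primrec_encodeList {α : Type} [Primcodable α] {f : α → List ℕ} (hf : Primrec f) :
    Primrec fun a => Encodable.encode (f a) := Primrec.encode.comp hf

theorem le_encode_of_mem {a : ℕ} : ∀ {l : List ℕ}, a ∈ l → a ≤ Encodable.encode l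
  | x :: l, h => by
    rw [Encodable.encode_list_cons]
    rcases List.mem_cons.1 h with rfl | h
    · exact Nat.le_succ_of_le (Nat.left_le_pair _ _)
    · exact Nat.le_succ_of_le ((le_encode_of_mem h).trans (Nat.right_le_pair _ _))

theorem lt_pair_of_le {a m n : ℕ} (hm : 0 < m) (h : a ≤ n) : a < Nat.pair m n := by
  have := Nat.add_le_pair m n
  omega

theorem exs0_code : ∀ (k : ℕ) (A : Fm L b), (exs0 k A).code = (Nat.pair 6)^[k] A.code
  | 0, _ => rfl
  | k + 1, A => by rw [exs0, Fm.code, exs0_code k A, Function.iterate_succ_apply']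

theorem exs1_code : ∀ (k : ℕ) (A : Fm L b), (exs1 k A).code = (Nat.pair 8)^[k] A.code
  | 0, _ => rfl
  | k + 1, A => by rw [exs1, Fm.code, exs1_code k A, Function.iterate_succ_apply']

theorem foldr_and_code (B : Fm L b) : ∀ l : List (Fm L b), (l.foldr .and B).code =
    (l.map Fm.code).foldr (fun m n => Nat.pair 2 (Nat.pair m n)) B.code
  | [] => rfl
  | A :: l => by rw [List.foldr, Fm.code, foldr_and_code B l]; rfl

theorem map_range_eq_ofFn {α : Type} (F : ℕ → α) (n : ℕ) :
    (List.range n).map F = List.ofFn fun i : Fin n => F i := by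
  rw [List.ofFn_eq_map, ← List.map_coe_finRange_eq_range, List.map_map]
  rfl

/-- The renaming of number variables that is given by a list below its length and is an addition
from then on. -/
def listRen (l : List ℕ) (c n : ℕ) : ℕ := l.getD n (n + c)

theorem listRen_add (l : List ℕ) (c k n : ℕ) :
    listRen (l.map (· + k)) (c + k) n = listRen l c n + k := by
  simp only [listRen, List.getD_eq_getElem?_getD, List.getElem?_map]
  cases l[n]? <;> simp [Nat.add_assoc]

/-- The inputs of the recursion that computes graphs: the sort (0 for terms, 1 for functors) and the
code of an expression, the variable for its value, and the renaming of its number and function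
variables (a list and an offset, and an offset). -/
abbrev GraphInput := (ℕ × ℕ) × (ℕ × List ℕ × ℕ × ℕ)

/-- The subexpressions, with the renamings under which their graphs occur in the graph of the
expression; `na`, `fa` give the numbers of arguments of the constants from their codes. -/
def graphChildren (na fa : ℕ → ℕ) (x : GraphInput) : List GraphInput :=
  if x.1.1 = 0 then
    if x.1.2.unpair.1 = 1 then
      ((List.range (na x.1.2.unpair.2.unpair.1)).map fun i =>
        ((0, (decodeList x.1.2.unpair.2.unpair.2.unpair.1).getD i 0),
          (i, x.2.2.1.map (fun n => n + (na x.1.2.unpair.2.unpair.1)),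
            x.2.2.2.1 + na x.1.2.unpair.2.unpair.1, x.2.2.2.2 + fa x.1.2.unpair.2.unpair.1))) ++
      ((List.range (fa x.1.2.unpair.2.unpair.1)).map fun i =>
        ((1, (decodeList x.1.2.unpair.2.unpair.2.unpair.2).getD i 0),
          (i, x.2.2.1.map (fun n => n + (na x.1.2.unpair.2.unpair.1)),
            x.2.2.2.1 + na x.1.2.unpair.2.unpair.1, x.2.2.2.2 + fa x.1.2.unpair.2.unpair.1)))
    else if x.1.2.unpair.1 = 2 then
      [((1, x.1.2.unpair.2.unpair.1), (0, x.2.2.1.map (fun n => n + 1), x.2.2.2.1 + 1, x.2.2.2.2 + 1)),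
        ((0, x.1.2.unpair.2.unpair.2), (0, x.2.2.1.map (fun n => n + 1), x.2.2.2.1 + 1,
          x.2.2.2.2 + 1))]
    else []
  else if x.1.2.unpair.1 = 2 then
    [((0, x.1.2.unpair.2), (0, 1 :: x.2.2.1.map (fun n => n + 2), x.2.2.2.1 + 1, x.2.2.2.2))]
  else []

/-- The code of u(t), from the codes of u and t. -/
def codeApp (u t : ℕ) : ℕ := Nat.pair 2 (Nat.pair u t)
/-- The code of the equation s = t. -/
def codeEq (s t : ℕ) : ℕ := Nat.pair 0 (Nat.pair s t)
/-- The code of a variable, of either sort. -/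
def codeVar (n : ℕ) : ℕ := Nat.pair 0 n

/-- From the values for the subexpressions, 1 or 0 according as the expression is λ-free or not, and
the code of its graph. -/
def graphStep (na fa : ℕ → ℕ) (x : GraphInput) (vs : List (ℕ × ℕ)) : ℕ × ℕ :=
  if x.1.1 = 0 then
    if x.1.2.unpair.1 = 0 then
      (1, codeEq (codeVar (x.2.2.1.getD x.1.2.unpair.2 (x.1.2.unpair.2 + x.2.2.2.1)))
        (codeVar x.2.1))
    else if x.1.2.unpair.1 = 1 then
      ((vs.map Prod.fst).foldr (fun m n => m * n) 1,
        (Nat.pair 6)^[na x.1.2.unpair.2.unpair.1] ((Nat.pair 8)^[fa x.1.2.unpair.2.unpair.1]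
          ((vs.map Prod.snd).foldr (fun m n => Nat.pair 2 (Nat.pair m n))
            (codeEq (Nat.pair 1 (Nat.pair x.1.2.unpair.2.unpair.1
              (Nat.pair (Encodable.encode ((List.range (na x.1.2.unpair.2.unpair.1)).map codeVar))
                (Encodable.encode ((List.range (fa x.1.2.unpair.2.unpair.1)).map codeVar)))))
              (codeVar (x.2.1 + na x.1.2.unpair.2.unpair.1))))))
    else
      ((vs.map Prod.fst).foldr (fun m n => m * n) 1,
        Nat.pair 6 (Nat.pair 8 (Nat.pair 2 (Nat.pair ((vs.map Prod.snd).getD 0 0)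
          (Nat.pair 2 (Nat.pair ((vs.map Prod.snd).getD 1 0)
            (codeEq (codeApp (codeVar 0) (codeVar 0)) (codeVar (x.2.1 + 1)))))))))
  else
    if x.1.2.unpair.1 = 0 then
      (1, Nat.pair 5 (codeEq (codeApp (codeVar (x.1.2.unpair.2 + x.2.2.2.2)) (codeVar 0))
        (codeApp (codeVar x.2.1) (codeVar 0))))
    else if x.1.2.unpair.1 = 1 then
      (1, Nat.pair 5 (codeEq (codeApp x.1.2 (codeVar 0)) (codeApp (codeVar x.2.1) (codeVar 0))))
    else
      (0, Nat.pair 5 (Nat.pair 6 (Nat.pair 2 (Nat.pair ((vs.map Prod.snd).getD 0 0)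
        (codeEq (codeVar 0) (codeApp (codeVar x.2.1) (codeVar 1)))))))

theorem primrec_graphChildren {na fa : ℕ → ℕ} (hna : Primrec na) (hfa : Primrec fa) :
    Primrec (graphChildren na fa) := by
  unfold graphChildren
  fun_prop

theorem primrec_graphStep {na fa : ℕ → ℕ} (hna : Primrec na) (hfa : Primrec fa) :
    Primrec fun p : GraphInput × List (ℕ × ℕ) => graphStep na fa p.1 p.2 := by
  unfold graphStep codeEq codeApp codeVar
  fun_prop

open Classical in
/-- 1 if the proposition holds, 0 otherwise. -/
noncomputable def bit (p : Prop) : ℕ := if p then 1 else 0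

theorem bit_true {p : Prop} (h : p) : bit p = 1 := if_pos h
theorem bit_false {p : Prop} (h : ¬ p) : bit p = 0 := if_neg h

theorem bit_and (p q : Prop) : bit (p ∧ q) = bit p * bit q := by
  by_cases hp : p <;> by_cases hq : q <;> simp [bit, hp, hq]

theorem foldr_mul_bit (p : Prop) : ∀ {k : ℕ} (q : Fin k → Prop),
    (List.ofFn fun i => bit (q i)).foldr (fun m n => m * n) (bit p) = bit ((∀ i, q i) ∧ p)
  | 0, q => by simp
  | k + 1, q => by
    rw [List.ofFn_succ, List.foldr, foldr_mul_bit, ← bit_and, Fin.forall_fin_succ, and_assoc]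

/-- The value of the recursion for graphs at the code of a term or functor. -/
def GraphRel (L : Sig) (x : GraphInput) (v : ℕ × ℕ) : Prop :=
  (∃ t : Tm L true, x.1 = (0, t.code) ∧ v = (bit t.LamFree,
    (t.graph.ren (scons x.2.1 (listRen x.2.2.1 x.2.2.2.1)) fun n => n + x.2.2.2.2).code)) ∨
  ∃ u : Fn L true, x.1 = (1, u.code) ∧ v = (bit u.LamFree,
    (u.graph.ren (listRen x.2.2.1 x.2.2.2.1) (scons x.2.1 fun n => n + x.2.2.2.2)).code)

theorem forall₂_ofFn {α β : Type} {R : α → β → Prop} : ∀ {k : ℕ} {f : Fin k → α} {g : Fin k → β},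
    (∀ i, R (f i) (g i)) → List.Forall₂ R (List.ofFn f) (List.ofFn g)
  | 0, _, _, _ => by simp
  | k + 1, f, g, h => by
    rw [List.ofFn_succ, List.ofFn_succ]
    exact .cons (h 0) (forall₂_ofFn fun i => h i.succ)

theorem ofFn_getD {k : ℕ} (f : Fin k → ℕ) (i : Fin k) : (List.ofFn f).getD i 0 = f i := by
  simp [List.getD_eq_getElem?_getD]

theorem up_iter_slot (ρ : ℕ → ℕ) (i k : ℕ) (hi : i < k) (l : List ℕ) (c a : ℕ)
    (hρ : ρ = scons a (listRen l c)) : (fun n => up^[k] ρ (slot i (k + 1) n)) =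
      scons i (listRen (l.map (· + k)) (c + k)) := by
  subst hρ
  funext n
  cases n with
  | zero => exact up_iter_lt _ _ _ hi
  | succ n =>
    rw [slot, show n + (k + 1) = n + 1 + k by omega, up_iter_add, scons, scons, listRen_add]

theorem up_iter_slot' (d i k : ℕ) (hi : i < k) :
    (fun n => up^[k] (fun n => n + d) (slot i k n)) = scons i fun n => n + (d + k) := by
  funext n
  cases n with
  | zero => exact up_iter_lt _ _ _ hi
  | succ n => rw [slot, up_iter_add, scons, Nat.add_assoc]

theorem up_iter_succ_listRen (k : ℕ) (l : List ℕ) (c a : ℕ) :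
    (fun n => up^[k] (scons a (listRen l c)) (n + (k + 1))) =
      listRen (l.map (· + k)) (c + k) := by
  funext n
  rw [show n + (k + 1) = n + 1 + k by omega, up_iter_add, scons, listRen_add]

theorem up_iter_add_add (d k : ℕ) :
    (fun n => up^[k] (fun n => n + d) (n + k)) = fun n => n + (d + k) := by
  funext n
  rw [up_iter_add, Nat.add_assoc]

section graphStep
variable {na fa : ℕ → ℕ} (hna : ∀ f, na (L.code f) = L.nArg f) (hfa : ∀ f, fa (L.code f) = L.fArg f)
include hna hfa

theorem graphRel_cst (f : L.Con) (h : ¬ L.Unary f) (ts : Fin (L.nArg f) → Tm L true)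
    (us : Fin (L.fArg f) → Fn L true) (p : ℕ × List ℕ × ℕ × ℕ) :
    ∃ vs, ((bit (Tm.cst f h ts us).LamFree, ((Tm.cst f h ts us).graph.ren
        (scons p.1 (listRen p.2.1 p.2.2.1)) fun n => n + p.2.2.2).code) =
          graphStep na fa ((0, (Tm.cst f h ts us).code), p) vs) ∧
      List.Forall₂ (GraphRel L) (graphChildren na fa ((0, (Tm.cst f h ts us).code), p)) vs ∧
      ∀ y ∈ graphChildren na fa ((0, (Tm.cst f h ts us).code), p),
        y.1.2 < (Tm.cst f h ts us).code := by
  obtain ⟨a, l, c, d⟩ := p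
  have hch : graphChildren na fa ((0, (Tm.cst f h ts us).code), (a, l, c, d)) =
      (List.ofFn fun i => ((0, (ts i).code), ((i : ℕ), l.map (· + L.nArg f), c + L.nArg f,
        d + L.fArg f))) ++
      List.ofFn fun j => ((1, (us j).code), ((j : ℕ), l.map (· + L.nArg f), c + L.nArg f,
        d + L.fArg f)) := by
    simp only [graphChildren, Tm.code, Nat.unpair_pair, if_true, hna, hfa, map_range_eq_ofFn,
      decodeList_encode, ofFn_getD]
  refine ⟨(List.ofFn fun i => (bit (ts i).LamFree, ((ts i).graph.ren
      (scons (i : ℕ) (listRen (l.map (· + L.nArg f)) (c + L.nArg f)))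
        fun n => n + (d + L.fArg f)).code)) ++
      List.ofFn fun j => (bit (us j).LamFree, ((us j).graph.ren
      (listRen (l.map (· + L.nArg f)) (c + L.nArg f))
        (scons (j : ℕ) fun n => n + (d + L.fArg f))).code), ?_, ?_, ?_⟩
  · simp only [graphStep, Tm.code, Nat.unpair_pair, if_true, hna, hfa, List.map_append,
      List.map_ofFn, List.foldr_append, Function.comp_def, if_neg Nat.one_ne_zero]
    refine Prod.ext ?_ ?_
    · have h1 : (1 : ℕ) = bit True := (bit_true trivial).symm
      simp only
      rw [h1, foldr_mul_bit, foldr_mul_bit, and_true]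
      rfl
    · simp only [Tm.graph]
      rw [exs0_ren, exs1_ren, foldr_and_ren, foldr_and_ren, exs0_code, exs1_code, foldr_and_code,
        foldr_and_code]
      simp only [List.map_ofFn, Function.comp_def, Fm.ren_ren, up_iter_slot _ _ _ (Fin.is_lt _) l c a rfl,
        up_iter_slot' _ _ _ (Fin.is_lt _), up_iter_succ_listRen, up_iter_add_add, Fm.ren, Tm.ren,
        Fn.ren, up_iter_lt _ _ _ (Fin.is_lt _), map_range_eq_ofFn, Fm.code, Tm.code, Fn.code,
        codeEq, codeVar]
      have := up_iter_add (scons a (listRen l c)) (L.nArg f) 0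
      rw [Nat.zero_add, scons] at this
      rw [this]
  · rw [hch]
    exact List.rel_append (R := GraphRel L) (forall₂_ofFn fun i => .inl ⟨ts i, rfl, rfl⟩)
      (forall₂_ofFn fun j => .inr ⟨us j, rfl, rfl⟩)
  · rw [hch]
    intro y hy
    simp only [List.mem_append, List.mem_ofFn] at hy
    rw [Tm.code]
    refine lt_pair_of_le Nat.one_pos ?_
    rcases hy with ⟨i, rfl⟩ | ⟨j, rfl⟩
    · exact (le_encode_of_mem ((List.mem_ofFn' (fun i => (ts i).code) _).2 ⟨i, rfl⟩)).trans
        ((Nat.left_le_pair _ _).trans ((Nat.right_le_pair _ _)))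
    · exact (le_encode_of_mem ((List.mem_ofFn' (fun j => (us j).code) _).2 ⟨j, rfl⟩)).trans
        ((Nat.right_le_pair _ _).trans ((Nat.right_le_pair _ _)))

/-- The recursion equations for graphs. -/
theorem graphRel_step (x : GraphInput) (v : ℕ × ℕ) (h : GraphRel L x v) :
    ∃ vs, v = graphStep na fa x vs ∧ List.Forall₂ (GraphRel L) (graphChildren na fa x) vs ∧
      ∀ y ∈ graphChildren na fa x, y.1.2 < x.1.2 := by
  obtain ⟨x, a, l, c, d⟩ := x
  rcases h with ⟨t, hx, rfl⟩ | ⟨u, hx, rfl⟩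
  · change x = _ at hx
    subst hx
    cases t with
    | var n =>
      refine ⟨[], ?_, ?_, ?_⟩
      · simp [graphStep, Tm.code, Tm.graph, Fm.ren, Fm.code, Tm.ren, scons, bit, Tm.LamFree, codeEq,
          codeVar, listRen]
      · simp [graphChildren, Tm.code]
      · simp [graphChildren, Tm.code]
    | cst f h ts us => exact graphRel_cst hna hfa f h ts us (a, l, c, d)
    | app u t =>
      have hch : graphChildren na fa ((0, (Tm.app u t).code), (a, l, c, d)) =
          [((1, u.code), (0, l.map (· + 1), c + 1, d + 1)),
            ((0, t.code), (0, l.map (· + 1), c + 1, d + 1))] := by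
        simp [graphChildren, Tm.code]
      have h1 : (fun n => up (scons a (listRen l c)) (n + 2)) = listRen (l.map (· + 1)) (c + 1) := by
        funext n; rw [listRen_add]; rfl
      have h2 : (fun n => up (scons a (listRen l c)) (slot 0 2 n)) =
          scons 0 (listRen (l.map (· + 1)) (c + 1)) := by
        funext n; cases n
        · rfl
        · rw [scons, listRen_add]; rfl
      have h3 : (fun n => up (· + d) n) = scons 0 fun n => n + (d + 1) := by
        funext n; cases n
        · rfl
        · rfl
      refine ⟨[(bit u.LamFree, (u.graph.ren (listRen (l.map (· + 1)) (c + 1))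
          (scons 0 fun n => n + (d + 1))).code), (bit t.LamFree, (t.graph.ren
          (scons 0 (listRen (l.map (· + 1)) (c + 1))) fun n => n + (d + 1)).code)], ?_, ?_, ?_⟩
      · simp only [Tm.graph, Fm.ren, Fm.ren_ren, h1, h2, h3, id]
        simp [graphStep, Tm.code, Fn.code, Fm.code, Tm.ren, Fn.ren, scons,
          Tm.LamFree, codeEq, codeVar, codeApp, bit_and, up]
        rfl
      · rw [hch]
        exact .cons (.inr ⟨u, rfl, rfl⟩) (.cons (.inl ⟨t, rfl, rfl⟩) .nil)
      · rw [hch]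
        intro y hy
        rw [Tm.code]
        refine lt_pair_of_le Nat.two_pos ?_
        simp only [List.mem_cons, List.not_mem_nil, or_false] at hy
        rcases hy with rfl | rfl
        · exact Nat.left_le_pair _ _
        · exact Nat.right_le_pair _ _
  · change x = _ at hx
    subst hx
    cases u with
    | var n =>
      refine ⟨[], ?_, ?_, ?_⟩
      · simp [graphStep, Fn.code, Tm.code, Fn.graph, Fm.ren, Fm.code, Tm.ren, Fn.ren, scons, bit,
          Fn.LamFree, codeEq, codeVar, codeApp, up]
      · simp [graphChildren, Fn.code]
      · simp [graphChildren, Fn.code]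
    | cst f h =>
      refine ⟨[], ?_, ?_, ?_⟩
      · simp [graphStep, Fn.code, Tm.code, Fn.graph, Fm.ren, Fm.code, Tm.ren, Fn.ren, scons, bit,
          Fn.LamFree, codeEq, codeVar, codeApp, up]
      · simp [graphChildren, Fn.code]
      · simp [graphChildren, Fn.code]
    | lam h t =>
      have hch : graphChildren na fa ((1, (Fn.lam h t).code), (a, l, c, d)) =
          [((0, t.code), (0, 1 :: l.map (· + 2), c + 1, d))] := by
        simp [graphChildren, Fn.code]
      have h1 : up (up (listRen l c)) = scons 0 (listRen (1 :: l.map (· + 2)) (c + 1)) := by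
        funext n
        rcases n with _ | _ | n
        · rfl
        · rfl
        · have : listRen (1 :: l.map (· + 2)) (c + 1) (n + 1) = listRen (l.map (· + 2)) (c + 2) n := by
            simp only [listRen, List.getD_cons_succ]
            congr 1
            omega
          rw [scons, this, listRen_add]; rfl
      refine ⟨[(bit t.LamFree, (t.graph.ren (scons 0 (listRen (1 :: l.map (· + 2)) (c + 1)))
          fun n => n + d).code)], ?_, ?_, ?_⟩
      · simp only [Fn.graph, Fm.ren, Fm.ren_ren, h1, id]
        simp [graphStep, Tm.code, Fn.code, Fm.code, Tm.ren, Fn.ren, scons, bit,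
          Fn.LamFree, codeEq, codeVar, codeApp]
        exact ⟨rfl, rfl⟩
      · rw [hch]
        exact .cons (.inl ⟨t, rfl, rfl⟩) .nil
      · rw [hch]
        intro y hy
        rw [Fn.code]
        refine lt_pair_of_le Nat.two_pos ?_
        simp only [List.mem_cons, List.not_mem_nil, or_false] at hy
        rw [hy]

end graphStep

mutual
theorem Tm.code_strip : ∀ t : Tm L true, t.LamFree → t.strip.code = t.code
  | .var _, _ => rfl
  | .cst f h ts us, H => by
    simp only [Tm.strip, Tm.code, fun i => (ts i).code_strip (H.1 i),
      fun j => (us j).code_strip (H.2 j)]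
  | .app u t, H => by simp only [Tm.strip, Tm.code, u.code_strip H.1, t.code_strip H.2]
theorem Fn.code_strip : ∀ u : Fn L true, u.LamFree → u.strip.code = u.code
  | .var _, _ => rfl
  | .cst _ _, _ => rfl
  | .lam _ _, H => H.elim
end

/-- The immediate subformulas of a formula that is not an equation. -/
def formulaChildren (n : ℕ) : List ℕ :=
  if n.unpair.1 = 0 then [] else if n.unpair.1 = 1 then [n.unpair.2.unpair.1, n.unpair.2.unpair.2]
  else if n.unpair.1 = 2 then [n.unpair.2.unpair.1, n.unpair.2.unpair.2]
  else if n.unpair.1 = 3 then [n.unpair.2.unpair.1, n.unpair.2.unpair.2]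
  else [n.unpair.2]

/-- The code of the translation of an equation from the codes of the equation and from the values
(λ-freeness and graph) of its sides. -/
def equationStep (n : ℕ) (v w : ℕ × ℕ) : ℕ :=
  if v.1 * w.1 = 1 then n else Nat.pair 6 (Nat.pair 2 (Nat.pair v.2 w.2))

/-- The code of the translation of a formula from those of its immediate subformulas; `g` computes
the values for terms. -/
def formulaStep (g : GraphInput → ℕ × ℕ) (n : ℕ) (vs : List ℕ) : ℕ :=
  if n.unpair.1 = 0 then equationStep n (g ((0, n.unpair.2.unpair.1), (0, [], 1, 0)))
      (g ((0, n.unpair.2.unpair.2), (0, [], 1, 0)))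
  else if n.unpair.1 = 1 then Nat.pair 1 (Nat.pair (vs.getD 0 0) (vs.getD 1 0))
  else if n.unpair.1 = 2 then Nat.pair 2 (Nat.pair (vs.getD 0 0) (vs.getD 1 0))
  else if n.unpair.1 = 3 then Nat.pair 3 (Nat.pair (vs.getD 0 0) (vs.getD 1 0))
  else Nat.pair n.unpair.1 (vs.getD 0 0)

theorem primrec_formulaChildren : Primrec formulaChildren := by
  unfold formulaChildren
  fun_prop

theorem primrec_formulaStep {g : GraphInput → ℕ × ℕ} (hg : Primrec g) :
    Primrec fun p : ℕ × List ℕ => formulaStep g p.1 p.2 := by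
  unfold formulaStep equationStep
  fun_prop

/-- The translation is computable if the numbers of arguments of the constants are. -/
theorem tr_computable {na fa : ℕ → ℕ} (hna : ∀ f, na (L.code f) = L.nArg f)
    (hfa : ∀ f, fa (L.code f) = L.fArg f) (pna : Primrec na) (pfa : Primrec fa) :
    ∃ g : ℕ → ℕ, Computable g ∧ ∀ E : Fm L true, E.tr.code = g E.code := by
  obtain ⟨g, hg, hgr⟩ := exists_primrec (R := GraphRel L) (rank := fun x => x.1.2)
    (primrec_graphChildren pna pfa) (primrec_graphStep pna pfa) (by fun_prop)
    (graphRel_step hna hfa)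
  have hg' : ∀ t : Tm L true, g ((0, t.code), (0, [], 1, 0)) = (bit t.LamFree, t.graph.code) := by
    intro t
    refine hgr _ _ (.inl ⟨t, rfl, ?_⟩)
    have h1 : scons 0 (listRen [] 1) = fun n => n := by funext n; cases n <;> rfl
    change _ = (_, (t.graph.ren (scons 0 (listRen [] 1)) fun n => n).code)
    rw [h1, Fm.ren_id]
  obtain ⟨k, hk, hkr⟩ := exists_primrec (R := fun n v => ∃ E : Fm L true, n = E.code ∧ v = E.tr.code)
    (rank := fun n => n) primrec_formulaChildren (primrec_formulaStep hg) (by fun_prop) (by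
      rintro _ _ ⟨E, rfl, rfl⟩
      cases E with
      | eq s t =>
        refine ⟨[], ?_, by simp [formulaChildren, Fm.code], by simp [formulaChildren, Fm.code]⟩
        simp only [formulaStep, Fm.code, Nat.unpair_pair, if_true, hg', equationStep, Fm.tr, trEq,
          ← bit_and]
        by_cases h : s.LamFree ∧ t.LamFree
        · rw [if_pos h, if_pos (bit_true h), Fm.code, s.code_strip h.1, t.code_strip h.2]
        · rw [if_neg h, bit_false h, if_neg Nat.zero_ne_one]; rfl
      | imp A B | and A B | or A B =>
        refine ⟨[A.tr.code, B.tr.code], ?_, ?_, ?_⟩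
        · simp [formulaStep, Fm.code, Fm.tr]
        · simp [formulaChildren, Fm.code]
          exact ⟨⟨A, rfl, rfl⟩, ⟨B, rfl, rfl⟩⟩
        · simp [formulaChildren, Fm.code]
          exact ⟨lt_pair_of_le (by omega) (Nat.left_le_pair _ _),
            lt_pair_of_le (by omega) (Nat.right_le_pair _ _)⟩
      | neg A | all0 A | ex0 A | all1 A | ex1 A =>
        refine ⟨[A.tr.code], ?_, ?_, ?_⟩
        · simp [formulaStep, Fm.code, Fm.tr]
        · simp [formulaChildren, Fm.code]
          exact ⟨A, rfl, rfl⟩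
        · simp [formulaChildren, Fm.code]
          exact lt_pair_of_le (by omega) (Nat.le_refl _))
  exact ⟨k, hk.to_comp, fun E => (hkr _ _ ⟨E, rfl, rfl⟩).symm⟩


/-! ### Congruence for number arguments -/

namespace EqBase
variable {Ax : Fm L b → Prop} (E : EqBase Ax) {Γ : List (Fm L b)}
include E

/-- A term respects equality of the value of a free number variable: by QF-AC₀₀ it defines a
function, and functions respect equality. -/
theorem sub_congr_head (t : Tm L b) {s s' : Tm L b} {σ : ℕ → Tm L b} {τ : ℕ → Fn L b}
    (h : Deriv Ax Γ (.eq s s')) : Deriv Ax Γ (.eq (t.sub (scons s σ) τ) (t.sub (scons s' σ) τ)) := by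
  refine E.exists_fun (t.sub (upN σ) fun n => (τ n).ren Nat.succ id) fun Δ ρ θ α e hα => ?_
  have key : ∀ x, Deriv Ax Δ (.eq (.app α (x.ren ρ θ)) ((t.sub (scons x σ) τ).ren ρ θ)) := by
    intro x
    have h1 := hα Δ (fun n => n) (fun n => n) (x.ren ρ θ) (.refl Δ)
    rw [Fn.ren_id, Tm.sub_sub] at h1
    convert h1 using 2
    rw [Tm.sub_ren, scons_apply (fun t : Tm L b => t.ren ρ θ)]
    congr 1
    · funext n; cases n
      · rfl
      · rw [upN_succ, Tm.ren_sub, scons, Tm.ren_eq_sub]; rfl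
    · funext n
      rw [Fn.ren_sub, Fn.ren_eq_sub]; rfl
  exact E.trans (E.symm (key s)) (E.trans (E.app (h.eq_mono e)) (key s'))

theorem cst_congr {f : L.Con} {h : ¬ L.Unary f} {ts ts' : Fin (L.nArg f) → Tm L b}
    {us : Fin (L.fArg f) → Fn L b} (H : ∀ i, Deriv Ax Γ (.eq (ts i) (ts' i))) :
    Deriv Ax Γ (.eq (.cst f h ts us) (.cst f h ts' us)) := by
  -- the arguments are replaced one by one
  have key : ∀ k, k ≤ L.nArg f → Deriv Ax Γ (.eq (.cst f h ts us)
      (.cst f h (fun i => if (i : ℕ) < k then ts' i else ts i) us)) := by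
    intro k
    induction k with
    | zero => intro _; simpa using E.refl _ _
    | succ k ih =>
      intro hk
      refine E.trans (ih (by omega)) ?_
      have h1 := E.sub_congr_head (.cst f h (fun i => if (i : ℕ) = k then .var 0 else
        Tm.ren Nat.succ id (if (i : ℕ) < k then ts' i else ts i)) fun j => (us j).ren Nat.succ id)
        (σ := .var) (τ := .var) (H ⟨k, hk⟩)
      simp only [Tm.sub, Fn.ren_sub, scons, id, Fn.sub_var] at h1
      convert h1 using 2
      · congr 1; funext i
        by_cases hi : (i : ℕ) = k
        · have : i = ⟨k, hk⟩ := Fin.ext hi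
          subst this
          simp [Tm.sub, scons]
        · simp only [hi, if_false, Tm.ren_sub, scons, id, Tm.sub_var]
      · congr 1; funext i
        by_cases hi : (i : ℕ) = k
        · have : i = ⟨k, hk⟩ := Fin.ext hi
          subst this
          simp [Tm.sub, scons]
        · simp only [hi, if_false, Tm.ren_sub, scons, id, Tm.sub_var,
            show ((i : ℕ) < k + 1) = ((i : ℕ) < k) by simp; omega]
  have := key _ (Nat.le_refl _)
  simpa only [Fin.is_lt, if_true] using this

end EqBase

theorem call_sub (f : L.Con) (ts : Fin (L.nArg f) → Tm L b) (us : Fin (L.fArg f) → Fn L b)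
    (σ : ℕ → Tm L b) (τ : ℕ → Fn L b) : (call f ts us).sub σ τ =
      call f (fun i => (ts i).sub σ τ) fun j => (us j).sub σ τ := by
  unfold call
  split <;> simp [Tm.sub, Fn.sub]

theorem call_emb (f : L.Con) (ts : Fin (L.nArg f) → Tm L false) (us : Fin (L.fArg f) → Fn L false) :
    (call f ts us).emb = call f (fun i => (ts i).emb) fun j => (us j).emb := by
  unfold call
  split <;> simp [Tm.emb, Fn.emb]

/-! ### Arithmetic -/

/-- Zero, successor and addition, given by terms, with induction. -/
structure AddOps (Ax : Fm L b → Prop) where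
  E : EqBase Ax
  zero : Tm L b
  succ : Tm L b → Tm L b
  add : Tm L b → Tm L b → Tm L b
  zero_sub : ∀ σ τ, zero.sub σ τ = zero
  succ_sub : ∀ s σ τ, (succ s).sub σ τ = succ (s.sub σ τ)
  add_sub : ∀ s t σ τ, (add s t).sub σ τ = add (s.sub σ τ) (t.sub σ τ)
  ind_ax : ∀ {A}, Ind zero succ A → ∀ Γ, Deriv Ax Γ A
  add_zero : ∀ Γ s, Deriv Ax Γ (.eq (add s zero) s)
  add_succ : ∀ Γ s t, Deriv Ax Γ (.eq (add s (succ t)) (succ (add s t)))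

namespace AddOps
variable {Ax : Fm L b → Prop} (O : AddOps Ax) {Γ : List (Fm L b)}
include O

/-- Induction under an environment. -/
theorem ind {A : Fm L b} {σ : ℕ → Tm L b} {τ : ℕ → Fn L b}
    (h0 : Deriv Ax Γ (A.sub (scons O.zero σ) τ))
    (hs : ∀ Δ ρ θ a, Ext ρ θ Γ Δ →
      Deriv Ax Δ (A.sub (scons a fun n => (σ n).ren ρ θ) fun n => (τ n).ren ρ θ) →
      Deriv Ax Δ (A.sub (scons (O.succ a) fun n => (σ n).ren ρ θ) fun n => (τ n).ren ρ θ))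
    (a : Tm L b) : Deriv Ax Γ (A.sub (scons a σ) τ) := by
  have h1 := ((O.ind_ax (.mk A) []).sub_nil σ τ).weaken (List.nil_subset Γ)
  refine Deriv.envAll0E (h1.impE (.andI ?_ ?_)) a
  · rw [Fm.inst0, Fm.sub_sub, single0_eq, scons_apply (fun t : Tm L b => t.sub σ τ), O.zero_sub]
    exact h0
  · refine Deriv.envAll0I fun Δ ρ θ a e => .impI ?_
    rw [Fm.sub_sub]
    have h2 := hs (A.sub (scons a fun n => (σ n).ren ρ θ) (fun n => (τ n).ren ρ θ) :: Δ) ρ θ a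
      (fun B hB => List.mem_cons_of_mem _ (e B hB)) .head
    convert h2 using 2
    · funext n
      cases n
      · simp [O.succ_sub, Tm.sub, scons]
      · rfl
    · rfl

theorem succ_ren (s : Tm L b) (ρ θ : ℕ → ℕ) : (O.succ s).ren ρ θ = O.succ (s.ren ρ θ) := by
  simp only [Tm.ren_eq_sub, O.succ_sub]

theorem add_ren (s t : Tm L b) (ρ θ : ℕ → ℕ) :
    (O.add s t).ren ρ θ = O.add (s.ren ρ θ) (t.ren ρ θ) := by
  simp only [Tm.ren_eq_sub, O.add_sub]

theorem succ_congr {s t : Tm L b} (h : Deriv Ax Γ (.eq s t)) :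
    Deriv Ax Γ (.eq (O.succ s) (O.succ t)) := by
  have := O.E.sub_congr_head (O.succ (.var 0)) (σ := .var) (τ := .var) h
  simpa only [O.succ_sub, Tm.sub, scons] using this

/-- A binary operation that commutes with substitution respects equality. -/
theorem congr₂ {f : Tm L b → Tm L b → Tm L b}
    (hf : ∀ s t σ τ, (f s t).sub σ τ = f (s.sub σ τ) (t.sub σ τ)) {s t s' t' : Tm L b}
    (h : Deriv Ax Γ (.eq s s')) (h' : Deriv Ax Γ (.eq t t')) :
    Deriv Ax Γ (.eq (f s t) (f s' t')) := by
  have h1 := O.E.sub_congr_head (f (.var 0) (.var 1)) (σ := scons t .var) (τ := .var) h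
  have h2 := O.E.sub_congr_head (f (.var 1) (.var 0)) (σ := scons s' .var) (τ := .var) h'
  simp only [hf, Tm.sub, scons] at h1 h2
  exact O.E.trans h1 h2

theorem add_congr {s t s' t' : Tm L b} (h : Deriv Ax Γ (.eq s s')) (h' : Deriv Ax Γ (.eq t t')) :
    Deriv Ax Γ (.eq (O.add s t) (O.add s' t')) := O.congr₂ O.add_sub h h'

theorem zero_add (s : Tm L b) : Deriv Ax Γ (.eq (O.add O.zero s) s) := by
  have := O.ind (A := .eq (O.add O.zero (.var 0)) (.var 0)) (σ := .var) (τ := .var) (Γ := Γ) ?_ ?_ s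
  · simpa only [Fm.sub, Tm.sub, O.add_sub, O.zero_sub, scons] using this
  · simp only [Fm.sub, Tm.sub, O.add_sub, O.zero_sub, scons]
    exact O.add_zero _ _
  · intro Δ ρ θ a e h
    simp only [Fm.sub, Tm.sub, O.add_sub, O.zero_sub, scons] at h ⊢
    exact O.E.trans (O.add_succ _ _ _) (O.succ_congr h)

theorem succ_add (s t : Tm L b) :
    Deriv Ax Γ (.eq (O.add (O.succ s) t) (O.succ (O.add s t))) := by
  have := O.ind (A := .eq (O.add (O.succ (.var 1)) (.var 0)) (O.succ (O.add (.var 1) (.var 0))))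
    (σ := scons s .var) (τ := .var) (Γ := Γ) ?_ ?_ t
  · simpa only [Fm.sub, Tm.sub, O.add_sub, O.succ_sub, scons] using this
  · simp only [Fm.sub, Tm.sub, O.add_sub, O.succ_sub, scons]
    exact O.E.trans (O.add_zero _ _) (O.succ_congr (O.E.symm (O.add_zero _ _)))
  · intro Δ ρ θ a e h
    simp only [Fm.sub, Tm.sub, O.add_sub, O.succ_sub, scons] at h ⊢
    exact O.E.trans (O.add_succ _ _ _)
      (O.succ_congr (O.E.trans h (O.E.symm (O.add_succ _ _ _))))

theorem add_comm (s t : Tm L b) : Deriv Ax Γ (.eq (O.add s t) (O.add t s)) := by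
  have := O.ind (A := .eq (O.add (.var 1) (.var 0)) (O.add (.var 0) (.var 1)))
    (σ := scons s .var) (τ := .var) (Γ := Γ) ?_ ?_ t
  · simpa only [Fm.sub, Tm.sub, O.add_sub, scons] using this
  · simp only [Fm.sub, Tm.sub, O.add_sub, scons]
    exact O.E.trans (O.add_zero _ _) (O.E.symm (O.zero_add _))
  · intro Δ ρ θ a e h
    simp only [Fm.sub, Tm.sub, O.add_sub, scons] at h ⊢
    exact O.E.trans (O.add_succ _ _ _) (O.E.trans (O.succ_congr h) (O.E.symm (O.succ_add _ _)))

end AddOps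

/-- The operations of arithmetic, given by terms, with their defining equations. -/
structure Arithmetic (Ax : Fm L b → Prop) extends AddOps Ax where
  mul : Tm L b → Tm L b → Tm L b
  pd : Tm L b → Tm L b
  sub : Tm L b → Tm L b → Tm L b
  mul_sub : ∀ s t σ τ, (mul s t).sub σ τ = mul (s.sub σ τ) (t.sub σ τ)
  pd_sub : ∀ s σ τ, (pd s).sub σ τ = pd (s.sub σ τ)
  sub_sub : ∀ s t σ τ, (sub s t).sub σ τ = sub (s.sub σ τ) (t.sub σ τ)
  succ_ne_zero : ∀ Γ s, Deriv Ax Γ (.neg (.eq (succ s) zero))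
  mul_zero : ∀ Γ s, Deriv Ax Γ (.eq (mul s zero) zero)
  mul_succ : ∀ Γ s t, Deriv Ax Γ (.eq (mul s (succ t)) (add (mul s t) s))
  pd_zero : ∀ Γ, Deriv Ax Γ (.eq (pd zero) zero)
  pd_succ : ∀ Γ s, Deriv Ax Γ (.eq (pd (succ s)) s)
  sub_zero : ∀ Γ s, Deriv Ax Γ (.eq (sub s zero) s)
  sub_succ : ∀ Γ s t, Deriv Ax Γ (.eq (sub s (succ t)) (pd (sub s t)))

namespace Arithmetic
variable {Ax : Fm L b → Prop} (R : Arithmetic Ax) {Γ Δ : List (Fm L b)}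

/-- The terms modulo deducible equality from the assumptions `Γ`. -/
def Num (R : Arithmetic Ax) (Γ : List (Fm L b)) : Type :=
  Quotient (⟨fun s t => Deriv Ax Γ (.eq s t), R.E.refl Γ, R.E.symm, R.E.trans⟩ : Setoid (Tm L b))

/-- The class of a term. -/
def num (R : Arithmetic Ax) (Γ : List (Fm L b)) (t : Tm L b) : R.Num Γ := Quotient.mk _ t

theorem num_eq {s t : Tm L b} : R.num Γ s = R.num Γ t ↔ Deriv Ax Γ (.eq s t) := Quotient.eq

theorem num_surj (x : R.Num Γ) : ∃ t, R.num Γ t = x := Quotient.exists_rep x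

instance : Zero (R.Num Γ) := ⟨R.num Γ R.zero⟩
instance : One (R.Num Γ) := ⟨R.num Γ (R.succ R.zero)⟩
instance : Add (R.Num Γ) := ⟨Quotient.map₂ R.add fun _ _ h _ _ h' => R.add_congr h h'⟩
instance : Mul (R.Num Γ) := ⟨Quotient.map₂ R.mul fun _ _ h _ _ h' => R.congr₂ R.mul_sub h h'⟩
instance : Sub (R.Num Γ) := ⟨Quotient.map₂ R.sub fun _ _ h _ _ h' => R.congr₂ R.sub_sub h h'⟩

theorem num_zero : R.num Γ R.zero = 0 := rfl
theorem num_add (s t : Tm L b) : R.num Γ (R.add s t) = R.num Γ s + R.num Γ t := rfl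
theorem num_mul (s t : Tm L b) : R.num Γ (R.mul s t) = R.num Γ s * R.num Γ t := rfl
theorem num_sub (s t : Tm L b) : R.num Γ (R.sub s t) = R.num Γ s - R.num Γ t := rfl

theorem num_succ (s : Tm L b) : R.num Γ (R.succ s) = R.num Γ s + 1 :=
  R.num_eq.2 (R.E.symm (R.E.trans (R.add_succ _ _ _) (R.succ_congr (R.add_zero _ _))))

/-- Induction for equations, on the level of classes of terms. -/
theorem ind_eq {s t : Tm L b} {σ : ℕ → Tm L b} {τ : ℕ → Fn L b}
    (h0 : R.num Γ (s.sub (scons R.zero σ) τ) = R.num Γ (t.sub (scons R.zero σ) τ))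
    (hs : ∀ Δ ρ θ a, Ext ρ θ Γ Δ →
      R.num Δ (s.sub (scons a fun n => (σ n).ren ρ θ) fun n => (τ n).ren ρ θ) =
        R.num Δ (t.sub (scons a fun n => (σ n).ren ρ θ) fun n => (τ n).ren ρ θ) →
      R.num Δ (s.sub (scons (R.succ a) fun n => (σ n).ren ρ θ) fun n => (τ n).ren ρ θ) =
        R.num Δ (t.sub (scons (R.succ a) fun n => (σ n).ren ρ θ) fun n => (τ n).ren ρ θ))
    (a : Tm L b) : R.num Γ (s.sub (scons a σ) τ) = R.num Γ (t.sub (scons a σ) τ) :=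
  R.num_eq.2 (R.ind (A := .eq s t) (R.num_eq.1 h0)
    (fun Δ ρ θ a e h => R.num_eq.1 (hs Δ ρ θ a e (R.num_eq.2 h))) a)

theorem num_add_assoc (x y z : Tm L b) : R.num Γ (R.add (R.add x y) z) =
    R.num Γ (R.add x (R.add y z)) := by
  have := R.ind_eq (s := R.add (R.add (.var 1) (.var 2)) (.var 0))
    (t := R.add (.var 1) (R.add (.var 2) (.var 0))) (σ := scons x (scons y .var)) (τ := .var) (Γ := Γ)
    ?_ ?_ z
  · simpa only [R.add_sub, Tm.sub, scons] using this
  · simp only [R.add_sub, Tm.sub, scons]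
    exact R.num_eq.2 (R.E.trans (R.add_zero _ _)
      (R.add_congr (R.E.refl _ _) (R.E.symm (R.add_zero _ _))))
  · intro Δ ρ θ a e h
    simp only [R.add_sub, Tm.sub, scons] at h ⊢
    refine R.num_eq.2 (R.E.trans (R.add_succ _ _ _) (R.E.trans (R.succ_congr (R.num_eq.1 h)) ?_))
    exact R.E.symm (R.E.trans (R.add_congr (R.E.refl _ _) (R.add_succ _ _ _)) (R.add_succ _ _ _))

instance : AddCommMonoid (R.Num Γ) where
  add_assoc a b c := by
    obtain ⟨x, rfl⟩ := R.num_surj a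
    obtain ⟨y, rfl⟩ := R.num_surj b
    obtain ⟨z, rfl⟩ := R.num_surj c
    exact R.num_add_assoc x y z
  zero_add a := by
    obtain ⟨x, rfl⟩ := R.num_surj a
    exact R.num_eq.2 (R.zero_add x)
  add_zero a := by
    obtain ⟨x, rfl⟩ := R.num_surj a
    exact R.num_eq.2 (R.add_zero _ x)
  add_comm a b := by
    obtain ⟨x, rfl⟩ := R.num_surj a
    obtain ⟨y, rfl⟩ := R.num_surj b
    exact R.num_eq.2 (R.add_comm x y)
  nsmul := nsmulRec

theorem num_mul_succ (s t : Tm L b) :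
    R.num Γ (R.mul s (R.succ t)) = R.num Γ s * R.num Γ t + R.num Γ s := R.num_eq.2 (R.mul_succ _ _ _)

theorem num_mul_zero (s : Tm L b) : R.num Γ (R.mul s R.zero) = 0 := R.num_eq.2 (R.mul_zero _ _)

theorem num_mul_add (x y z : Tm L b) : R.num Γ (R.mul x (R.add y z)) =
    R.num Γ (R.add (R.mul x y) (R.mul x z)) := by
  have := R.ind_eq (s := R.mul (.var 1) (R.add (.var 2) (.var 0)))
    (t := R.add (R.mul (.var 1) (.var 2)) (R.mul (.var 1) (.var 0)))
    (σ := scons x (scons y .var)) (τ := .var) (Γ := Γ) ?_ ?_ z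
  · simpa only [R.add_sub, R.mul_sub, Tm.sub, scons] using this
  · simp only [R.add_sub, R.mul_sub, Tm.sub, scons]
    rw [num_mul, num_add, num_zero, _root_.add_zero, num_add, num_mul_zero, _root_.add_zero]
    rfl
  · intro Δ ρ θ a e h
    simp only [R.add_sub, R.mul_sub, Tm.sub, scons] at h ⊢
    have h1 : R.num Δ (R.add (y.ren ρ θ) (R.succ a)) = R.num Δ (R.succ (R.add (y.ren ρ θ) a)) :=
      R.num_eq.2 (R.add_succ _ _ _)
    rw [num_mul, h1, ← num_mul, num_mul_succ, ← num_mul, h, num_add, num_add, R.num_mul_succ _ a,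
      _root_.add_assoc]
    rfl

theorem num_zero_mul (x : Tm L b) : R.num Γ (R.mul R.zero x) = R.num Γ R.zero := by
  have := R.ind_eq (s := R.mul R.zero (.var 0)) (t := R.zero) (σ := .var) (τ := .var) (Γ := Γ) ?_ ?_ x
  · simpa only [R.zero_sub, R.mul_sub, Tm.sub, scons] using this
  · simp only [R.zero_sub, R.mul_sub, Tm.sub, scons]
    exact R.num_mul_zero _
  · intro Δ ρ θ a e h
    simp only [R.zero_sub, R.mul_sub, Tm.sub, scons] at h ⊢
    rw [num_mul_succ, ← num_mul, h, num_zero, _root_.add_zero]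

theorem num_succ_mul (x y : Tm L b) : R.num Γ (R.mul (R.succ x) y) =
    R.num Γ (R.add (R.mul x y) y) := by
  have := R.ind_eq (s := R.mul (R.succ (.var 1)) (.var 0))
    (t := R.add (R.mul (.var 1) (.var 0)) (.var 0)) (σ := scons x .var) (τ := .var) (Γ := Γ) ?_ ?_ y
  · simpa only [R.succ_sub, R.add_sub, R.mul_sub, Tm.sub, scons] using this
  · simp only [R.succ_sub, R.add_sub, R.mul_sub, Tm.sub, scons]
    rw [num_mul_zero, num_add, num_mul_zero, num_zero, _root_.add_zero]
  · intro Δ ρ θ a e h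
    simp only [R.succ_sub, R.add_sub, R.mul_sub, Tm.sub, scons] at h ⊢
    rw [num_mul_succ, ← num_mul, h, num_add, num_add, num_mul_succ, num_succ, num_succ, num_mul]
    simp only [_root_.add_assoc]
    rw [add_left_comm (R.num Δ a)]

theorem num_mul_comm (x y : Tm L b) : R.num Γ (R.mul x y) = R.num Γ (R.mul y x) := by
  have := R.ind_eq (s := R.mul (.var 1) (.var 0))
    (t := R.mul (.var 0) (.var 1)) (σ := scons x .var) (τ := .var) (Γ := Γ) ?_ ?_ y
  · simpa only [R.succ_sub, R.add_sub, R.mul_sub, Tm.sub, scons] using this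
  · simp only [R.mul_sub, Tm.sub, scons]
    rw [num_mul_zero, num_zero_mul, num_zero]
  · intro Δ ρ θ a e h
    simp only [R.mul_sub, Tm.sub, scons] at h ⊢
    rw [num_mul_succ, num_succ_mul, num_add, ← h, num_mul]

theorem num_mul_assoc (x y z : Tm L b) : R.num Γ (R.mul (R.mul x y) z) =
    R.num Γ (R.mul x (R.mul y z)) := by
  have := R.ind_eq (s := R.mul (R.mul (.var 1) (.var 2)) (.var 0))
    (t := R.mul (.var 1) (R.mul (.var 2) (.var 0)))
    (σ := scons x (scons y .var)) (τ := .var) (Γ := Γ) ?_ ?_ z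
  · simpa only [R.mul_sub, Tm.sub, scons] using this
  · simp only [R.mul_sub, Tm.sub, scons]
    rw [num_mul_zero, num_mul, num_mul_zero, ← num_zero, ← num_mul, num_mul_zero, num_zero]
  · intro Δ ρ θ a e h
    simp only [R.mul_sub, Tm.sub, scons] at h ⊢
    have h1 : R.num Δ (R.mul (y.ren ρ θ) (R.succ a)) =
        R.num Δ (R.add (R.mul (y.ren ρ θ) a) (y.ren ρ θ)) := R.num_mul_succ _ _
    rw [num_mul_succ, ← num_mul, h, num_mul _ (x.ren ρ θ) (R.mul _ (R.succ a)), h1, ← num_mul,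
      num_mul_add, num_add]

instance : CommSemiring (R.Num Γ) where
  left_distrib a b c := by
    obtain ⟨x, rfl⟩ := R.num_surj a
    obtain ⟨y, rfl⟩ := R.num_surj b
    obtain ⟨z, rfl⟩ := R.num_surj c
    exact R.num_mul_add x y z
  right_distrib a b c := by
    obtain ⟨x, rfl⟩ := R.num_surj a
    obtain ⟨y, rfl⟩ := R.num_surj b
    obtain ⟨z, rfl⟩ := R.num_surj c
    have := R.num_mul_add (Γ := Γ) z x y
    rw [R.num_mul_comm z, num_add, R.num_mul_comm z x, R.num_mul_comm z y] at this
    exact this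
  zero_mul a := by
    obtain ⟨x, rfl⟩ := R.num_surj a
    exact R.num_zero_mul x
  mul_zero a := by
    obtain ⟨x, rfl⟩ := R.num_surj a
    exact R.num_mul_zero x
  mul_assoc a b c := by
    obtain ⟨x, rfl⟩ := R.num_surj a
    obtain ⟨y, rfl⟩ := R.num_surj b
    obtain ⟨z, rfl⟩ := R.num_surj c
    exact R.num_mul_assoc x y z
  one_mul a := by
    obtain ⟨x, rfl⟩ := R.num_surj a
    have := R.num_succ_mul (Γ := Γ) R.zero x
    rw [num_add, num_zero_mul, num_zero, _root_.zero_add] at this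
    exact this
  mul_one a := by
    obtain ⟨x, rfl⟩ := R.num_surj a
    have := R.num_mul_succ (Γ := Γ) x R.zero
    rw [← num_mul, num_mul_zero, _root_.zero_add] at this
    exact this
  mul_comm a b := by
    obtain ⟨x, rfl⟩ := R.num_surj a
    obtain ⟨y, rfl⟩ := R.num_surj b
    exact R.num_mul_comm x y

theorem pd_congr {s t : Tm L b} (h : Deriv Ax Γ (.eq s t)) :
    Deriv Ax Γ (.eq (R.pd s) (R.pd t)) := by
  have := R.E.sub_congr_head (R.pd (.var 0)) (σ := .var) (τ := .var) h
  simpa only [R.pd_sub, Tm.sub, scons] using this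

theorem num_succ_sub_succ (s t : Tm L b) : R.num Γ (R.sub (R.succ s) (R.succ t)) =
    R.num Γ (R.sub s t) := by
  have := R.ind_eq (s := R.sub (R.succ (.var 1)) (R.succ (.var 0)))
    (t := R.sub (.var 1) (.var 0)) (σ := scons s .var) (τ := .var) (Γ := Γ) ?_ ?_ t
  · simpa only [R.succ_sub, R.sub_sub, Tm.sub, scons] using this
  · simp only [R.succ_sub, R.sub_sub, Tm.sub, scons]
    exact R.num_eq.2 (R.E.trans (R.sub_succ _ _ _) (R.E.trans (R.pd_congr (R.sub_zero _ _))
      (R.E.trans (R.pd_succ _ _) (R.E.symm (R.sub_zero _ _)))))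
  · intro Δ ρ θ a e h
    simp only [R.succ_sub, R.sub_sub, Tm.sub, scons] at h ⊢
    exact R.num_eq.2 (R.E.trans (R.sub_succ _ _ _) (R.E.trans (R.pd_congr (R.num_eq.1 h))
      (R.E.symm (R.sub_succ _ _ _))))

theorem num_add_sub (s t : Tm L b) : R.num Γ (R.sub (R.add s t) t) = R.num Γ s := by
  have := R.ind_eq (s := R.sub (R.add (.var 1) (.var 0)) (.var 0)) (t := .var 1)
    (σ := scons s .var) (τ := .var) (Γ := Γ) ?_ ?_ t
  · simpa only [R.add_sub, R.sub_sub, Tm.sub, scons] using this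
  · simp only [R.add_sub, R.sub_sub, Tm.sub, scons]
    exact R.num_eq.2 (R.E.trans (R.sub_zero _ _) (R.add_zero _ _))
  · intro Δ ρ θ a e h
    simp only [R.add_sub, R.sub_sub, Tm.sub, scons] at h ⊢
    rw [← h, ← R.num_succ_sub_succ (R.add _ a) a, num_sub, num_sub]
    congr 1
    exact R.num_eq.2 (R.add_succ _ _ _)

theorem num_zero_sub (t : Tm L b) : R.num Γ (R.sub R.zero t) = R.num Γ R.zero := by
  have := R.ind_eq (s := R.sub R.zero (.var 0)) (t := R.zero)
    (σ := .var) (τ := .var) (Γ := Γ) ?_ ?_ t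
  · simpa only [R.zero_sub, R.sub_sub, Tm.sub, scons] using this
  · simp only [R.zero_sub, R.sub_sub, Tm.sub, scons]
    exact R.num_eq.2 (R.sub_zero _ _)
  · intro Δ ρ θ a e h
    simp only [R.zero_sub, R.sub_sub, Tm.sub, scons] at h ⊢
    exact R.num_eq.2 (R.E.trans (R.sub_succ _ _ _)
      (R.E.trans (R.pd_congr (R.num_eq.1 h)) (R.pd_zero _)))

theorem num_sub_add (s t : Tm L b) : R.num Γ (R.sub s (R.add s t)) = R.num Γ R.zero := by
  have := R.ind_eq (s := R.sub (.var 0) (R.add (.var 0) (.var 1))) (t := R.zero)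
    (σ := scons t .var) (τ := .var) (Γ := Γ) ?_ ?_ s
  · simpa only [R.zero_sub, R.add_sub, R.sub_sub, Tm.sub, scons] using this
  · simp only [R.zero_sub, R.add_sub, R.sub_sub, Tm.sub, scons]
    exact R.num_zero_sub _
  · intro Δ ρ θ a e h
    simp only [R.zero_sub, R.add_sub, R.sub_sub, Tm.sub, scons] at h ⊢
    rw [← h, ← R.num_succ_sub_succ a (R.add a _), num_sub, num_sub]
    congr 1
    exact R.num_eq.2 (R.succ_add _ _)

theorem add_sub_cancel (x y : R.Num Γ) : x + y - y = x := by
  obtain ⟨s, rfl⟩ := R.num_surj x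
  obtain ⟨t, rfl⟩ := R.num_surj y
  exact R.num_add_sub s t

theorem sub_add_eq_zero (x y : R.Num Γ) : x - (x + y) = 0 := by
  obtain ⟨s, rfl⟩ := R.num_surj x
  obtain ⟨t, rfl⟩ := R.num_surj y
  exact R.num_sub_add s t

instance : IsCancelAdd (R.Num Γ) :=
  have h : ∀ a b c : R.Num Γ, b + a = c + a → b = c := fun a b c h => by
    rw [← R.add_sub_cancel b a, h, R.add_sub_cancel]
  { add_right_cancel := fun a b c => h a b c
    add_left_cancel := fun a b c h' => h a b c (by simpa [_root_.add_comm] using h') }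

theorem one_ne_zero_elim {x : R.Num Γ} (h : x + 1 = 0) {C : Fm L b} : Deriv Ax Γ C := by
  obtain ⟨s, rfl⟩ := R.num_surj x
  rw [← num_succ, ← num_zero, num_eq] at h
  exact (R.succ_ne_zero Γ s).negE h

end Arithmetic


namespace Arithmetic
variable {Ax : Fm L b → Prop} (R : Arithmetic Ax) {Γ Δ : List (Fm L b)}

/-! ### Order and case distinctions -/

theorem mul_ren (s t : Tm L b) (ρ θ : ℕ → ℕ) :
    (R.mul s t).ren ρ θ = R.mul (s.ren ρ θ) (t.ren ρ θ) := by
  simp only [Tm.ren_eq_sub, R.mul_sub]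

theorem num_mono {s t : Tm L b} {ρ θ : ℕ → ℕ} (h : R.num Γ s = R.num Γ t) (e : Ext ρ θ Γ Δ) :
    R.num Δ (s.ren ρ θ) = R.num Δ (t.ren ρ θ) := R.num_eq.2 ((R.num_eq.1 h).ren e)

theorem num_weaken {s t : Tm L b} (h : R.num Γ s = R.num Γ t) (e : Γ ⊆ Δ) :
    R.num Δ s = R.num Δ t := R.num_eq.2 ((R.num_eq.1 h).weaken e)

theorem num_app {u : Fn L b} {s t : Tm L b} (h : R.num Γ s = R.num Γ t) :
    R.num Γ (.app u s) = R.num Γ (.app u t) := R.num_eq.2 (R.E.app (R.num_eq.1 h))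

theorem num_add_sub_cancel {x y d : R.Num Γ} (h : x = y + d) : x - y = d := by
  rw [h, _root_.add_comm, R.add_sub_cancel]

/-- Case distinction between 0 and successors. -/
theorem cases (x : Tm L b) {C : Fm L b} (h0 : ∀ Δ, Γ ⊆ Δ → R.num Δ x = 0 → Deriv Ax Δ C)
    (hs : ∀ Δ y, Γ ⊆ Δ → R.num Δ x = R.num Δ y + 1 → Deriv Ax Δ C) : Deriv Ax Γ C := by
  have h : Deriv Ax Γ (.or (.eq x R.zero) (.eq x (R.succ (R.pd x)))) := by
    have := R.ind (A := .or (.eq (.var 0) R.zero) (.eq (.var 0) (R.succ (R.pd (.var 0)))))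
      (σ := .var) (τ := .var) (Γ := Γ) ?_ ?_ x
    · simpa only [Fm.sub, Tm.sub, R.zero_sub, R.succ_sub, R.pd_sub, scons] using this
    · simp only [Fm.sub, Tm.sub, R.zero_sub, R.succ_sub, R.pd_sub, scons]
      exact .orI1 (R.E.refl _ _)
    · intro Δ ρ θ a e h
      simp only [Fm.sub, Tm.sub, R.zero_sub, R.succ_sub, R.pd_sub, scons]
      exact .orI2 (R.E.symm (R.succ_congr (R.pd_succ _ _)))
  refine .orE h (h0 _ (List.subset_cons_self _ _) (R.num_eq.2 .head))
    (hs _ (R.pd x) (List.subset_cons_self _ _) ?_)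
  rw [← num_succ]
  exact R.num_eq.2 .head

/-- Case distinction between y ≤ x and x < y, with the differences as witnesses. -/
theorem le_or_lt (x y : Tm L b) {C : Fm L b}
    (h1 : ∀ Δ d, Γ ⊆ Δ → R.num Δ x = R.num Δ y + R.num Δ d → Deriv Ax Δ C)
    (h2 : ∀ Δ d, Γ ⊆ Δ → R.num Δ y = R.num Δ x + R.num Δ d + 1 → Deriv Ax Δ C) : Deriv Ax Γ C := by
  have h : Deriv Ax Γ (.or (.eq x (R.add y (R.sub x y)))
      (.eq y (R.succ (R.add x (R.sub y (R.succ x)))))) := by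
    have := R.ind (A := .or (.eq (.var 0) (R.add (.var 1) (R.sub (.var 0) (.var 1))))
      (.eq (.var 1) (R.succ (R.add (.var 0) (R.sub (.var 1) (R.succ (.var 0)))))))
      (σ := scons y .var) (τ := .var) (Γ := Γ) ?_ ?_ x
    · simpa only [Fm.sub, Tm.sub, R.add_sub, R.succ_sub, R.sub_sub, scons] using this
    · simp only [Fm.sub, Tm.sub, R.add_sub, R.succ_sub, R.sub_sub, scons]
      refine R.cases y (fun Δ _ h => .orI1 (R.num_eq.1 ?_)) fun Δ z _ h => .orI2 (R.num_eq.1 ?_)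
      · rw [num_add, num_sub, h, num_zero, _root_.zero_add, R.num_add_sub_cancel (d := 0)]
        simp
      · rw [num_succ, num_add, num_sub, num_succ, num_zero, R.num_add_sub_cancel (d := R.num Δ z), h]
          <;> simp [h, _root_.add_comm]
    · intro Δ ρ θ a e h
      simp only [Fm.sub, Tm.sub, R.add_sub, R.succ_sub, R.sub_sub, scons] at h ⊢
      generalize y.ren ρ θ = y at h
      have key : ∀ Δ' d, R.num Δ' (R.succ a) = R.num Δ' y + d →
          Deriv Ax Δ' (.eq (R.succ a) (R.add y (R.sub (R.succ a) y))) := by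
        intro Δ' d h
        refine R.num_eq.1 ?_
        rw [num_add, num_sub, R.num_add_sub_cancel h, h]
      refine .orE h (.orI1 ?_) ?_
      · refine key _ (R.num _ (R.sub a y) + 1) ?_
        have := R.num_eq.2 (Deriv.head (Ax := Ax) (A := .eq a (R.add y (R.sub a y))) (Γ := Δ))
        rw [num_succ, this, num_add, _root_.add_assoc]
      · have h3 := R.num_eq.2 (Deriv.head (Ax := Ax)
          (A := .eq y (R.succ (R.add a (R.sub y (R.succ a))))) (Γ := Δ))
        refine R.cases (R.sub y (R.succ a)) (fun Δ' e h => .orI1 (key _ 0 ?_))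
          fun Δ' z e h => .orI2 (R.num_eq.1 ?_)
        · have h4 := R.num_weaken h3 e
          rw [num_succ, num_add, h] at h4
          rw [num_succ, h4]; simp
        · have h4 := R.num_weaken h3 e
          rw [num_succ, num_add, h] at h4
          have h5 : R.num Δ' y = R.num Δ' (R.succ (R.succ a)) + R.num Δ' z := by
            rw [num_succ, num_succ, h4]; grind
          rw [num_succ, num_add, num_sub, R.num_add_sub_cancel h5, h5, num_succ, num_succ]
          grind
  refine .orE h (h1 _ (R.sub x y) (List.subset_cons_self _ _) (R.num_eq.2 .head))
    (h2 _ (R.sub y (R.succ x)) (List.subset_cons_self _ _) ?_)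
  rw [← num_add, ← num_succ]
  exact R.num_eq.2 .head

/-- Cancellation of a factor a + 1. -/
theorem mul_cancel {c a x y : Tm L b} (hc : R.num Γ c = R.num Γ a + 1)
    (h : R.num Γ c * R.num Γ x = R.num Γ c * R.num Γ y) : R.num Γ x = R.num Γ y := by
  have key : ∀ Δ (x y d : Tm L b), R.num Δ c = R.num Δ a + 1 →
      R.num Δ c * R.num Δ x = R.num Δ c * R.num Δ y → R.num Δ y = R.num Δ x + R.num Δ d + 1 →
      ∀ C, Deriv Ax Δ C := by
    intro Δ x y d hc h hd C
    refine R.one_ne_zero_elim (x := R.num Δ a * R.num Δ d + R.num Δ a + R.num Δ d) ?_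
    refine add_left_cancel (a := R.num Δ c * R.num Δ x) ?_
    rw [hd] at h
    grind
  rw [← num_mul, ← num_mul] at h
  rw [← num_succ] at hc
  refine R.num_eq.2 (R.le_or_lt x y (fun Δ d e hd => ?_) fun Δ d e hd => ?_)
  · refine R.cases d (fun Δ' e' h0 => R.num_eq.1 ?_) fun Δ' d' e' hs => ?_
    all_goals have hd' := R.num_weaken (s := x) (t := R.add y d) hd e'
    · rw [hd', num_add, h0, _root_.add_zero]
    · have e'' : Γ ⊆ Δ' := fun _ hx => e' (e hx)
      refine key Δ' y x d' ?_ (R.num_weaken h e'').symm ?_ _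
      · rw [R.num_weaken hc e'', num_succ]
      · rw [hd', num_add, hs, _root_.add_assoc]
  · refine key Δ x y d ?_ (R.num_weaken h e) hd _
    rw [R.num_weaken hc e, num_succ]

/-! ### Square roots and pairing -/

/-- r² ≤ n ≤ r² + 2r, expressed by truncated subtraction. -/
def IsSqrt (n r : Tm L b) : Fm L b :=
  .and (.eq n (R.add (R.mul r r) (R.sub n (R.mul r r))))
    (.eq (R.add r r) (R.add (R.sub n (R.mul r r)) (R.sub (R.add r r) (R.sub n (R.mul r r)))))

theorem isSqrt_sub (n r : Tm L b) (σ : ℕ → Tm L b) (τ : ℕ → Fn L b) :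
    (R.IsSqrt n r).sub σ τ = R.IsSqrt (n.sub σ τ) (r.sub σ τ) := by
  simp only [IsSqrt, Fm.sub, R.add_sub, R.mul_sub, R.sub_sub]

theorem isSqrt_intro {n r : Tm L b} {i j : R.Num Γ} (h : R.num Γ n = R.num Γ r * R.num Γ r + i)
    (h' : R.num Γ r + R.num Γ r = i + j) : Deriv Ax Γ (R.IsSqrt n r) := by
  have h1 : R.num Γ n - R.num Γ r * R.num Γ r = i := R.num_add_sub_cancel h
  refine .andI (R.num_eq.1 ?_) (R.num_eq.1 ?_)
  · rw [num_add, num_sub, num_mul, h1, h]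
  · have h2 : R.num Γ (R.sub n (R.mul r r)) = i := h1
    rw [num_add, num_add, R.num_sub (R.add r r), num_add, h2, R.num_add_sub_cancel h', h']

theorem isSqrt_elim {n r : Tm L b} (h : Deriv Ax Γ (R.IsSqrt n r)) : ∃ i j : R.Num Γ,
    R.num Γ n = R.num Γ r * R.num Γ r + i ∧ R.num Γ r + R.num Γ r = i + j :=
  ⟨R.num Γ (R.sub n (R.mul r r)), R.num Γ (R.sub (R.add r r) (R.sub n (R.mul r r))),
    R.num_eq.2 h.andE1, R.num_eq.2 h.andE2⟩

/-- Every number has an integer square root, by induction: the root r of n is also that of n + 1 unless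
n = r² + 2r. -/
theorem exists_isSqrt (n : Tm L b) : Deriv Ax Γ (.ex0 (R.IsSqrt (n.ren Nat.succ id) (.var 0))) := by
  have := R.ind (A := .ex0 (R.IsSqrt (.var 1) (.var 0))) (σ := .var) (τ := .var) (Γ := Γ) ?_ ?_ n
  · simp only [Fm.sub, R.isSqrt_sub] at this
    exact this
  · refine .envEx0I R.zero ?_
    rw [R.isSqrt_sub]
    exact R.isSqrt_intro (i := 0) (j := 0) (by simp [Tm.sub, scons, num_zero])
      (by simp [Tm.sub, scons, num_zero])
  · intro Δ ρ θ a e h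
    refine Deriv.envEx0E h fun Δ' ρ' θ' r e' h' => ?_
    rw [R.isSqrt_sub] at h'
    simp only [Tm.sub, scons] at h'
    obtain ⟨i, j, h1, h2⟩ := R.isSqrt_elim h'
    obtain ⟨i, rfl⟩ := R.num_surj i
    obtain ⟨j, rfl⟩ := R.num_surj j
    rw [Fm.sub_ren]
    refine R.cases j (fun Δ'' e'' h => .envEx0I (R.succ r) ?_) fun Δ'' j' e'' h => .envEx0I r ?_
    all_goals
      rw [← num_mul, ← num_add] at h1
      rw [← num_add, ← num_add] at h2
      have h1 := R.num_weaken h1 e''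
      have h2 := R.num_weaken h2 e''
      rw [num_add, num_mul] at h1
      rw [num_add, num_add, h] at h2
      rw [R.isSqrt_sub]
      simp only [Tm.sub, scons, R.succ_ren]
    · refine R.isSqrt_intro (i := 0) (j := R.num Δ'' (R.succ r) + R.num Δ'' (R.succ r)) ?_ ?_
      · rw [num_succ, num_succ, h1]; grind
      · simp
    · refine R.isSqrt_intro (i := R.num Δ'' i + 1) (j := R.num Δ'' j') ?_ ?_
      · rw [num_succ, h1]; grind
      · rw [h2]; grind

theorem isSqrt_uniq {n r k : Tm L b} {i j : R.Num Γ} (h : Deriv Ax Γ (R.IsSqrt n r))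
    (h1 : R.num Γ n = R.num Γ k * R.num Γ k + i) (h2 : R.num Γ k + R.num Γ k = i + j) :
    R.num Γ r = R.num Γ k := by
  -- if r > k, then n ≥ (k + 1)² > n
  have key : ∀ Δ r k d, Deriv Ax Δ (R.IsSqrt n r) → Deriv Ax Δ (R.IsSqrt n k) →
      R.num Δ r = R.num Δ k + d + 1 → ∀ C, Deriv Ax Δ C := by
    intro Δ r k d h h' hd C
    obtain ⟨i, j, h1, h2⟩ := R.isSqrt_elim h
    obtain ⟨i', j', h3, h4⟩ := R.isSqrt_elim h'
    refine R.one_ne_zero_elim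
      (x := d * d + 2 * d + 2 * R.num Δ k * d + i + j') ?_
    rw [hd] at h1 h2
    refine add_left_cancel (a := R.num Δ k * R.num Δ k + R.num Δ k + R.num Δ k) ?_
    grind
  have h' := R.isSqrt_intro h1 h2
  refine R.num_eq.2 (R.le_or_lt r k (fun Δ d e hd => ?_) fun Δ d e hd =>
    key Δ k r _ (h'.weaken e) (h.weaken e) hd _)
  refine R.cases d (fun Δ' e' h0 => R.num_eq.1 ?_) fun Δ' d' e' hs => ?_
  all_goals
    have hd' := R.num_weaken (s := r) (t := R.add k d) hd e'
  · rw [hd', num_add, h0, _root_.add_zero]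
  · refine key Δ' r k (R.num Δ' d') (h.weaken fun _ hx => e' (e hx))
      (h'.weaken fun _ hx => e' (e hx)) ?_ _
    rw [hd', num_add, hs, _root_.add_assoc]

/-- The functor `u` is the integer square root. -/
def Sqrt (u : Fn L b) : Fm L b := .all0 (R.IsSqrt (.var 0) (.app (u.ren Nat.succ id) (.var 0)))

theorem sqrt_sub (u : Fn L b) (σ : ℕ → Tm L b) (τ : ℕ → Fn L b) :
    (R.Sqrt u).sub σ τ = R.Sqrt (u.sub σ τ) := by
  simp only [Sqrt, Fm.sub, Tm.sub, R.isSqrt_sub, Fn.ren_sub, Fn.sub_ren, id, upN]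

/-- The integer square root is a function, by QF-AC₀₀. -/
theorem exists_sqrt (Γ : List (Fm L b)) : Deriv Ax Γ (.ex1 (R.Sqrt (.var 0))) := by
  refine R.E.choice (A := R.IsSqrt (.var 1) (.var 0)) (σ := .var) (τ := .var) ⟨trivial, trivial⟩
    ?_ fun Δ ρ θ α e h => ?_
  · refine .envAll0I fun Δ ρ θ a e => ?_
    have := R.exists_isSqrt (Γ := Δ) a
    simp only [Fm.sub, R.isSqrt_sub]
    exact this
  · have h1 := h _ _ _ (.var 0) (.shift0 Δ)
    rw [R.isSqrt_sub] at h1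
    refine Deriv.ex1I α ?_
    simp only [Fm.inst1, Fm.ren_eq_sub, R.sqrt_sub]
    exact .all0I h1

/-- √(k² + i) = k when i ≤ 2k -/
theorem sqrt_eq {u : Fn L b} (h : Deriv Ax Γ (R.Sqrt u)) {n k : Tm L b} {i j : R.Num Γ}
    (h1 : R.num Γ n = R.num Γ k * R.num Γ k + i) (h2 : R.num Γ k + R.num Γ k = i + j) :
    R.num Γ (.app u n) = R.num Γ k := by
  have := h.all0E n
  rw [Fm.inst0, R.isSqrt_sub] at this
  simp only [Tm.sub, Fn.ren_sub, single0, Fn.sub_var, id] at this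
  exact R.isSqrt_uniq this h1 h2

/-- The pair of x and y is (x + y)² + (x + y) + x. -/
def pr (x y : Tm L b) : Tm L b :=
  R.add (R.mul (R.add x y) (R.add x y)) (R.add (R.add x y) x)

/-- The first component of the pair n, where the functor `u` is the integer square root. -/
def p1 (u : Fn L b) (n : Tm L b) : Tm L b :=
  R.sub (R.sub n (R.mul (.app u n) (.app u n))) (.app u n)

/-- The second component of the pair n, where the functor `u` is the integer square root. -/
def p2 (u : Fn L b) (n : Tm L b) : Tm L b := R.sub (.app u n) (R.p1 u n)

theorem sqrt_pr {u : Fn L b} (h : Deriv Ax Γ (R.Sqrt u)) (x y : Tm L b) :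
    R.num Γ (.app u (R.pr x y)) = R.num Γ (R.add x y) :=
  R.sqrt_eq h (i := R.num Γ (R.add (R.add x y) x)) (j := R.num Γ y) rfl (by
    simp only [num_add]; grind)

theorem num_p1_pr {u : Fn L b} (h : Deriv Ax Γ (R.Sqrt u)) (x y : Tm L b) :
    R.num Γ (R.p1 u (R.pr x y)) = R.num Γ x := by
  rw [p1, num_sub, num_sub, num_mul, R.sqrt_pr h]
  exact R.num_add_sub_cancel (R.num_add_sub_cancel rfl)

theorem num_p2_pr {u : Fn L b} (h : Deriv Ax Γ (R.Sqrt u)) (x y : Tm L b) :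
    R.num Γ (R.p2 u (R.pr x y)) = R.num Γ y := by
  rw [p2, num_sub, R.num_p1_pr h, R.sqrt_pr h]
  exact R.num_add_sub_cancel rfl

theorem pr_sub (x y : Tm L b) (σ : ℕ → Tm L b) (τ : ℕ → Fn L b) :
    (R.pr x y).sub σ τ = R.pr (x.sub σ τ) (y.sub σ τ) := by
  simp only [pr, R.add_sub, R.mul_sub]

theorem p1_sub (u : Fn L b) (n : Tm L b) (σ : ℕ → Tm L b) (τ : ℕ → Fn L b) :
    (R.p1 u n).sub σ τ = R.p1 (u.sub σ τ) (n.sub σ τ) := by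
  simp only [p1, R.sub_sub, R.mul_sub, Tm.sub]

theorem p2_sub (u : Fn L b) (n : Tm L b) (σ : ℕ → Tm L b) (τ : ℕ → Fn L b) :
    (R.p2 u n).sub σ τ = R.p2 (u.sub σ τ) (n.sub σ τ) := by
  simp only [p2, R.sub_sub, R.p1_sub, Tm.sub]

theorem num_pr_congr {x x' y y' : Tm L b} (h : R.num Γ x = R.num Γ x')
    (h' : R.num Γ y = R.num Γ y') : R.num Γ (R.pr x y) = R.num Γ (R.pr x' y') := by
  simp only [pr, num_add, num_mul, h, h']

theorem num_p1_congr {u : Fn L b} {n n' : Tm L b} (h : R.num Γ n = R.num Γ n') :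
    R.num Γ (R.p1 u n) = R.num Γ (R.p1 u n') := by
  simp only [p1, num_sub, num_mul, h, R.num_app h]

theorem num_p2_congr {u : Fn L b} {n n' : Tm L b} (h : R.num Γ n = R.num Γ n') :
    R.num Γ (R.p2 u n) = R.num Γ (R.p2 u n') := by
  simp only [p2, num_sub, R.num_p1_congr h, R.num_app h]

/-- The pairing of arithmetic, with the integer square root as parameter. -/
def pairing {Ax : Fm L false → Prop} (R : Arithmetic Ax) : Pairing Ax where
  ax := R.Sqrt
  pr := R.pr
  p1 := R.p1
  p2 := R.p2
  ax_sub := R.sqrt_sub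
  pr_sub := R.pr_sub
  p1_sub := R.p1_sub
  p2_sub := R.p2_sub
  exists_ax := R.exists_sqrt
  p1_pr h x y := R.num_eq.1 (R.num_p1_pr h x y)
  p2_pr h x y := R.num_eq.1 (R.num_p2_pr h x y)
  pr_congr h h' := R.num_eq.1 (R.num_pr_congr (R.num_eq.2 h) (R.num_eq.2 h'))

end Arithmetic


theorem call_of_not_unary {f : L.Con} (h : ¬ L.Unary f) (ts : Fin (L.nArg f) → Tm L b)
    (us : Fin (L.fArg f) → Fn L b) : call f ts us = .cst f h ts us := dif_neg h

theorem EqBase.call_congr {Ax : Fm L b → Prop} (E : EqBase Ax) {Γ : List (Fm L b)} {f : L.Con}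
    {ts ts' : Fin (L.nArg f) → Tm L b} {us : Fin (L.fArg f) → Fn L b}
    (H : ∀ i, Deriv Ax Γ (.eq (ts i) (ts' i))) :
    Deriv Ax Γ (.eq (call f ts us) (call f ts' us)) := by
  unfold call
  split
  · exact E.app (H _)
  · exact E.cst_congr H

/-- Since number arguments can always be replaced, only function arguments matter for the
extensionality of the constants. -/
theorem EqBase.base {Ax : Fm L b → Prop} (E : EqBase Ax)
    (H : ∀ (Γ : List (Fm L b)) f (h : ¬ L.Unary f) ts us us', L.fArg f ≠ 0 →
      (∀ j, Deriv Ax Γ (feq (us j) (us' j))) → Deriv Ax Γ (.eq (.cst f h ts us) (.cst f h ts us'))) :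
    Base Ax where
  toEqBase := E
  cst {Γ f h ts us ts' us'} h1 h2 := by
    refine E.trans (E.cst_congr h1) ?_
    by_cases hf : L.fArg f = 0
    · have : us = us' := funext fun j => (Fin.cast hf j).elim0
      rw [this]; exact E.refl _ _
    · exact H Γ f h ts' us us' hf h2

namespace EL

/-! ### Equality and arithmetic in EL -/

theorem prim_sub {n : ℕ} (p : PR n) (ts : Fin n → Tm ELSig b) (σ : ℕ → Tm ELSig b)
    (τ : ℕ → Fn ELSig b) : (prim p ts).sub σ τ = prim p fun i => (ts i).sub σ τ := by
  unfold prim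
  rw [call_sub]
  congr 1
  funext i; exact i.elim0

theorem zero_sub (σ : ℕ → Tm ELSig b) (τ : ℕ → Fn ELSig b) : (zero : Tm ELSig b).sub σ τ = zero := by
  unfold zero
  rw [call_sub]
  congr 1 <;> funext i <;> exact i.elim0

theorem recr_sub (t s : Tm ELSig b) (u : Fn ELSig b) (σ : ℕ → Tm ELSig b) (τ : ℕ → Fn ELSig b) :
    (recr t u s).sub σ τ = recr (t.sub σ τ) (u.sub σ τ) (s.sub σ τ) := by
  unfold recr
  rw [call_sub]
  congr 1 <;> funext i <;> fin_cases i <;> rfl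

theorem succ_sub (t : Tm ELSig b) (σ : ℕ → Tm ELSig b) (τ : ℕ → Fn ELSig b) :
    (succ t).sub σ τ = succ (t.sub σ τ) := by
  unfold succ
  rw [prim_sub]
  congr 1; funext i; fin_cases i; rfl

theorem prim_sub₂ (p : PR 2) (s t : Tm ELSig b) (σ : ℕ → Tm ELSig b) (τ : ℕ → Fn ELSig b) :
    (prim p ![s, t]).sub σ τ = prim p ![s.sub σ τ, t.sub σ τ] := by
  rw [prim_sub]
  congr 1; funext i; fin_cases i <;> rfl

theorem prim_sub₁ (p : PR 1) (s : Tm ELSig b) (σ : ℕ → Tm ELSig b) (τ : ℕ → Fn ELSig b) :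
    (prim p ![s]).sub σ τ = prim p ![s.sub σ τ] := by
  rw [prim_sub]
  congr 1; funext i; fin_cases i; rfl

theorem pair_sub (s t : Tm ELSig b) (σ : ℕ → Tm ELSig b) (τ : ℕ → Fn ELSig b) :
    (pair s t).sub σ τ = pair (s.sub σ τ) (t.sub σ τ) := by
  unfold pair
  simp only [prim_sub₂, succ_sub, zero_sub]

/-- The description of the predecessor. -/
def pdD : PR 1 := .prec (.zero 0) (.proj 2 0)
/-- The description of x ∸ y, as a function of (y, x), by recursion on y. -/
def subD : PR 2 := .prec (.proj 1 0) (.comp pdD ![.proj 3 1])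
/-- The description of the sign. -/
def sgD : PR 1 := .prec (.zero 0) (.comp .succ ![.zero 2])

section
variable {Ax : Fm ELSig b → Prop} (hA : ∀ A, Arith A → Ax A) (hQ : ∀ A, QFAC A → Ax A)
include hA

theorem arith_sub {A : Fm ELSig b} (h : Arith A) (Γ : List (Fm ELSig b)) (σ : ℕ → Tm ELSig b)
    (τ : ℕ → Fn ELSig b) : Deriv Ax Γ (A.sub σ τ) :=
  ((Deriv.ax (hA _ h)).sub_nil σ τ).weaken (List.nil_subset Γ)

include hQ in
theorem eqBase : EqBase Ax where
  refl Γ t := arith_sub hA .refl Γ (fun _ => t) .var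
  euclid {Γ r s t} h h' := by
    have := arith_sub hA (.repl (.eq (.var 0) (.var 3)) 0 1) Γ
      (scons r (scons s (scons t .var))) .var
    exact this.impE (.andI h' h)
  app {Γ u s t} h := by
    have := arith_sub hA (.repl (.eq (.app (.var 0) (.var 1)) (.app (.var 0) (.var 0))) 0 1) Γ
      (scons s (scons t .var)) (scons u .var)
    exact this.impE (.andI (arith_sub hA .refl Γ (fun _ => .app u s) .var) h)
  qfac h Γ := .ax (hQ _ h)

variable {Γ : List (Fm ELSig b)}

omit hA in
theorem exists_env {n : ℕ} (ts : Fin n → Tm ELSig b) : ∃ σ : ℕ → Tm ELSig b, ∀ i : Fin n, σ i = ts i :=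
  ⟨fun k => if h : k < n then ts ⟨k, h⟩ else .var 0, fun i => by simp⟩

theorem prim_zero {n : ℕ} (ts : Fin n → Tm ELSig b) : Deriv Ax Γ (.eq (prim (.zero n) ts) zero) := by
  obtain ⟨σ, hσ⟩ := exists_env ts
  have := arith_sub hA (.prim_zero n) Γ σ .var
  simpa only [Fm.sub, prim_sub, Tm.sub, hσ, zero_sub] using this

theorem prim_proj {n : ℕ} (i : Fin n) (ts : Fin n → Tm ELSig b) :
    Deriv Ax Γ (.eq (prim (.proj n i) ts) (ts i)) := by
  obtain ⟨σ, hσ⟩ := exists_env ts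
  have := arith_sub hA (.prim_proj n i) Γ σ .var
  simpa only [Fm.sub, prim_sub, Tm.sub, hσ, zero_sub] using this

theorem prim_comp {m n : ℕ} (g : PR m) (h : Fin m → PR n) (ts : Fin n → Tm ELSig b) :
    Deriv Ax Γ (.eq (prim (.comp g h) ts) (prim g fun j => prim (h j) ts)) := by
  obtain ⟨σ, hσ⟩ := exists_env ts
  have := arith_sub hA (.prim_comp g h) Γ σ .var
  simpa only [Fm.sub, prim_sub, Tm.sub, hσ, zero_sub] using this

theorem prim_prec_zero {n : ℕ} (g : PR n) (h : PR (n + 2)) (ts : Fin n → Tm ELSig b) :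
    Deriv Ax Γ (.eq (prim (.prec g h) (Fin.cons zero ts)) (prim g ts)) := by
  obtain ⟨σ, hσ⟩ := exists_env ts
  have := arith_sub hA (.prim_prec_zero g h) Γ σ .var
  simp only [Fm.sub, prim_sub, Tm.sub, hσ] at this
  convert this using 3
  funext i; cases i using Fin.cases <;> simp [zero_sub, Tm.sub, hσ]

theorem prim_prec_succ {n : ℕ} (g : PR n) (h : PR (n + 2)) (t : Tm ELSig b)
    (ts : Fin n → Tm ELSig b) :
    Deriv Ax Γ (.eq (prim (.prec g h) (Fin.cons (succ t) ts))
      (prim h (Fin.cons t (Fin.cons (prim (.prec g h) (Fin.cons t ts)) ts)))) := by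
  obtain ⟨σ, hσ⟩ := exists_env ts
  have := arith_sub hA (.prim_prec_succ g h) Γ (scons t σ) .var
  simp only [Fm.sub, prim_sub] at this
  convert this using 3
  · funext i; cases i using Fin.cases <;> simp [succ_sub, Tm.sub, hσ, scons]
  · funext i
    cases i using Fin.cases with
    | zero => simp [Tm.sub, scons]
    | succ i =>
      cases i using Fin.cases with
      | zero =>
        simp only [Fin.cons_succ, Fin.cons_zero, prim_sub]
        congr 1
        funext i; cases i using Fin.cases <;> simp [Tm.sub, hσ, scons]
      | succ i => simp [Tm.sub, hσ, scons]

end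

end EL

namespace EL

section
variable {Ax : Fm ELSig b → Prop} (hA : ∀ A, Arith A → Ax A) (hQ : ∀ A, QFAC A → Ax A)
  {Γ : List (Fm ELSig b)}
include hA hQ

theorem prim_congr {n : ℕ} (p : PR n) {ts ts' : Fin n → Tm ELSig b}
    (h : ∀ i, Deriv Ax Γ (.eq (ts i) (ts' i))) : Deriv Ax Γ (.eq (prim p ts) (prim p ts')) :=
  (eqBase hA hQ).call_congr (f := .prim n p) h

/-- The recursion equation for a description in which the step only uses the previous value. -/
theorem prec_comp {n : ℕ} (g : PR (n + 1)) (f : PR 1) (t : Tm ELSig b) (ts : Fin (n + 1) → Tm ELSig b) :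
    Deriv Ax Γ (.eq (prim (.prec g (.comp f ![.proj (n + 3) 1])) (Fin.cons (succ t) ts))
      (prim f ![prim (.prec g (.comp f ![.proj (n + 3) 1])) (Fin.cons t ts)])) := by
  refine (eqBase hA hQ).trans (prim_prec_succ hA _ _ _ _)
    ((eqBase hA hQ).trans (prim_comp hA _ _ _) (prim_congr hA hQ _ fun j => ?_))
  obtain rfl : j = 0 := Subsingleton.elim _ _
  exact prim_proj hA 1 _

/-- The recursion equation for a binary description in which the step only uses the previous value
and the parameter. -/
theorem prec_comp₂ (g : PR 1) (f : PR 2) (s t : Tm ELSig b) :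
    Deriv Ax Γ (.eq (prim (.prec g (.comp f ![.proj 3 1, .proj 3 2])) ![succ t, s])
      (prim f ![prim (.prec g (.comp f ![.proj 3 1, .proj 3 2])) ![t, s], s])) := by
  refine (eqBase hA hQ).trans (prim_prec_succ hA _ _ t ![s])
    ((eqBase hA hQ).trans (prim_comp hA _ _ _) (prim_congr hA hQ _ fun j => ?_))
  fin_cases j
  · exact prim_proj hA 1 _
  · exact prim_proj hA 2 _

/-- Addition in EL. -/
def addOps : AddOps Ax where
  E := eqBase hA hQ
  zero := zero
  succ := succ
  add s t := prim addD ![t, s]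
  zero_sub := zero_sub
  succ_sub := succ_sub
  add_sub _ _ := prim_sub₂ _ _ _
  ind_ax h _ := .ax (hA _ (.ind _ h))
  add_zero _ s := (eqBase hA hQ).trans (prim_prec_zero hA _ _ ![s]) (prim_proj hA 0 _)
  add_succ _ s t := prec_comp hA hQ _ _ t ![s]

theorem sgD_succ (s : Tm ELSig b) :
    Deriv Ax Γ (.eq (prim sgD ![succ s]) (succ zero)) := by
  refine (eqBase hA hQ).trans (prim_prec_succ hA _ _ s ![])
    ((eqBase hA hQ).trans (prim_comp hA _ _ _) (prim_congr hA hQ _ fun j => ?_))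
  obtain rfl : j = 0 := Subsingleton.elim _ _
  exact prim_zero hA _

/-- Arithmetic in EL. -/
def arithmetic : Arithmetic Ax where
  toAddOps := addOps hA hQ
  mul s t := prim mulD ![t, s]
  pd s := prim pdD ![s]
  sub s t := prim subD ![t, s]
  mul_sub _ _ := prim_sub₂ _ _ _
  pd_sub _ := prim_sub₁ _ _
  sub_sub _ _ := prim_sub₂ _ _ _
  succ_ne_zero Γ s := by
    -- from S(s) = 0 follows S(0) = sg(S(s)) = sg(0) = 0
    have h : Deriv Ax (.eq (succ s) zero :: Γ) (.eq (prim sgD ![succ s]) (prim sgD ![zero])) :=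
      prim_congr hA hQ _ fun i => by fin_cases i; exact .head
    refine .negI ((eqBase hA hQ).euclid (sgD_succ hA hQ s) ((eqBase hA hQ).trans h
      ((eqBase hA hQ).trans (prim_prec_zero hA _ _ ![]) (prim_zero hA _)))) ?_
    have := arith_sub hA .succ_ne_zero (.eq (succ s) zero :: Γ) .var .var
    simp only [Fm.sub, succ_sub, zero_sub] at this
    exact this
  mul_zero _ s := (eqBase hA hQ).trans (prim_prec_zero hA _ _ ![s]) (prim_zero hA _)
  mul_succ _ s t := (eqBase hA hQ).trans (prec_comp₂ hA hQ _ _ s t) ((addOps hA hQ).add_comm _ _)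
  pd_zero _ := (eqBase hA hQ).trans (prim_prec_zero hA _ _ ![]) (prim_zero hA _)
  pd_succ _ s := (eqBase hA hQ).trans (prim_prec_succ hA _ _ s ![]) (prim_proj hA 0 _)
  sub_zero _ s := (eqBase hA hQ).trans (prim_prec_zero hA _ _ ![s]) (prim_proj hA 0 _)
  sub_succ _ s t := prec_comp hA hQ _ _ t ![s]

/-! ### Extensionality of the recursor -/

omit hQ in
theorem recr_zero (s : Tm ELSig b) (u : Fn ELSig b) : Deriv Ax Γ (.eq (recr s u zero) s) := by
  have := arith_sub hA .rec_zero Γ (scons s .var) (scons u .var)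
  simp only [Fm.sub, recr_sub, zero_sub] at this
  exact this

omit hQ in
theorem recr_succ (s t : Tm ELSig b) (u : Fn ELSig b) :
    Deriv Ax Γ (.eq (recr s u (succ t)) (.app u (pair (recr s u t) t))) := by
  have := arith_sub hA .rec_succ Γ (scons s (scons t .var)) (scons u .var)
  simp only [Fm.sub, recr_sub, succ_sub, pair_sub, Tm.sub] at this
  exact this

theorem pair_congr {s t s' t' : Tm ELSig b} (h : Deriv Ax Γ (.eq s s')) (h' : Deriv Ax Γ (.eq t t')) :
    Deriv Ax Γ (.eq (pair s t) (pair s' t')) := (addOps hA hQ).congr₂ pair_sub h h'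

theorem recr_congr {u v : Fn ELSig b} (h : Deriv Ax Γ (feq u v)) (s t : Tm ELSig b) :
    Deriv Ax Γ (.eq (recr s u t) (recr s v t)) := by
  have E := eqBase hA hQ
  have := (addOps hA hQ).ind (A := .eq (recr (.var 1) (.var 0) (.var 0)) (recr (.var 1) (.var 1) (.var 0)))
    (Γ := Γ) (σ := scons s .var) (τ := scons u (scons v .var)) ?_ ?_ t
  · simpa only [Fm.sub, recr_sub, Tm.sub, Fn.sub, scons] using this
  · simp only [Fm.sub, recr_sub, Tm.sub, Fn.sub, scons]
    exact E.trans (recr_zero hA _ _) (E.symm (recr_zero hA _ _))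
  · intro Δ ρ θ a e ih
    simp only [Fm.sub, recr_sub, Tm.sub, Fn.sub, scons] at ih ⊢
    exact E.trans (recr_succ hA _ _ _) (E.trans (E.app_congr (EqBase.feq_mono h e)
      (pair_congr hA hQ ih (E.refl _ _))) (E.symm (recr_succ hA _ _ _)))

omit hA hQ in
theorem recr_eq (h : ¬ ELSig.Unary .recursor)
    (ts : Fin (ELSig.nArg .recursor) → Tm ELSig b) (us : Fin (ELSig.fArg .recursor) → Fn ELSig b) :
    Tm.cst (L := ELSig) .recursor h ts us = recr (ts (0 : Fin 2)) (us (0 : Fin 1)) (ts (1 : Fin 2)) := by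
  unfold recr
  rw [call_of_not_unary h]
  congr 1 <;> funext i <;> fin_cases i <;> rfl

theorem base : Base Ax := (eqBase hA hQ).base fun Γ f h ts us us' hf hu => by
  cases f with
  | zero => exact absurd rfl hf
  | prim n p => exact absurd rfl hf
  | recursor =>
    rw [recr_eq, recr_eq]
    exact recr_congr hA hQ (hu _) _ _

end
end EL

namespace Arithmetic
variable {Ax : Fm L b → Prop} (R : Arithmetic Ax) {Γ Δ : List (Fm L b)}

/-! ### Powers and the decoding of 2 ^ x · 3 ^ y -/

/-- Exponentiation, given by a term. -/
structure Power (R : Arithmetic Ax) where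
  pw : Tm L b → Tm L b → Tm L b
  pw_sub : ∀ s t σ τ, (pw s t).sub σ τ = pw (s.sub σ τ) (t.sub σ τ)
  num_pw_zero : ∀ Γ c, R.num Γ (pw c R.zero) = 1
  num_pw_succ : ∀ Γ c t, R.num Γ (pw c (R.succ t)) = R.num Γ c * R.num Γ (pw c t)

/-- The numeral 2 of the arithmetic. -/
def two : Tm L b := R.succ (R.succ R.zero)

/-- The numeral 3 of the arithmetic. -/
def three : Tm L b := R.succ R.two

theorem num_two : R.num Γ R.two = 2 := by
  rw [two, num_succ, num_succ, num_zero]; grind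

theorem num_three : R.num Γ R.three = 3 := by
  rw [three, num_succ, num_two]; grind

theorem two_sub (σ : ℕ → Tm L b) (τ : ℕ → Fn L b) : R.two.sub σ τ = R.two := by
  simp only [two, R.succ_sub, R.zero_sub]

theorem three_sub (σ : ℕ → Tm L b) (τ : ℕ → Fn L b) : R.three.sub σ τ = R.three := by
  simp only [three, R.succ_sub, R.two_sub]

/-- Every number is even or odd. -/
theorem parity (x : Tm L b) {C : Fm L b}
    (H : ∀ Δ ρ θ h, Ext ρ θ Γ Δ → R.num Δ (x.ren ρ θ) = 2 * R.num Δ h → Deriv Ax Δ (C.ren ρ θ))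
    (H' : ∀ Δ ρ θ h, Ext ρ θ Γ Δ → R.num Δ (x.ren ρ θ) = 2 * R.num Δ h + 1 →
      Deriv Ax Δ (C.ren ρ θ)) : Deriv Ax Γ C := by
  have := R.ind (A := .ex0 (.or (.eq (.var 1) (R.add (.var 0) (.var 0)))
    (.eq (.var 1) (R.succ (R.add (.var 0) (.var 0)))))) (σ := .var) (τ := .var) (Γ := Γ) ?_ ?_ x
  · refine Deriv.envEx0E this fun Δ ρ θ h e hh => ?_
    simp only [Fm.sub, Tm.sub, R.add_sub, R.succ_sub, scons] at hh
    refine .orE hh (H _ _ _ h (fun B hB => List.mem_cons_of_mem _ (e B hB)) ?_)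
      (H' _ _ _ h (fun B hB => List.mem_cons_of_mem _ (e B hB)) ?_)
    · rw [R.num_eq.2 .head, num_add]; grind
    · rw [R.num_eq.2 .head, num_succ, num_add]; grind
  · refine .envEx0I R.zero (.orI1 ?_)
    simp only [Fm.sub, Tm.sub, R.add_sub, scons]
    exact R.E.symm (R.add_zero _ _)
  · intro Δ ρ θ a e h
    refine Deriv.envEx0E h fun Δ' ρ' θ' h e' hh => ?_
    rw [Fm.sub_ren]
    simp only [Fm.sub, Tm.sub, R.add_sub, R.succ_sub, scons] at hh
    refine .orE hh (.envEx0I h (.orI2 ?_)) (.envEx0I (R.succ h) (.orI1 ?_))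
    all_goals
      simp only [Fm.sub, Tm.sub, R.add_sub, R.succ_sub, scons, R.succ_ren]
      refine R.num_eq.1 ?_
      rw [num_succ, R.num_eq.2 .head]
    · rw [num_succ]
    · simp only [num_succ, num_add]; grind

theorem even_ne_odd {x y : Tm L b} (h : 2 * R.num Γ x = 2 * R.num Γ y + 1) {C : Fm L b} :
    Deriv Ax Γ C := by
  have h' : R.num Γ (R.mul R.two x) = R.num Γ (R.succ (R.mul R.two y)) := by
    rw [num_succ, num_mul, num_mul, num_two, h]
  refine R.le_or_lt x y (fun Δ d e hd => R.cases d (fun Δ' e' h0 => ?_) fun Δ' d' e' hs => ?_)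
    fun Δ d e hd => ?_
  · have hd' := R.num_weaken (s := x) (t := R.add y d) hd e'
    have h1 := R.num_weaken h' fun _ hx => e' (e hx)
    simp only [num_succ, num_mul, num_two, num_add] at h1 hd'
    exact R.one_ne_zero_elim (x := 0) (add_left_cancel (a := 2 * R.num Δ' y) (by grind))
  · have hd' := R.num_weaken (s := x) (t := R.add y d) hd e'
    have h1 := R.num_weaken h' fun _ hx => e' (e hx)
    simp only [num_succ, num_mul, num_two, num_add] at h1 hd'
    exact R.one_ne_zero_elim (x := 2 * R.num Δ' d')
      (add_left_cancel (a := 2 * R.num Δ' y + 1) (by grind))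
  · have h1 := R.num_weaken h' e
    simp only [num_succ, num_mul, num_two] at h1
    exact R.one_ne_zero_elim (x := 2 * R.num Δ d + 2)
      (add_left_cancel (a := 2 * R.num Δ x) (by grind))

variable (W : R.Power)

theorem num_pw_add (c s t : Tm L b) : R.num Γ (W.pw c (R.add s t)) =
    R.num Γ (W.pw c s) * R.num Γ (W.pw c t) := by
  have := R.ind_eq (s := W.pw (.var 1) (R.add (.var 2) (.var 0)))
    (t := R.mul (W.pw (.var 1) (.var 2)) (W.pw (.var 1) (.var 0)))
    (σ := scons c (scons s .var)) (τ := .var) (Γ := Γ) ?_ ?_ t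
  · rw [← num_mul]
    simpa only [W.pw_sub, R.add_sub, R.mul_sub, Tm.sub, scons] using this
  · simp only [W.pw_sub, R.add_sub, R.mul_sub, Tm.sub, scons]
    rw [num_mul, W.num_pw_zero, mul_one]
    exact R.num_eq.2 (R.congr₂ W.pw_sub (R.E.refl _ _) (R.add_zero _ _))
  · intro Δ ρ θ a e h
    simp only [W.pw_sub, R.add_sub, R.mul_sub, Tm.sub, scons] at h ⊢
    rw [R.num_eq.2 (R.congr₂ W.pw_sub (R.E.refl _ _) (R.add_succ _ _ _)), W.num_pw_succ, h, num_mul,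
      num_mul, W.num_pw_succ, mul_left_comm]

/-- n < 2 ^ n -/
theorem num_two_pw (t : Tm L b) : R.num Γ (W.pw R.two t) =
    R.num Γ t + R.num Γ (R.sub (W.pw R.two t) (R.succ t)) + 1 := by
  have := R.ind_eq (s := W.pw R.two (.var 0))
    (t := R.succ (R.add (.var 0) (R.sub (W.pw R.two (.var 0)) (R.succ (.var 0)))))
    (σ := .var) (τ := .var) (Γ := Γ) ?_ ?_ t
  · simpa only [W.pw_sub, R.add_sub, R.sub_sub, R.succ_sub, R.two_sub, Tm.sub, scons, num_succ,
      num_add] using this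
  · simp only [W.pw_sub, R.add_sub, R.sub_sub, R.succ_sub, R.two_sub, Tm.sub, scons, num_succ,
      num_add, W.num_pw_zero, R.num_sub, R.num_zero]
    rw [R.num_add_sub_cancel (d := 0)] <;> simp
  · intro Δ ρ θ a e h
    simp only [W.pw_sub, R.add_sub, R.sub_sub, R.succ_sub, R.two_sub, Tm.sub, scons, num_succ,
      num_add, W.num_pw_succ, num_two, R.num_sub] at h ⊢
    generalize R.num Δ (W.pw R.two a) - (R.num Δ a + 1) = d at h
    rw [R.num_add_sub_cancel (d := R.num Δ a + 2 * d)]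
    all_goals rw [h]; grind

/-- The odd part of n, and the exponent of 2, are coded by w: n = 2 ^ (w)₁ (2 (w)₂ + 1). -/
def Decomp (u : Fn L b) (n w : Tm L b) : Fm L b :=
  .eq n (R.mul (W.pw R.two (R.p1 u w)) (R.succ (R.add (R.p2 u w) (R.p2 u w))))

theorem decomp_sub (u : Fn L b) (n w : Tm L b) (σ : ℕ → Tm L b) (τ : ℕ → Fn L b) :
    (R.Decomp W u n w).sub σ τ = R.Decomp W (u.sub σ τ) (n.sub σ τ) (w.sub σ τ) := by
  simp only [Decomp, Fm.sub, R.mul_sub, W.pw_sub, R.two_sub, R.p1_sub, R.p2_sub, R.succ_sub,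
    R.add_sub]

theorem exists_decomp {u : Fn L b} (hu : Deriv Ax Γ (R.Sqrt u)) (n : Tm L b) :
    Deriv Ax Γ ((Fm.ex0 (.or (.eq (.var 1) R.zero) (R.Decomp W (.var 0) (.var 1) (.var 0)))).sub
      (scons n .var) (scons u .var)) := by
  -- by induction on k: a decomposition is found, or 2 ^ k divides n; the latter is impossible for
  -- k = n, unless n = 0
  have := R.ind (A := .ex0 (.or (R.Decomp W (.var 0) (.var 2) (.var 0))
    (.eq (.var 2) (R.mul (W.pw R.two (.var 1)) (.var 0)))))
    (σ := scons n .var) (τ := scons u .var) (Γ := Γ) ?_ ?_ n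
  · refine Deriv.envEx0E this fun Δ ρ θ w e h => ?_
    rw [Fm.sub_ren]
    simp only [Fm.sub, R.decomp_sub, Tm.sub, Fn.sub, R.mul_sub, W.pw_sub, R.two_sub, scons] at h
    refine .orE h (.envEx0I w (.orI2 ?_)) (.envEx0I w (.orI1 ?_))
    · simp only [R.decomp_sub, Tm.sub, Fn.sub, scons]
      exact .head
    · simp only [Fm.sub, Tm.sub, R.zero_sub, scons]
      have h1 := R.num_eq.2 (Deriv.head (Ax := Ax) (A := .eq (n.ren ρ θ)
        (R.mul (W.pw R.two (n.ren ρ θ)) w)) (Γ := Δ))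
      generalize n.ren ρ θ = n at h1
      refine R.cases w (fun Δ' e' h0 => R.num_eq.1 ?_) fun Δ' w' e' hs => ?_
      · rw [R.num_weaken h1 e', num_mul, h0, MulZeroClass.mul_zero, num_zero]
      · have h2 := R.num_weaken h1 e'
        rw [num_mul, hs, num_two_pw] at h2
        generalize R.num Δ' (R.sub (W.pw R.two n) (R.succ n)) = d at h2
        exact R.one_ne_zero_elim (x := R.num Δ' n * R.num Δ' w' + d * R.num Δ' w' + d + R.num Δ' w')
          (add_left_cancel (a := R.num Δ' n) (by grind))
  · refine .envEx0I n (.orI2 ?_)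
    simp only [Fm.sub, Tm.sub, R.mul_sub, W.pw_sub, R.two_sub, scons]
    refine R.num_eq.1 ?_
    rw [num_mul, W.num_pw_zero, one_mul]
  · intro Δ ρ θ k e h
    refine Deriv.envEx0E h fun Δ' ρ' θ' w e' h => ?_
    have hu' := hu.ren (e.trans e')
    rw [Fm.ren_eq_sub, R.sqrt_sub, ← Fn.ren_eq_sub] at hu'
    simp only [Fm.sub, R.decomp_sub, Tm.sub, Fn.sub, R.mul_sub, W.pw_sub, R.two_sub, scons,
      Tm.ren_ren, Fn.ren_ren] at h
    simp only [Fm.sub_ren, Tm.ren_ren, Fn.ren_ren, scons_apply (fun t : Tm L b => t.ren ρ' θ'),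
      R.succ_ren]
    have e2 := e.trans e'
    generalize (fun n => ρ' (ρ n)) = ρ₂ at *
    generalize (fun n => θ' (θ n)) = θ₂ at *
    generalize k.ren ρ' θ' = k at *
    clear e e'
    refine .orE h (.envEx0I w (.orI1 ?_)) (R.parity w (fun Δ'' ρ'' θ'' c e'' h1 => ?_)
      fun Δ'' ρ'' θ'' c e'' h1 => ?_)
    · simp only [R.decomp_sub, Tm.sub, Fn.sub, scons]
      exact .head
    all_goals
      have h2 := R.num_mono (R.num_eq.2 .head) e''
      simp only [R.mul_ren, num_mul, h1] at h2
      rw [Tm.ren_eq_sub (W.pw _ _), W.pw_sub, R.two_sub, ← Tm.ren_eq_sub] at h2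
      rw [Fm.sub_ren]
    · refine .envEx0I c (.orI2 ?_)
      simp only [Fm.sub, Tm.sub, R.mul_sub, W.pw_sub, R.two_sub, scons, R.succ_ren]
      refine R.num_eq.1 ?_
      rw [h2, num_mul, W.num_pw_succ, num_two]
      grind
    · refine .envEx0I (R.pr (k.ren ρ'' θ'') c) (.orI1 ?_)
      have hu'' := hu'.ren (fun B hB => e'' B (List.mem_cons_of_mem _ hB))
      rw [Fm.ren_eq_sub, R.sqrt_sub, ← Fn.ren_eq_sub] at hu''
      simp only [R.decomp_sub, Tm.sub, Fn.sub, scons]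
      refine R.num_eq.1 ?_
      rw [h2, num_mul, num_succ, num_add, R.num_p2_pr hu'',
        R.num_eq.2 (R.congr₂ W.pw_sub (R.E.refl _ _) (R.num_eq.1 (R.num_p1_pr hu'' _ _)))]
      grind

/-- 3 ^ y is odd. -/
theorem three_pw_odd (y : Tm L b) : Deriv Ax Γ ((Fm.ex0 (.eq (W.pw R.three (.var 1))
    (R.succ (R.add (.var 0) (.var 0))))).sub (scons y .var) .var) := by
  refine R.ind (σ := .var) (τ := .var) (.envEx0I R.zero ?_) (fun Δ ρ θ k e h => ?_) y
  · simp only [Fm.sub, Tm.sub, R.add_sub, R.succ_sub, W.pw_sub, R.three_sub, scons]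
    refine R.num_eq.1 ?_
    rw [W.num_pw_zero, num_succ, num_add, num_zero]; grind
  · refine Deriv.envEx0E h fun Δ' ρ' θ' q e' h => ?_
    rw [Fm.sub_ren]
    simp only [Fm.sub, Tm.sub, R.add_sub, R.succ_sub, W.pw_sub, R.three_sub, scons] at h
    refine .envEx0I (R.succ (R.add q (R.add q q))) ?_
    simp only [Fm.sub, Tm.sub, R.add_sub, R.succ_sub, W.pw_sub, R.three_sub, R.succ_ren, scons]
    refine R.num_eq.1 ?_
    rw [W.num_pw_succ, R.num_eq.2 h]
    simp only [num_succ, num_add, num_three]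
    grind

theorem three_pw_ne_even {x y : Tm L b} (h : R.num Γ (W.pw R.three y) = 2 * R.num Γ x)
    {C : Fm L b} : Deriv Ax Γ C := by
  refine Deriv.envEx0E (R.three_pw_odd W y) fun Δ ρ θ q e h' => ?_
  simp only [Fm.sub, Tm.sub, R.add_sub, R.succ_sub, W.pw_sub, R.three_sub, scons] at h'
  rw [← num_two, ← num_mul] at h
  have h1 := R.num_mono h e
  rw [Tm.ren_eq_sub, W.pw_sub, R.three_sub, ← Tm.ren_eq_sub, R.num_eq.2 h', R.mul_ren, num_mul,
    Tm.ren_eq_sub R.two, two_sub, num_two, num_succ, num_add] at h1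
  exact R.even_ne_odd (x := x.ren ρ θ) (y := q) (by rw [← h1]; grind)

/-- The exponent of 2 in a number is unique. -/
theorem decomp_uniq {k m x y : Tm L b} (h : R.num Γ (W.pw R.two k) * (2 * R.num Γ m + 1) =
    R.num Γ (W.pw R.two x) * R.num Γ (W.pw R.three y)) : R.num Γ k = R.num Γ x := by
  have h' : R.num Γ (R.mul (W.pw R.two k) (R.succ (R.mul R.two m))) =
      R.num Γ (R.mul (W.pw R.two x) (W.pw R.three y)) := by
    rw [num_mul, num_mul, num_succ, num_mul, num_two, h]
  have cg : ∀ Δ s t, R.num Δ s = R.num Δ t → R.num Δ (W.pw R.two s) = R.num Δ (W.pw R.two t) :=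
    fun Δ s t h => R.num_eq.2 (R.congr₂ W.pw_sub (R.E.refl _ _) (R.num_eq.1 h))
  have cancel : ∀ Δ z s t, R.num Δ (W.pw R.two z) * R.num Δ s = R.num Δ (W.pw R.two z) * R.num Δ t →
      R.num Δ s = R.num Δ t := fun Δ z s t h =>
    R.mul_cancel (a := R.add z (R.sub (W.pw R.two z) (R.succ z))) (R.num_two_pw W z) h
  refine R.num_eq.2 (R.le_or_lt k x (fun Δ d e hd => ?_) fun Δ d e hd => ?_)
  · have h1 := R.num_weaken h' e
    simp only [num_mul] at h1
    rw [cg Δ k (R.add x d) hd, num_pw_add, _root_.mul_assoc] at h1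
    have h2 := cancel Δ x (R.mul (W.pw R.two d) (R.succ (R.mul R.two m))) (W.pw R.three y) h1
    refine R.cases d (fun Δ' e' h0 => R.num_eq.1 ?_) fun Δ' d' e' hs => ?_
    · rw [R.num_weaken (t := R.add x d) hd e', num_add, h0, _root_.add_zero]
    · have h3 := R.num_weaken h2 e'
      rw [← num_succ] at hs
      rw [num_mul, cg Δ' d _ hs, W.num_pw_succ, num_two] at h3
      refine R.three_pw_ne_even W (y := y) (x := R.mul (W.pw R.two d') (R.succ (R.mul R.two m))) ?_
      rw [← h3, num_mul, _root_.mul_assoc]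
  · have h1 := R.num_weaken h' e
    have hd' : R.num Δ x = R.num Δ (R.add k (R.succ d)) := by
      rw [hd, num_add, num_succ, _root_.add_assoc]
    simp only [num_mul] at h1
    rw [cg Δ x _ hd', num_pw_add, _root_.mul_assoc] at h1
    have h2 := cancel Δ k (R.succ (R.mul R.two m))
      (R.mul (W.pw R.two (R.succ d)) (W.pw R.three y)) h1
    refine R.even_ne_odd (x := R.mul (W.pw R.two d) (W.pw R.three y)) (y := m) ?_
    rw [num_succ, num_mul, num_mul, W.num_pw_succ, num_two] at h2
    rw [h2, num_mul, _root_.mul_assoc]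

/-- There is a function that decodes the exponent x of 3 ^ y · 2 ^ x. -/
theorem exists_decode {u : Fn L b} (hu : Deriv Ax Γ (R.Sqrt u)) {C : Fm L b}
    (H : ∀ Δ ρ θ (D : Fn L b), Ext ρ θ Γ Δ → (∀ Δ' ρ' θ' x y, Ext ρ' θ' Δ Δ' →
      R.num Δ' (.app (D.ren ρ' θ') (R.mul (W.pw R.three y) (W.pw R.two x))) = R.num Δ' x) →
        Deriv Ax Δ (C.ren ρ θ)) : Deriv Ax Γ C := by
  have mono : ∀ {Γ Δ : List (Fm L b)} {ρ θ : ℕ → ℕ} {u : Fn L b}, Deriv Ax Γ (R.Sqrt u) →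
      Ext ρ θ Γ Δ → Deriv Ax Δ (R.Sqrt (u.ren ρ θ)) := fun h e => by
    have := h.ren e
    rwa [Fm.ren_eq_sub, R.sqrt_sub, ← Fn.ren_eq_sub] at this
  refine R.E.choice (A := .or (.eq (.var 1) R.zero) (R.Decomp W (.var 0) (.var 1) (.var 0)))
    (σ := .var) (τ := scons u .var) ⟨trivial, trivial⟩ ?_ fun Δ ρ θ α e hα => ?_
  · refine .envAll0I fun Δ ρ θ a e => ?_
    have := R.exists_decomp W (mono hu e) a
    simp only [Fm.sub, R.decomp_sub, R.zero_sub] at this ⊢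
    exact this
  · refine R.E.exists_fun (R.p1 ((u.ren ρ θ).ren Nat.succ id) (.app (α.ren Nat.succ id) (.var 0)))
      fun Δ₁ ρ₁ θ₁ D e₁ hD => ?_
    rw [Fm.ren_ren]
    refine H Δ₁ _ _ D (e.trans e₁) fun Δ₂ ρ₂ θ₂ x y e₂ => ?_
    have h1 := R.num_eq.2 (hD Δ₂ ρ₂ θ₂ (R.mul (W.pw R.three y) (W.pw R.two x)) e₂)
    have h2 := hα Δ₂ _ _ (R.mul (W.pw R.three y) (W.pw R.two x)) (e₁.trans e₂)
    simp only [R.p1_sub, Fn.ren_sub, Tm.sub, scons, id, ← Fn.ren_eq_sub] at h1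
    simp only [Fm.sub, R.decomp_sub, R.zero_sub, Tm.sub, Fn.sub, scons, Fn.ren_ren] at h2
    rw [h1]
    generalize u.ren (fun n => ρ₂ (ρ₁ (ρ n))) (fun n => θ₂ (θ₁ (θ n))) = u' at h2
    generalize α.ren (fun n => ρ₂ (ρ₁ n)) (fun n => θ₂ (θ₁ n)) = α' at h2
    refine R.num_eq.2 (.orE h2 ?_ (R.num_eq.1 ?_))
    · have h3 := R.num_eq.2 (Deriv.head (Ax := Ax)
        (A := .eq (R.mul (W.pw R.three y) (W.pw R.two x)) R.zero) (Γ := Δ₂))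
      refine R.three_pw_ne_even W (y := y) (x := R.zero) ?_
      rw [num_zero, MulZeroClass.mul_zero, ← num_zero]
      refine R.mul_cancel (c := W.pw R.two x)
        (a := R.add x (R.sub (W.pw R.two x) (R.succ x))) (R.num_two_pw W x) ?_
      rw [num_zero, MulZeroClass.mul_zero, ← num_zero, ← h3, num_mul, _root_.mul_comm]
    · generalize hN : R.mul (W.pw R.three y) (W.pw R.two x) = N
      have h3 := R.num_eq.2 (Deriv.head (Ax := Ax) (A := R.Decomp W u' N (.app α' N)) (Γ := Δ₂))
      refine R.decomp_uniq W (m := R.p2 u' (.app α' N)) (y := y) ?_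
      rw [_root_.mul_comm (R.num _ (W.pw R.two x)), ← num_mul, hN, h3, num_mul, num_succ, num_add]
      grind

end Arithmetic

namespace EL

/-! ### Totality of evaluation in EL -/

section
variable {Ax : Fm ELSig b → Prop} (hA : ∀ A, Arith A → Ax A) (hQ : ∀ A, QFAC A → Ax A)

/-- Exponentiation in EL. -/
def power : (arithmetic hA hQ).Power where
  pw s t := prim powD ![t, s]
  pw_sub _ _ := prim_sub₂ _ _ _
  num_pw_zero Γ c := by
    refine (arithmetic hA hQ).num_eq.2 ((eqBase hA hQ).trans (prim_prec_zero hA _ _ ![c])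
      ((eqBase hA hQ).trans (prim_comp hA _ _ _) (prim_congr hA hQ _ fun j => ?_)))
    obtain rfl : j = 0 := Subsingleton.elim _ _
    exact prim_zero hA _
  num_pw_succ Γ c t := (arithmetic hA hQ).num_eq.2 (prec_comp₂ hA hQ _ _ c t)

end

section
variable {Ax : Fm ELSig false → Prop} (hA : ∀ A, Arith A → Ax A) (hQ : ∀ A, QFAC A → Ax A)
  {Γ : List (Fm ELSig false)}
include hA hQ

local notation "N" => arithmetic hA hQ

/-- A single function `ε` serves for the recursions with the functions λz.B(x, z), for all x: the values
of the recursion with `ε` carry x and the argument along. -/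
theorem recr_pr {ε α B : Fn ELSig false} {x a : Tm ELSig false}
    (hε : ∀ Δ ρ θ x v y n, Ext ρ θ Γ Δ →
      Deriv Ax Δ (.eq (.app (ε.ren ρ θ) (pair ((N).pr x ((N).pr v y)) n))
        ((N).pr x ((N).pr (.app (B.ren ρ θ) ((N).pr x (pair v y))) (succ y)))))
    (hα : Deriv Ax Γ ((N).pairing.sect α B x)) (y : Tm ELSig false) :
    Deriv Ax Γ (.eq (recr ((N).pr x ((N).pr a zero)) ε y) ((N).pr x ((N).pr (recr a α y) y))) := by
  have E := eqBase hA hQ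
  have cg : ∀ {Δ x x' y y'}, Deriv Ax Δ (.eq x x') → Deriv Ax Δ (.eq y y') →
      Deriv Ax Δ (.eq ((N).pr x y) ((N).pr x' y')) := (N).pairing.pr_congr
  have := (addOps hA hQ).ind (A := .eq (recr ((N).pr (.var 1) ((N).pr (.var 2) zero)) (.var 0) (.var 0))
    ((N).pr (.var 1) ((N).pr (recr (.var 2) (.var 1) (.var 0)) (.var 0)))) (Γ := Γ)
    (σ := scons x (scons a .var)) (τ := scons ε (scons α .var)) ?_ ?_ y
  · simpa only [Fm.sub, recr_sub, Tm.sub, Fn.sub, (N).pr_sub, zero_sub, scons] using this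
  · simp only [Fm.sub, recr_sub, Tm.sub, Fn.sub, (N).pr_sub, zero_sub, scons]
    exact E.trans (recr_zero hA _ _) (cg (E.refl _ _) (cg (E.symm (recr_zero hA _ _)) (E.refl _ _)))
  · intro Δ ρ θ k e ih
    simp only [Fm.sub, recr_sub, Tm.sub, Fn.sub, (N).pr_sub, zero_sub, scons] at ih ⊢
    refine E.trans (recr_succ hA _ _ _) (E.trans (E.app (pair_congr hA hQ ih (E.refl _ _)))
      (E.trans (hε Δ ρ θ _ _ _ _ e) (cg (E.refl _ _) (cg ?_ (E.refl _ _)))))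
    exact E.symm (E.trans (recr_succ hA _ _ _)
      ((N).pairing.sect_apply ((N).pairing.sect_mono hα e) _))

/-- The value rec(a, λz.B(x, z), y) is a function of x: it is a component of a recursion with a fixed
function `ε`, where `ε` has to decode its argument ⟨a, b⟩ = 2 ^ a · 3 ^ b. -/
theorem uniform_recursor : (N).pairing.Uniform .recursor := by
  have E := eqBase hA hQ
  intro h Γ u C γ B hu H
  have hu : Deriv Ax Γ ((N).Sqrt u) := hu
  have mono : ∀ {Γ Δ ρ θ u}, Deriv Ax Γ ((N).Sqrt u) → Ext ρ θ Γ Δ →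
      Deriv Ax Δ ((N).Sqrt (u.ren ρ θ)) := fun h e => (N).pairing.ax_mono h e
  refine (N).exists_decode (power hA hQ) hu fun Δ₁ ρ₁ θ₁ D e₁ hD => ?_
  refine E.exists_fun
    (let u := (u.ren ρ₁ θ₁).ren Nat.succ id
     let p := .app (D.ren Nat.succ id) (.var 0)
     let x := (N).p1 u p
     let y := (N).p2 u ((N).p2 u p)
     (N).pr x ((N).pr (.app ((B.ren ρ₁ θ₁).ren Nat.succ id)
       ((N).pr x (pair ((N).p1 u ((N).p2 u p)) y))) (succ y)))
    fun Δ₂ ρ₂ θ₂ ε e₂ hε => ?_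
  refine E.exists_fun
    (let u := ((u.ren ρ₁ θ₁).ren ρ₂ θ₂).ren Nat.succ id
     let γ := fun i => (((γ i).ren ρ₁ θ₁).ren ρ₂ θ₂).ren Nat.succ id
     (N).p1 u ((N).p2 u (recr ((N).pr (.var 0) ((N).pr (.app (γ (0 : Fin 2)) (.var 0)) zero))
       (ε.ren Nat.succ id) (.app (γ (1 : Fin 2)) (.var 0)))))
    fun Δ₃ ρ₃ θ₃ δ e₃ hδ => ?_
  rw [Fm.ren_ren, Fm.ren_ren]
  refine H Δ₃ _ _ δ ((e₁.trans e₂).trans e₃) ((N).pairing.uniI fun Δ ρ θ x α e hα => ?_)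
  rw [recr_eq]
  have h1 := hδ Δ ρ θ x e
  simp only [(N).p1_sub, (N).p2_sub, (N).pr_sub, recr_sub, zero_sub, Fn.ren_sub, Tm.sub, scons, id,
    ← Fn.ren_eq_sub] at h1
  have hu' := mono hu (((e₁.trans e₂).trans e₃).trans e)
  simp only [Fn.ren_ren] at hα ⊢
  have hε' : ∀ Δ' ρ' θ' x v y n, Ext ρ' θ' Δ Δ' → Deriv Ax Δ' (.eq
      (.app ((ε.ren (fun n => ρ (ρ₃ n)) fun n => θ (θ₃ n)).ren ρ' θ') (pair ((N).pr x ((N).pr v y)) n))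
      ((N).pr x ((N).pr (.app ((B.ren (fun n => ρ (ρ₃ (ρ₂ (ρ₁ n)))) fun n => θ (θ₃ (θ₂ (θ₁ n)))).ren ρ' θ')
        ((N).pr x (pair v y))) (succ y)))) := by
    intro Δ' ρ' θ' x v y n e'
    have h2 := hε Δ' _ _ (pair ((N).pr x ((N).pr v y)) n) ((e₃.trans e).trans e')
    simp only [(N).p1_sub, (N).p2_sub, (N).pr_sub, pair_sub, succ_sub, Fn.ren_sub, Tm.sub, scons, id,
      ← Fn.ren_eq_sub] at h2
    have hu'' := mono hu ((((e₁.trans e₂).trans e₃).trans e).trans e')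
    have h3 := hD Δ' _ _ ((N).pr x ((N).pr v y)) n (((e₂.trans e₃).trans e).trans e')
    have h4 := (N).num_p1_pr hu'' x ((N).pr v y)
    have h5 := (N).num_p2_pr hu'' x ((N).pr v y)
    have h6 := (N).num_p1_pr hu'' v y
    have h7 := (N).num_p2_pr hu'' v y
    rw [← (N).num_p1_congr h3] at h4
    rw [← (N).num_p2_congr h3] at h5
    rw [← (N).num_p1_congr h5] at h6
    rw [← (N).num_p2_congr h5] at h7
    have cg : ∀ {Δ x x' y y'}, Deriv Ax Δ (.eq x x') → Deriv Ax Δ (.eq y y') →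
      Deriv Ax Δ (.eq ((N).pr x y) ((N).pr x' y')) := (N).pairing.pr_congr
    have h4 := (N).num_eq.1 h4
    have h6 := (N).num_eq.1 h6
    have h7 := (N).num_eq.1 h7
    simp only [Fn.ren_ren]
    exact E.trans h2 (cg h4 (cg (E.app (cg h4 (pair_congr hA hQ h6 h7)))
      ((addOps hA hQ).succ_congr h7)))
  have key := recr_pr hA hQ (a := .app ((γ (0 : Fin 2)).ren (fun n => ρ (ρ₃ (ρ₂ (ρ₁ n))))
    fun n => θ (θ₃ (θ₂ (θ₁ n)))) x) hε' hα (.app ((γ (1 : Fin 2)).ren (fun n => ρ (ρ₃ (ρ₂ (ρ₁ n))))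
    fun n => θ (θ₃ (θ₂ (θ₁ n)))) x)
  refine E.symm (E.trans h1 ((N).num_eq.1 ?_))
  rw [(N).num_p1_congr ((N).num_p2_congr ((N).num_eq.2 key)),
    (N).num_p1_congr ((N).num_p2_pr hu' _ _), (N).num_p1_pr hu']

end

end EL

namespace EL

/-! ### EL and EL − λ -/

theorem prim_emb {n : ℕ} (p : PR n) (ts : Fin n → Tm ELSig false) :
    (prim p ts).emb = prim p fun i => (ts i).emb := by
  unfold prim
  rw [call_emb]
  congr 1
  funext i; exact i.elim0

theorem zero_emb : (zero : Tm ELSig false).emb = zero := by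
  unfold zero
  rw [call_emb]
  congr 1 <;> funext i <;> exact i.elim0

theorem succ_emb (t : Tm ELSig false) : (succ t).emb = succ t.emb := by
  unfold succ
  rw [prim_emb]
  congr 1; funext i; fin_cases i; rfl

theorem recr_emb (t s : Tm ELSig false) (u : Fn ELSig false) :
    (recr t u s).emb = recr t.emb u.emb s.emb := by
  unfold recr
  rw [call_emb]
  congr 1 <;> funext i <;> fin_cases i <;> rfl

theorem pair_emb (s t : Tm ELSig false) : (pair s t).emb = pair s.emb t.emb := by
  have h : ∀ (p : PR 2) (s t : Tm ELSig false), (prim p ![s, t]).emb = prim p ![s.emb, t.emb] := by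
    intro p s t
    rw [prim_emb]
    congr 1; funext i; fin_cases i <;> rfl
  simp only [pair, h, succ_emb, zero_emb]

theorem cons_emb {n : ℕ} (t : Tm ELSig false) (ts : Fin n → Tm ELSig false) :
    (fun i => ((Fin.cons t ts : Fin (n + 1) → Tm ELSig false) i).emb) =
      (Fin.cons t.emb fun i => (ts i).emb : Fin (n + 1) → Tm ELSig true) := by
  funext i; cases i using Fin.cases <;> simp

theorem inst0_var_eq (A : Fm L b) (i : ℕ) :
    A.inst0 (.var i) = A.ren (fun | 0 => i | n + 1 => n) id := by
  rw [Fm.inst0, Fm.ren_eq_sub]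
  congr 1
  funext n; cases n <;> rfl

theorem Arith.emb {A : Fm ELSig false} (h : Arith A) : Arith A.emb := by
  cases h with
  | refl => exact .refl
  | repl A i j =>
    simp only [Fm.emb, Fm.emb_inst0, Tm.emb]
    exact .repl A.emb i j
  | ind A h =>
    have := h.emb (succ' := succ) (succ_emb (.var 0)).symm
    rw [zero_emb] at this
    exact .ind _ this
  | succ_ne_zero => simpa only [Fm.emb, succ_emb, zero_emb] using Arith.succ_ne_zero
  | prim_zero n =>
    simpa only [Fm.emb, prim_emb, zero_emb, Tm.emb] using Arith.prim_zero n
  | prim_proj n i =>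
    simpa only [Fm.emb, prim_emb, zero_emb, Tm.emb] using Arith.prim_proj n i
  | prim_comp g h =>
    simpa only [Fm.emb, prim_emb, zero_emb, Tm.emb] using Arith.prim_comp g h
  | prim_prec_zero g h =>
    simpa only [Fm.emb, prim_emb, zero_emb, Tm.emb, cons_emb] using Arith.prim_prec_zero g h
  | prim_prec_succ g h =>
    simpa only [Fm.emb, prim_emb, succ_emb, Tm.emb, cons_emb] using Arith.prim_prec_succ g h
  | rec_zero => simpa only [Fm.emb, recr_emb, zero_emb, Tm.emb, Fn.emb] using Arith.rec_zero
  | rec_succ =>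
    simpa only [Fm.emb, recr_emb, succ_emb, pair_emb, Tm.emb, Fn.emb] using Arith.rec_succ

theorem Arith.tr {Ax : Fm ELSig false → Prop} (hA : ∀ A, Arith A → Ax A) (hQ : ∀ A, QFAC A → Ax A)
    {A : Fm ELSig true} (h : Arith A) : Deriv Ax [] A.tr := by
  have of_emb : ∀ {A : Fm ELSig true} {B : Fm ELSig false}, Arith B → B.emb = A →
      Deriv Ax [] A.tr := by
    rintro A B h rfl
    rw [Fm.tr_emb]
    exact .ax (hA _ h)
  cases h with
  | refl => exact of_emb .refl rfl
  | repl A i j =>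
    have : ((A.inst0 (.var i)).and (.eq (.var i) (.var j)) |>.imp (A.inst0 (.var j))).tr =
        .imp (.and (A.tr.inst0 (.var i)) (.eq (.var i) (.var j))) (A.tr.inst0 (.var j)) := by
      rw [inst0_var_eq, inst0_var_eq, inst0_var_eq, inst0_var_eq, Fm.tr, Fm.tr, Fm.tr_ren, Fm.tr_ren,
        show (Fm.eq (.var i) (.var j)).tr = _ from Fm.tr_emb (.eq (.var i) (.var j))]
    rw [this]
    exact .ax (hA _ (.repl A.tr i j))
  | ind A h =>
    have := tr_ind (base hA hQ) (zero := zero) (succ := succ) (succ' := succ)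
      (succ_emb (.var 0)).symm (fun A h => .ax (hA _ (.ind A h))) (A := A)
    rw [zero_emb] at this
    exact this h
  | succ_ne_zero => exact of_emb .succ_ne_zero (by simp only [Fm.emb, succ_emb, zero_emb])
  | prim_zero n => exact of_emb (.prim_zero n) (by simp only [Fm.emb, prim_emb, zero_emb, Tm.emb])
  | prim_proj n i => exact of_emb (.prim_proj n i) (by simp only [Fm.emb, prim_emb, Tm.emb])
  | prim_comp g h => exact of_emb (.prim_comp g h) (by simp only [Fm.emb, prim_emb, Tm.emb])
  | prim_prec_zero g h =>
    exact of_emb (.prim_prec_zero g h) (by simp only [Fm.emb, prim_emb, zero_emb, Tm.emb, cons_emb])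
  | prim_prec_succ g h =>
    exact of_emb (.prim_prec_succ g h) (by simp only [Fm.emb, prim_emb, succ_emb, Tm.emb, cons_emb])
  | rec_zero =>
    exact of_emb .rec_zero (by simp only [Fm.emb, recr_emb, zero_emb, Tm.emb, Fn.emb])
  | rec_succ =>
    exact of_emb .rec_succ (by simp only [Fm.emb, recr_emb, succ_emb, pair_emb, Tm.emb, Fn.emb])

/-- EL is a definitional extension of EL − λ. -/
theorem isDefinitionalExtension_EL : IsDefinitionalExtension WithLam WithoutLam := by
  have hA : ∀ A, Arith A → WithoutLam A := fun _ => .inl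
  have hQ : ∀ A, QFAC A → WithoutLam A := fun _ => .inr
  have hf : ∀ f, ELSig.fArg f ≤ 1 := by rintro (_ | _ | _) <;> simp
  have hU : ∀ f, (arithmetic hA hQ).pairing.Uniform f := by
    rintro (_ | ⟨n, p⟩ | _)
    · exact Pairing.uniform_of_fArg_eq_zero _ (base hA hQ) rfl
    · exact Pairing.uniform_of_fArg_eq_zero _ (base hA hQ) rfl
    · exact uniform_recursor hA hQ
  refine isDefinitionalExtension (arithmetic hA hQ).pairing (base hA hQ) hU hf
    (base (Ax := WithLam) (fun _ => .inl) (fun _ h => .inr (.inl h))) (fun _ h => .ax (.inr (.inr h)))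
    ?_ ?_ ?_
  · rintro A (h | h)
    · exact .ax (.inl h.emb)
    · exact .ax (.inr (.inl h.emb))
  · rintro A (h | h | h)
    · exact h.tr hA hQ
    · exact tr_qfac _ (base hA hQ) hU hf h
    · exact tr_lamConv _ (base hA hQ) hU hf h
  · refine tr_computable
      (na := fun c => if c.unpair.1 = 1 then c.unpair.2.unpair.1 else if c.unpair.1 = 2 then 2 else 0)
      (fa := fun c => if c.unpair.1 = 2 then 1 else 0) ?_ ?_ ?_ ?_
    · rintro (_ | _ | _) <;> simp [ELCon.code]
    · rintro (_ | _ | _) <;> simp [ELCon.code]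
    · refine Primrec.ite (PrimrecRel.comp Primrec.eq (by fun_prop) (by fun_prop)) (by fun_prop) (Primrec.ite
        (PrimrecRel.comp Primrec.eq (by fun_prop) (by fun_prop)) (by fun_prop) (by fun_prop))
    · exact Primrec.ite (PrimrecRel.comp Primrec.eq (by fun_prop) (by fun_prop)) (by fun_prop) (by fun_prop)

end EL

/-- Evaluation of a constant applied to arguments; a constant with one number argument and no function
argument is a functor, so that its application is not formed by `cst`. -/
theorem Ev.call {Ax : Fm L false → Prop} (E : EqBase Ax) {Γ : List (Fm L false)}
    {σ : ℕ → Tm L false} {τ : ℕ → Fn L false} {w : Tm L false} {f : L.Con}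
    {ts : Fin (L.nArg f) → Tm L true} {us : Fin (L.fArg f) → Fn L true}
    {a : Fin (L.nArg f) → Tm L false} {β : Fin (L.fArg f) → Fn L false}
    (ha : ∀ i, Ev Ax Γ σ τ (ts i) (a i)) (hβ : ∀ j, EvF Ax Γ σ τ (us j) (β j))
    (hw : Deriv Ax Γ (.eq (call f a β) w)) : Ev Ax Γ σ τ (call f ts us) w := by
  unfold TwoSorted.call at *
  split
  · rename_i h
    rw [dif_pos h] at hw
    exact Ev.app (evF_cst.2 (E.feq_refl _)) (ha _) hw
  · rename_i h
    rw [dif_neg h] at hw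
    exact Ev.cst ha hβ hw

namespace IA

/-! ### Equality and arithmetic in IA₁ -/

section
variable (σ : ℕ → Tm IASig b) (τ : ℕ → Fn IASig b) (s t : Tm IASig b) (u : Fn IASig b)

theorem zero_sub : (zero : Tm IASig b).sub σ τ = zero := by
  refine (call_sub _ _ _ _ _).trans (congrArg₂ (call _) (funext fun i => ?_) (funext fun i => ?_)) <;>
    exact i.elim0

theorem one_place_sub : (succ s).sub σ τ = succ (s.sub σ τ) ∧ (pd s).sub σ τ = pd (s.sub σ τ) ∧
    (sgb s).sub σ τ = sgb (s.sub σ τ) ∧ (prime s).sub σ τ = prime (s.sub σ τ) := by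
  refine ⟨?_, ?_, ?_, ?_⟩ <;>
    refine (call_sub _ _ _ _ _).trans (congrArg₂ (call _) (funext fun i => ?_) (funext fun i => ?_)) <;>
    fin_cases i <;> rfl

theorem two_place_sub : (add s t).sub σ τ = add (s.sub σ τ) (t.sub σ τ) ∧
    (mul s t).sub σ τ = mul (s.sub σ τ) (t.sub σ τ) ∧ (pow s t).sub σ τ = pow (s.sub σ τ) (t.sub σ τ) ∧
    (sub s t).sub σ τ = sub (s.sub σ τ) (t.sub σ τ) ∧ (min s t).sub σ τ = min (s.sub σ τ) (t.sub σ τ) ∧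
    (max s t).sub σ τ = max (s.sub σ τ) (t.sub σ τ) := by
  refine ⟨?_, ?_, ?_, ?_, ?_, ?_⟩ <;>
    refine (call_sub _ _ _ _ _).trans (congrArg₂ (call _) (funext fun i => ?_) (funext fun i => ?_)) <;>
    fin_cases i <;> rfl

theorem functional_sub : (sum s u).sub σ τ = sum (s.sub σ τ) (u.sub σ τ) ∧
    (prod s u).sub σ τ = prod (s.sub σ τ) (u.sub σ τ) ∧
    (minle s u).sub σ τ = minle (s.sub σ τ) (u.sub σ τ) ∧
    (maxle s u).sub σ τ = maxle (s.sub σ τ) (u.sub σ τ) ∧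
    (bar s u).sub σ τ = bar (s.sub σ τ) (u.sub σ τ) ∧
    (tilde s u).sub σ τ = tilde (s.sub σ τ) (u.sub σ τ) := by
  refine ⟨?_, ?_, ?_, ?_, ?_, ?_⟩ <;>
    refine (call_sub _ _ _ _ _).trans (congrArg₂ (call _) (funext fun i => ?_) (funext fun i => ?_)) <;>
    fin_cases i <;> rfl

theorem one_sub : (one : Tm IASig b).sub σ τ = one := by
  unfold one
  rw [(one_place_sub σ τ _).1, zero_sub]

end

section
variable {Ax : Fm IASig b → Prop} (hA : ∀ A, Arith A → Ax A) (hQ : ∀ A, QFAC A → Ax A)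
include hA

theorem arith_sub {A : Fm IASig b} (h : Arith A) (Γ : List (Fm IASig b)) (σ : ℕ → Tm IASig b)
    (τ : ℕ → Fn IASig b) : Deriv Ax Γ (A.sub σ τ) :=
  ((Deriv.ax (hA _ h)).sub_nil σ τ).weaken (List.nil_subset Γ)

/-- An axiom s = t under an environment. -/
theorem arith_eq {Γ : List (Fm IASig b)} {s t s' t' : Tm IASig b} (h : Arith (.eq s t))
    (σ : ℕ → Tm IASig b) (τ : ℕ → Fn IASig b) (hs : s.sub σ τ = s') (ht : t.sub σ τ = t') :
    Deriv Ax Γ (.eq s' t') := by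
  subst hs ht
  exact arith_sub hA h Γ σ τ

variable {Γ : List (Fm IASig b)}

theorem add_zero (s : Tm IASig b) : Deriv Ax Γ (.eq (add s zero) s) :=
  arith_eq hA .add_zero (scons s .var) .var (by simp only [two_place_sub, zero_sub]; rfl) rfl

include hQ in
theorem eqBase : EqBase Ax :=
  have euclid : ∀ {Γ : List (Fm IASig b)} {r s t}, Deriv Ax Γ (.eq r s) → Deriv Ax Γ (.eq r t) →
      Deriv Ax Γ (.eq s t) := fun {Γ r s t} h h' =>
    ((arith_sub hA .eq_trans Γ (scons r (scons s (scons t .var))) .var).impE h).impE h'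
  { refl := fun _ t => euclid (add_zero hA t) (add_zero hA t)
    euclid := euclid
    app := fun {Γ u s t} h =>
      (arith_sub hA .eq_app Γ (scons s (scons t .var)) (scons u .var)).impE h
    qfac := fun h _ => .ax (hQ _ h) }

include hQ

/-- Arithmetic in IA₁. -/
def arithmetic : Arithmetic Ax where
  E := eqBase hA hQ
  zero := zero
  succ := succ
  add := add
  mul := mul
  pd := pd
  sub := sub
  zero_sub := zero_sub
  succ_sub s σ τ := (one_place_sub σ τ s).1
  add_sub s t σ τ := (two_place_sub σ τ s t).1
  mul_sub s t σ τ := (two_place_sub σ τ s t).2.1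
  pd_sub s σ τ := (one_place_sub σ τ s).2.1
  sub_sub s t σ τ := (two_place_sub σ τ s t).2.2.2.1
  ind_ax h _ := .ax (hA _ (.ind _ h))
  succ_ne_zero Γ s := by
    have := arith_sub hA .succ_ne_zero Γ (scons s .var) .var
    simp only [Fm.sub, one_place_sub, zero_sub] at this
    exact this
  add_zero _ s := add_zero hA s
  add_succ _ s t := arith_eq hA .add_succ (scons s (scons t .var)) .var
    (by simp only [two_place_sub, one_place_sub]; rfl) (by simp only [two_place_sub, one_place_sub]; rfl)
  mul_zero _ s := arith_eq hA .mul_zero (scons s .var) .var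
    (by simp only [two_place_sub, zero_sub]; rfl) (by simp only [zero_sub])
  mul_succ _ s t := arith_eq hA .mul_succ (scons s (scons t .var)) .var
    (by simp only [two_place_sub, one_place_sub]; rfl) (by simp only [two_place_sub]; rfl)
  pd_zero _ := arith_eq hA .pd_zero .var .var (by simp only [one_place_sub, zero_sub]) (zero_sub _ _)
  pd_succ _ s := arith_eq hA .pd_succ (scons s .var) .var (by simp only [one_place_sub]; rfl) rfl
  sub_zero _ s := arith_eq hA .sub_zero (scons s .var) .var
    (by simp only [two_place_sub, zero_sub]; rfl) rfl
  sub_succ _ s t := arith_eq hA .sub_succ (scons s (scons t .var)) .var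
    (by simp only [two_place_sub, one_place_sub]; rfl) (by simp only [two_place_sub, one_place_sub]; rfl)

local notation "N" => arithmetic hA hQ

omit hQ in
theorem sum_zero (u : Fn IASig b) : Deriv Ax Γ (.eq (sum zero u) zero) :=
  arith_eq hA .sum_zero .var (scons u .var) (by simp only [functional_sub, zero_sub]; rfl) (zero_sub _ _)

omit hQ in
theorem sum_succ (s : Tm IASig b) (u : Fn IASig b) :
    Deriv Ax Γ (.eq (sum (succ s) u) (add (sum s u) (.app u s))) :=
  arith_eq hA .sum_succ (scons s .var) (scons u .var) (by simp only [functional_sub, one_place_sub]; rfl)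
    (by simp only [functional_sub, two_place_sub]; rfl)

omit hQ in
theorem prod_zero (u : Fn IASig b) : Deriv Ax Γ (.eq (prod zero u) one) :=
  arith_eq hA .prod_zero .var (scons u .var) (by simp only [functional_sub, zero_sub]; rfl) (one_sub _ _)

omit hQ in
theorem prod_succ (s : Tm IASig b) (u : Fn IASig b) :
    Deriv Ax Γ (.eq (prod (succ s) u) (mul (prod s u) (.app u s))) :=
  arith_eq hA .prod_succ (scons s .var) (scons u .var) (by simp only [functional_sub, one_place_sub]; rfl)
    (by simp only [functional_sub, two_place_sub]; rfl)

omit hQ in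
theorem minle_zero (u : Fn IASig b) : Deriv Ax Γ (.eq (minle zero u) (.app u zero)) :=
  arith_eq hA .minle_zero .var (scons u .var) (by simp only [functional_sub, zero_sub]; rfl)
    (by simp only [Tm.sub, zero_sub]; rfl)

omit hQ in
theorem minle_succ (s : Tm IASig b) (u : Fn IASig b) :
    Deriv Ax Γ (.eq (minle (succ s) u) (min (minle s u) (.app u (succ s)))) :=
  arith_eq hA .minle_succ (scons s .var) (scons u .var)
    (by simp only [functional_sub, one_place_sub]; rfl)
    (by simp only [functional_sub, two_place_sub, Tm.sub, one_place_sub]; rfl)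

omit hQ in
theorem maxle_zero (u : Fn IASig b) : Deriv Ax Γ (.eq (maxle zero u) (.app u zero)) :=
  arith_eq hA .maxle_zero .var (scons u .var) (by simp only [functional_sub, zero_sub]; rfl)
    (by simp only [Tm.sub, zero_sub]; rfl)

omit hQ in
theorem maxle_succ (s : Tm IASig b) (u : Fn IASig b) :
    Deriv Ax Γ (.eq (maxle (succ s) u) (max (maxle s u) (.app u (succ s)))) :=
  arith_eq hA .maxle_succ (scons s .var) (scons u .var)
    (by simp only [functional_sub, one_place_sub]; rfl)
    (by simp only [functional_sub, two_place_sub, Tm.sub, one_place_sub]; rfl)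

omit hQ in
theorem min_def (s t : Tm IASig b) : Deriv Ax Γ (.eq (min s t) (sub t (sub t s))) :=
  arith_eq hA .min_def (scons s (scons t .var)) .var (by simp only [two_place_sub]; rfl)
    (by simp only [two_place_sub]; rfl)

omit hQ in
theorem max_def (s t : Tm IASig b) : Deriv Ax Γ (.eq (max s t) (add (sub s t) t)) :=
  arith_eq hA .max_def (scons s (scons t .var)) .var (by simp only [two_place_sub]; rfl)
    (by simp only [two_place_sub]; rfl)

omit hQ in
theorem sgb_zero : Deriv Ax Γ (.eq (sgb zero) one) :=
  arith_eq hA .sgb_zero .var .var (by simp only [one_place_sub, zero_sub]) (one_sub _ _)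

omit hQ in
theorem sgb_succ (s : Tm IASig b) : Deriv Ax Γ (.eq (sgb (succ s)) zero) :=
  arith_eq hA .sgb_succ (scons s .var) .var (by simp only [one_place_sub]; rfl) (zero_sub _ _)

/-! ### Extensionality of the constants of IA₁ -/

/-- Operations defined by recursion on the number argument respect extensional equality. -/
theorem functional_congr {F : Tm IASig b → Fn IASig b → Tm IASig b}
    (hF : ∀ s u σ τ, (F s u).sub σ τ = F (s.sub σ τ) (u.sub σ τ))
    (h0 : ∀ {Γ u v}, Deriv Ax Γ (feq u v) → Deriv Ax Γ (.eq (F zero u) (F zero v)))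
    (hs : ∀ {Γ u v a}, Deriv Ax Γ (feq u v) → Deriv Ax Γ (.eq (F a u) (F a v)) →
      Deriv Ax Γ (.eq (F (succ a) u) (F (succ a) v)))
    {u v : Fn IASig b} (h : Deriv Ax Γ (feq u v)) (t : Tm IASig b) :
    Deriv Ax Γ (.eq (F t u) (F t v)) := by
  have := (N).ind (A := .eq (F (.var 0) (.var 0)) (F (.var 0) (.var 1))) (Γ := Γ) (σ := .var)
    (τ := scons u (scons v .var)) ?_ ?_ t
  · simpa only [Fm.sub, hF, Tm.sub, Fn.sub, scons] using this
  · simp only [Fm.sub, hF, Tm.sub, Fn.sub, scons]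
    exact h0 h
  · intro Δ ρ θ a e ih
    simp only [Fm.sub, hF, Tm.sub, Fn.sub, scons] at ih ⊢
    exact hs (EqBase.feq_mono h e) ih

theorem sum_congr {u v : Fn IASig b} (h : Deriv Ax Γ (feq u v)) (t : Tm IASig b) :
    Deriv Ax Γ (.eq (sum t u) (sum t v)) := by
  have E := eqBase hA hQ
  exact functional_congr hA hQ (fun s u σ τ => (functional_sub σ τ s u).1)
    (fun _ => E.trans (sum_zero hA _) (E.symm (sum_zero hA _)))
    (fun h ih => E.trans (sum_succ hA _ _) (E.trans ((N).add_congr ih (EqBase.feq_app h _))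
      (E.symm (sum_succ hA _ _)))) h t

theorem prod_congr {u v : Fn IASig b} (h : Deriv Ax Γ (feq u v)) (t : Tm IASig b) :
    Deriv Ax Γ (.eq (prod t u) (prod t v)) := by
  have E := eqBase hA hQ
  exact functional_congr hA hQ (fun s u σ τ => (functional_sub σ τ s u).2.1)
    (fun _ => E.trans (prod_zero hA _) (E.symm (prod_zero hA _)))
    (fun h ih => E.trans (prod_succ hA _ _) (E.trans ((N).congr₂ (N).mul_sub ih (EqBase.feq_app h _))
      (E.symm (prod_succ hA _ _)))) h t

theorem minle_congr {u v : Fn IASig b} (h : Deriv Ax Γ (feq u v)) (t : Tm IASig b) :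
    Deriv Ax Γ (.eq (minle t u) (minle t v)) := by
  have E := eqBase hA hQ
  exact functional_congr hA hQ (fun s u σ τ => (functional_sub σ τ s u).2.2.1)
    (fun h => E.trans (minle_zero hA _) (E.trans (EqBase.feq_app h _) (E.symm (minle_zero hA _))))
    (fun h ih => E.trans (minle_succ hA _ _) (E.trans
      ((N).congr₂ (fun s t σ τ => (two_place_sub σ τ s t).2.2.2.2.1) ih (EqBase.feq_app h _))
      (E.symm (minle_succ hA _ _)))) h t

theorem maxle_congr {u v : Fn IASig b} (h : Deriv Ax Γ (feq u v)) (t : Tm IASig b) :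
    Deriv Ax Γ (.eq (maxle t u) (maxle t v)) := by
  have E := eqBase hA hQ
  exact functional_congr hA hQ (fun s u σ τ => (functional_sub σ τ s u).2.2.2.1)
    (fun h => E.trans (maxle_zero hA _) (E.trans (EqBase.feq_app h _) (E.symm (maxle_zero hA _))))
    (fun h ih => E.trans (maxle_succ hA _ _) (E.trans
      ((N).congr₂ (fun s t σ τ => (two_place_sub σ τ s t).2.2.2.2.2) ih (EqBase.feq_app h _))
      (E.symm (maxle_succ hA _ _)))) h t

end

/-- The operation `F` is the product Π_{y < x} G(y, α(y)), in the form in which the equation can be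
stated with or without λ. -/
def IsProd (Ax : Fm IASig b → Prop) (F : Tm IASig b → Fn IASig b → Tm IASig b)
    (G : Tm IASig b → Tm IASig b → Tm IASig b) : Prop :=
  ∀ (Γ : List (Fm IASig b)) (x : Tm IASig b) (u δ : Fn IASig b),
    (∀ Δ ρ θ a, Ext ρ θ Γ Δ →
      Deriv Ax Δ (.eq (.app (δ.ren ρ θ) a) (G a (.app (u.ren ρ θ) a)))) →
    Deriv Ax Γ (.eq (F x u) (prod x δ))

/-- p_i ^ (a + 1) -/
def barG (i a : Tm IASig b) : Tm IASig b := pow (prime i) (add a one)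

/-- p_i ^ a -/
def tildeG (i a : Tm IASig b) : Tm IASig b := pow (prime i) a

theorem barG_sub (i a : Tm IASig b) (σ : ℕ → Tm IASig b) (τ : ℕ → Fn IASig b) :
    (barG i a).sub σ τ = barG (i.sub σ τ) (a.sub σ τ) := by
  simp only [barG, two_place_sub, one_place_sub, one_sub]

theorem tildeG_sub (i a : Tm IASig b) (σ : ℕ → Tm IASig b) (τ : ℕ → Fn IASig b) :
    (tildeG i a).sub σ τ = tildeG (i.sub σ τ) (a.sub σ τ) := by
  simp only [tildeG, two_place_sub, one_place_sub]

section
variable {Ax : Fm IASig b → Prop} (hA : ∀ A, Arith A → Ax A) (hQ : ∀ A, QFAC A → Ax A)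
  {Γ : List (Fm IASig b)}
include hA hQ

local notation "N" => arithmetic hA hQ

/-- Given `u`, there is a function δ with δ(y) = G(y, u(y)). -/
theorem exists_comp {G : Tm IASig b → Tm IASig b → Tm IASig b}
    (hG : ∀ s t σ τ, (G s t).sub σ τ = G (s.sub σ τ) (t.sub σ τ)) (u : Fn IASig b) {C : Fm IASig b}
    (H : ∀ Δ ρ θ (δ : Fn IASig b), Ext ρ θ Γ Δ → (∀ Δ' ρ' θ' a, Ext ρ' θ' Δ Δ' →
      Deriv Ax Δ' (.eq (.app (δ.ren ρ' θ') a) (G a (.app ((u.ren ρ θ).ren ρ' θ') a)))) →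
        Deriv Ax Δ (C.ren ρ θ)) : Deriv Ax Γ C := by
  refine (eqBase hA hQ).exists_fun (G (.var 0) (.app (u.ren Nat.succ id) (.var 0)))
    fun Δ ρ θ δ e h => H Δ ρ θ δ e fun Δ' ρ' θ' a e' => ?_
  have := h Δ' ρ' θ' a e'
  simp only [hG, Tm.sub, Fn.ren_sub, scons, id, ← Fn.ren_eq_sub] at this
  simpa only [Fn.ren_ren] using this

theorem IsProd.congr {F : Tm IASig b → Fn IASig b → Tm IASig b}
    {G : Tm IASig b → Tm IASig b → Tm IASig b}
    (hF : ∀ s u σ τ, (F s u).sub σ τ = F (s.sub σ τ) (u.sub σ τ))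
    (hG : ∀ s t σ τ, (G s t).sub σ τ = G (s.sub σ τ) (t.sub σ τ)) (h : IsProd Ax F G)
    {u v : Fn IASig b} (huv : Deriv Ax Γ (feq u v)) (t : Tm IASig b) :
    Deriv Ax Γ (.eq (F t u) (F t v)) := by
  have E := eqBase hA hQ
  refine exists_comp hA hQ hG u fun Δ ρ θ δ e hδ => ?_
  rw [Fm.ren, Tm.ren_eq_sub, Tm.ren_eq_sub, hF, hF]
  simp only [← Tm.ren_eq_sub, ← Fn.ren_eq_sub]
  refine E.trans (h _ _ _ _ hδ) (E.symm (h _ _ _ δ fun Δ' ρ' θ' a e' => ?_))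
  refine E.trans (hδ Δ' ρ' θ' a e') ((N).congr₂ hG (E.refl _ _) (EqBase.feq_app ?_ _))
  exact EqBase.feq_mono (EqBase.feq_mono huv e) e'

omit hA hQ in
theorem cst_functional {f : IACon} (h : ¬ IASig.Unary f) {F : Tm IASig b → Fn IASig b → Tm IASig b}
    (hn : IASig.nArg f = 1) (hf : IASig.fArg f = 1)
    (hF : ∀ s u, F s u = call (L := IASig) f (fun _ => s) fun _ => u)
    (ts : Fin (IASig.nArg f) → Tm IASig b) (us : Fin (IASig.fArg f) → Fn IASig b) :
    Tm.cst (L := IASig) f h ts us = F (ts ⟨0, by omega⟩) (us ⟨0, by omega⟩) := by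
  rw [hF, call_of_not_unary h]
  congr 1
  · funext i
    exact congrArg ts (Fin.ext (by have h := i.isLt.trans_eq hn; simp only at h ⊢; omega))
  · funext i
    exact congrArg us (Fin.ext (by have h := i.isLt.trans_eq hf; simp only at h ⊢; omega))

omit hA hQ in
/-- The constants with a function argument. -/
theorem fArg_ne_zero_cases {motive : IACon → Prop} (hsum : motive .sum) (hprod : motive .prod)
    (hminle : motive .minle) (hmaxle : motive .maxle) (hbar : motive .bar) (htilde : motive .tilde)
    {f : IACon} (hf : IASig.fArg f ≠ 0) : motive f := by
  cases f <;> first | assumption | exact absurd rfl hf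

omit hA hQ in
theorem functional_eq (s : Tm IASig b) (u : Fn IASig b) :
    sum s u = call (L := IASig) .sum (fun _ => s) (fun _ => u) ∧
    prod s u = call (L := IASig) .prod (fun _ => s) (fun _ => u) ∧
    minle s u = call (L := IASig) .minle (fun _ => s) (fun _ => u) ∧
    maxle s u = call (L := IASig) .maxle (fun _ => s) (fun _ => u) ∧
    bar s u = call (L := IASig) .bar (fun _ => s) (fun _ => u) ∧
    tilde s u = call (L := IASig) .tilde (fun _ => s) (fun _ => u) := by
  refine ⟨?_, ?_, ?_, ?_, ?_, ?_⟩ <;>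
    refine congrArg₂ (call _) (funext fun i => ?_) (funext fun i => ?_) <;> fin_cases i <;> rfl

theorem base (hbar : IsProd Ax bar barG) (htilde : IsProd Ax tilde tildeG) : Base Ax := by
  refine (eqBase hA hQ).base fun Γ f h ts us us' hf => ?_
  refine fArg_ne_zero_cases (motive := fun f => ∀ h ts us us', (∀ j, Deriv Ax Γ (feq (us j) (us' j))) →
    Deriv Ax Γ (.eq (.cst (L := IASig) f h ts us) (.cst f h ts us'))) ?_ ?_ ?_ ?_ ?_ ?_ hf h ts us us'
  · intro h ts us us' hu
    rw [cst_functional h rfl rfl fun s u => (functional_eq s u).1,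
      cst_functional h rfl rfl fun s u => (functional_eq s u).1]
    exact sum_congr hA hQ (hu _) _
  · intro h ts us us' hu
    rw [cst_functional h rfl rfl fun s u => (functional_eq s u).2.1,
      cst_functional h rfl rfl fun s u => (functional_eq s u).2.1]
    exact prod_congr hA hQ (hu _) _
  · intro h ts us us' hu
    rw [cst_functional h rfl rfl fun s u => (functional_eq s u).2.2.1,
      cst_functional h rfl rfl fun s u => (functional_eq s u).2.2.1]
    exact minle_congr hA hQ (hu _) _
  · intro h ts us us' hu
    rw [cst_functional h rfl rfl fun s u => (functional_eq s u).2.2.2.1,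
      cst_functional h rfl rfl fun s u => (functional_eq s u).2.2.2.1]
    exact maxle_congr hA hQ (hu _) _
  · intro h ts us us' hu
    rw [cst_functional h rfl rfl fun s u => (functional_eq s u).2.2.2.2.1,
      cst_functional h rfl rfl fun s u => (functional_eq s u).2.2.2.2.1]
    exact hbar.congr hA hQ (fun s u σ τ => (functional_sub σ τ s u).2.2.2.2.1) barG_sub (hu _) _
  · intro h ts us us' hu
    rw [cst_functional h rfl rfl fun s u => (functional_eq s u).2.2.2.2.2,
      cst_functional h rfl rfl fun s u => (functional_eq s u).2.2.2.2.2]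
    exact htilde.congr hA hQ (fun s u σ τ => (functional_sub σ τ s u).2.2.2.2.2) tildeG_sub (hu _) _

end

/-- Without λ: the value of the product in the defining equation is found from that of the factor. -/
theorem isProd_without {Ax : Fm IASig false → Prop} (hA : ∀ A, Arith A → Ax A)
    (hQ : ∀ A, QFAC A → Ax A) {F : Tm IASig false → Fn IASig false → Tm IASig false}
    (hF : ∀ s u σ τ, (F s u).sub σ τ = F (s.sub σ τ) (u.sub σ τ))
    {G : Tm IASig false → Tm IASig false → Tm IASig false} {t : Tm IASig true}
    (ht : ∀ Γ σ τ a u, (σ 0) = a → (τ 0) = u →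
      Ev Ax Γ σ τ t (G a (.app u a)))
    (h : Deriv Ax [] (.all0 (.imp (prod (.var 0) (lam t)).graph
      (.eq ((F (.var 0) (.var 0)).ren Nat.succ id) (.var 0))))) : IsProd Ax F G := by
  intro Γ x u δ hδ
  have E := eqBase hA hQ
  have h1 : Ev Ax Γ (scons x .var) (scons u .var) (prod (.var 0) (lam t)) (prod x δ) := by
    refine Ev.call E (a := ![x]) (β := ![δ]) (fun i => ?_) (fun j => ?_) (E.refl _ _)
    · fin_cases i; exact E.refl _ _
    · fin_cases j
      exact evF_lam_raw fun Δ ρ θ a e => ⟨_, ht _ _ _ _ _ rfl rfl, E.symm (hδ Δ ρ θ a e)⟩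
  have h2 := eq_of_ev h h1
  rw [hF] at h2
  exact h2

theorem isProd_with {Ax : Fm IASig true → Prop} (hA : ∀ A, Arith A → Ax A)
    (hQ : ∀ A, QFAC A → Ax A) (hL : ∀ A, LamConv A → Ax A)
    {F : Tm IASig true → Fn IASig true → Tm IASig true}
    (hF : ∀ s u σ τ, (F s u).sub σ τ = F (s.sub σ τ) (u.sub σ τ))
    {G : Tm IASig true → Tm IASig true → Tm IASig true}
    (hG : ∀ s t σ τ, (G s t).sub σ τ = G (s.sub σ τ) (t.sub σ τ))
    (h : Ax (.eq (F (.var 0) (.var 0)) (prod (.var 0) (lam (G (.var 0) (.app (.var 0) (.var 0))))))) :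
    IsProd Ax F G := by
  intro Γ x u δ hδ
  have E := eqBase hA hQ
  have h1 := ((Deriv.ax h).sub_nil (scons x .var) (scons u .var)).weaken (List.nil_subset Γ)
  simp only [Fm.sub, hF, functional_sub] at h1
  refine E.trans h1 (prod_congr hA hQ (EqBase.feqI fun Δ ρ θ a e => ?_) _)
  refine E.trans ?_ (E.symm (hδ Δ ρ θ a e))
  have h2 : Deriv Ax Δ _ := .ax (hL _ (.mk (G (.var 0) (.app (u.sub (fun n => .var (ρ n + 1)) fun n => .var (θ n)) (.var 0))) a))
  simp only [Tm.inst0, hG, Tm.sub, Fn.sub_sub, single0] at h2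
  simp only [lam, Fn.sub, Fn.ren, hG, Tm.ren_eq_sub, Tm.sub] at h2 ⊢
  rw [scons, Fn.ren_sub, Fn.ren_eq_sub u ρ θ]
  exact h2

end IA


namespace Arithmetic
variable {Ax : Fm L false → Prop} (R : Arithmetic Ax) {Γ Δ : List (Fm L false)}

/-! ### Bounded induction -/

theorem num_sub_eq_zero {x y d : R.Num Γ} (h : y = x + d) : x - y = 0 := by
  rw [h, R.sub_add_eq_zero]

theorem sqrt_mono {u : Fn L false} (h : Deriv Ax Γ (R.Sqrt u)) {ρ θ : ℕ → ℕ} (e : Ext ρ θ Γ Δ) :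
    Deriv Ax Δ (R.Sqrt (u.ren ρ θ)) := R.pairing.ax_mono h e

theorem p1_ren (u : Fn L false) (n : Tm L false) (ρ θ : ℕ → ℕ) :
    (R.p1 u n).ren ρ θ = R.p1 (u.ren ρ θ) (n.ren ρ θ) := by
  simp only [Tm.ren_eq_sub, Fn.ren_eq_sub, R.p1_sub]

/-- An operation respects equality of its number argument. -/
theorem num_functional {F : Tm L false → Fn L false → Tm L false}
    (hF : ∀ s u σ τ, (F s u).sub σ τ = F (s.sub σ τ) (u.sub σ τ)) (u : Fn L false) {s t : Tm L false}
    (h : R.num Γ s = R.num Γ t) : R.num Γ (F s u) = R.num Γ (F t u) := by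
  have := R.E.sub_congr_head (F (.var 0) (u.ren Nat.succ id)) (σ := .var) (τ := .var) (R.num_eq.1 h)
  simp only [hF, Fn.ren_sub, scons, id, Fn.sub_var, Tm.sub] at this
  exact R.num_eq.2 this

theorem num_add_succ (s t : Tm L false) :
    R.num Γ (R.add s (R.succ t)) = R.num Γ (R.succ (R.add s t)) := R.num_eq.2 (R.add_succ _ _ _)

theorem num_sub_of_eq_add {s t : Tm L false} {d : R.Num Γ} (h : R.num Γ s = R.num Γ t + d) :
    R.num Γ (R.sub s t) = d := R.num_add_sub_cancel h

theorem num_sub_of_add_eq {s t : Tm L false} {d : R.Num Γ} (h : R.num Γ t = R.num Γ s + d) :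
    R.num Γ (R.sub s t) = 0 := R.num_sub_eq_zero h

theorem num_sub_congr {s s' t t' : Tm L false} (h : R.num Γ s = R.num Γ s')
    (h' : R.num Γ t = R.num Γ t') : R.num Γ (R.sub s t) = R.num Γ (R.sub s' t') := by
  rw [num_sub, h, h', num_sub]

theorem pr_ren (x y : Tm L false) (ρ θ : ℕ → ℕ) :
    (R.pr x y).ren ρ θ = R.pr (x.ren ρ θ) (y.ren ρ θ) := by
  simp only [Tm.ren_eq_sub, R.pr_sub]

theorem num_succ_pd {s : Tm L false} {y : R.Num Γ} (h : R.num Γ s = y + 1) :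
    R.num Γ s = R.num Γ (R.succ (R.pd s)) := by
  obtain ⟨t, rfl⟩ := R.num_surj y
  rw [← num_succ] at h
  rw [num_succ, R.num_eq.2 (R.E.trans (R.pd_congr (R.num_eq.1 h)) (R.pd_succ _ _)), h, num_succ]

/-- Induction for equations up to a bound, which is the value of the variable `m`. -/
theorem ind_le (m : ℕ) {s t : Tm L false} {σ : ℕ → Tm L false} {τ : ℕ → Fn L false}
    (h0 : R.num Γ (s.sub (scons R.zero σ) τ) = R.num Γ (t.sub (scons R.zero σ) τ))
    (hs : ∀ Δ ρ θ a (d : R.Num Δ), Ext ρ θ Γ Δ → R.num Δ ((σ m).ren ρ θ) = R.num Δ a + d →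
      R.num Δ (s.sub (scons a fun n => (σ n).ren ρ θ) fun n => (τ n).ren ρ θ) =
        R.num Δ (t.sub (scons a fun n => (σ n).ren ρ θ) fun n => (τ n).ren ρ θ) →
      R.num Δ (s.sub (scons (R.succ a) fun n => (σ n).ren ρ θ) fun n => (τ n).ren ρ θ) =
        R.num Δ (t.sub (scons (R.succ a) fun n => (σ n).ren ρ θ) fun n => (τ n).ren ρ θ))
    {y : Tm L false} {d : R.Num Γ} (hy : R.num Γ (σ m) = R.num Γ y + d) :
    R.num Γ (s.sub (scons y σ) τ) = R.num Γ (t.sub (scons y σ) τ) := by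
  have := R.ind (A := .imp (.eq (.var (m + 1)) (R.add (.var 0) (R.sub (.var (m + 1)) (.var 0))))
    (.eq s t)) (Γ := Γ) (σ := σ) (τ := τ) ?_ ?_ y
  · refine R.num_eq.2 (this.impE ?_)
    simp only [Fm.sub, Tm.sub, R.add_sub, R.sub_sub, scons]
    refine R.num_eq.1 ?_
    rw [num_add, num_sub, R.num_add_sub_cancel hy, hy]
  · exact .impI (R.num_eq.1 (R.num_weaken h0 (List.subset_cons_self _ _)))
  · intro Δ ρ θ a e h
    refine .impI ?_
    simp only [Fm.sub, Tm.sub, R.add_sub, R.sub_sub, scons] at h ⊢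
    have h1 := R.num_eq.2 (Deriv.head (Ax := Ax) (A := .eq ((σ m).ren ρ θ)
      (R.add (R.succ a) (R.sub ((σ m).ren ρ θ) (R.succ a)))) (Γ := Δ))
    rw [num_add, num_succ, _root_.add_assoc] at h1
    refine R.num_eq.1 (hs _ ρ θ a _ (fun B hB => List.mem_cons_of_mem _ (e B hB)) h1 (R.num_eq.2 ?_))
    refine (h.weaken (List.subset_cons_self _ _)).impE (R.num_eq.1 ?_)
    rw [num_add, num_sub, R.num_add_sub_cancel h1, h1]

/-! ### Functions defined by terms -/

/-- δ(x) = T(x, u, v) for all x. -/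
def IsFun (Γ : List (Fm L false)) (T : Tm L false → Fn L false → Fn L false → Tm L false)
    (u v δ : Fn L false) : Prop :=
  ∀ Δ ρ θ x, Ext ρ θ Γ Δ → R.num Δ (.app (δ.ren ρ θ) x) = R.num Δ (T x (u.ren ρ θ) (v.ren ρ θ))

variable {R} in
theorem IsFun.mono {T : Tm L false → Fn L false → Fn L false → Tm L false} {u v δ : Fn L false}
    (h : R.IsFun Γ T u v δ) {ρ θ : ℕ → ℕ} (e : Ext ρ θ Γ Δ) :
    R.IsFun Δ T (u.ren ρ θ) (v.ren ρ θ) (δ.ren ρ θ) := by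
  intro Δ' ρ' θ' x e'
  simpa only [Fn.ren_ren] using h Δ' _ _ x (e.trans e')

variable {R} in
theorem IsFun.apply {T : Tm L false → Fn L false → Fn L false → Tm L false} {u v δ : Fn L false}
    (h : R.IsFun Γ T u v δ) (x : Tm L false) : R.num Γ (.app δ x) = R.num Γ (T x u v) := by
  simpa only [Fn.ren_id] using h Γ _ _ x (.refl Γ)

theorem exists_isFun {T : Tm L false → Fn L false → Fn L false → Tm L false}
    (hT : ∀ s u v σ τ, (T s u v).sub σ τ = T (s.sub σ τ) (u.sub σ τ) (v.sub σ τ)) (u v : Fn L false)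
    {C : Fm L false} (H : ∀ Δ ρ θ δ, Ext ρ θ Γ Δ → R.IsFun Δ T (u.ren ρ θ) (v.ren ρ θ) δ →
      Deriv Ax Δ (C.ren ρ θ)) : Deriv Ax Γ C := by
  refine R.E.exists_fun (T (.var 0) (u.ren Nat.succ id) (v.ren Nat.succ id))
    fun Δ ρ θ δ e h => H Δ ρ θ δ e fun Δ' ρ' θ' x e' => R.num_eq.2 ?_
  have := h Δ' ρ' θ' x e'
  simp only [hT, Tm.sub, Fn.ren_sub, scons, id, ← Fn.ren_eq_sub] at this
  simpa only [Fn.ren_ren] using this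

/-- The sections of `B` in blocks: the block at k² + y, for y ≤ 2k, is λy.B(x, y), where x is the first
component of k. -/
def block (n : Tm L false) (u B : Fn L false) : Tm L false :=
  .app B (R.pr (R.p1 u (.app u n)) (R.sub n (R.mul (.app u n) (.app u n))))

theorem block_sub (n : Tm L false) (u B : Fn L false) (σ : ℕ → Tm L false) (τ : ℕ → Fn L false) :
    (R.block n u B).sub σ τ = R.block (n.sub σ τ) (u.sub σ τ) (B.sub σ τ) := by
  simp only [block, Tm.sub, R.pr_sub, R.p1_sub, R.sub_sub, R.mul_sub]

theorem block_apply {u B α δ : Fn L false} {x k y : Tm L false} {e : R.Num Γ}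
    (hu : Deriv Ax Γ (R.Sqrt u)) (hδ : R.IsFun Γ R.block u B δ)
    (hα : Deriv Ax Γ (R.pairing.sect α B x)) (hk : R.num Γ (R.p1 u k) = R.num Γ x)
    (hy : R.num Γ k + R.num Γ k = R.num Γ y + e) :
    R.num Γ (.app δ (R.add (R.mul k k) y)) = R.num Γ (.app α y) := by
  have h : R.num Γ (.app u (R.add (R.mul k k) y)) = R.num Γ k := R.sqrt_eq hu rfl hy
  rw [hδ.apply, block, R.num_eq.2 (R.pairing.sect_apply hα y)]
  refine R.num_app (R.num_pr_congr ((R.num_p1_congr h).trans hk) ?_)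
  rw [num_sub, num_mul, h]
  exact R.num_add_sub_cancel rfl

/-- The block at ⟨x, z⟩ is longer than z. -/
theorem add_pr (x z : Tm L false) : ∃ e, R.num Γ (R.pr x z) + R.num Γ (R.pr x z) = R.num Γ z + e := by
  refine ⟨2 * (R.num Γ x + R.num Γ z) * (R.num Γ x + R.num Γ z) + 4 * R.num Γ x + R.num Γ z, ?_⟩
  simp only [pr, num_add, num_mul]
  ring

/-! ### Uniform evaluation of operations on functions -/

/-- δ(x) = F(g(x), λy.B(x, y)) for all x. -/
def Values (Γ : List (Fm L false)) (F : Tm L false → Fn L false → Tm L false) (g B δ : Fn L false) :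
    Prop :=
  ∀ Δ ρ θ x α, Ext ρ θ Γ Δ → Deriv Ax Δ (R.pairing.sect α (B.ren ρ θ) x) →
    R.num Δ (F (.app (g.ren ρ θ) x) α) = R.num Δ (.app (δ.ren ρ θ) x)

variable {R} in
theorem Values.mono {F : Tm L false → Fn L false → Tm L false} {g B δ : Fn L false}
    (h : R.Values Γ F g B δ) {ρ θ : ℕ → ℕ} (e : Ext ρ θ Γ Δ) :
    R.Values Δ F (g.ren ρ θ) (B.ren ρ θ) (δ.ren ρ θ) := by
  intro Δ' ρ' θ' x α e' hα
  simp only [Fn.ren_ren] at hα ⊢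
  exact h _ _ _ _ _ (e.trans e') hα

variable {R} in
theorem Values.apply {F : Tm L false → Fn L false → Tm L false} {g B δ α : Fn L false}
    {x : Tm L false} (h : R.Values Γ F g B δ) (hα : Deriv Ax Γ (R.pairing.sect α B x)) :
    R.num Γ (F (.app g x) α) = R.num Γ (.app δ x) := by
  simpa only [Fn.ren_id] using h Γ _ _ x α (.refl Γ) (by simpa only [Fn.ren_id] using hα)

/-- For all g, B, the value F(g(x), λy.B(x, y)) is a function of x. -/
def UniformOp (F : Tm L false → Fn L false → Tm L false) : Prop :=
  ∀ {Γ : List (Fm L false)} {u : Fn L false} {C : Fm L false} (g B : Fn L false),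
    Deriv Ax Γ (R.Sqrt u) → (∀ Δ ρ θ δ, Ext ρ θ Γ Δ → R.Values Δ F (g.ren ρ θ) (B.ren ρ θ) δ →
      Deriv Ax Δ (C.ren ρ θ)) → Deriv Ax Γ C

/-- The values are a function if a quantifier-free formula describes them. -/
theorem exists_values {F : Tm L false → Fn L false → Tm L false} {g B : Fn L false} {A C : Fm L false}
    (hA : A.QF) (σ : ℕ → Tm L false) (τ : ℕ → Fn L false)
    (hex : ∀ Δ ρ θ x α, Ext ρ θ Γ Δ → Deriv Ax Δ (R.pairing.sect α (B.ren ρ θ) x) →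
      Deriv Ax Δ (A.sub (scons (F (.app (g.ren ρ θ) x) α) (scons x fun n => (σ n).ren ρ θ))
        fun n => (τ n).ren ρ θ))
    (huniq : ∀ Δ ρ θ x α w, Ext ρ θ Γ Δ → Deriv Ax Δ (R.pairing.sect α (B.ren ρ θ) x) →
      Deriv Ax Δ (A.sub (scons w (scons x fun n => (σ n).ren ρ θ)) fun n => (τ n).ren ρ θ) →
      R.num Δ (F (.app (g.ren ρ θ) x) α) = R.num Δ w)
    (H : ∀ Δ ρ θ δ, Ext ρ θ Γ Δ → R.Values Δ F (g.ren ρ θ) (B.ren ρ θ) δ → Deriv Ax Δ (C.ren ρ θ)) :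
    Deriv Ax Γ C := by
  refine R.E.choice hA (σ := σ) (τ := τ) ?_ fun Δ ρ θ δ e h => H Δ ρ θ δ e
    fun Δ' ρ' θ' x α e' hα => ?_
  · refine .envAll0I fun Δ ρ θ a e => R.pairing.exists_sect R.E (B.ren ρ θ) a
      fun Δ' ρ' θ' α e' hα => ?_
    rw [Fm.sub_ren]
    rw [Fn.ren_ren] at hα
    refine .envEx0I (F (.app (g.ren (fun n => ρ' (ρ n)) fun n => θ' (θ n)) (a.ren ρ' θ')) α) ?_
    have := hex Δ' _ _ _ α (e.trans e') hα
    convert this using 2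
    · funext n
      rcases n with _ | _ | n
      · rfl
      · rfl
      · simp only [scons, Tm.ren_ren]
    · funext n
      simp only [Fn.ren_ren]
  · simp only [Fn.ren_ren] at hα ⊢
    refine huniq Δ' _ _ x α _ (e.trans e') hα ?_
    simpa only [Fn.ren_ren, Tm.ren_ren] using h Δ' ρ' θ' x e'

/-- Operations with a uniform evaluation are closed under definition from the composition of the argument
with a function `G`. -/
theorem UniformOp.comp {F F' : Tm L false → Fn L false → Tm L false}
    {G : Tm L false → Tm L false → Tm L false} (hF : R.UniformOp F)
    (hG : ∀ s t σ τ, (G s t).sub σ τ = G (s.sub σ τ) (t.sub σ τ))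
    (hF' : ∀ s u σ τ, (F' s u).sub σ τ = F' (s.sub σ τ) (u.sub σ τ))
    (h : ∀ Γ s u δ, (∀ Δ ρ θ a, Ext ρ θ Γ Δ →
      Deriv Ax Δ (.eq (.app (δ.ren ρ θ) a) (G a (.app (u.ren ρ θ) a)))) →
        Deriv Ax Γ (.eq (F' s u) (F s δ))) : R.UniformOp F' := by
  intro Γ u C g B hu H
  refine R.exists_isFun (T := fun n u B => G (R.p2 u n) (.app B n))
    (by intros; simp only [hG, R.p2_sub, Tm.sub]) u B fun Δ₁ ρ₁ θ₁ B' e₁ hB => ?_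
  refine hF (g.ren ρ₁ θ₁) B' (R.sqrt_mono hu e₁) fun Δ₂ ρ₂ θ₂ δ e₂ hδ => ?_
  rw [Fm.ren_ren]
  refine H _ _ _ δ (e₁.trans e₂) fun Δ ρ θ x α e hα => R.num_eq.2 ?_
  refine R.pairing.exists_sect R.E ((B'.ren ρ₂ θ₂).ren ρ θ) x fun Δ' ρ' θ' α' e' hα' => ?_
  rw [Fm.ren, Tm.ren_eq_sub, hF']
  simp only [← Fn.ren_eq_sub, ← Tm.ren_eq_sub, Tm.ren, Fn.ren_ren] at hα hα' ⊢
  refine R.E.trans (h Δ' _ _ α' fun Δ'' ρ'' θ'' a e'' => ?_) (R.num_eq.1 ?_)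
  · have hu' := R.sqrt_mono hu ((((e₁.trans e₂).trans e).trans e').trans e'')
    refine R.num_eq.1 ?_
    have h1 := R.num_eq.2 (R.pairing.sect_apply (R.pairing.sect_mono hα' e'') a)
    have h2 := R.num_eq.2 (R.pairing.sect_apply (R.pairing.sect_mono hα (e'.trans e'')) a)
    have h3 := hB _ _ _ (R.pr (x.ren (fun n => ρ'' (ρ' n)) fun n => θ'' (θ' n)) a)
      (((e₂.trans e).trans e').trans e'')
    simp only [Fn.ren_ren, Tm.ren_ren] at h1 h2 h3 ⊢
    exact h1.trans (h3.trans (R.num_eq.2 (R.congr₂ hG (R.num_eq.1 (R.num_p2_pr hu' _ _))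
      (R.num_eq.1 h2.symm))))
  · have := hδ Δ' _ _ (x.ren ρ' θ') α' (e.trans e') (by simpa only [Fn.ren_ren] using hα')
    simpa only [Fn.ren_ren] using this

end Arithmetic

namespace IA

/-! ### Uniform evaluation of sums and products -/

section
variable {Ax : Fm IASig false → Prop} (hA : ∀ A, Arith A → Ax A) (hQ : ∀ A, QFAC A → Ax A)
  {Γ : List (Fm IASig false)}

local notation "N" => arithmetic hA hQ

theorem num_sum_zero (u : Fn IASig false) : (N).num Γ (sum (N).zero u) = 0 :=
  (N).num_eq.2 (sum_zero hA u)

theorem num_sum_succ (s : Tm IASig false) (u : Fn IASig false) :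
    (N).num Γ (sum ((N).succ s) u) = (N).num Γ (sum s u) + (N).num Γ (.app u s) :=
  (N).num_eq.2 (sum_succ hA s u)

theorem num_prod_zero (u : Fn IASig false) : (N).num Γ (prod (N).zero u) = 1 :=
  (N).num_eq.2 (prod_zero hA u)

theorem num_prod_succ (s : Tm IASig false) (u : Fn IASig false) :
    (N).num Γ (prod ((N).succ s) u) = (N).num Γ (prod s u) * (N).num Γ (.app u s) :=
  (N).num_eq.2 (prod_succ hA s u)

theorem sum_sub (s : Tm IASig b) (u : Fn IASig b) (σ : ℕ → Tm IASig b) (τ : ℕ → Fn IASig b) :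
    (sum s u).sub σ τ = sum (s.sub σ τ) (u.sub σ τ) := (functional_sub σ τ s u).1

theorem prod_sub (s : Tm IASig b) (u : Fn IASig b) (σ : ℕ → Tm IASig b) (τ : ℕ → Fn IASig b) :
    (prod s u).sub σ τ = prod (s.sub σ τ) (u.sub σ τ) := (functional_sub σ τ s u).2.1

theorem sgb_sub (s : Tm IASig b) (σ : ℕ → Tm IASig b) (τ : ℕ → Fn IASig b) :
    (sgb s).sub σ τ = sgb (s.sub σ τ) := (one_place_sub σ τ s).2.2.1

theorem num_sgb_congr {s t : Tm IASig false} (h : (N).num Γ s = (N).num Γ t) :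
    (N).num Γ (sgb s) = (N).num Γ (sgb t) :=
  (N).num_functional (F := fun s _ => sgb s) (fun s _ => sgb_sub s) (.var 0) h

theorem num_sgb_of_eq_zero {s : Tm IASig false} (h : (N).num Γ s = 0) : (N).num Γ (sgb s) = 1 :=
  (num_sgb_congr hA hQ (t := (N).zero) h).trans ((N).num_eq.2 (sgb_zero hA))

theorem num_sgb_of_eq_succ {s : Tm IASig false} {y : (N).Num Γ} (h : (N).num Γ s = y + 1) :
    (N).num Γ (sgb s) = 0 := by
  obtain ⟨t, rfl⟩ := (N).num_surj y
  rw [← (N).num_succ] at h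
  exact (num_sgb_congr hA hQ h).trans ((N).num_eq.2 (sgb_succ hA t))

/-- The partial sums of the function that lists the blocks: the part of the block `k` below `z` contributes
the sum over the section. -/
theorem sum_block {u B α δ : Fn IASig false} {x k z : Tm IASig false} {e : (N).Num Γ}
    (hu : Deriv Ax Γ ((N).Sqrt u)) (hδ : (N).IsFun Γ (N).block u B δ)
    (hα : Deriv Ax Γ ((N).pairing.sect α B x)) (hk : (N).num Γ ((N).p1 u k) = (N).num Γ x)
    (hz : (N).num Γ k + (N).num Γ k = (N).num Γ z + e) :
    (N).num Γ (sum ((N).add ((N).mul k k) z) δ) =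
      (N).num Γ (sum ((N).mul k k) δ) + (N).num Γ (sum z α) := by
  have := (N).ind_le 1 (s := sum ((N).add ((N).mul (.var 1) (.var 1)) (.var 0)) (.var 0))
    (t := (N).add (sum ((N).mul (.var 1) (.var 1)) (.var 0)) (sum (.var 0) (.var 1)))
    (σ := scons k (scons z .var)) (τ := scons δ (scons α .var)) (Γ := Γ) (y := z) (d := 0) ?_ ?_
    (_root_.add_zero _).symm
  · simpa only [sum_sub, (N).add_sub, (N).mul_sub, Tm.sub, Fn.sub, scons, (N).num_add] using this
  · simp only [sum_sub, (N).add_sub, (N).mul_sub, Tm.sub, Fn.sub, scons]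
    rw [(N).num_add, num_sum_zero, _root_.add_zero]
    exact (N).num_functional sum_sub δ (_root_.add_zero ((N).num Γ _))
  · intro Δ ρ θ a d e' hd h
    simp only [sum_sub, (N).add_sub, (N).mul_sub, Tm.sub, Fn.sub, scons] at h hd ⊢
    obtain ⟨e, rfl⟩ := (N).num_surj e
    have hz' := (N).num_mono (s := (N).add k k) (t := (N).add z e) hz e'
    rw [(N).add_ren, (N).add_ren, (N).num_add, (N).num_add, hd, _root_.add_assoc] at hz'
    have hk' := (N).num_mono hk e'
    rw [(N).p1_ren] at hk'
    have h1 := (N).block_apply ((N).sqrt_mono hu e') (hδ.mono e') ((N).pairing.sect_mono hα e')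
      hk' hz'
    rw [(N).num_functional sum_sub _ ((N).num_add_succ _ _), num_sum_succ, h, h1, (N).num_add,
      (N).num_add, num_sum_succ, _root_.add_assoc]

/-- The sum over a section is a difference of two values of one function of partial sums. -/
theorem uniformOp_sum : (N).UniformOp sum := by
  intro Γ u C g B hu H
  refine (N).exists_isFun (N).block_sub u B fun Δ₁ ρ₁ θ₁ δ e₁ hδ => ?_
  refine (N).exists_isFun (T := fun x g δ =>
      let k := (N).pr x (.app g x)
      (N).sub (sum ((N).add ((N).mul k k) (.app g x)) δ) (sum ((N).mul k k) δ))
    (by intros; simp only [sum_sub, (N).sub_sub, (N).add_sub, (N).mul_sub, (N).pr_sub, Tm.sub])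
    (g.ren ρ₁ θ₁) δ fun Δ₂ ρ₂ θ₂ ε e₂ hε => ?_
  rw [Fm.ren_ren]
  refine H _ _ _ ε (e₁.trans e₂) fun Δ ρ θ x α e hα => ?_
  have hu' := (N).sqrt_mono hu ((e₁.trans e₂).trans e)
  obtain ⟨d, hd⟩ := (N).add_pr (Γ := Δ) x (.app (((g.ren ρ₁ θ₁).ren ρ₂ θ₂).ren ρ θ) x)
  simp only [Fn.ren_ren] at hα hd ⊢
  have h1 := hδ.mono (e₂.trans e)
  simp only [Fn.ren_ren] at h1
  have h2 := sum_block hA hQ hu' h1 hα ((N).num_p1_pr hu' _ _) hd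
  have h3 := hε _ _ _ x e
  simp only [Fn.ren_ren] at h3
  rw [h3, (N).num_sub, h2, _root_.add_comm, (N).add_sub_cancel]

/-- s + sgb(s), which is s if s ≠ 0 and 1 otherwise. -/
def orOne (s : Tm IASig false) : Tm IASig false := (N).add s (sgb s)

theorem orOne_sub (s : Tm IASig false) (σ : ℕ → Tm IASig false) (τ : ℕ → Fn IASig false) :
    (orOne hA hQ s).sub σ τ = orOne hA hQ (s.sub σ τ) := by
  simp only [orOne, (N).add_sub, sgb_sub]

theorem num_orOne (s : Tm IASig false) :
    (N).num Γ (orOne hA hQ s) = (N).num Γ ((N).pd (orOne hA hQ s)) + 1 := by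
  rw [← (N).num_succ]
  refine (N).num_eq.2 ((N).cases s (fun Δ _ h => (N).num_eq.1 ((N).num_succ_pd (y := 0) ?_))
    fun Δ y _ h => (N).num_eq.1 ((N).num_succ_pd (y := (N).num Δ y) ?_))
  · rw [orOne, (N).num_add, h, num_sgb_of_eq_zero hA hQ h]
  · rw [orOne, (N).num_add, h, num_sgb_of_eq_succ hA hQ h, _root_.add_zero]

/-- a · sgb(s) = (a + sgb a) · sgb(s + sgb a): both sides are 0 if a = 0. -/
theorem num_mul_sgb (a s : Tm IASig false) : (N).num Γ a * (N).num Γ (sgb s) =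
    (N).num Γ (orOne hA hQ a) * (N).num Γ (sgb ((N).add s (sgb a))) := by
  rw [← (N).num_mul, ← (N).num_mul]
  refine (N).num_eq.2 ((N).cases a (fun Δ _ h => (N).num_eq.1 ?_) fun Δ y _ h => (N).num_eq.1 ?_)
  · rw [(N).num_mul, (N).num_mul, h, num_sgb_of_eq_succ hA hQ (s := (N).add s (sgb a)) (y := (N).num Δ s)]
    · simp
    · rw [(N).num_add, num_sgb_of_eq_zero hA hQ h]
  · have h1 := num_sgb_of_eq_succ hA hQ h
    rw [(N).num_mul, (N).num_mul, orOne, (N).num_add, h1, _root_.add_zero,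
      num_sgb_congr hA hQ (s := (N).add s (sgb a)) (t := s)]
    rw [(N).num_add, h1, _root_.add_zero]

/-- A product of nonzero factors is nonzero. -/
theorem num_prod_orOne {δ ε : Fn IASig false}
    (hε : (N).IsFun Γ (fun n u _ => orOne hA hQ (.app u n)) δ δ ε) (s : Tm IASig false) :
    (N).num Γ (prod s ε) = (N).num Γ ((N).pd (prod s ε)) + 1 := by
  rw [← (N).num_succ]
  have := (N).ind_eq (s := prod (.var 0) (.var 0)) (t := (N).succ ((N).pd (prod (.var 0) (.var 0))))
    (σ := .var) (τ := scons ε .var) (Γ := Γ) ?_ ?_ s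
  · simpa only [prod_sub, (N).succ_sub, (N).pd_sub, Tm.sub, Fn.sub, scons] using this
  · simp only [prod_sub, (N).succ_sub, (N).pd_sub, Tm.sub, Fn.sub, scons]
    refine (N).num_succ_pd (y := 0) ?_
    rw [num_prod_zero, _root_.zero_add]
  · intro Δ ρ θ a e h
    simp only [prod_sub, (N).succ_sub, (N).pd_sub, Tm.sub, Fn.sub, scons] at h ⊢
    have h1 := num_prod_succ hA hQ (Γ := Δ) a (ε.ren ρ θ)
    rw [h, hε Δ ρ θ a e, num_orOne, (N).num_succ] at h1
    refine (N).num_succ_pd (y := (N).num Δ ((N).pd (prod a (ε.ren ρ θ))) *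
      (N).num Δ ((N).pd (orOne hA hQ (.app (δ.ren ρ θ) a))) + (N).num Δ ((N).pd (prod a (ε.ren ρ θ))) +
        (N).num Δ ((N).pd (orOne hA hQ (.app (δ.ren ρ θ) a)))) ?_
    rw [h1]
    ring

/-- The product over a part of a block, where the factors 0 of the product over the blocks are replaced by
1; their number is the sum. -/
theorem prod_block {u B α δ ε β : Fn IASig false} {x k z : Tm IASig false} {e : (N).Num Γ}
    (hu : Deriv Ax Γ ((N).Sqrt u)) (hδ : (N).IsFun Γ (N).block u B δ)
    (hε : (N).IsFun Γ (fun n u _ => orOne hA hQ (.app u n)) δ δ ε)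
    (hα : Deriv Ax Γ ((N).pairing.sect α B x))
    (hβ : (N).IsFun Γ (fun n u _ => sgb (.app u n)) α α β)
    (hk : (N).num Γ ((N).p1 u k) = (N).num Γ x)
    (hz : (N).num Γ k + (N).num Γ k = (N).num Γ z + e) :
    (N).num Γ (prod z α) * (N).num Γ (prod ((N).mul k k) ε) =
      (N).num Γ (prod ((N).add ((N).mul k k) z) ε) * (N).num Γ (sgb (sum z β)) := by
  have := (N).ind_le 1 (s := (N).mul (prod (.var 0) (.var 1)) (prod ((N).mul (.var 1) (.var 1)) (.var 0)))
    (t := (N).mul (prod ((N).add ((N).mul (.var 1) (.var 1)) (.var 0)) (.var 0))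
      (sgb (sum (.var 0) (.var 2))))
    (σ := scons k (scons z .var)) (τ := scons ε (scons α (scons β .var))) (Γ := Γ) (y := z) (d := 0) ?_ ?_
    (_root_.add_zero _).symm
  · simpa only [sum_sub, prod_sub, sgb_sub, (N).add_sub, (N).mul_sub, Tm.sub, Fn.sub, scons,
      (N).num_mul] using this
  · simp only [sum_sub, prod_sub, sgb_sub, (N).add_sub, (N).mul_sub, Tm.sub, Fn.sub, scons]
    rw [(N).num_mul, (N).num_mul, num_prod_zero, num_sgb_of_eq_zero hA hQ (num_sum_zero hA hQ _),
      one_mul, mul_one]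
    exact (N).num_functional prod_sub ε (_root_.add_zero ((N).num Γ _)).symm
  · intro Δ ρ θ a d e' hd h
    simp only [sum_sub, prod_sub, sgb_sub, (N).add_sub, (N).mul_sub, Tm.sub, Fn.sub, scons] at h hd ⊢
    obtain ⟨e, rfl⟩ := (N).num_surj e
    have hz' := (N).num_mono (s := (N).add k k) (t := (N).add z e) hz e'
    rw [(N).add_ren, (N).add_ren, (N).num_add, (N).num_add, hd, _root_.add_assoc] at hz'
    have hk' := (N).num_mono hk e'
    rw [(N).p1_ren] at hk'
    have h1 := (N).block_apply ((N).sqrt_mono hu e') (hδ.mono e') ((N).pairing.sect_mono hα e')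
      hk' hz'
    have h2 := hε Δ ρ θ ((N).add ((N).mul (k.ren ρ θ) (k.ren ρ θ)) a) e'
    have h3 := (N).num_functional (Γ := Δ) (F := fun s _ => orOne hA hQ s) (fun s _ => orOne_sub hA hQ s)
      (.var 0) h1
    have h4 := num_mul_sgb hA hQ (Γ := Δ) (.app (α.ren ρ θ) a) (sum a (β.ren ρ θ))
    have h5 : (N).num Δ (sum ((N).succ a) (β.ren ρ θ)) =
        (N).num Δ ((N).add (sum a (β.ren ρ θ)) (sgb (.app (α.ren ρ θ) a))) := by
      rw [num_sum_succ, hβ Δ ρ θ a e']; rfl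
    rw [(N).num_mul, (N).num_mul] at h ⊢
    rw [(N).num_functional prod_sub _ ((N).num_add_succ _ _), num_prod_succ, num_prod_succ, h2, h3,
      num_sgb_congr hA hQ h5, mul_right_comm, h, mul_assoc, mul_assoc, ← h4,
      mul_comm ((N).num Δ (sgb _)), mul_left_comm]

/-- The equation that describes the product over a section by values of functions. -/
theorem prod_values {u g B α δ ε B' γ : Fn IASig false} {x : Tm IASig false}
    (hu : Deriv Ax Γ ((N).Sqrt u)) (hδ : (N).IsFun Γ (N).block u B δ)
    (hε : (N).IsFun Γ (fun n u _ => orOne hA hQ (.app u n)) δ δ ε)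
    (hB : (N).IsFun Γ (fun n u _ => sgb (.app u n)) B B B') (hγ : (N).Values Γ sum g B' γ)
    (hα : Deriv Ax Γ ((N).pairing.sect α B x)) :
    let k := (N).pr x (.app g x)
    (N).num Γ (prod (.app g x) α) * (N).num Γ (prod ((N).mul k k) ε) =
      (N).num Γ (prod ((N).add ((N).mul k k) (.app g x)) ε) * (N).num Γ (sgb (.app γ x)) := by
  intro k
  rw [← (N).num_mul, ← (N).num_mul]
  refine (N).num_eq.2 ((N).exists_isFun (T := fun n u _ => sgb (.app u n))
    (by intros; simp only [sgb_sub, Tm.sub]) α α fun Δ ρ θ β e hβ => ?_)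
  rw [Fm.ren_eq_sub]
  simp only [Fm.sub, (N).mul_sub, (N).add_sub, (N).pr_sub, prod_sub, sgb_sub, Tm.sub, k]
  simp only [← Fn.ren_eq_sub, ← Tm.ren_eq_sub]
  obtain ⟨d, hd⟩ := (N).add_pr (Γ := Δ) (x.ren ρ θ) (.app (g.ren ρ θ) (x.ren ρ θ))
  have hu := (N).sqrt_mono hu e
  have hα := (N).pairing.sect_mono hα e
  have h := prod_block hA hQ hu (hδ.mono e) (hε.mono e) hα hβ ((N).num_p1_pr hu _ _) hd
  refine (N).num_eq.1 (h.trans ?_)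
  rw [(N).num_mul]
  refine congrArg _ (num_sgb_congr hA hQ ((hγ.mono e).apply ((N).pairing.sectI fun Δ' ρ' θ' y e' => ?_)))
  refine (N).num_eq.1 ?_
  rw [hβ _ _ _ _ e', hB.mono e _ _ _ _ e']
  exact num_sgb_congr hA hQ ((N).num_eq.2 ((N).pairing.sect_apply ((N).pairing.sect_mono hα e') y))

/-- The products over the sections are a function, as they are determined by an equation between values
of functions: the factor on the left is a product of numbers different from 0. -/
theorem exists_prod_values {u g B δ ε B' γ : Fn IASig false} {C : Fm IASig false}
    (hu : Deriv Ax Γ ((N).Sqrt u)) (hδ : (N).IsFun Γ (N).block u B δ)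
    (hε : (N).IsFun Γ (fun n u _ => orOne hA hQ (.app u n)) δ δ ε)
    (hB : (N).IsFun Γ (fun n u _ => sgb (.app u n)) B B B') (hγ : (N).Values Γ sum g B' γ)
    (H : ∀ Δ ρ θ δ, Ext ρ θ Γ Δ → (N).Values Δ prod (g.ren ρ θ) (B.ren ρ θ) δ → Deriv Ax Δ (C.ren ρ θ)) :
    Deriv Ax Γ C := by
  refine (N).exists_values (F := prod) (A :=
    .eq ((N).mul (.var 0) (prod ((N).mul ((N).pr (.var 1) (.app (.var 2) (.var 1)))
        ((N).pr (.var 1) (.app (.var 2) (.var 1)))) (.var 0)))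
      ((N).mul (prod ((N).add ((N).mul ((N).pr (.var 1) (.app (.var 2) (.var 1)))
        ((N).pr (.var 1) (.app (.var 2) (.var 1)))) (.app (.var 2) (.var 1))) (.var 0))
        (sgb (.app (.var 1) (.var 1))))) trivial
    .var (scons ε (scons γ (scons g .var)))
    (fun Δ ρ θ x α e hα => ?_) (fun Δ ρ θ x α w e hα h => ?_) H
  · simp only [Fm.sub, (N).mul_sub, (N).add_sub, (N).pr_sub, prod_sub, sgb_sub, Tm.sub, Fn.sub, scons]
    exact (N).num_eq.1
      (prod_values hA hQ ((N).sqrt_mono hu e) (hδ.mono e) (hε.mono e) (hB.mono e) (hγ.mono e) hα)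
  · simp only [Fm.sub, (N).mul_sub, (N).add_sub, (N).pr_sub, prod_sub, sgb_sub, Tm.sub, Fn.sub,
      scons] at h
    have h1 :=
      prod_values hA hQ ((N).sqrt_mono hu e) (hδ.mono e) (hε.mono e) (hB.mono e) (hγ.mono e) hα
    have h2 := ((N).num_eq.2 h).symm
    rw [(N).num_mul, (N).num_mul, ← h1, mul_comm] at h2
    exact (N).mul_cancel (num_prod_orOne hA hQ (hε.mono e) _) (h2.trans (mul_comm _ _))

/-- The product over a section is a quotient of two values of one function of partial products, as long as
no factor is 0. The factors 0 are therefore replaced by 1 and counted separately, by a sum. -/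
theorem uniformOp_prod : (N).UniformOp prod := by
  intro Γ u C g B hu H
  refine (N).exists_isFun (N).block_sub u B fun Δ₁ ρ₁ θ₁ δ e₁ hδ => ?_
  refine (N).exists_isFun (T := fun n u _ => orOne hA hQ (.app u n))
    (by intros; simp only [orOne_sub, Tm.sub]) δ δ fun Δ₂ ρ₂ θ₂ ε e₂ hε => ?_
  refine (N).exists_isFun (T := fun n u _ => sgb (.app u n))
    (by intros; simp only [sgb_sub, Tm.sub]) ((B.ren ρ₁ θ₁).ren ρ₂ θ₂) ((B.ren ρ₁ θ₁).ren ρ₂ θ₂)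
    fun Δ₃ ρ₃ θ₃ B' e₃ hB => ?_
  have hu' := (N).sqrt_mono hu ((e₁.trans e₂).trans e₃)
  refine uniformOp_sum hA hQ (((g.ren ρ₁ θ₁).ren ρ₂ θ₂).ren ρ₃ θ₃) B' hu' fun Δ₄ ρ₄ θ₄ γ e₄ hγ => ?_
  have hδ' := ((hδ.mono e₂).mono e₃).mono e₄
  have hu'' := (N).sqrt_mono hu' e₄
  simp only [Fn.ren_ren] at hδ' hu''
  have hB' := hB.mono e₄
  have hε' := (hε.mono e₃).mono e₄
  simp only [Fn.ren_ren] at hε' hB' hγ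
  refine exists_prod_values hA hQ hu'' hδ' hε' hB' hγ fun Δ ρ θ ζ e hζ => ?_
  simp only [Fm.ren_ren, Fn.ren_ren] at hζ ⊢
  exact H _ _ _ _ ((((e₁.trans e₂).trans e₃).trans e₄).trans e) hζ

end

end IA

namespace IA

/-! ### Uniform evaluation of maxima and minima -/

section
variable {Ax : Fm IASig false → Prop} (hA : ∀ A, Arith A → Ax A) (hQ : ∀ A, QFAC A → Ax A)
  {Γ : List (Fm IASig false)}

local notation "N" => arithmetic hA hQ

/-- The operation `F` determines a number F(z, α) by the values H(F(z, α), w), which are c for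
w ≥ F(z, α) and d for w < F(z, α), and are the product of the values H(α(y), w) for y ≤ z. -/
structure Threshold (F : Tm IASig false → Fn IASig false → Tm IASig false)
    (H : Tm IASig false → Tm IASig false → Tm IASig false) (c d : Tm IASig false) : Prop where
  F_sub : ∀ s u σ τ, (F s u).sub σ τ = F (s.sub σ τ) (u.sub σ τ)
  H_sub : ∀ s t σ τ, (H s t).sub σ τ = H (s.sub σ τ) (t.sub σ τ)
  c_sub : ∀ σ τ, c.sub σ τ = c
  d_sub : ∀ σ τ, d.sub σ τ = d
  ne : ∀ Γ C, (N).num Γ c = (N).num Γ d → Deriv Ax Γ C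
  ge : ∀ Γ a w (e : (N).Num Γ), (N).num Γ w = (N).num Γ a + e → (N).num Γ (H a w) = (N).num Γ c
  lt : ∀ Γ a w (e : (N).Num Γ), (N).num Γ a = (N).num Γ w + e + 1 → (N).num Γ (H a w) = (N).num Γ d
  zero : ∀ Γ u, (N).num Γ (F (N).zero u) = (N).num Γ (.app u (N).zero)
  succ : ∀ Γ s u w, (N).num Γ (H (F ((N).succ s) u) w) =
    (N).num Γ (H (F s u) w) * (N).num Γ (H (.app u ((N).succ s)) w)

namespace Threshold
variable {hA hQ} {F : Tm IASig false → Fn IASig false → Tm IASig false}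
  {H : Tm IASig false → Tm IASig false → Tm IASig false} {c d : Tm IASig false}
  (T : Threshold hA hQ F H c d)
include T

theorem num_H {s s' t t' : Tm IASig false} (h : (N).num Γ s = (N).num Γ s')
    (h' : (N).num Γ t = (N).num Γ t') : (N).num Γ (H s t) = (N).num Γ (H s' t') :=
  (N).num_eq.2 ((N).congr₂ T.H_sub ((N).num_eq.1 h) ((N).num_eq.1 h'))

/-- The values H(α(y), w) for y ≤ z multiply to H(F(z, α), w). -/
theorem prod_eq {α β : Fn IASig false} {w : Tm IASig false}
    (hβ : ∀ Δ ρ θ y, Ext ρ θ Γ Δ →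
      (N).num Δ (.app (β.ren ρ θ) y) = (N).num Δ (H (.app (α.ren ρ θ) y) (w.ren ρ θ)))
    (z : Tm IASig false) : (N).num Γ (prod ((N).succ z) β) = (N).num Γ (H (F z α) w) := by
  have h := (N).ind_eq (s := prod ((N).succ (.var 0)) (.var 1)) (t := H (F (.var 0) (.var 0)) (.var 1))
    (σ := scons w .var) (τ := scons α (scons β .var)) (Γ := Γ) ?_ ?_ z
  · simpa only [prod_sub, T.H_sub, T.F_sub, (N).succ_sub, Tm.sub, Fn.sub, scons] using h
  · simp only [prod_sub, T.H_sub, T.F_sub, (N).succ_sub, Tm.sub, Fn.sub, scons]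
    have h := hβ Γ _ _ (N).zero (.refl Γ)
    rw [Fn.ren_id, Fn.ren_id, Tm.ren_id] at h
    rw [num_prod_succ, num_prod_zero, one_mul, h, T.num_H (T.zero _ _) rfl]
  · intro Δ ρ θ a e h
    simp only [prod_sub, T.H_sub, T.F_sub, (N).succ_sub, Tm.sub, Fn.sub, scons] at h ⊢
    rw [num_prod_succ, h, T.succ, hβ Δ ρ θ _ e]

/-- The number `a` is the least `w` with H(a, w) = c, which is a quantifier-free condition on `w`. -/
theorem eq_of_H {a w : Tm IASig false} (h : (N).num Γ (H a w) = (N).num Γ c)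
    (h' : Deriv Ax Γ (.or (.eq w (N).zero) (.eq (H a ((N).pd w)) d))) : (N).num Γ a = (N).num Γ w := by
  refine (N).num_eq.2 ((N).le_or_lt a w (fun Δ k e hk => ?_) fun Δ k e hk => ?_)
  · refine (N).cases k (fun Δ' e' h0 => (N).num_eq.1 ?_) fun Δ' k' e' hs => T.ne _ _ ?_
    all_goals have hk' := (N).num_weaken (s := a) (t := (N).add w k) hk e'
    · rw [hk', (N).num_add, h0, _root_.add_zero]
    · rw [← (N).num_weaken h (List.Subset.trans e e')]
      refine T.lt _ _ _ ((N).num _ k') ?_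
      rw [hk', (N).num_add, hs, _root_.add_assoc]
  · rw [← (N).num_add, ← (N).num_succ] at hk
    refine .orE (h'.weaken e) ?_ ?_
    · refine (N).one_ne_zero_elim (x := (N).num _ ((N).add a k)) ?_
      rw [← (N).num_succ, ← (N).num_weaken hk (List.subset_cons_self _ _)]
      exact (N).num_eq.2 .head
    · refine T.ne _ _ ?_
      rw [← (N).num_eq.2 (Deriv.head (A := .eq (H a ((N).pd w)) d))]
      refine (T.ge _ _ _ ((N).num _ k) ?_).symm
      rw [← (N).num_add]
      exact (N).num_eq.2 ((N).E.trans ((N).pd_congr ((N).num_eq.1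
        ((N).num_weaken hk (List.subset_cons_self _ _)))) ((N).pd_succ _ _))

theorem H_or (a : Tm IASig false) :
    Deriv Ax Γ (.or (.eq a (N).zero) (.eq (H a ((N).pd a)) d)) := by
  refine (N).cases a (fun Δ _ h => .orI1 ((N).num_eq.1 h)) fun Δ y _ h =>
    .orI2 ((N).num_eq.1 (T.lt _ _ _ 0 ?_))
  rw [_root_.add_zero, ← (N).num_succ]
  exact (N).num_succ_pd h

/-- The values H(F(g(x), λy.B(x, y)), w) are a function γ of ⟨x, w⟩. -/
theorem eq_value {u g B g' B' γ α : Fn IASig false} {x : Tm IASig false} (hu : Deriv Ax Γ ((N).Sqrt u))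
    (hg : (N).IsFun Γ (fun n u g => (N).succ (.app g ((N).p1 u n))) u g g')
    (hB : (N).IsFun Γ (fun n u B => H (.app B ((N).pr ((N).p1 u ((N).p1 u n)) ((N).p2 u n)))
      ((N).p2 u ((N).p1 u n))) u B B')
    (hγ : (N).Values Γ prod g' B' γ) (hα : Deriv Ax Γ ((N).pairing.sect α B x)) (w : Tm IASig false) :
    (N).num Γ (.app γ ((N).pr x w)) = (N).num Γ (H (F (.app g x) α) w) := by
  refine (N).num_eq.2 ((N).pairing.exists_sect (N).E B' ((N).pr x w) fun Δ ρ θ β e hβ => ?_)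
  rw [Fm.ren_eq_sub]
  simp only [Fm.sub, (N).pr_sub, T.H_sub, T.F_sub, Tm.sub]
  simp only [← Fn.ren_eq_sub, ← Tm.ren_eq_sub]
  refine (N).num_eq.1 ?_
  rw [(N).pr_ren] at hβ
  have hu := (N).sqrt_mono hu e
  refine ((hγ.mono e).apply hβ).symm.trans (Eq.trans ((N).num_functional prod_sub _
    (t := (N).succ (.app (g.ren ρ θ) (x.ren ρ θ))) ?_) (T.prod_eq (fun Δ' ρ' θ' y e' => ?_) _))
  · refine ((hg.mono e).apply _).trans ?_
    rw [(N).num_succ, (N).num_succ, (N).num_app ((N).num_p1_pr hu _ _)]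
  · have hu' := (N).sqrt_mono hu e'
    have h1 := (N).num_eq.2 ((N).pairing.sect_apply ((N).pairing.sect_mono hβ e') y)
    have h2 := (N).num_eq.2 ((N).pairing.sect_apply ((N).pairing.sect_mono
      ((N).pairing.sect_mono hα e) e') y)
    rw [(N).pr_ren] at h1
    refine h1.trans (((hB.mono e).mono e').apply _ |>.trans (T.num_H (Eq.trans ((N).num_app
      ((N).num_pr_congr ?_ ((N).num_p2_pr hu' _ _))) h2.symm) ?_))
    · exact ((N).num_p1_congr ((N).num_p1_pr hu' _ _)).trans ((N).num_p1_pr hu' _ _)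
    · exact ((N).num_p2_congr ((N).num_p1_pr hu' _ _)).trans ((N).num_p2_pr hu' _ _)

/-- The values F(g(x), λy.B(x, y)) are the thresholds of the function γ, and so a function of x. -/
theorem exists_values {u g B g' B' γ : Fn IASig false} {C : Fm IASig false}
    (hu : Deriv Ax Γ ((N).Sqrt u))
    (hg : (N).IsFun Γ (fun n u g => (N).succ (.app g ((N).p1 u n))) u g g')
    (hB : (N).IsFun Γ (fun n u B => H (.app B ((N).pr ((N).p1 u ((N).p1 u n)) ((N).p2 u n)))
      ((N).p2 u ((N).p1 u n))) u B B')
    (hγ : (N).Values Γ prod g' B' γ)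
    (K : ∀ Δ ρ θ δ, Ext ρ θ Γ Δ → (N).Values Δ F (g.ren ρ θ) (B.ren ρ θ) δ → Deriv Ax Δ (C.ren ρ θ)) :
    Deriv Ax Γ C := by
  refine (N).exists_values (F := F) (A :=
      .and (.eq (.app (.var 0) ((N).pr (.var 1) (.var 0))) c)
        (.or (.eq (.var 0) (N).zero) (.eq (.app (.var 0) ((N).pr (.var 1) ((N).pd (.var 0)))) d)))
    ⟨trivial, trivial, trivial⟩ .var (scons γ .var)
    (fun Δ ρ θ x α e hα => ?_) (fun Δ ρ θ x α w e hα h => ?_) K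
  all_goals have key := T.eq_value ((N).sqrt_mono hu e) (hg.mono e) (hB.mono e) (hγ.mono e) hα
  · simp only [Fm.sub, (N).pr_sub, (N).pd_sub, (N).zero_sub, T.c_sub, T.d_sub, Tm.sub, Fn.sub, scons]
    refine .andI ((N).num_eq.1 ((key _).trans (T.ge _ _ _ 0 (_root_.add_zero _).symm)))
      (.orE (T.H_or (F (.app (g.ren ρ θ) x) α)) (.orI1 .head) (.orI2 ?_))
    exact (N).E.trans (((N).num_eq.1 (key _)).weaken (List.subset_cons_self _ _)) .head
  · simp only [Fm.sub, (N).pr_sub, (N).pd_sub, (N).zero_sub, T.c_sub, T.d_sub, Tm.sub, Fn.sub,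
      scons] at h
    refine T.eq_of_H ((key _).symm.trans ((N).num_eq.2 h.andE1)) (.orE h.andE2 (.orI1 .head) (.orI2 ?_))
    exact (N).E.trans ((N).E.symm (((N).num_eq.1 (key _)).weaken (List.subset_cons_self _ _))) .head

/-- The uniform evaluation of products yields that of `F`: the values H(B(x, y), w) for y ≤ g(x) are
multiplied, with ⟨x, w⟩ as the parameter. -/
theorem uniformOp : (N).UniformOp F := by
  intro Γ u C g B hu K
  refine (N).exists_isFun (T := fun n u g => (N).succ (.app g ((N).p1 u n)))
    (by intros; simp only [(N).succ_sub, (N).p1_sub, Tm.sub]) u g fun Δ₁ ρ₁ θ₁ g' e₁ hg => ?_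
  refine (N).exists_isFun (T := fun n u B => H (.app B ((N).pr ((N).p1 u ((N).p1 u n)) ((N).p2 u n)))
      ((N).p2 u ((N).p1 u n)))
    (by intros; simp only [T.H_sub, (N).pr_sub, (N).p2_sub, (N).p1_sub, Tm.sub]) (u.ren ρ₁ θ₁)
    (B.ren ρ₁ θ₁) fun Δ₂ ρ₂ θ₂ B' e₂ hB => ?_
  have hu' := (N).sqrt_mono hu (e₁.trans e₂)
  refine uniformOp_prod hA hQ (g'.ren ρ₂ θ₂) B' hu' fun Δ₃ ρ₃ θ₃ γ e₃ hγ => ?_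
  have hg' := (hg.mono e₂).mono e₃
  have hB' := hB.mono e₃
  have hu'' := (N).sqrt_mono hu' e₃
  simp only [Fn.ren_ren] at hg' hB' hu'' hγ
  refine T.exists_values hu'' hg' hB' hγ fun Δ ρ θ ζ e hζ => ?_
  simp only [Fm.ren_ren, Fn.ren_ren] at hζ ⊢
  exact K _ _ _ _ (((e₁.trans e₂).trans e₃).trans e) hζ

end Threshold

theorem maxle_sub (s : Tm IASig b) (u : Fn IASig b) (σ : ℕ → Tm IASig b) (τ : ℕ → Fn IASig b) :
    (maxle s u).sub σ τ = maxle (s.sub σ τ) (u.sub σ τ) := (functional_sub σ τ s u).2.2.2.1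

theorem minle_sub (s : Tm IASig b) (u : Fn IASig b) (σ : ℕ → Tm IASig b) (τ : ℕ → Fn IASig b) :
    (minle s u).sub σ τ = minle (s.sub σ τ) (u.sub σ τ) := (functional_sub σ τ s u).2.2.1

/-- For s ≥ t, the condition s ≤ w implies t ≤ w. -/
theorem num_sgb_sub_of_ge {s t w : Tm IASig false} {d : (N).Num Γ}
    (h : (N).num Γ s = (N).num Γ t + d) : (N).num Γ (sgb ((N).sub s w)) =
      (N).num Γ (sgb ((N).sub s w)) * (N).num Γ (sgb ((N).sub t w)) := by
  obtain ⟨d, rfl⟩ := (N).num_surj d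
  rw [← (N).num_mul]
  refine (N).num_eq.2 ((N).le_or_lt w s (fun Δ k e hk => (N).num_eq.1 ?_)
    fun Δ k e hk => (N).num_eq.1 ?_)
  · have h := (N).num_weaken (s := s) (t := (N).add t d) h e
    rw [(N).num_mul, num_sgb_of_eq_zero hA hQ ((N).num_sub_eq_zero hk),
      num_sgb_of_eq_zero hA hQ ((N).num_sub_of_add_eq (s := t)
        (d := (N).num Δ d + (N).num Δ k) ?_), mul_one]
    rw [hk, h, (N).num_add, _root_.add_assoc]
  · rw [(N).num_mul, num_sgb_of_eq_succ hA hQ (s := (N).sub s w) (y := (N).num Δ k), zero_mul]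
    exact (N).num_add_sub_cancel (hk.trans (_root_.add_assoc _ _ _))

/-- For s ≥ t, the condition w ≤ t implies w ≤ s. -/
theorem num_sgb_sub_of_le {s t w : Tm IASig false} {d : (N).Num Γ}
    (h : (N).num Γ s = (N).num Γ t + d) : (N).num Γ (sgb ((N).sub w t)) =
      (N).num Γ (sgb ((N).sub w s)) * (N).num Γ (sgb ((N).sub w t)) := by
  obtain ⟨d, rfl⟩ := (N).num_surj d
  rw [← (N).num_mul]
  refine (N).num_eq.2 ((N).le_or_lt t w (fun Δ k e hk => (N).num_eq.1 ?_)
    fun Δ k e hk => (N).num_eq.1 ?_)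
  · have h := (N).num_weaken (s := s) (t := (N).add t d) h e
    rw [(N).num_mul, num_sgb_of_eq_zero hA hQ ((N).num_sub_eq_zero hk),
      num_sgb_of_eq_zero hA hQ ((N).num_sub_of_add_eq (t := s)
        (d := (N).num Δ k + (N).num Δ d) ?_), mul_one]
    rw [h, (N).num_add, hk, _root_.add_assoc]
  · rw [(N).num_mul, num_sgb_of_eq_succ hA hQ (s := (N).sub w t) (y := (N).num Δ k), mul_zero]
    exact (N).num_add_sub_cancel (hk.trans (_root_.add_assoc _ _ _))

/-- Equations about s and t can be proved for s ≥ t and t ≥ s separately. -/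
theorem le_total (s t : Tm IASig false) {C : Fm IASig false}
    (h1 : ∀ Δ (d : (N).Num Δ), Γ ⊆ Δ → (N).num Δ s = (N).num Δ t + d → Deriv Ax Δ C)
    (h2 : ∀ Δ (d : (N).Num Δ), Γ ⊆ Δ → (N).num Δ t = (N).num Δ s + d → Deriv Ax Δ C) : Deriv Ax Γ C :=
  (N).le_or_lt s t (fun Δ _ e h => h1 Δ _ e h)
    fun Δ d e h => h2 Δ ((N).num Δ d + 1) e (h.trans (_root_.add_assoc _ _ _))

theorem num_sgb_max (s t w : Tm IASig false) : (N).num Γ (sgb ((N).sub (max s t) w)) =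
    (N).num Γ (sgb ((N).sub s w)) * (N).num Γ (sgb ((N).sub t w)) := by
  rw [← (N).num_mul]
  have hm : ∀ Δ, (N).num Δ (max s t) = (N).num Δ s - (N).num Δ t + (N).num Δ t :=
    fun Δ => (N).num_eq.2 (max_def hA s t)
  refine (N).num_eq.2 (le_total hA hQ s t (fun Δ k _ hk => (N).num_eq.1 ?_)
    fun Δ k _ hk => (N).num_eq.1 ?_)
  · have h : (N).num Δ (max s t) = (N).num Δ s := by
      rw [hm, (N).num_add_sub_cancel hk, hk, _root_.add_comm]
    rw [(N).num_mul, ← num_sgb_sub_of_ge hA hQ hk]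
    exact num_sgb_congr hA hQ ((N).num_sub_congr h rfl)
  · have h : (N).num Δ (max s t) = (N).num Δ t := by
      rw [hm, (N).num_sub_eq_zero hk, _root_.zero_add]
    rw [(N).num_mul, mul_comm, ← num_sgb_sub_of_ge hA hQ hk]
    exact num_sgb_congr hA hQ ((N).num_sub_congr h rfl)

theorem num_sgb_min (s t w : Tm IASig false) : (N).num Γ (sgb ((N).sub w (min s t))) =
    (N).num Γ (sgb ((N).sub w s)) * (N).num Γ (sgb ((N).sub w t)) := by
  rw [← (N).num_mul]
  have hm : ∀ Δ, (N).num Δ (min s t) = (N).num Δ t - ((N).num Δ t - (N).num Δ s) :=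
    fun Δ => (N).num_eq.2 (min_def hA s t)
  refine (N).num_eq.2 (le_total hA hQ s t (fun Δ k _ hk => (N).num_eq.1 ?_)
    fun Δ k _ hk => (N).num_eq.1 ?_)
  · have h : (N).num Δ (min s t) = (N).num Δ t := by
      rw [hm, (N).num_sub_eq_zero hk]
      exact (N).num_add_sub_cancel (_root_.zero_add _).symm
    rw [(N).num_mul, ← num_sgb_sub_of_le hA hQ hk]
    exact num_sgb_congr hA hQ ((N).num_sub_congr rfl h)
  · have h : (N).num Δ (min s t) = (N).num Δ s := by
      rw [hm, (N).num_add_sub_cancel hk]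
      exact (N).num_add_sub_cancel (hk.trans (_root_.add_comm _ _))
    rw [(N).num_mul, mul_comm, ← num_sgb_sub_of_le hA hQ hk]
    exact num_sgb_congr hA hQ ((N).num_sub_congr rfl h)

theorem threshold_maxle :
    Threshold hA hQ maxle (fun a w => sgb ((N).sub a w)) ((N).succ (N).zero) (N).zero where
  F_sub := maxle_sub
  H_sub _ _ _ _ := by simp only [sgb_sub, (N).sub_sub]
  c_sub _ _ := by simp only [(N).succ_sub, (N).zero_sub]
  d_sub := (N).zero_sub
  ne Γ C h := (N).one_ne_zero_elim (x := 0) ((_root_.zero_add _).trans h)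
  ge Γ a w e h := num_sgb_of_eq_zero hA hQ ((N).num_sub_eq_zero h)
  lt Γ a w e h := num_sgb_of_eq_succ hA hQ ((N).num_add_sub_cancel (h.trans (_root_.add_assoc _ _ _)))
  zero Γ u := (N).num_eq.2 (maxle_zero hA u)
  succ Γ s u w := by
    rw [← num_sgb_max]
    refine num_sgb_congr hA hQ ?_
    exact (N).num_sub_congr ((N).num_eq.2 (maxle_succ hA s u)) rfl

theorem threshold_minle :
    Threshold hA hQ minle (fun a w => sgb ((N).sub ((N).succ w) a)) (N).zero ((N).succ (N).zero) where
  F_sub := minle_sub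
  H_sub _ _ _ _ := by simp only [sgb_sub, (N).sub_sub, (N).succ_sub]
  c_sub := (N).zero_sub
  d_sub _ _ := by simp only [(N).succ_sub, (N).zero_sub]
  ne Γ C h := (N).one_ne_zero_elim (x := 0) ((_root_.zero_add _).trans h.symm)
  ge Γ a w e h := num_sgb_of_eq_succ hA hQ (s := (N).sub ((N).succ w) a) (y := e)
    ((N).num_sub_of_eq_add (by rw [(N).num_succ, h, _root_.add_assoc]))
  lt Γ a w e h := num_sgb_of_eq_zero hA hQ (s := (N).sub ((N).succ w) a)
    ((N).num_sub_of_add_eq (d := e) (by rw [(N).num_succ, h, _root_.add_right_comm]))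
  zero Γ u := (N).num_eq.2 (minle_zero hA u)
  succ Γ s u w := by
    rw [← num_sgb_min]
    refine num_sgb_congr hA hQ ?_
    exact (N).num_sub_congr rfl ((N).num_eq.2 (minle_succ hA s u))

end

end IA

namespace IA

/-! ### IA₁ + QF-AC₀₀ and IA₁ + QF-AC₀₀ − λ -/

section
variable {Ax : Fm IASig false → Prop} (hA : ∀ A, Arith A → Ax A) (hQ : ∀ A, QFAC A → Ax A)

local notation "N" => arithmetic hA hQ

theorem uniform_of_uniformOp {f : IACon} {F : Tm IASig false → Fn IASig false → Tm IASig false}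
    (hn : IASig.nArg f = 1) (hf : IASig.fArg f = 1)
    (hF : ∀ s u, F s u = call (L := IASig) f (fun _ => s) fun _ => u) (hU : (N).UniformOp F) :
    (N).pairing.Uniform f := by
  intro h Γ u C γ B hu H
  refine hU (γ ⟨0, by omega⟩) B hu fun Δ ρ θ δ e hδ => H Δ ρ θ δ e
    ((N).pairing.uniI fun Δ' ρ' θ' x α e' hα => ?_)
  rw [cst_functional h hn hf hF]
  exact (N).num_eq.1 (hδ Δ' ρ' θ' x α e' hα)

/-- Every constant of IA₁ has a uniform evaluation: five of the six operations on functions come down to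
products, and the sixth is the sum. -/
theorem uniform (hbar : IsProd Ax bar barG) (htilde : IsProd Ax tilde tildeG) (f : IACon) :
    (N).pairing.Uniform f := by
  by_cases hf : IASig.fArg f = 0
  · exact Pairing.uniform_of_fArg_eq_zero _ (base hA hQ hbar htilde) hf
  refine fArg_ne_zero_cases (motive := (N).pairing.Uniform) ?_ ?_ ?_ ?_ ?_ ?_ hf
  · exact uniform_of_uniformOp hA hQ rfl rfl (fun s u => (functional_eq s u).1) (uniformOp_sum hA hQ)
  · exact uniform_of_uniformOp hA hQ rfl rfl (fun s u => (functional_eq s u).2.1) (uniformOp_prod hA hQ)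
  · exact uniform_of_uniformOp hA hQ rfl rfl (fun s u => (functional_eq s u).2.2.1)
      (threshold_minle hA hQ).uniformOp
  · exact uniform_of_uniformOp hA hQ rfl rfl (fun s u => (functional_eq s u).2.2.2.1)
      (threshold_maxle hA hQ).uniformOp
  · exact uniform_of_uniformOp hA hQ rfl rfl (fun s u => (functional_eq s u).2.2.2.2.1)
      (Arithmetic.UniformOp.comp _ (uniformOp_prod hA hQ) barG_sub (fun s u σ τ => (functional_sub σ τ s u).2.2.2.2.1) hbar)
  · exact uniform_of_uniformOp hA hQ rfl rfl (fun s u => (functional_eq s u).2.2.2.2.2)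
      (Arithmetic.UniformOp.comp _ (uniformOp_prod hA hQ) tildeG_sub (fun s u σ τ => (functional_sub σ τ s u).2.2.2.2.2) htilde)

end

section
variable (s t : Tm IASig false) (u : Fn IASig false)

theorem zero_emb : (zero : Tm IASig false).emb = zero := by
  refine (call_emb _ _ _).trans (congrArg₂ (call _) (funext fun i => ?_) (funext fun i => ?_)) <;>
    exact i.elim0

theorem one_place_emb : (succ s).emb = succ s.emb ∧ (fac s).emb = fac s.emb ∧ (pd s).emb = pd s.emb ∧
    (sgb s).emb = sgb s.emb ∧ (sg s).emb = sg s.emb ∧ (prime s).emb = prime s.emb ∧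
    (lh s).emb = lh s.emb ∧ (ccp s).emb = ccp s.emb := by
  refine ⟨?_, ?_, ?_, ?_, ?_, ?_, ?_, ?_⟩ <;>
    refine (call_emb _ _ _).trans (congrArg₂ (call _) (funext fun i => ?_) (funext fun i => ?_)) <;>
    fin_cases i <;> rfl

theorem two_place_emb : (add s t).emb = add s.emb t.emb ∧ (mul s t).emb = mul s.emb t.emb ∧
    (pow s t).emb = pow s.emb t.emb ∧ (sub s t).emb = sub s.emb t.emb ∧
    (min s t).emb = min s.emb t.emb ∧ (max s t).emb = max s.emb t.emb ∧
    (dist s t).emb = dist s.emb t.emb ∧ (rm s t).emb = rm s.emb t.emb ∧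
    (quo s t).emb = quo s.emb t.emb := by
  refine ⟨?_, ?_, ?_, ?_, ?_, ?_, ?_, ?_, ?_⟩ <;>
    refine (call_emb _ _ _).trans (congrArg₂ (call _) (funext fun i => ?_) (funext fun i => ?_)) <;>
    fin_cases i <;> rfl

theorem functional_emb : (sum s u).emb = sum s.emb u.emb ∧ (prod s u).emb = prod s.emb u.emb ∧
    (minle s u).emb = minle s.emb u.emb ∧ (maxle s u).emb = maxle s.emb u.emb ∧
    (bar s u).emb = bar s.emb u.emb ∧ (tilde s u).emb = tilde s.emb u.emb := by
  refine ⟨?_, ?_, ?_, ?_, ?_, ?_⟩ <;>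
    refine (call_emb _ _ _).trans (congrArg₂ (call _) (funext fun i => ?_) (funext fun i => ?_)) <;>
    fin_cases i <;> rfl

end

theorem Arith.emb {A : Fm IASig false} (h : Arith A) : Arith A.emb := by
  cases h
  case ind h =>
    have := h.emb (succ' := succ) (one_place_emb (.var 0)).1.symm
    rw [zero_emb] at this
    exact .ind _ this
  all_goals simp only [Fm.emb, Tm.emb, Fn.emb, zero_emb, one_place_emb, two_place_emb, functional_emb,
    one, two]
  exacts [
    .eq_trans, .eq_app, .succ_ne_zero, .succ_congr, .succ_inj, .add_zero, .add_succ, .mul_zero,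
    .mul_succ, .pow_zero, .pow_succ, .fac_zero, .fac_succ, .pd_zero, .pd_succ, .sub_zero,
    .sub_succ, .min_def, .max_def, .sgb_zero, .sgb_succ, .sg_zero, .sg_succ, .dist_def, .rm_zero,
    .rm_succ, .quo_zero, .quo_succ, .sum_zero, .sum_succ, .prod_zero, .prod_succ, .minle_zero,
    .minle_succ, .maxle_zero, .maxle_succ, .prime_zero, .ccp_zero]

/-- An axiom of the system with λ is an instance of induction or an axiom of the system without λ. -/
theorem Arith.ind_or_emb {A : Fm IASig true} (h : Arith A) :
    Ind zero succ A ∨ ∃ B : Fm IASig false, Arith B ∧ B.emb = A := by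
  cases h
  case ind h => exact .inl h
  all_goals refine .inr ?_
  map_tacs [
    refine ⟨_, .eq_trans, ?_⟩; refine ⟨_, .eq_app, ?_⟩; refine ⟨_, .succ_ne_zero, ?_⟩;
    refine ⟨_, .succ_congr, ?_⟩; refine ⟨_, .succ_inj, ?_⟩; refine ⟨_, .add_zero, ?_⟩;
    refine ⟨_, .add_succ, ?_⟩; refine ⟨_, .mul_zero, ?_⟩; refine ⟨_, .mul_succ, ?_⟩;
    refine ⟨_, .pow_zero, ?_⟩; refine ⟨_, .pow_succ, ?_⟩; refine ⟨_, .fac_zero, ?_⟩;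
    refine ⟨_, .fac_succ, ?_⟩; refine ⟨_, .pd_zero, ?_⟩; refine ⟨_, .pd_succ, ?_⟩;
    refine ⟨_, .sub_zero, ?_⟩; refine ⟨_, .sub_succ, ?_⟩; refine ⟨_, .min_def, ?_⟩;
    refine ⟨_, .max_def, ?_⟩; refine ⟨_, .sgb_zero, ?_⟩; refine ⟨_, .sgb_succ, ?_⟩;
    refine ⟨_, .sg_zero, ?_⟩; refine ⟨_, .sg_succ, ?_⟩; refine ⟨_, .dist_def, ?_⟩;
    refine ⟨_, .rm_zero, ?_⟩; refine ⟨_, .rm_succ, ?_⟩; refine ⟨_, .quo_zero, ?_⟩;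
    refine ⟨_, .quo_succ, ?_⟩; refine ⟨_, .sum_zero, ?_⟩; refine ⟨_, .sum_succ, ?_⟩;
    refine ⟨_, .prod_zero, ?_⟩; refine ⟨_, .prod_succ, ?_⟩; refine ⟨_, .minle_zero, ?_⟩;
    refine ⟨_, .minle_succ, ?_⟩; refine ⟨_, .maxle_zero, ?_⟩; refine ⟨_, .maxle_succ, ?_⟩;
    refine ⟨_, .prime_zero, ?_⟩; refine ⟨_, .ccp_zero, ?_⟩]
  all_goals simp only [Fm.emb, Tm.emb, Fn.emb, zero_emb, one_place_emb, two_place_emb, functional_emb,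
    one, two]

theorem Arith.tr {Ax : Fm IASig false → Prop} (hA : ∀ A, Arith A → Ax A) (S : Base Ax)
    {A : Fm IASig true} (h : Arith A) : Deriv Ax [] A.tr := by
  obtain h | ⟨B, hB, rfl⟩ := h.ind_or_emb
  · have := tr_ind S (zero := zero) (succ := succ) (succ' := succ) (one_place_emb (.var 0)).1.symm
      (fun A h => .ax (hA _ (.ind A h))) (A := A)
    rw [zero_emb] at this
    exact this h
  · rw [Fm.tr_emb]
    exact .ax (hA _ hB)

section
variable {Ax : Fm IASig false → Prop} (E : EqBase Ax) {Γ : List (Fm IASig false)}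
  {σ : ℕ → Tm IASig false} {τ : ℕ → Fn IASig false}
include E

theorem ev_prime {s : Tm IASig true} {a : Tm IASig false} (h : Ev Ax Γ σ τ s a) :
    Ev Ax Γ σ τ (prime s) (prime a) :=
  Ev.call E (a := ![a]) (β := ![]) (fun i => by fin_cases i; exact h) (fun j => j.elim0) (E.refl _ _)

theorem ev_zero : Ev Ax Γ σ τ zero zero :=
  Ev.call (f := .zero) E (a := ![]) (β := ![]) (fun i => i.elim0) (fun j => j.elim0) (E.refl _ _)

theorem ev_one : Ev Ax Γ σ τ one one :=
  Ev.call (f := .succ) E (ts := ![zero]) (us := ![]) (a := ![zero]) (β := ![]) (fun i => by fin_cases i; exact ev_zero E)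
    (fun j => j.elim0) (E.refl _ _)

theorem ev_add {s t : Tm IASig true} {a c : Tm IASig false} (h : Ev Ax Γ σ τ s a)
    (h' : Ev Ax Γ σ τ t c) : Ev Ax Γ σ τ (add s t) (add a c) :=
  Ev.call E (a := ![a, c]) (β := ![]) (fun i => by fin_cases i; exacts [h, h']) (fun j => j.elim0)
    (E.refl _ _)

theorem ev_pow {s t : Tm IASig true} {a c : Tm IASig false} (h : Ev Ax Γ σ τ s a)
    (h' : Ev Ax Γ σ τ t c) : Ev Ax Γ σ τ (pow s t) (pow a c) :=
  Ev.call E (a := ![a, c]) (β := ![]) (fun i => by fin_cases i; exacts [h, h']) (fun j => j.elim0)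
    (E.refl _ _)

theorem ev_app_var {i j : ℕ} : Ev Ax Γ σ τ (.app (.var j) (.var i)) (.app (τ j) (σ i)) :=
  Ev.app (u := .var j) (α := τ j) (evF_var.2 (E.feq_refl _)) (ev_var.2 (E.refl _ _)) (E.refl _ _)

end

/-- IA₁ + QF-AC₀₀ is a definitional extension of IA₁ + QF-AC₀₀ − λ. -/
theorem isDefinitionalExtension_IA (r : Tm IASig true) :
    IsDefinitionalExtension (WithLam r) (WithoutLam r) := by
  have hA : ∀ A, Arith A → WithoutLam r A := fun _ => .inl
  have hQ : ∀ A, QFAC A → WithoutLam r A := fun _ h => .inr (.inr h)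
  have hA' : ∀ A, Arith A → WithLam r A := fun _ => .inl
  have hQ' : ∀ A, QFAC A → WithLam r A := fun _ h => .inr (.inr (.inl h))
  have hL : ∀ A, LamConv A → WithLam r A := fun _ h => .inr (.inr (.inr h))
  have E := eqBase hA hQ
  have hbar : IsProd (WithoutLam r) bar barG :=
    isProd_without hA hQ (fun s u σ τ => (functional_sub σ τ s u).2.2.2.2.1)
      (fun Γ σ τ a u ha hu => by
        subst ha hu
        exact ev_pow E (ev_prime E (ev_var.2 (E.refl _ _))) (ev_add E (ev_app_var E) (ev_one E)))
      (.ax (.inr (.inl (.mk _ _ .bar_def))))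
  have htilde : IsProd (WithoutLam r) tilde tildeG :=
    isProd_without hA hQ (fun s u σ τ => (functional_sub σ τ s u).2.2.2.2.2)
      (fun Γ σ τ a u ha hu => by
        subst ha hu
        exact ev_pow E (ev_prime E (ev_var.2 (E.refl _ _))) (ev_app_var E))
      (.ax (.inr (.inl (.mk _ _ .tilde_def))))
  have hbar' : IsProd (WithLam r) bar barG :=
    isProd_with hA' hQ' hL (fun s u σ τ => (functional_sub σ τ s u).2.2.2.2.1) barG_sub (by
      have := Def.mk _ _ (LamDef.bar_def (r := r))
      rw [(functional_emb _ _).2.2.2.2.1] at this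
      exact .inr (.inl this))
  have htilde' : IsProd (WithLam r) tilde tildeG :=
    isProd_with hA' hQ' hL (fun s u σ τ => (functional_sub σ τ s u).2.2.2.2.2) tildeG_sub (by
      have := Def.mk _ _ (LamDef.tilde_def (r := r))
      rw [(functional_emb _ _).2.2.2.2.2] at this
      exact .inr (.inl this))
  have S := base hA hQ hbar htilde
  have S' := base hA' hQ' hbar' htilde'
  have hU := uniform hA hQ hbar htilde
  have hf : ∀ f, IASig.fArg f ≤ 1 := by rintro (_ | _) <;> decide
  have hL' : ∀ A, LamConv A → Deriv (WithLam r) [] A := fun A h => .ax (hL A h)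
  refine isDefinitionalExtension (arithmetic hA hQ).pairing S hU hf S' hL' ?_ ?_ ?_
  · rintro A (h | ⟨s, t, h⟩ | h)
    · exact .ax (hA' _ h.emb)
    · exact def_emb S' hL' (.ax (.inr (.inl (.mk s t h))))
    · exact .ax (hQ' _ h.emb)
  · rintro A (h | ⟨s, t, h⟩ | h | h)
    · exact h.tr hA S
    · exact tr_def _ S hU hf (.ax (.inr (.inl (.mk s t h))))
    · exact tr_qfac _ S hU hf h
    · exact tr_lamConv _ S hU hf h
  · refine tr_computable
      (na := fun c => [0, 1, 2, 2, 2, 1, 1, 2, 2, 2, 1, 1, 2, 2, 2, 1, 1, 1, 1, 1, 2, 1, 2, 1, 1, 2, 1].getD c 0)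
      (fa := fun c => [0, 0, 0, 0, 0, 0, 0, 0, 0, 0, 0, 0, 0, 0, 0, 1, 1, 1, 1, 0, 0, 0, 0, 1, 1].getD c 0)
      ?_ ?_ ?_ ?_
    · rintro (_ | _) <;> rfl
    · rintro (_ | _) <;> rfl
    · exact (Primrec.list_getD 0).comp (Primrec.const _) Primrec.id
    · exact (Primrec.list_getD 0).comp (Primrec.const _) Primrec.id

end IA

end TwoSorted

theorem theorem6p5 :
    TwoSorted.IsDefinitionalExtension TwoSorted.EL.WithLam TwoSorted.EL.WithoutLam ∧
    ∀ r : TwoSorted.Tm TwoSorted.IASig true, TwoSorted.IA.Admissible r →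
      TwoSorted.IsDefinitionalExtension (TwoSorted.IA.WithLam r) (TwoSorted.IA.WithoutLam r) := by
  exact ⟨TwoSorted.EL.isDefinitionalExtension_EL,
    fun r _ => TwoSorted.IA.isDefinitionalExtension_IA r⟩
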